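/- Let $A:\mathbb R^3\to\mathbb R^3$ and $V:\mathbb R^3\to\mathbb R$ satisfy $A_\ell\in L^2_{\rm loc}(\mathbb R^3)$ for $\ell=1,2,3$ and $V\in L^1_{\rm loc}(\mathbb R^3)$, and suppose that for every $\varepsilon>0$ there is a constant $C_\varepsilon$ with $$\Big|\int V|\varphi|^2\,dx\Big|\le \varepsilon\|\nabla\varphi\|^2+C_\varepsilon\|\varphi\|^2\qquad\text{for all }\varphi\in C_0^\infty(\mathbb R^3).$$ Write $D_A=-i\nabla+A$ and $H^1_A=\{\varphi\in L^2(\mathbb R^3): D_A\varphi\in L^2(\mathbb R^3)\}$, where $D_A\varphi$ is taken in the sense of distributions. For $\varphi\in H^1_A$ let $\langle\varphi,V\varphi\rangle$ denote the extension of $\int V|\varphi|^2dx$ from $C_0^\infty(\mathbb R^3)$ to $H^1_A$ by continuity with respect to the norm $(\|\varphi\|^2+\|D_A\varphi\|^2)^{1/2}$, and put $\langle\varphi,(D_A^2+V)\varphi\rangle=\|D_A\varphi\|^2+\langle\varphi,V\varphi\rangle$. Let $$E_P(A,V)=\inf\Big\{\|D_A\varphi\|^2+\langle\varphi,V\varphi\rangle-\iint\frac{|\varphi(x)|^2|\varphi(y)|^2}{|x-y|}\,dx\,dy\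 :\ \varphi\in H^1_A,\ \|\varphi\|=1\Big\}.$$ Let $\mathcal F$ be the symmetric Fock space over $L^2(\mathbb R^3)$ with annihilation operators $a(k)$, let $\mathcal F_0\subset\mathcal F$ be the set of sequences $(\eta^{(n)})$ of continuous, compactly supported (symmetric) functions $\eta^{(n)}$ on $\mathbb R^{3n}$, only finitely many of them non-zero, and let $\mathcal Q_A=H^1_A\otimes\mathcal F_0\subset L^2(\mathbb R^3)\otimes\mathcal F$ (algebraic tensor product). For $\alpha>0$ and $\psi\in\mathcal Q_A$ let $$H_{A,V,\alpha}(\psi)=\langle\psi,(D_A^2+V)\psi\rangle+\int\|a(k)\psi\|^2\,dk+\frac{\sqrt\alpha}{\sqrt2\,\pi}\int\frac{dk}{|k|}\Big(\langle\psi,e^{ikx}a(k)\psi\rangle+\langle e^{ikx}a(k)\psi,\psi\rangle\Big),$$ $$E(A,V,\alpha)=\inf\{H_{A,V,\alpha}(\psi):\psi\in\mathcal Q_A,\ \|\psi\|=1\}.$$ Let $A_\alpha(x)=\alpha A(\alpha x)$ and $V_\alpha(x)=\alpha^2V(\alpha x)$. Then $E_P(A,V)$ is finite, and there is a constant $C=C(A,V)$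 such that for all sufficiently large $\alpha>0$ the energy $E(A_\alpha,V_\alpha,\alpha)$ is finite and $$\alpha^2E_P(A,V)\ \ge\ E(A_\alpha,V_\alpha,\alpha)\ \ge\ \alpha^2E_P(A,V)-C\alpha^{9/5}.$$ -/

import Mathlib

open MeasureTheory Filter Topology
open scoped ContDiff

noncomputable section

namespace Polaron

/-- Physical space (and momentum space), with Euclidean norm and Lebesgue measure. -/
abbrev R3 := EuclideanSpace ℝ (Fin 3)

/-- The partial derivative in the `l`-th coordinate direction. -/
def partialD (l : Fin 3) (f : R3 → ℂ) (x : R3) : ℂ :=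
  fderiv ℝ f x (EuclideanSpace.single l 1)

/-- Complex-valued smooth functions with compact support. -/
def IsTest (f : R3 → ℂ) : Prop :=
  ContDiff ℝ ∞ f ∧ HasCompactSupport f

/-! ### Assumptions on the potentials -/

/-- Every component of `A` is in `L²` on compact sets. -/
def VectorL2Loc (A : R3 → R3) : Prop :=
  ∀ K : Set R3, IsCompact K → ∀ l : Fin 3, MemLp (fun x => A x l) 2 (volume.restrict K)

/-- `V` is infinitesimally form bounded with respect to `-Δ`, on test functions. -/
def InfFormBounded (V : R3 → ℝ) : Prop :=
  ∀ ε : ℝ, 0 < ε → ∃ Cε : ℝ, ∀ f : R3 → ℂ, IsTest f →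
    |∫ x, V x * ‖f x‖ ^ 2| ≤
      ε * (∑ l : Fin 3, ∫ x, ‖partialD l f x‖ ^ 2) + Cε * ∫ x, ‖f x‖ ^ 2

/-! ### The magnetic Sobolev space and the Schrödinger form -/

/-- `g = D_A φ = (-i∇ + A) φ` in the sense of distributions. -/
def IsMagGrad (A : R3 → R3) (φ : R3 → ℂ) (g : Fin 3 → R3 → ℂ) : Prop :=
  ∀ l : Fin 3, ∀ f : R3 → ℂ, IsTest f →
    ∫ x, φ x * (Complex.I * partialD l f x + ((A x l : ℝ) : ℂ) * f x) = ∫ x, g l x * f x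

/-- `g` is a square integrable distributional magnetic gradient of `φ`. -/
def IsL2MagGrad (A : R3 → R3) (φ : R3 → ℂ) (g : Fin 3 → R3 → ℂ) : Prop :=
  (∀ l, MemLp (g l) 2 volume) ∧ IsMagGrad A φ g

/-- The space `H¹_A`: both `φ` and `D_A φ` are square integrable. -/
def MemH1 (A : R3 → R3) (φ : R3 → ℂ) : Prop :=
  MemLp φ 2 volume ∧ ∃ g : Fin 3 → R3 → ℂ, IsL2MagGrad A φ g

open Classical in
/-- The magnetic gradient `D_A φ` of `φ ∈ H¹_A`; it is unique up to null sets. -/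
def magGrad (A : R3 → R3) (φ : R3 → ℂ) : Fin 3 → R3 → ℂ :=
  if h : ∃ g : Fin 3 → R3 → ℂ, IsL2MagGrad A φ g then h.choose else 0

/-- `‖φ‖²` in `L²`. -/
def l2Sq (φ : R3 → ℂ) : ℝ := ∫ x, ‖φ x‖ ^ 2

/-- `‖D_A φ‖²`. -/
def kinetic (A : R3 → R3) (φ : R3 → ℂ) : ℝ := ∑ l : Fin 3, l2Sq (magGrad A φ l)

/-- The test functions `f` that tend to `φ` in the norm of `H¹_A`. -/
def coreNhds (A : R3 → R3) (φ : R3 → ℂ) : Filter (R3 → ℂ) :=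
  comap (fun f => l2Sq (f - φ) + kinetic A (f - φ)) (𝓝 0) ⊓ 𝓟 {f | IsTest f}

/-- The form `⟨φ, V φ⟩` on `H¹_A`: the extension by continuity, in the norm of `H¹_A`, of
`∫ V |f|²` from the form core of test functions. (A bound on `|∫ V |f|²|` for test functions does
not make `V |φ|²` integrable for every `φ` in `H¹_A`.) -/
def potForm (A : R3 → R3) (V : R3 → ℝ) (φ : R3 → ℂ) : ℝ :=
  limUnder (coreNhds A φ) (fun f => ∫ x, V x * ‖f x‖ ^ 2)

/-- The form `⟨φ, (D_A² + V) φ⟩` on `H¹_A`. -/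
def schrodingerForm (A : R3 → R3) (V : R3 → ℝ) (φ : R3 → ℂ) : ℝ :=
  kinetic A φ + potForm A V φ

/-! ### The Pekar functional -/

/-- The Pekar functional with external fields. -/
def pekarFunctional (A : R3 → R3) (V : R3 → ℝ) (φ : R3 → ℂ) : ℝ :=
  schrodingerForm A V φ - ∫ x, ∫ y, ‖φ x‖ ^ 2 * ‖φ y‖ ^ 2 / ‖x - y‖

/-- The values of the Pekar functional on the unit sphere. -/
def pekarValues (A : R3 → R3) (V : R3 → ℝ) : Set ℝ :=
  {e | ∃ φ : R3 → ℂ, MemH1 A φ ∧ l2Sq φ = 1 ∧ e = pekarFunctional A V φ}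

/-- `E_P(A, V)`. -/
def pekarEnergy (A : R3 → R3) (V : R3 → ℝ) : ℝ := sInf (pekarValues A V)

/-! ### The Fröhlich model -/

/-- Sequences of `n`-phonon wave functions of the phonon momenta. -/
abbrev FockFn := (n : ℕ) → (Fin n → R3) → ℂ

/-- The space `F₀`: symmetric, continuous, compactly supported wave functions, all but finitely
many of which vanish. -/
def MemF0 (η : FockFn) : Prop :=
  (∀ n, Continuous (η n) ∧ HasCompactSupport (η n)) ∧
  (∀ n (σ : Equiv.Perm (Fin n)) (K : Fin n → R3), η n (K ∘ σ) = η n K) ∧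
  {n | η n ≠ 0}.Finite

/-- Elements of `L²(ℝ³) ⊗ F` as sequences of functions `ψⁿ(x; k₁, …, kₙ)` of the electron position
and the phonon momenta. -/
abbrev PolaronFn := (n : ℕ) → R3 → (Fin n → R3) → ℂ

/-- The form domain `Q = H¹_A ⊗ F₀` (algebraic tensor product). -/
def MemQ (A : R3 → R3) (ψ : PolaronFn) : Prop :=
  ∃ (m : ℕ) (φ : Fin m → R3 → ℂ) (η : Fin m → FockFn),
    (∀ j, MemH1 A (φ j)) ∧ (∀ j, MemF0 (η j)) ∧
    ∀ n x K, ψ n x K = ∑ j, φ j x * η j n K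

/-- The inner product of `L²(ℝ³) ⊗ F`, linear in the second argument. -/
def ip (ψ χ : PolaronFn) : ℂ :=
  ∑' n : ℕ, ∫ p : R3 × (Fin n → R3), (starRingEnd ℂ) (ψ n p.1 p.2) * χ n p.1 p.2

/-- `‖ψ‖²` in `L²(ℝ³) ⊗ F`. -/
def normSqH (ψ : PolaronFn) : ℝ := (ip ψ ψ).re

/-- The annihilation operator `a(k)`. -/
def annihilate (k : R3) (ψ : PolaronFn) : PolaronFn :=
  fun n x K => (Real.sqrt (n + 1) : ℂ) * ψ (n + 1) x (Fin.cons k K)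

/-- Multiplication by `e^{ikx}`. -/
def planeWave (k : R3) (ψ : PolaronFn) : PolaronFn :=
  fun n x K => Complex.exp (Complex.I * ((inner ℝ k x : ℝ) : ℂ)) * ψ n x K

/-- The form of `(D_A² + V) ⊗ 1`: the Schrödinger form in the electron variable, integrated over
the phonon momenta. -/
def electronForm (A : R3 → R3) (V : R3 → ℝ) (ψ : PolaronFn) : ℝ :=
  ∑' n : ℕ, ∫ K : Fin n → R3, schrodingerForm A V (fun x => ψ n x K)

/-- The phonon number form `N(ψ) = ∫ ‖a(k) ψ‖² dk`. -/
def numberForm (ψ : PolaronFn) : ℝ := ∫ k : R3, normSqH (annihilate k ψ)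

/-- The electron-phonon interaction form `W(ψ)`. -/
def interactionForm (ψ : PolaronFn) : ℝ :=
  1 / (Real.sqrt 2 * Real.pi) *
    ∫ k : R3, 1 / ‖k‖ *
      (ip ψ (planeWave k (annihilate k ψ)) + ip (planeWave k (annihilate k ψ)) ψ).re

/-- The Fröhlich form `H(ψ)` with coupling constant `√α`. -/
def frohlichForm (A : R3 → R3) (V : R3 → ℝ) (α : ℝ) (ψ : PolaronFn) : ℝ :=
  electronForm A V ψ + numberForm ψ + Real.sqrt α * interactionForm ψ

/-- The values of the Fröhlich form on the normalized elements of `Q`. -/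
def frohlichValues (A : R3 → R3) (V : R3 → ℝ) (α : ℝ) : Set ℝ :=
  {e | ∃ ψ : PolaronFn, MemQ A ψ ∧ normSqH ψ = 1 ∧ e = frohlichForm A V α ψ}

/-- The ground state energy `E(A, V, α)`. -/
def frohlichEnergy (A : R3 → R3) (V : R3 → ℝ) (α : ℝ) : ℝ := sInf (frohlichValues A V α)

/-- `A_α(x) = α A(α x)`. -/
def scaledA (α : ℝ) (A : R3 → R3) : R3 → R3 := fun x => α • A (α • x)

/-- `V_α(x) = α² V(α x)`. -/
def scaledV (α : ℝ) (V : R3 → ℝ) : R3 → ℝ := fun x => α ^ 2 * V (α • x)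

end Polaron

end

open MeasureTheory Filter Topology
open scoped ContDiff

noncomputable section

namespace Polaron

/-! ### Test functions -/

/-! At strong coupling the phonon field is nearly classical. For a normalized electron function φ,
replace each a(k) by a number z(k) and complete the square in z. With ρ = |φ|² and κ² = α/(2π²), the
field energy becomes -κ²∫|ρ̂(k)|²/|k|² dk. By `lintegral_coulomb_eq` this equals -α times the
Coulomb energy of ρ, and a dilation by α turns the total into α² times the Pekar functional.

The upper bound uses product states of a test function and a truncated coherent state. Coherent
states are eigenvectors of a(k), so after normalization the energy of the product is the classical
energy (`le_classical_energy`), and the optimal field, suitably regularized, gives the Pekar energy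
(`le_pekar_of_test`).

The lower bound follows the method of Lieb and Thomas. Replacing a normalized mode by a number costs
one unit of energy, because |z|² represents bb* = b*b + 1 in the coherent state calculus
(`hasMean_normSq_B`, `modes_lower_bound`). The infinitely many modes must therefore be cut down to
O(α^(9/5)) of them: large momenta are removed with the commutator of the plane wave and D_A, at the
price of a little kinetic energy (`uv_bound`), and momenta in the unit ball cost only O(α)
(`low_density_bound`); the electron is localized to a small ball (`cutForm_ge_of_loc`), the price
being the gradient energy of the localizing function; on such a ball a plane wave hardly changes
when k moves within a small cube, so that each momentum cube interacts through a single mode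
(`block_density_bound`, `cutForm_blocks_ge`). Completing the square in the classical block fields
leaves the Pekar functional with its kinetic and Coulomb terms perturbed by a relative amount s
(`one_particle_bound`), which moves its infimum by O(s) only (`exists_perturbed_pekar_bound`). With
α = β^10, cutoff β^12, localization radius β^(-9), about β^6 cubes per side and s of order β^(-2),
every error is O(β^18) = O(α^(9/5)).

Both bounds are proved on test functions, where V|f|² is integrable, and then extended. This needs
density of test functions in H¹_A when A is only locally square integrable
(`exists_test_h1Sq_sub_lt`: cut off, truncate the values, mollify). It also needs the magnetic form
of the bound on V, obtained from the diamagnetic inequality (`exists_form_bound`), which makes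
∫V|f|² continuous in the H¹_A norm. The Coulomb term is only shown to be lower semicontinuous
(`coulombE_le_liminf`), which is the direction that `le_pekarFunctional` requires.

For the lower bound all states are finite sums ∑ f_j ⊗ η_j. Every quantity is then a matrix of
electron integrals paired with a Gram matrix of Fock vectors, and inequalities need be checked on
rank one matrices only, that is, for a single electron function (`re_mpair_gram_le`). -/

lemma IsTest.continuous {f : R3 → ℂ} (hf : IsTest f) : Continuous f := hf.1.continuous

lemma IsTest.differentiable {f : R3 → ℂ} (hf : IsTest f) : Differentiable ℝ f :=
  hf.1.differentiable (by simp)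

lemma IsTest.isTest_partialD {f : R3 → ℂ} (hf : IsTest f) (l : Fin 3) : IsTest (partialD l f) := by
  refine ⟨?_, ?_⟩
  · exact (hf.1.fderiv_right (m := ∞) (by simp)).clm_apply contDiff_const
  · exact hf.2.fderiv_apply (𝕜 := ℝ) _

lemma IsTest.add {f g : R3 → ℂ} (hf : IsTest f) (hg : IsTest g) : IsTest (f + g) :=
  ⟨hf.1.add hg.1, hf.2.add hg.2⟩

lemma IsTest.const_smul {f : R3 → ℂ} (c : ℂ) (hf : IsTest f) : IsTest (c • f) :=
  ⟨contDiff_const.smul hf.1, hf.2.mono (by intro x hx; simp at hx ⊢; exact hx.2)⟩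

lemma IsTest.neg {f : R3 → ℂ} (hf : IsTest f) : IsTest (-f) := by
  simpa using hf.const_smul (-1)

lemma IsTest.sub {f g : R3 → ℂ} (hf : IsTest f) (hg : IsTest g) : IsTest (f - g) := by
  simpa [sub_eq_add_neg] using hf.add hg.neg

lemma IsTest.mul {f g : R3 → ℂ} (hf : IsTest f) (hg : ContDiff ℝ ∞ g) : IsTest (f * g) :=
  ⟨hf.1.mul hg, hf.2.mul_right⟩

lemma isTest_zero : IsTest (0 : R3 → ℂ) := ⟨contDiff_const, HasCompactSupport.zero⟩

lemma isTest_sum {ι : Type*} (s : Finset ι) {f : ι → R3 → ℂ} (hf : ∀ i ∈ s, IsTest (f i)) :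
    IsTest (∑ i ∈ s, f i) := by
  classical
  induction s using Finset.induction_on with
  | empty => simpa using isTest_zero
  | insert a s ha ih =>
    rw [Finset.sum_insert ha]
    exact (hf a (by simp)).add (ih fun i hi => hf i (by simp [hi]))

lemma isTest_of_smul_real {u : R3 → ℝ} (hu : ContDiff ℝ ∞ u) (hc : HasCompactSupport u) :
    IsTest (fun x => (u x : ℂ)) :=
  ⟨Complex.ofRealCLM.contDiff.comp hu, hc.comp_left (g := fun t : ℝ => (t : ℂ)) (by simp)⟩

lemma IsTest.memLp {f : R3 → ℂ} (hf : IsTest f) (p : ENNReal) : MemLp f p volume :=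
  hf.continuous.memLp_of_hasCompactSupport hf.2

lemma IsTest.integrable {f : R3 → ℂ} (hf : IsTest f) : Integrable f volume :=
  hf.continuous.integrable_of_hasCompactSupport hf.2

lemma partialD_mul {f g : R3 → ℂ} (hf : Differentiable ℝ f) (hg : Differentiable ℝ g) (l : Fin 3)
    (x : R3) : partialD l (f * g) x = f x * partialD l g x + partialD l f x * g x := by
  simp [partialD, fderiv_mul (hf x) (hg x)]; ring

/-- Integration by parts against a test function. -/
lemma integral_mul_partialD {f g : R3 → ℂ} (hf : ContDiff ℝ 1 f) (hg : IsTest g) (l : Fin 3) :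
    ∫ x, f x * partialD l g x = - ∫ x, partialD l f x * g x := by
  have hf' : Continuous (partialD l f) := (hf.continuous_fderiv (by simp)).clm_apply continuous_const
  refine integral_mul_fderiv_eq_neg_fderiv_mul_of_integrable ?_ ?_ ?_
    (fun x _ => hf.differentiable (by simp) x) (fun x _ => hg.differentiable x)
  · exact (hf'.mul hg.continuous).integrable_of_hasCompactSupport hg.2.mul_left
  · exact (hf.continuous.mul (hg.isTest_partialD l).continuous).integrable_of_hasCompactSupport
      (hg.isTest_partialD l).2.mul_left
  · exact (hf.continuous.mul hg.continuous).integrable_of_hasCompactSupport hg.2.mul_left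

/-! ### Square norms -/

lemma l2Sq_nonneg (φ : R3 → ℂ) : 0 ≤ l2Sq φ := integral_nonneg fun _ => by positivity

lemma l2Sq_congr {φ χ : R3 → ℂ} (h : φ =ᵐ[volume] χ) : l2Sq φ = l2Sq χ :=
  integral_congr_ae (by filter_upwards [h] with x hx; rw [hx])

lemma integrable_norm_sq {φ : R3 → ℂ} (h : MemLp φ 2 volume) :
    Integrable (fun x => ‖φ x‖ ^ 2) volume := by
  have := h.integrable_norm_pow (p := 2) (by simp)
  simpa using this

lemma l2Sq_smul (c : ℂ) (φ : R3 → ℂ) : l2Sq (c • φ) = ‖c‖ ^ 2 * l2Sq φ := by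
  simp [l2Sq, mul_pow, integral_const_mul]

lemma l2Sq_parallelogram {φ χ : R3 → ℂ} (h : MemLp φ 2 volume) (h' : MemLp χ 2 volume) :
    l2Sq (φ + χ) + l2Sq (φ - χ) = 2 * l2Sq φ + 2 * l2Sq χ := by
  unfold l2Sq
  rw [← integral_add (integrable_norm_sq (h.add h')) (integrable_norm_sq (h.sub h')),
    ← integral_const_mul, ← integral_const_mul,
    ← integral_add ((integrable_norm_sq h).const_mul _) ((integrable_norm_sq h').const_mul _)]
  refine integral_congr_ae (Eventually.of_forall fun x => ?_)
  have := parallelogram_law_with_norm ℝ (φ x) (χ x)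
  simp only [Pi.add_apply, Pi.sub_apply]
  nlinarith

lemma l2Sq_add_le {φ χ : R3 → ℂ} (h : MemLp φ 2 volume) (h' : MemLp χ 2 volume) :
    l2Sq (φ + χ) ≤ 2 * l2Sq φ + 2 * l2Sq χ := by
  have := l2Sq_parallelogram h h'
  have := l2Sq_nonneg (φ - χ)
  linarith

lemma l2Sq_eq_norm_toLp {φ : R3 → ℂ} (h : MemLp φ 2 volume) : l2Sq φ = ‖h.toLp φ‖ ^ 2 := by
  have h1 : (‖h.toLp φ‖ ^ 2 : ℝ) = (inner ℂ (h.toLp φ) (h.toLp φ)).re := by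
    rw [inner_self_eq_norm_sq_to_K]; norm_cast
  rw [h1, L2.inner_def, l2Sq, ← RCLike.re_eq_complex_re, ← integral_re]
  · refine integral_congr_ae ?_
    filter_upwards [h.coeFn_toLp] with x hx
    rw [hx]; simp only [RCLike.inner_apply]
    rw [Complex.mul_conj, Complex.normSq_eq_norm_sq]; exact (Complex.ofReal_re _).symm
  · exact L2.integrable_inner _ _

lemma inner_toLp {φ χ : R3 → ℂ} (h : MemLp φ 2 volume) (h' : MemLp χ 2 volume) :
    inner ℂ (h.toLp φ) (h'.toLp χ) = ∫ x, (starRingEnd ℂ) (φ x) * χ x := by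
  rw [L2.inner_def]
  refine integral_congr_ae ?_
  filter_upwards [h.coeFn_toLp, h'.coeFn_toLp] with x hx hx'
  rw [hx, hx']; simp [RCLike.inner_apply, mul_comm]

/-- Cauchy-Schwarz. -/
lemma norm_integral_conj_mul_le {φ χ : R3 → ℂ} (h : MemLp φ 2 volume) (h' : MemLp χ 2 volume) :
    ‖∫ x, (starRingEnd ℂ) (φ x) * χ x‖ ≤ Real.sqrt (l2Sq φ) * Real.sqrt (l2Sq χ) := by
  rw [← inner_toLp h h', l2Sq_eq_norm_toLp h, l2Sq_eq_norm_toLp h',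
    Real.sqrt_sq (norm_nonneg _), Real.sqrt_sq (norm_nonneg _)]
  exact norm_inner_le_norm _ _

lemma integral_norm_mul_norm_le {φ χ : R3 → ℂ} (h : MemLp φ 2 volume) (h' : MemLp χ 2 volume) :
    ∫ x, ‖φ x‖ * ‖χ x‖ ≤ Real.sqrt (l2Sq φ) * Real.sqrt (l2Sq χ) := by
  have h1 : MemLp (fun x => (‖φ x‖ : ℂ)) 2 volume := by
    have := h.norm.ofReal (K := ℂ); simpa using this
  have h2 : MemLp (fun x => (‖χ x‖ : ℂ)) 2 volume := by
    have := h'.norm.ofReal (K := ℂ); simpa using this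
  have := norm_integral_conj_mul_le h1 h2
  have e : ∀ u : R3 → ℂ, l2Sq (fun x => (‖u x‖ : ℂ)) = l2Sq u := fun u => by simp [l2Sq]
  rw [e, e] at this
  refine le_trans ?_ this
  have : (∫ x, (starRingEnd ℂ) (‖φ x‖ : ℂ) * (‖χ x‖ : ℂ)) = ((∫ x, ‖φ x‖ * ‖χ x‖ : ℝ) : ℂ) := by
    rw [← integral_complex_ofReal]; congr 1; ext x; simp
  rw [this, Complex.norm_real]
  exact le_abs_self _

lemma integrable_conj_mul {φ χ : R3 → ℂ} (h : MemLp φ 2 volume) (h' : MemLp χ 2 volume) :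
    Integrable (fun x => (starRingEnd ℂ) (φ x) * χ x) volume :=
  MemLp.integrable_mul (p := 2) (q := 2) h.star h'

/-! ### The magnetic gradient -/

/-- The pointwise magnetic derivative `(-i∂ₗ + Aₗ) f`. -/
def dA (A : R3 → R3) (l : Fin 3) (f : R3 → ℂ) (x : R3) : ℂ :=
  -Complex.I * partialD l f x + ((A x l : ℝ) : ℂ) * f x

lemma aestronglyMeasurable_component {A : R3 → R3} (hA : VectorL2Loc A) (l : Fin 3) :
    AEStronglyMeasurable (fun x => A x l) volume := by
  have h : AEStronglyMeasurable (fun x => A x l)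
      (volume.restrict (⋃ n : ℕ, Metric.closedBall (0 : R3) n)) := by
    rw [aestronglyMeasurable_iUnion_iff]
    exact fun n => (hA _ (isCompact_closedBall _ _) l).1
  rwa [Metric.iUnion_closedBall_nat, Measure.restrict_univ] at h

/-- A locally square integrable function times a bounded compactly supported one is in `L²`. -/
lemma memLp_component_mul {A : R3 → R3} (hA : VectorL2Loc A) (l : Fin 3) {f : R3 → ℂ}
    (hf : AEStronglyMeasurable f volume) (C : ℝ) (hC : ∀ x, ‖f x‖ ≤ C) {K : Set R3}
    (hK : IsCompact K) (hfK : ∀ x ∉ K, f x = 0) :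
    MemLp (fun x => ((A x l : ℝ) : ℂ) * f x) 2 volume := by
  have h1 : MemLp (K.indicator fun x => ((A x l : ℝ) : ℂ)) 2 volume := by
    rw [memLp_indicator_iff_restrict hK.measurableSet]
    have := (hA K hK l).ofReal (K := ℂ); simpa using this
  refine (h1.const_mul (C : ℂ)).mono
    ((Complex.continuous_ofReal.comp_aestronglyMeasurable
      (aestronglyMeasurable_component hA l)).mul hf) (Eventually.of_forall fun x => ?_)
  by_cases hx : x ∈ K
  · simp only [norm_mul, Set.indicator_of_mem hx, Complex.norm_real, Real.norm_eq_abs]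
    rw [mul_comm]
    gcongr
    exact (hC x).trans (le_abs_self _)
  · simp only [hfK x hx, mul_zero, norm_zero]; positivity

lemma IsTest.memLp_component_mul {A : R3 → R3} (hA : VectorL2Loc A) (l : Fin 3) {f : R3 → ℂ}
    (hf : IsTest f) : MemLp (fun x => ((A x l : ℝ) : ℂ) * f x) 2 volume := by
  obtain ⟨C, hC⟩ := hf.2.exists_bound_of_continuous hf.continuous
  exact Polaron.memLp_component_mul hA l hf.continuous.aestronglyMeasurable C hC hf.2
    (fun x hx => image_eq_zero_of_notMem_tsupport hx)

lemma IsTest.memLp_dA {A : R3 → R3} (hA : VectorL2Loc A) (l : Fin 3) {f : R3 → ℂ}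
    (hf : IsTest f) : MemLp (dA A l f) 2 volume :=
  (((hf.isTest_partialD l).memLp 2).const_mul _).add (hf.memLp_component_mul hA l)

lemma IsTest.memLp_adjoint {A : R3 → R3} (hA : VectorL2Loc A) (l : Fin 3) {f : R3 → ℂ}
    (hf : IsTest f) :
    MemLp (fun x => Complex.I * partialD l f x + ((A x l : ℝ) : ℂ) * f x) 2 volume :=
  (((hf.isTest_partialD l).memLp 2).const_mul _).add (hf.memLp_component_mul hA l)

/-- Integration by parts. The distributional pairing has no complex conjugate, so the transpose of
-i∂ + A is i∂ + A. -/
lemma IsTest.isL2MagGrad {A : R3 → R3} (hA : VectorL2Loc A) {f : R3 → ℂ} (hf : IsTest f) :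
    IsL2MagGrad A f (fun l => dA A l f) := by
  refine ⟨fun l => hf.memLp_dA hA l, fun l u hu => ?_⟩
  have hAu : Integrable (fun x => f x * (((A x l : ℝ) : ℂ) * u x)) volume :=
    MemLp.integrable_mul (p := 2) (q := 2) (hf.memLp 2) (hu.memLp_component_mul hA l)
  have h1 : Integrable (fun x => Complex.I * (f x * partialD l u x)) volume :=
    ((hf.mul (hu.isTest_partialD l).1).integrable).const_mul _
  have h2 : Integrable (fun x => -Complex.I * (partialD l f x * u x)) volume :=
    (((hf.isTest_partialD l).mul hu.1).integrable).const_mul _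
  have e1 : (fun x => f x * (Complex.I * partialD l u x + ((A x l : ℝ) : ℂ) * u x)) =
      fun x => Complex.I * (f x * partialD l u x) + f x * (((A x l : ℝ) : ℂ) * u x) := by
    ext x; ring
  have e2 : (fun x => dA A l f x * u x) =
      fun x => -Complex.I * (partialD l f x * u x) + f x * (((A x l : ℝ) : ℂ) * u x) := by
    ext x; simp only [dA]; ring
  rw [e1, e2, integral_add h1 hAu, integral_add h2 hAu, integral_const_mul, integral_const_mul,
    integral_mul_partialD (hf.1.of_le (by simp)) hu l]
  ring

lemma IsTest.memH1 {A : R3 → R3} (hA : VectorL2Loc A) {f : R3 → ℂ} (hf : IsTest f) :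
    MemH1 A f := ⟨hf.memLp 2, _, hf.isL2MagGrad hA⟩

/-- Real test functions already determine a locally integrable function. Hence the choice made in
`magGrad` is harmless and `kinetic` may be computed from any square integrable gradient. -/
lemma IsL2MagGrad.ae_eq {A : R3 → R3} {φ : R3 → ℂ} {g g' : Fin 3 → R3 → ℂ}
    (h : IsL2MagGrad A φ g) (h' : IsL2MagGrad A φ g') (l : Fin 3) : g l =ᵐ[volume] g' l := by
  refine ae_eq_of_integral_contDiff_smul_eq ((h.1 l).locallyIntegrable (by norm_num))
    ((h'.1 l).locallyIntegrable (by norm_num)) fun u hu hc => ?_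
  have ht := isTest_of_smul_real hu hc
  have := (h.2 l _ ht).symm.trans (h'.2 l _ ht)
  simpa [mul_comm] using this

lemma MemH1.isL2MagGrad {A : R3 → R3} {φ : R3 → ℂ} (h : MemH1 A φ) :
    IsL2MagGrad A φ (magGrad A φ) := by
  rw [magGrad, dif_pos h.2]; exact h.2.choose_spec

lemma IsL2MagGrad.magGrad_ae_eq {A : R3 → R3} {φ : R3 → ℂ} {g : Fin 3 → R3 → ℂ}
    (h : IsL2MagGrad A φ g) (l : Fin 3) : magGrad A φ l =ᵐ[volume] g l := by
  have : IsL2MagGrad A φ (magGrad A φ) := by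
    rw [magGrad, dif_pos ⟨g, h⟩]; exact Exists.choose_spec (p := IsL2MagGrad A φ) ⟨g, h⟩
  exact this.ae_eq h l

lemma IsL2MagGrad.kinetic_eq {A : R3 → R3} {φ : R3 → ℂ} {g : Fin 3 → R3 → ℂ}
    (h : IsL2MagGrad A φ g) : kinetic A φ = ∑ l, l2Sq (g l) :=
  Finset.sum_congr rfl fun l _ => l2Sq_congr (h.magGrad_ae_eq l)

lemma IsTest.kinetic_eq {A : R3 → R3} (hA : VectorL2Loc A) {f : R3 → ℂ} (hf : IsTest f) :
    kinetic A f = ∑ l, l2Sq (dA A l f) := (hf.isL2MagGrad hA).kinetic_eq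

lemma IsL2MagGrad.add {A : R3 → R3} (hA : VectorL2Loc A) {φ χ : R3 → ℂ}
    {g g' : Fin 3 → R3 → ℂ} (hφ : MemLp φ 2 volume) (hχ : MemLp χ 2 volume)
    (h : IsL2MagGrad A φ g) (h' : IsL2MagGrad A χ g') : IsL2MagGrad A (φ + χ) (g + g') := by
  refine ⟨fun l => (h.1 l).add (h'.1 l), fun l u hu => ?_⟩
  have i1 := MemLp.integrable_mul (p := 2) (q := 2) hφ (hu.memLp_adjoint hA l)
  have i2 := MemLp.integrable_mul (p := 2) (q := 2) hχ (hu.memLp_adjoint hA l)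
  have i3 := MemLp.integrable_mul (p := 2) (q := 2) (h.1 l) (hu.memLp 2)
  have i4 := MemLp.integrable_mul (p := 2) (q := 2) (h'.1 l) (hu.memLp 2)
  have e1 := integral_add i1 i2
  have e2 := integral_add i3 i4
  simp only [Pi.mul_apply] at e1 e2
  rw [h.2 l u hu, h'.2 l u hu, ← e2] at e1
  simpa [add_mul] using e1

lemma IsL2MagGrad.const_smul {A : R3 → R3} {φ : R3 → ℂ}
    {g : Fin 3 → R3 → ℂ} (c : ℂ) (h : IsL2MagGrad A φ g) : IsL2MagGrad A (c • φ) (c • g) := by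
  refine ⟨fun l => (h.1 l).const_smul c, fun l u hu => ?_⟩
  have := h.2 l u hu
  simp only [Pi.smul_apply, smul_eq_mul, mul_assoc, integral_const_mul, this]

lemma MemH1.add {A : R3 → R3} (hA : VectorL2Loc A) {φ χ : R3 → ℂ} (h : MemH1 A φ)
    (h' : MemH1 A χ) : MemH1 A (φ + χ) :=
  ⟨h.1.add h'.1, _, h.isL2MagGrad.add hA h.1 h'.1 h'.isL2MagGrad⟩

lemma MemH1.const_smul {A : R3 → R3} {φ : R3 → ℂ} (c : ℂ) (h : MemH1 A φ) : MemH1 A (c • φ) :=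
  ⟨h.1.const_smul c, _, h.isL2MagGrad.const_smul c⟩

lemma MemH1.sub {A : R3 → R3} (hA : VectorL2Loc A) {φ χ : R3 → ℂ} (h : MemH1 A φ)
    (h' : MemH1 A χ) : MemH1 A (φ - χ) := by
  simpa [sub_eq_add_neg] using h.add hA (h'.const_smul (-1))

/-- The squared norm of `H¹_A`. -/
def h1Sq (A : R3 → R3) (φ : R3 → ℂ) : ℝ := l2Sq φ + kinetic A φ

lemma kinetic_nonneg (A : R3 → R3) (φ : R3 → ℂ) : 0 ≤ kinetic A φ :=
  Finset.sum_nonneg fun _ _ => l2Sq_nonneg _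

lemma h1Sq_nonneg (A : R3 → R3) (φ : R3 → ℂ) : 0 ≤ h1Sq A φ :=
  add_nonneg (l2Sq_nonneg _) (kinetic_nonneg _ _)

lemma kinetic_smul {A : R3 → R3} {φ : R3 → ℂ} (c : ℂ) (h : MemH1 A φ) :
    kinetic A (c • φ) = ‖c‖ ^ 2 * kinetic A φ := by
  rw [(h.isL2MagGrad.const_smul c).kinetic_eq, kinetic, Finset.mul_sum]
  exact Finset.sum_congr rfl fun l _ => l2Sq_smul _ _

lemma kinetic_parallelogram {A : R3 → R3} (hA : VectorL2Loc A) {φ χ : R3 → ℂ} (h : MemH1 A φ)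
    (h' : MemH1 A χ) :
    kinetic A (φ + χ) + kinetic A (φ - χ) = 2 * kinetic A φ + 2 * kinetic A χ := by
  have e1 := (h.isL2MagGrad.add hA h.1 h'.1 h'.isL2MagGrad).kinetic_eq
  have e2 := (h.isL2MagGrad.add hA h.1 (h'.const_smul (-1)).1
    (h'.isL2MagGrad.const_smul (-1))).kinetic_eq
  rw [show φ - χ = φ + (-1 : ℂ) • χ by simp [sub_eq_add_neg], e1, e2, kinetic, kinetic,
    Finset.mul_sum, Finset.mul_sum, ← Finset.sum_add_distrib, ← Finset.sum_add_distrib]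
  refine Finset.sum_congr rfl fun l _ => ?_
  have := l2Sq_parallelogram (h.isL2MagGrad.1 l) (h'.isL2MagGrad.1 l)
  simpa [sub_eq_add_neg] using this

/-- This identity replaces an inner product on H¹_A: it yields the quasi-triangle inequality
`h1Sq_add_le` and the polarization argument of `abs_potEnergy_sub_le`. -/
lemma h1Sq_parallelogram {A : R3 → R3} (hA : VectorL2Loc A) {φ χ : R3 → ℂ} (h : MemH1 A φ)
    (h' : MemH1 A χ) : h1Sq A (φ + χ) + h1Sq A (φ - χ) = 2 * h1Sq A φ + 2 * h1Sq A χ := by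
  have := kinetic_parallelogram hA h h'
  have := l2Sq_parallelogram h.1 h'.1
  simp only [h1Sq]; linarith

lemma h1Sq_smul {A : R3 → R3} {φ : R3 → ℂ} (c : ℂ) (h : MemH1 A φ) :
    h1Sq A (c • φ) = ‖c‖ ^ 2 * h1Sq A φ := by
  rw [h1Sq, h1Sq, kinetic_smul c h, l2Sq_smul]; ring

lemma h1Sq_add_le {A : R3 → R3} (hA : VectorL2Loc A) {φ χ : R3 → ℂ} (h : MemH1 A φ)
    (h' : MemH1 A χ) : h1Sq A (φ + χ) ≤ 2 * h1Sq A φ + 2 * h1Sq A χ := by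
  have := h1Sq_parallelogram hA h h'
  have := h1Sq_nonneg A (φ - χ)
  linarith

/-! ### Mollification -/

/-- A sequence bounded by a sequence whose integrals converge to that of its limit. -/
lemma tendsto_integral_zero_of_le {α : Type*} [MeasurableSpace α] {μ : Measure α}
    {F G : ℕ → α → ℝ} {G₀ : α → ℝ}
    (hF0 : ∀ n x, 0 ≤ F n x) (hFG : ∀ n, ∀ᵐ x ∂μ, F n x ≤ G n x)
    (hF : ∀ n, Integrable (F n) μ) (hG : ∀ n, Integrable (G n) μ) (hG₀ : Integrable G₀ μ)
    (hFt : ∀ᵐ x ∂μ, Tendsto (fun n => F n x) atTop (𝓝 0))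
    (hGt : ∀ᵐ x ∂μ, Tendsto (fun n => G n x) atTop (𝓝 (G₀ x)))
    (hGi : Tendsto (fun n => ∫ x, G n x ∂μ) atTop (𝓝 (∫ x, G₀ x ∂μ))) :
    Tendsto (fun n => ∫ x, F n x ∂μ) atTop (𝓝 0) := by
  have hG₀0 : ∀ᵐ x ∂μ, 0 ≤ G₀ x := by
    filter_upwards [hGt, ae_all_iff.2 hFG] with x h1 h2
    exact ge_of_tendsto' h1 fun n => (hF0 n x).trans (h2 n)
  -- Fatou's lemma for G n - F n ≥ 0, whose pointwise limit is G₀. Since ∫ G n converges to ∫ G₀, no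
  -- mass is left for F n.
  have fatou : ENNReal.ofReal (∫ x, G₀ x ∂μ) ≤
      liminf (fun n => ENNReal.ofReal (∫ x, G n x ∂μ - ∫ x, F n x ∂μ)) atTop := by
    have h1 := lintegral_liminf_le' (μ := μ) (u := atTop)
      (f := fun n x => ENNReal.ofReal (G n x - F n x))
      (fun n => ((hG n).sub (hF n)).aemeasurable.ennreal_ofReal)
    have h2 : ∫⁻ x, liminf (fun n => ENNReal.ofReal (G n x - F n x)) atTop ∂μ
        = ENNReal.ofReal (∫ x, G₀ x ∂μ) := by
      rw [ofReal_integral_eq_lintegral_ofReal hG₀ hG₀0]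
      refine lintegral_congr_ae ?_
      filter_upwards [hFt, hGt] with x h1 h2
      have := (ENNReal.tendsto_ofReal (h2.sub h1)).liminf_eq
      simpa using this
    rw [h2] at h1
    refine h1.trans (le_of_eq ?_)
    congr 1
    ext n
    rw [← integral_sub (hG n) (hF n)]
    refine (ofReal_integral_eq_lintegral_ofReal ((hG n).sub (hF n)) ?_).symm
    filter_upwards [hFG n] with x hx
    simpa using hx
  have hle : ∀ n, ∫ x, F n x ∂μ ≤ ∫ x, G n x ∂μ := fun n =>
    integral_mono_ae (hF n) (hG n) (hFG n)
  have hF0' : ∀ n, 0 ≤ ∫ x, F n x ∂μ := fun n => integral_nonneg (hF0 n)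
  -- The strict inequality between extended reals used below needs ∫ G₀ > 0; when ∫ G₀ = 0 a squeeze
  -- suffices.
  rcases (integral_nonneg_of_ae hG₀0).eq_or_lt with h0 | h0
  · refine squeeze_zero hF0' hle ?_
    simpa [h0] using hGi
  · rw [Metric.tendsto_atTop]
    intro ε hε
    have hlt : ENNReal.ofReal (∫ x, G₀ x ∂μ - ε / 2) < ENNReal.ofReal (∫ x, G₀ x ∂μ) :=
      (ENNReal.ofReal_lt_ofReal_iff h0).2 (by linarith)
    have e1 := eventually_lt_of_lt_liminf (hlt.trans_le fatou)
    have e2 := (tendsto_order.1 hGi).2 (∫ x, G₀ x ∂μ + ε / 2) (by linarith)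
    obtain ⟨N, hN⟩ := eventually_atTop.1 (e1.and e2)
    refine ⟨N, fun n hn => ?_⟩
    obtain ⟨h1, h2⟩ := hN n hn
    have h3 : ∫ x, G₀ x ∂μ - ε / 2 < ∫ x, G n x ∂μ - ∫ x, F n x ∂μ :=
      lt_of_not_ge fun h => absurd (ENNReal.ofReal_le_ofReal h) (not_le.2 h1)
    rw [Real.dist_eq, sub_zero, abs_of_nonneg (hF0' n)]
    linarith

/-- Dominated convergence to zero in `L²`. -/
lemma tendsto_l2Sq_zero {u : ℕ → R3 → ℂ} {F : R3 → ℝ} (hu : ∀ n, AEStronglyMeasurable (u n) volume)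
    (hF : Integrable (fun x => F x ^ 2) volume) (hb : ∀ n, ∀ᵐ x, ‖u n x‖ ≤ F x)
    (ht : ∀ᵐ x, Tendsto (fun n => u n x) atTop (𝓝 0)) :
    Tendsto (fun n => l2Sq (u n)) atTop (𝓝 0) := by
  have := tendsto_integral_of_dominated_convergence (F := fun n x => ‖u n x‖ ^ 2)
    (f := fun _ => (0 : ℝ)) (bound := fun x => F x ^ 2) (fun n => (hu n).norm.pow 2) hF
    (fun n => by
      filter_upwards [hb n] with x hx
      rw [Real.norm_eq_abs, abs_of_nonneg (by positivity)]
      gcongr)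
    (by
      filter_upwards [ht] with x hx
      simpa using (hx.norm.pow 2))
  simpa [l2Sq] using this

/-- A shrinking sequence of bump functions. -/
def bump (n : ℕ) : ContDiffBump (0 : R3) where
  rIn := 1 / (n + 1)
  rOut := 2 / (n + 1)
  rIn_pos := by positivity
  rIn_lt_rOut := by gcongr; norm_num

/-- The mollifier kernel. -/
def mollKernel (n : ℕ) : R3 → ℝ := (bump n).normed volume

variable {E : Type*} [NormedAddCommGroup E] [NormedSpace ℝ E]

/-- Mollification. -/
def moll (n : ℕ) (g : R3 → E) (x : R3) : E := ∫ t, mollKernel n (x - t) • g t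

lemma moll_eq (n : ℕ) (g : R3 → E) :
    moll n g = MeasureTheory.convolution (mollKernel n) g (ContinuousLinearMap.lsmul ℝ ℝ) volume := by
  ext x; rw [convolution_lsmul_swap]; rfl

lemma mollKernel_nonneg (n : ℕ) (x : R3) : 0 ≤ mollKernel n x := (bump n).nonneg_normed x

lemma mollKernel_contDiff (n : ℕ) : ContDiff ℝ ∞ (mollKernel n) := (bump n).contDiff_normed

lemma mollKernel_compact (n : ℕ) : HasCompactSupport (mollKernel n) :=
  (bump n).hasCompactSupport_normed

lemma integral_mollKernel_sub (n : ℕ) (x : R3) : ∫ t, mollKernel n (x - t) = 1 := by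
  rw [integral_sub_left_eq_self (mollKernel n) volume x]
  exact (bump n).integral_normed

lemma mollKernel_integrable (n : ℕ) : Integrable (mollKernel n) volume :=
  (mollKernel_contDiff n).continuous.integrable_of_hasCompactSupport (mollKernel_compact n)

lemma moll_tendsto_ae [CompleteSpace E] {g : R3 → E} (hg : LocallyIntegrable g volume) :
    ∀ᵐ x, Tendsto (fun n => moll n g x) atTop (𝓝 (g x)) := by
  -- Lebesgue differentiation along the kernels requires a bounded ratio of outer to inner radius;
  -- for `bump` it is exactly 2.
  have h := ContDiffBump.ae_convolution_tendsto_right_of_locallyIntegrable (φ := bump)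
    (l := atTop) (K := 2) (μ := (volume : Measure R3)) (g := g) ?_ ?_ hg
  · filter_upwards [h] with x hx
    simp_rw [moll_eq]; exact hx
  · have := (tendsto_one_div_add_atTop_nhds_zero_nat (𝕜 := ℝ)).const_mul 2
    simpa [bump, mul_one_div, div_eq_mul_inv] using this
  · refine Eventually.of_forall fun n => le_of_eq ?_
    simp [bump]; ring

lemma moll_integrand_integrable {g : R3 → E} (hg : LocallyIntegrable g volume) (n : ℕ) (x : R3) :
    Integrable (fun t => mollKernel n (x - t) • g t) volume := by
  have h : ConvolutionExists (mollKernel n) g (ContinuousLinearMap.lsmul ℝ ℝ) volume :=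
    (mollKernel_compact n).convolutionExists_left _ (mollKernel_contDiff n).continuous hg
  have := (h x).integrable_swap
  simpa using this

lemma norm_moll_le {g : R3 → E} (n : ℕ) (x : R3) :
    ‖moll n g x‖ ≤ moll n (fun t => ‖g t‖) x := by
  refine (norm_integral_le_integral_norm _).trans (le_of_eq ?_)
  simp [moll, norm_smul, abs_of_nonneg (mollKernel_nonneg _ _)]

lemma norm_moll_le_const {g : R3 → E} {C : ℝ} (hC : ∀ x, ‖g x‖ ≤ C) (n : ℕ) (x : R3) :
    ‖moll n g x‖ ≤ C := by
  have hi : Integrable (fun t => mollKernel n (x - t)) volume :=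
    (mollKernel_integrable n).comp_sub_left x
  refine (norm_integral_le_of_norm_le (hi.mul_const C) (Eventually.of_forall fun t => ?_)).trans ?_
  · rw [norm_smul, Real.norm_eq_abs, abs_of_nonneg (mollKernel_nonneg _ _)]
    exact mul_le_mul_of_nonneg_left (hC t) (mollKernel_nonneg _ _)
  · rw [integral_mul_const, integral_mollKernel_sub, one_mul]

lemma moll_eq_zero {g : R3 → E} {R : ℝ} (hg : ∀ x ∉ Metric.closedBall (0 : R3) R, g x = 0) (n : ℕ) :
    ∀ x ∉ Metric.closedBall (0 : R3) (R + 2), moll n g x = 0 := by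
  intro x hx
  refine integral_eq_zero_of_ae (Eventually.of_forall fun t => ?_)
  by_cases ht : t ∈ Metric.closedBall (0 : R3) R
  · have : mollKernel n (x - t) = 0 := by
      by_contra h
      have : x - t ∈ Function.support ((bump n).normed volume) := h
      rw [ContDiffBump.support_normed_eq] at this
      have h2 : (bump n).rOut ≤ 2 := by
        simp only [bump]; rw [div_le_iff₀ (by positivity)]; nlinarith [Nat.cast_nonneg (α := ℝ) n]
      simp only [Metric.mem_ball, Metric.mem_closedBall, dist_zero_right] at *
      have := norm_sub_norm_le x t
      linarith
    simp [this]
  · simp [hg t ht]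

lemma moll_contDiff {g : R3 → E} (hg : LocallyIntegrable g volume) (n : ℕ) :
    ContDiff ℝ ∞ (moll n g) := by
  rw [moll_eq]
  exact (mollKernel_compact n).contDiff_convolution_left _ (mollKernel_contDiff n) hg

lemma moll_integrable {g : R3 → E} (hg : Integrable g volume) (n : ℕ) :
    Integrable (moll n g) volume := by
  rw [moll_eq]; exact (mollKernel_integrable n).integrable_convolution _ hg

lemma integral_moll {g : R3 → ℝ} (hg : Integrable g volume) (n : ℕ) :
    ∫ x, moll n g x = ∫ x, g x := by
  rw [moll_eq, integral_convolution _ (mollKernel_integrable n) hg]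
  have : ∫ x, mollKernel n x = 1 := (bump n).integral_normed
  simp [this]

/-- Mollification preserves the integral of |g|, so the majorants moll |g| + |g| have constant
integral and the generalized dominated convergence theorem applies. -/
lemma tendsto_integral_norm_moll_sub [CompleteSpace E] {g : R3 → E} (hg : Integrable g volume) :
    Tendsto (fun n => ∫ x, ‖moll n g x - g x‖) atTop (𝓝 0) := by
  have hn : ∀ n, Integrable (moll n fun t => ‖g t‖) volume := fun n => moll_integrable hg.norm n
  refine tendsto_integral_zero_of_le (G := fun n x => moll n (fun t => ‖g t‖) x + ‖g x‖)
    (G₀ := fun x => ‖g x‖ + ‖g x‖) (fun _ _ => norm_nonneg _)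
    (fun n => Eventually.of_forall fun x => ?_) (fun n => ((moll_integrable hg n).sub hg).norm)
    (fun n => (hn n).add hg.norm) (hg.norm.add hg.norm) ?_ ?_ ?_
  · exact (norm_sub_le _ _).trans (by gcongr; exact norm_moll_le n x)
  · filter_upwards [moll_tendsto_ae hg.locallyIntegrable] with x hx
    simpa using (hx.sub_const (g x)).norm
  · filter_upwards [moll_tendsto_ae hg.norm.locallyIntegrable] with x hx
    exact hx.add_const _
  · refine tendsto_const_nhds.congr fun n => ?_
    rw [integral_add (hn n) hg.norm, integral_add hg.norm hg.norm, integral_moll hg.norm]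

/-- Jensen's inequality for the probability density t ↦ K(x - t), obtained by integrating (m - |g|)²
≥ 0 with m the mean of |g|. -/
lemma norm_moll_sq_le {g : R3 → ℂ} (hg : MemLp g 2 volume) (n : ℕ) (x : R3) :
    ‖moll n g x‖ ^ 2 ≤ moll n (fun t => ‖g t‖ ^ 2) x := by
  have h1 := norm_moll_le (g := g) n x
  set m := moll n (fun t => ‖g t‖) x with hm
  have hgl : LocallyIntegrable g volume := hg.locallyIntegrable (by norm_num)
  have i1 : Integrable (fun t => mollKernel n (x - t) • ‖g t‖) volume := by
    refine (moll_integrand_integrable hgl n x).norm.congr (Eventually.of_forall fun t => ?_)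
    simp [abs_of_nonneg (mollKernel_nonneg _ _)]
  have i2 := (moll_integrand_integrable (integrable_norm_sq hg).locallyIntegrable n x)
  have i0 : Integrable (fun t => mollKernel n (x - t)) volume :=
    (mollKernel_integrable n).comp_sub_left x
  have key : 2 * m * m ≤ m ^ 2 + moll n (fun t => ‖g t‖ ^ 2) x := by
    have e1 : 2 * m * m = ∫ t, 2 * m * (mollKernel n (x - t) • ‖g t‖) := by
      rw [integral_const_mul]; rfl
    have e2 : m ^ 2 + moll n (fun t => ‖g t‖ ^ 2) x =
        ∫ t, (m ^ 2 * mollKernel n (x - t) + mollKernel n (x - t) • ‖g t‖ ^ 2) := by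
      rw [integral_add (i0.const_mul _) i2, integral_const_mul, integral_mollKernel_sub, mul_one]
      rfl
    rw [e1, e2]
    refine integral_mono (i1.const_mul _) ((i0.const_mul _).add i2) fun t => ?_
    simp only [smul_eq_mul]
    nlinarith [mollKernel_nonneg n (x - t), mul_nonneg (mollKernel_nonneg n (x - t))
      (sq_nonneg (m - ‖g t‖))]
  have : ‖moll n g x‖ ^ 2 ≤ m ^ 2 := by gcongr
  nlinarith

lemma moll_memLp {g : R3 → ℂ} (hg : MemLp g 2 volume) (n : ℕ) : MemLp (moll n g) 2 volume := by
  have hc := (moll_contDiff (hg.locallyIntegrable (by norm_num)) n).continuous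
  refine (memLp_two_iff_integrable_sq_norm hc.aestronglyMeasurable).2 ?_
  refine (moll_integrable (integrable_norm_sq hg) n).mono' (hc.norm.pow 2).aestronglyMeasurable
    (Eventually.of_forall fun x => ?_)
  rw [Real.norm_eq_abs, abs_of_nonneg (by positivity)]
  exact norm_moll_sq_le hg n x

lemma tendsto_l2Sq_moll_sub {g : R3 → ℂ} (hg : MemLp g 2 volume) :
    Tendsto (fun n => l2Sq (moll n g - g)) atTop (𝓝 0) := by
  have hs := integrable_norm_sq hg
  have hn : ∀ n, Integrable (moll n fun t => ‖g t‖ ^ 2) volume := fun n => moll_integrable hs n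
  refine tendsto_integral_zero_of_le
    (G := fun n x => 2 * (moll n (fun t => ‖g t‖ ^ 2) x + ‖g x‖ ^ 2))
    (G₀ := fun x => 2 * (‖g x‖ ^ 2 + ‖g x‖ ^ 2)) (fun _ _ => by positivity)
    (fun n => Eventually.of_forall fun x => ?_)
    (fun n => integrable_norm_sq ((moll_memLp hg n).sub hg))
    (fun n => ((hn n).add hs).const_mul _) ((hs.add hs).const_mul _) ?_ ?_ ?_
  · have h1 := norm_sub_le (moll n g x) (g x)
    have h2 := norm_moll_sq_le hg n x
    have : ‖(moll n g - g) x‖ ^ 2 ≤ (‖moll n g x‖ + ‖g x‖) ^ 2 := by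
      gcongr; exact h1
    nlinarith [sq_nonneg (‖moll n g x‖ - ‖g x‖)]
  · filter_upwards [moll_tendsto_ae (hg.locallyIntegrable (by norm_num))] with x hx
    simpa using ((hx.sub_const (g x)).norm.pow 2)
  · filter_upwards [moll_tendsto_ae hs.locallyIntegrable] with x hx
    exact (hx.add_const _).const_mul _
  · refine tendsto_const_nhds.congr fun n => ?_
    rw [integral_const_mul, integral_const_mul, integral_add (hn n) hs, integral_add hs hs,
      integral_moll hs]

/-! ### Weak derivatives -/

/-- `d` is the distributional derivative of `φ` in direction `l`. -/
def WeakD (l : Fin 3) (φ d : R3 → ℂ) : Prop :=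
  ∀ f : R3 → ℂ, IsTest f → ∫ x, φ x * partialD l f x = - ∫ x, d x * f x

/-- The function t ↦ K(x - t) is itself a test function. The sign from reflecting the kernel cancels
the sign in the definition of the weak derivative. -/
lemma WeakD.partialD_moll {l : Fin 3} {φ d : R3 → ℂ} (h : WeakD l φ d)
    (hφ : LocallyIntegrable φ volume) (n : ℕ) : partialD l (moll n φ) = moll n d := by
  ext x
  have hd := ((mollKernel_compact n).hasFDerivAt_convolution_left (μ := volume)
    (ContinuousLinearMap.lsmul ℝ ℝ : ℝ →L[ℝ] ℂ →L[ℝ] ℂ)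
    ((mollKernel_contDiff n).of_le (by simp)) hφ x)
  rw [← moll_eq] at hd
  have hex : ConvolutionExistsAt (fderiv ℝ (mollKernel n)) φ x
      (ContinuousLinearMap.precompL R3 (ContinuousLinearMap.lsmul ℝ ℝ : ℝ →L[ℝ] ℂ →L[ℝ] ℂ)) volume :=
    ((mollKernel_compact n).fderiv (𝕜 := ℝ)).convolutionExists_left _
      ((mollKernel_contDiff n).continuous_fderiv (by simp)) hφ x
  have h1 : partialD l (moll n φ) x =
      ∫ t, (fderiv ℝ (mollKernel n) (x - t) (EuclideanSpace.single l 1)) • φ t := by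
    rw [partialD, hd.fderiv, convolution_eq_swap,
      ContinuousLinearMap.integral_apply hex.integrable_swap]
    rfl
  have ht : IsTest (fun t => (mollKernel n (x - t) : ℂ)) := by
    refine isTest_of_smul_real ((mollKernel_contDiff n).comp (contDiff_const.sub contDiff_id)) ?_
    exact (mollKernel_compact n).comp_homeomorph (Homeomorph.subLeft x)
  have h2 : ∀ t, partialD l (fun t => (mollKernel n (x - t) : ℂ)) t =
      -((fderiv ℝ (mollKernel n) (x - t) (EuclideanSpace.single l 1) : ℝ) : ℂ) := by
    intro t
    have e1 : HasFDerivAt (fun t : R3 => x - t) (-ContinuousLinearMap.id ℝ R3) t := 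
      (hasFDerivAt_id t).const_sub x
    have e2 := ((mollKernel_contDiff n).differentiable (by simp) (x - t)).hasFDerivAt
    have e3 := Complex.ofRealCLM.hasFDerivAt.comp t (e2.comp t e1)
    have e4 : HasFDerivAt (fun t => (mollKernel n (x - t) : ℂ)) _ t := e3
    rw [partialD, e4.fderiv]; simp
  have h3 := h _ ht
  simp_rw [h2] at h3
  rw [h1, moll]
  simp only [mul_neg, integral_neg, neg_inj] at h3
  simp only [Complex.real_smul]
  rw [← integral_congr_ae (Eventually.of_forall fun t => mul_comm _ _), h3]
  exact integral_congr_ae (Eventually.of_forall fun t => mul_comm _ _)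

/-! ### Bounded truncation of complex values -/

/-- A smooth bounded truncation of complex values. -/
def trunc (ε : ℝ) (w : ℂ) : ℂ := (1 + ε * ‖w‖ ^ 2)⁻¹ • w

/-- The derivative of `trunc`. -/
def truncD (ε : ℝ) (w v : ℂ) : ℂ :=
  (1 + ε * ‖w‖ ^ 2)⁻¹ • v - (ε * (2 * inner ℝ w v) * ((1 + ε * ‖w‖ ^ 2)⁻¹) ^ 2) • w

lemma trunc_den_pos {ε : ℝ} (hε : 0 ≤ ε) (w : ℂ) : 0 < 1 + ε * ‖w‖ ^ 2 := by positivity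

lemma trunc_contDiff {ε : ℝ} (hε : 0 ≤ ε) : ContDiff ℝ ∞ (trunc ε) :=
  ((contDiff_const.add (contDiff_const.mul (contDiff_norm_sq ℝ))).inv
    (fun w => (trunc_den_pos hε w).ne')).smul contDiff_id

lemma partialD_trunc_comp {ε : ℝ} (hε : 0 ≤ ε) {u : R3 → ℂ} (hu : Differentiable ℝ u) (l : Fin 3)
    (x : R3) : partialD l (fun y => trunc ε (u y)) x = truncD ε (u x) (partialD l u x) := by
  have h1 := (hu x).hasFDerivAt
  have h2 := ((h1.norm_sq.const_mul ε).const_add 1)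
  have h3 := (hasDerivAt_inv (trunc_den_pos hε (u x)).ne').comp_hasFDerivAt x h2
  have h4 : HasFDerivAt (fun y => trunc ε (u y)) _ x := h3.smul h1
  rw [partialD, h4.fderiv]
  simp only [truncD, partialD, add_apply, smul_apply,
    ContinuousLinearMap.smulRight_apply, Function.comp, ContinuousLinearMap.comp_apply,
    innerSL_apply_apply]
  rw [sub_eq_add_neg, ← neg_smul]
  congr 2
  simp only [smul_eq_mul, nsmul_eq_mul, inv_pow]
  push_cast
  ring

lemma norm_trunc_le {ε : ℝ} (hε : 0 < ε) (w : ℂ) : ‖trunc ε w‖ ≤ 1 + 1 / ε := by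
  have h := trunc_den_pos hε.le w
  rw [trunc, norm_smul, Real.norm_eq_abs, abs_of_pos (inv_pos.2 h), inv_mul_le_iff₀ h]
  have : (1 + ε * ‖w‖ ^ 2) * (1 + 1 / ε) = 1 + 1 / ε + ε * ‖w‖ ^ 2 + ‖w‖ ^ 2 := by
    field_simp; ring
  rw [this]
  have : 0 < 1 / ε := by positivity
  nlinarith [norm_nonneg w, mul_nonneg hε.le (sq_nonneg ‖w‖), sq_nonneg (‖w‖ - 1)]

lemma inv_den_le_one {ε : ℝ} (hε : 0 ≤ ε) (w : ℂ) : (1 + ε * ‖w‖ ^ 2)⁻¹ ≤ 1 :=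
  inv_le_one_of_one_le₀ (by nlinarith [mul_nonneg hε (sq_nonneg ‖w‖)])

lemma norm_trunc_le_norm {ε : ℝ} (hε : 0 ≤ ε) (w : ℂ) : ‖trunc ε w‖ ≤ ‖w‖ := by
  rw [trunc, norm_smul, Real.norm_eq_abs, abs_of_pos (inv_pos.2 (trunc_den_pos hε w))]
  exact mul_le_of_le_one_left (norm_nonneg _) (inv_den_le_one hε w)

/-- The radial term contributes 2‖v‖ because ε|w|²/(1 + ε|w|²) ≤ 1. The bound is independent of ε,
so it dominates along ε → 0. -/
lemma norm_truncD_le {ε : ℝ} (hε : 0 ≤ ε) (w v : ℂ) : ‖truncD ε w v‖ ≤ 3 * ‖v‖ := by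
  have h := trunc_den_pos hε w
  have hi := inv_pos.2 h
  have h1 := inv_den_le_one hε w
  have e1 : ‖(1 + ε * ‖w‖ ^ 2)⁻¹ • v‖ ≤ ‖v‖ := by
    rw [norm_smul, Real.norm_eq_abs, abs_of_pos hi]
    exact mul_le_of_le_one_left (norm_nonneg _) h1
  have e2 : ‖(ε * (2 * inner ℝ w v) * ((1 + ε * ‖w‖ ^ 2)⁻¹) ^ 2) • w‖ ≤ 2 * ‖v‖ := by
    rw [norm_smul, Real.norm_eq_abs, abs_mul, abs_mul, abs_mul, abs_of_nonneg hε,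
      abs_of_pos (pow_pos hi 2), abs_of_pos (two_pos)]
    have h3 := abs_real_inner_le_norm w v
    have h4 : ε * ‖w‖ ^ 2 * (1 + ε * ‖w‖ ^ 2)⁻¹ ≤ 1 := by
      rw [mul_inv_le_iff₀ h]; linarith
    calc ε * (2 * |inner ℝ w v|) * ((1 + ε * ‖w‖ ^ 2)⁻¹) ^ 2 * ‖w‖
        ≤ ε * (2 * (‖w‖ * ‖v‖)) * ((1 + ε * ‖w‖ ^ 2)⁻¹) ^ 2 * ‖w‖ := by gcongr
      _ = 2 * ‖v‖ * (ε * ‖w‖ ^ 2 * (1 + ε * ‖w‖ ^ 2)⁻¹) * (1 + ε * ‖w‖ ^ 2)⁻¹ := by ring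
      _ ≤ 2 * ‖v‖ * 1 * 1 := by gcongr
      _ = 2 * ‖v‖ := by ring
  calc ‖truncD ε w v‖ ≤ ‖v‖ + 2 * ‖v‖ := (norm_sub_le _ _).trans (add_le_add e1 e2)
    _ = 3 * ‖v‖ := by ring

lemma continuous_truncD {ε : ℝ} (hε : 0 ≤ ε) :
    Continuous (fun p : ℂ × ℂ => truncD ε p.1 p.2) := by
  have : Continuous (fun p : ℂ × ℂ => (1 + ε * ‖p.1‖ ^ 2)⁻¹) :=
    (by fun_prop : Continuous (fun p : ℂ × ℂ => 1 + ε * ‖p.1‖ ^ 2)).inv₀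
      (fun p => (trunc_den_pos hε p.1).ne')
  unfold truncD
  fun_prop

lemma truncD_sub (ε : ℝ) (w v v' : ℂ) : truncD ε w (v - v') = truncD ε w v - truncD ε w v' := by
  simp only [truncD, inner_sub_right, smul_sub, mul_sub, sub_mul, sub_smul]; ring

/-- The truncation acts on magnetic derivatives without involving the vector potential. -/
lemma truncD_magnetic (ε : ℝ) (w g : ℂ) (a : ℝ) :
    -Complex.I * truncD ε w (Complex.I * (g - a * w)) + a * trunc ε w =
      -Complex.I * truncD ε w (Complex.I * g) := by
  -- A rotation direction i·a·w is orthogonal to w as a real vector and so does not change |w|.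
  -- Along it the derivative of the truncation is multiplication by the scalar factor, which makes
  -- the A terms cancel.
  have h : inner ℝ w (Complex.I * (a * w)) = 0 := by
    simp [Complex.inner]; ring
  have h2 : truncD ε w (Complex.I * (a * w)) = Complex.I * (a * trunc ε w) := by
    simp only [truncD, h, trunc, Complex.real_smul]
    push_cast
    ring
  rw [mul_sub Complex.I, truncD_sub, h2]
  linear_combination (a * trunc ε w) * (Complex.I_mul_I)

lemma tendsto_trunc (w : ℂ) : Tendsto (fun n : ℕ => trunc (1 / (n + 1)) w) atTop (𝓝 w) := by
  have h : Tendsto (fun n : ℕ => (1 + 1 / ((n : ℝ) + 1) * ‖w‖ ^ 2)⁻¹) atTop (𝓝 1) := by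
    have := ((tendsto_one_div_add_atTop_nhds_zero_nat (𝕜 := ℝ)).mul_const (‖w‖ ^ 2)).const_add 1
    simpa using this.inv₀ (by simp)
  simpa [trunc] using h.smul_const w

lemma tendsto_truncD (w v : ℂ) :
    Tendsto (fun n : ℕ => truncD (1 / (n + 1)) w v) atTop (𝓝 v) := by
  have h0 := (tendsto_one_div_add_atTop_nhds_zero_nat (𝕜 := ℝ))
  have h : Tendsto (fun n : ℕ => (1 + 1 / ((n : ℝ) + 1) * ‖w‖ ^ 2)⁻¹) atTop (𝓝 1) := by
    have := (h0.mul_const (‖w‖ ^ 2)).const_add 1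
    simpa using this.inv₀ (by simp)
  have := (h.smul_const v).sub (((h0.mul_const (2 * inner ℝ w v)).mul (h.pow 2)).smul_const w)
  simpa [truncD] using this

/-- The chain rule for truncations of weakly differentiable functions. -/
lemma WeakD.trunc {l : Fin 3} {φ d : R3 → ℂ} (h : WeakD l φ d) (hφ : Integrable φ volume)
    (hd : Integrable d volume) {ε : ℝ} (hε : 0 < ε) :
    WeakD l (fun x => trunc ε (φ x)) (fun x => truncD ε (φ x) (d x)) := by
  intro f hf
  have hst : ∀ n, ∫ x, Polaron.trunc ε (moll n φ x) * partialD l f x =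
      - ∫ x, truncD ε (moll n φ x) (moll n d x) * f x := by
    intro n
    have hc := moll_contDiff hφ.locallyIntegrable n
    have := integral_mul_partialD (f := fun x => Polaron.trunc ε (moll n φ x))
      (((trunc_contDiff hε.le).comp hc).of_le (by simp)) hf l
    rw [this]
    congr 2
    ext x
    rw [partialD_trunc_comp hε.le (hc.differentiable (by simp)), h.partialD_moll hφ.locallyIntegrable]
  obtain ⟨C, hC⟩ := hf.2.exists_bound_of_continuous hf.continuous
  have hC0 : 0 ≤ C := (norm_nonneg _).trans (hC 0)
  have lim1 : Tendsto (fun n => ∫ x, Polaron.trunc ε (moll n φ x) * partialD l f x) atTop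
      (𝓝 (∫ x, Polaron.trunc ε (φ x) * partialD l f x)) := by
    refine tendsto_integral_of_dominated_convergence
      (bound := fun x => (1 + 1 / ε) * ‖partialD l f x‖) (fun n => ?_)
      ((hf.isTest_partialD l).integrable.norm.const_mul _)
      (fun n => Eventually.of_forall fun x => ?_) ?_
    · exact (((trunc_contDiff hε.le).continuous.comp
        (moll_contDiff hφ.locallyIntegrable n).continuous).mul
        (hf.isTest_partialD l).continuous).aestronglyMeasurable
    · rw [norm_mul]; gcongr; exact norm_trunc_le hε _
    · filter_upwards [moll_tendsto_ae hφ.locallyIntegrable] with x hx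
      exact (((trunc_contDiff hε.le).continuous.tendsto _).comp hx).mul_const _
  have hTm : ∀ n, AEStronglyMeasurable (fun x => truncD ε (moll n φ x) (d x) * f x) volume := fun n =>
    ((continuous_truncD hε.le).comp_aestronglyMeasurable
      ((moll_contDiff hφ.locallyIntegrable n).continuous.aestronglyMeasurable.prodMk hd.1)).mul
      hf.continuous.aestronglyMeasurable
  have hTm' : ∀ n, AEStronglyMeasurable
      (fun x => truncD ε (moll n φ x) (moll n d x - d x) * f x) volume := fun n =>
    ((continuous_truncD hε.le).comp_aestronglyMeasurable
      ((moll_contDiff hφ.locallyIntegrable n).continuous.aestronglyMeasurable.prodMk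
        ((moll_integrable hd n).sub hd).1)).mul
      hf.continuous.aestronglyMeasurable
  have bd : ∀ (v w : ℂ) (x : R3), ‖truncD ε w v * f x‖ ≤ 3 * C * ‖v‖ := by
    intro v w x
    rw [norm_mul]
    calc ‖truncD ε w v‖ * ‖f x‖ ≤ (3 * ‖v‖) * C := by
          gcongr
          · exact norm_truncD_le hε.le _ _
          · exact hC x
      _ = _ := by ring
  -- By linearity in the last argument, the mollified derivative is split as d + (moll n d - d). The
  -- first part converges by dominated convergence, the second is controlled by L¹ convergence of
  -- the mollified d.
  have lim2 : Tendsto (fun n => ∫ x, truncD ε (moll n φ x) (d x) * f x) atTop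
      (𝓝 (∫ x, truncD ε (φ x) (d x) * f x)) := by
    refine tendsto_integral_of_dominated_convergence
      (bound := fun x => 3 * C * ‖d x‖) hTm (hd.norm.const_mul _)
      (fun n => Eventually.of_forall fun x => bd _ _ _) ?_
    filter_upwards [moll_tendsto_ae hφ.locallyIntegrable] with x hx
    exact (((continuous_truncD hε.le).tendsto (φ x, d x)).comp
      (hx.prodMk_nhds tendsto_const_nhds)).mul_const _
  have hi1 : ∀ n, Integrable (fun x => truncD ε (moll n φ x) (moll n d x - d x) * f x) volume :=
    fun n => (((moll_integrable hd n).sub hd).norm.const_mul (3 * C)).mono' (hTm' n)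
      (Eventually.of_forall fun x => bd _ _ _)
  have hi2 : ∀ n, Integrable (fun x => truncD ε (moll n φ x) (d x) * f x) volume :=
    fun n => (hd.norm.const_mul (3 * C)).mono' (hTm n) (Eventually.of_forall fun x => bd _ _ _)
  have lim3 : Tendsto (fun n => ∫ x, truncD ε (moll n φ x) (moll n d x - d x) * f x) atTop
      (𝓝 0) := by
    refine squeeze_zero_norm (a := fun n => 3 * C * ∫ x, ‖moll n d x - d x‖) (fun n => ?_) ?_
    · rw [← integral_const_mul]
      exact norm_integral_le_of_norm_le (((moll_integrable hd n).sub hd).norm.const_mul _)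
        (Eventually.of_forall fun x => bd _ _ _)
    · simpa using (tendsto_integral_norm_moll_sub hd).const_mul (3 * C)
  have lim4 := (lim3.add lim2).neg
  rw [zero_add] at lim4
  refine tendsto_nhds_unique lim1 (lim4.congr fun n => ?_)
  rw [hst n, ← integral_add (hi1 n) (hi2 n)]
  congr 2
  ext x
  rw [truncD_sub]; ring

/-! ### Density of test functions -/

/-- The plain weak derivative is only locally integrable, since Aφ need not lie in L². It is
extracted because the chain rule and mollification are available for plain derivatives. -/
lemma IsL2MagGrad.weakD {A : R3 → R3} (hA : VectorL2Loc A) {φ : R3 → ℂ} {g : Fin 3 → R3 → ℂ}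
    (hφ : MemLp φ 2 volume) (h : IsL2MagGrad A φ g) (l : Fin 3) :
    WeakD l φ (fun x => Complex.I * (g l x - ((A x l : ℝ) : ℂ) * φ x)) := by
  intro f hf
  have h1 := h.2 l f hf
  have i1 : Integrable (fun x => φ x * partialD l f x) volume :=
    MemLp.integrable_mul (p := 2) (q := 2) hφ ((hf.isTest_partialD l).memLp 2)
  have i2 : Integrable (fun x => φ x * (((A x l : ℝ) : ℂ) * f x)) volume :=
    MemLp.integrable_mul (p := 2) (q := 2) hφ (hf.memLp_component_mul hA l)
  have i3 : Integrable (fun x => g l x * f x) volume :=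
    MemLp.integrable_mul (p := 2) (q := 2) (h.1 l) (hf.memLp 2)
  have e1 : (fun x => φ x * (Complex.I * partialD l f x + ((A x l : ℝ) : ℂ) * f x)) =
      fun x => Complex.I * (φ x * partialD l f x) + φ x * (((A x l : ℝ) : ℂ) * f x) := by
    ext x; ring
  have e2 : (fun x => Complex.I * (g l x - ((A x l : ℝ) : ℂ) * φ x) * f x) =
      fun x => Complex.I * (g l x * f x - φ x * (((A x l : ℝ) : ℂ) * f x)) := by
    ext x; ring
  rw [e1, integral_add (i1.const_mul _) i2, integral_const_mul] at h1
  rw [e2, integral_const_mul, integral_sub i3 i2, ← h1]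
  linear_combination (∫ x, φ x * partialD l f x) * Complex.I_mul_I

lemma WeakD.isMagGrad {A : R3 → R3} (hA : VectorL2Loc A) {φ : R3 → ℂ} {d : Fin 3 → R3 → ℂ}
    (hφ : MemLp φ 2 volume) (hd : ∀ l, LocallyIntegrable (d l) volume) (h : ∀ l, WeakD l φ (d l)) :
    IsMagGrad A φ (fun l x => -Complex.I * d l x + ((A x l : ℝ) : ℂ) * φ x) := by
  intro l f hf
  have i1 : Integrable (fun x => φ x * partialD l f x) volume :=
    MemLp.integrable_mul (p := 2) (q := 2) hφ ((hf.isTest_partialD l).memLp 2)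
  have i2 : Integrable (fun x => φ x * (((A x l : ℝ) : ℂ) * f x)) volume :=
    MemLp.integrable_mul (p := 2) (q := 2) hφ (hf.memLp_component_mul hA l)
  have i3 : Integrable (fun x => d l x * f x) volume := by
    have := (hd l).integrable_smul_left_of_hasCompactSupport hf.continuous hf.2
    refine this.congr (Eventually.of_forall fun x => ?_)
    simp [mul_comm]
  have e1 : (fun x => φ x * (Complex.I * partialD l f x + ((A x l : ℝ) : ℂ) * f x)) =
      fun x => Complex.I * (φ x * partialD l f x) + φ x * (((A x l : ℝ) : ℂ) * f x) := by
    ext x; ring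
  have e2 : (fun x => (-Complex.I * d l x + ((A x l : ℝ) : ℂ) * φ x) * f x) =
      fun x => -Complex.I * (d l x * f x) + φ x * (((A x l : ℝ) : ℂ) * f x) := by
    ext x; ring
  rw [e1, e2, integral_add (i1.const_mul _) i2, integral_add (i3.const_mul _) i2,
    integral_const_mul, integral_const_mul, h l f hf]
  ring

lemma h1Sq_sub_eq {A : R3 → R3} (hA : VectorL2Loc A) {φ χ : R3 → ℂ} {g g' : Fin 3 → R3 → ℂ}
    (hφ : MemLp φ 2 volume) (hχ : MemLp χ 2 volume) (h : IsL2MagGrad A φ g)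
    (h' : IsL2MagGrad A χ g') : h1Sq A (φ - χ) = l2Sq (φ - χ) + ∑ l, l2Sq (g l - g' l) := by
  have := (h.add hA hφ (hχ.const_smul (-1 : ℂ)) (h'.const_smul (-1))).kinetic_eq
  rw [h1Sq]
  congr 1
  simpa [sub_eq_add_neg] using this

/-- A pair `φ, D_A φ` in `L²`, both vanishing outside a ball. -/
structure IsCompactH1 (A : R3 → R3) (φ : R3 → ℂ) (g : Fin 3 → R3 → ℂ) (R : ℝ) : Prop where
  memLp : MemLp φ 2 volume
  grad : IsL2MagGrad A φ g
  zero : ∀ x ∉ Metric.closedBall (0 : R3) R, φ x = 0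
  grad_zero : ∀ l, ∀ x ∉ Metric.closedBall (0 : R3) R, g l x = 0

/-- The Leibniz rule, obtained by testing D_A φ against χf in place of f. -/
lemma IsL2MagGrad.mul_smooth {A : R3 → R3} (hA : VectorL2Loc A) {φ : R3 → ℂ}
    {g : Fin 3 → R3 → ℂ} (hφ : MemLp φ 2 volume) (h : IsL2MagGrad A φ g) {χ : R3 → ℂ}
    (hχ : IsTest χ) :
    IsL2MagGrad A (fun x => χ x * φ x)
      (fun l x => χ x * g l x - Complex.I * partialD l χ x * φ x) := by
  obtain ⟨C, hC⟩ := hχ.2.exists_bound_of_continuous hχ.continuous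
  have bmul : ∀ {u v : R3 → ℂ}, IsTest u → MemLp v 2 volume → MemLp (fun x => u x * v x) 2 volume :=
    fun {u v} hu hv => by
      obtain ⟨C, hC⟩ := hu.2.exists_bound_of_continuous hu.continuous
      refine (hv.const_mul (C : ℂ)).mono (hu.continuous.aestronglyMeasurable.mul hv.1)
        (Eventually.of_forall fun x => ?_)
      simp only [norm_mul, Complex.norm_real, Real.norm_eq_abs]
      gcongr
      exact (hC x).trans (le_abs_self _)
  have m2 : ∀ l, MemLp (fun x => Complex.I * partialD l χ x * φ x) 2 volume := fun l => by
    have := (bmul (hχ.isTest_partialD l) hφ).const_mul Complex.I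
    simpa [mul_assoc] using this
  refine ⟨fun l => (bmul hχ (h.1 l)).sub (m2 l), fun l f hf => ?_⟩
  have hχf : IsTest (χ * f) := hχ.mul hf.1
  have h1 := h.2 l _ hχf
  have i1 := MemLp.integrable_mul (p := 2) (q := 2) hφ (hχf.memLp_adjoint hA l)
  have i2 := MemLp.integrable_mul (p := 2) (q := 2) (m2 l) (hf.memLp 2)
  have i3 := MemLp.integrable_mul (p := 2) (q := 2) (bmul hχ (h.1 l)) (hf.memLp 2)
  have e1 : (fun x => χ x * φ x * (Complex.I * partialD l f x + ((A x l : ℝ) : ℂ) * f x)) =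
      fun x => φ x * (Complex.I * partialD l (χ * f) x + ((A x l : ℝ) : ℂ) * (χ * f) x) -
        Complex.I * partialD l χ x * φ x * f x := by
    ext x
    rw [partialD_mul hχ.differentiable hf.differentiable]
    simp only [Pi.mul_apply]; ring
  have e2 : (fun x => (χ x * g l x - Complex.I * partialD l χ x * φ x) * f x) =
      fun x => g l x * (χ * f) x - Complex.I * partialD l χ x * φ x * f x := by
    ext x; simp only [Pi.mul_apply]; ring
  have i4 : Integrable (fun x => g l x * (χ * f) x) volume := by
    refine i3.congr (Eventually.of_forall fun x => ?_)
    simp only [Pi.mul_apply]; ring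
  rw [e1, e2]
  have s1 := integral_sub i1 i2
  have s2 := integral_sub i4 i2
  simp only [Pi.mul_apply] at s1 s2
  simp only [Pi.mul_apply] at h1 ⊢
  rw [s1, s2, h1]

/-- A smooth cutoff function, equal to one on the unit ball. -/
def cutoffBump : ContDiffBump (0 : R3) where
  rIn := 1
  rOut := 2
  rIn_pos := one_pos
  rIn_lt_rOut := one_lt_two

/-- Cutoff functions exhausting space. -/
def cutoff (n : ℕ) (x : R3) : ℂ := ((cutoffBump (((n : ℝ) + 1)⁻¹ • x) : ℝ) : ℂ)

lemma isTest_cutoff (n : ℕ) : IsTest (cutoff n) := by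
  refine isTest_of_smul_real (cutoffBump.contDiff.comp (contDiff_const_smul _)) ?_
  exact cutoffBump.hasCompactSupport.comp_homeomorph
    (Homeomorph.smulOfNeZero (((n : ℝ) + 1)⁻¹) (by positivity))

lemma norm_cutoff_le (n : ℕ) (x : R3) : ‖cutoff n x‖ ≤ 1 := by
  rw [cutoff, Complex.norm_real, Real.norm_eq_abs, abs_of_nonneg cutoffBump.nonneg]
  exact cutoffBump.le_one

lemma cutoff_eq_one {n : ℕ} {x : R3} (h : ‖x‖ ≤ n + 1) : cutoff n x = 1 := by
  rw [cutoff, cutoffBump.one_of_mem_closedBall]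
  · simp
  · simp only [Metric.mem_closedBall, dist_zero_right, norm_smul, norm_inv, Real.norm_eq_abs]
    rw [abs_of_pos (by positivity), inv_mul_le_iff₀ (by positivity)]
    simpa [cutoffBump] using h

lemma cutoff_eq_zero {n : ℕ} {x : R3} (h : x ∉ Metric.closedBall (0 : R3) (2 * (n + 1))) :
    cutoff n x = 0 := by
  rw [cutoff, cutoffBump.zero_of_le_dist]
  · simp
  · simp only [Metric.mem_closedBall, dist_zero_right, not_le] at h
    simp only [dist_zero_right, norm_smul, norm_inv, Real.norm_eq_abs]
    rw [abs_of_pos (by positivity), le_inv_mul_iff₀ (by positivity)]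
    simp only [cutoffBump]
    linarith

lemma partialD_cutoff (n : ℕ) (l : Fin 3) (x : R3) :
    partialD l (cutoff n) x = (((n : ℝ) + 1)⁻¹ : ℝ) * partialD l (cutoff 0) (((n : ℝ) + 1)⁻¹ • x) := by
  have h0 : cutoff n = fun x => cutoff 0 (((n : ℝ) + 1)⁻¹ • x) := by
    ext x; simp [cutoff]
  have h1 : HasFDerivAt (fun x : R3 => ((n : ℝ) + 1)⁻¹ • x)
      (((n : ℝ) + 1)⁻¹ • ContinuousLinearMap.id ℝ R3) x :=
    (hasFDerivAt_id (𝕜 := ℝ) x).const_smul (((n : ℝ) + 1)⁻¹)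
  have h2 := ((isTest_cutoff 0).differentiable (((n : ℝ) + 1)⁻¹ • x)).hasFDerivAt.comp x h1
  have h3 : HasFDerivAt (fun x => cutoff 0 (((n : ℝ) + 1)⁻¹ • x)) _ x := h2
  rw [partialD, h0, h3.fderiv]
  simp [partialD]

lemma partialD_cutoff_zero {n : ℕ} {l : Fin 3} {x : R3}
    (h : x ∉ Metric.closedBall (0 : R3) (2 * (n + 1))) : partialD l (cutoff n) x = 0 := by
  have : cutoff n =ᶠ[𝓝 x] fun _ => 0 := by
    filter_upwards [Metric.isClosed_closedBall.isOpen_compl.mem_nhds h] with y hy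
    exact cutoff_eq_zero hy
  rw [partialD, this.fderiv_eq]; simp

/-- The gradients of the dilated cutoffs are bounded uniformly in n and vanish near any given point
once n is large, so dominated convergence handles both φ and its gradient. -/
lemma exists_isCompactH1 {A : R3 → R3} (hA : VectorL2Loc A) {φ : R3 → ℂ} (h : MemH1 A φ) {δ : ℝ}
    (hδ : 0 < δ) : ∃ χ g R, IsCompactH1 A χ g R ∧ h1Sq A (χ - φ) < δ := by
  obtain ⟨C, hC⟩ : ∃ C : ℝ, ∀ l x, ‖partialD l (cutoff 0) x‖ ≤ C := by
    choose C hC using fun l => ((isTest_cutoff 0).isTest_partialD l).2.exists_bound_of_continuous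
      ((isTest_cutoff 0).isTest_partialD l).continuous
    exact ⟨∑ l, |C l|, fun l x => (hC l x).trans ((le_abs_self _).trans
      (Finset.single_le_sum (f := fun l => |C l|) (fun _ _ => abs_nonneg _) (Finset.mem_univ l)))⟩
  have hC0 : 0 ≤ C := (norm_nonneg _).trans (hC 0 0)
  set g := magGrad A φ
  have hg := h.isL2MagGrad
  have hcut : ∀ n, IsL2MagGrad A (fun x => cutoff n x * φ x)
      (fun l x => cutoff n x * g l x - Complex.I * partialD l (cutoff n) x * φ x) :=
    fun n => hg.mul_smooth hA h.1 (isTest_cutoff n)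
  have hdb : ∀ n l x, ‖partialD l (cutoff n) x‖ ≤ C := fun n l x => by
    rw [partialD_cutoff, norm_mul, Complex.norm_real, Real.norm_eq_abs,
      abs_of_pos (by positivity : (0 : ℝ) < ((n : ℝ) + 1)⁻¹)]
    calc _ ≤ 1 * C := by
          gcongr
          · exact inv_le_one_of_one_le₀ (by linarith [Nat.cast_nonneg (α := ℝ) n])
          · exact hC _ _
      _ = C := one_mul _
  have hm : ∀ n, MemLp (fun x => cutoff n x * φ x) 2 volume := fun n =>
    h.1.mono ((isTest_cutoff n).continuous.aestronglyMeasurable.mul h.1.1)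
      (Eventually.of_forall fun x => by
        rw [norm_mul]; exact mul_le_of_le_one_left (norm_nonneg _) (norm_cutoff_le n x))
  have hev : ∀ x : R3, ∀ᶠ n : ℕ in atTop, ‖x‖ < n + 1 := fun x => by
    filter_upwards [eventually_ge_atTop ⌈‖x‖⌉₊] with n hn
    have := Nat.le_ceil ‖x‖
    have : (⌈‖x‖⌉₊ : ℝ) ≤ n := by exact_mod_cast hn
    linarith
  have t1 : Tendsto (fun n => l2Sq ((fun x => cutoff n x * φ x) - φ)) atTop (𝓝 0) := by
    refine tendsto_l2Sq_zero (F := fun x => 2 * ‖φ x‖) (fun n => ((hm n).sub h.1).1) ?_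
      (fun n => Eventually.of_forall fun x => ?_) (Eventually.of_forall fun x => ?_)
    · simpa [mul_pow] using (integrable_norm_sq h.1).const_mul (2 ^ 2)
    · refine (norm_sub_le _ _).trans ?_
      rw [norm_mul]
      have := mul_le_of_le_one_left (norm_nonneg (φ x)) (norm_cutoff_le n x)
      linarith
    · refine tendsto_const_nhds.congr' ?_
      filter_upwards [hev x] with n hn
      simp [cutoff_eq_one hn.le]
  have t2 : ∀ l, Tendsto (fun n => l2Sq ((fun x => cutoff n x * g l x -
      Complex.I * partialD l (cutoff n) x * φ x) - g l)) atTop (𝓝 0) := fun l => by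
    refine tendsto_l2Sq_zero (F := fun x => ‖(2 * ‖g l x‖ + C * ‖φ x‖ : ℝ)‖)
      (fun n => (((hcut n).1 l).sub (hg.1 l)).1) ?_
      (fun n => Eventually.of_forall fun x => ?_) (Eventually.of_forall fun x => ?_)
    · have := ((hg.1 l).norm.const_mul 2).add (h.1.norm.const_mul C)
      exact (memLp_two_iff_integrable_sq_norm this.1).1 this
    · rw [Real.norm_eq_abs, abs_of_nonneg (by positivity)]
      have e1 := norm_sub_le (cutoff n x * g l x - Complex.I * partialD l (cutoff n) x * φ x) (g l x)
      have e2 := norm_sub_le (cutoff n x * g l x) (Complex.I * partialD l (cutoff n) x * φ x)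
      have e3 : ‖cutoff n x * g l x‖ ≤ ‖g l x‖ := by
        rw [norm_mul]; exact mul_le_of_le_one_left (norm_nonneg _) (norm_cutoff_le n x)
      have e4 : ‖Complex.I * partialD l (cutoff n) x * φ x‖ ≤ C * ‖φ x‖ := by
        rw [norm_mul, norm_mul, Complex.norm_I, one_mul]; gcongr; exact hdb n l x
      simp only [Pi.sub_apply]
      linarith
    · refine tendsto_const_nhds.congr' ?_
      filter_upwards [hev x] with n hn
      have : partialD l (cutoff n) x = 0 := by
        have : cutoff n =ᶠ[𝓝 x] fun _ => 1 := by
          filter_upwards [(continuous_norm.tendsto x).eventually (gt_mem_nhds hn)] with y hy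
          exact cutoff_eq_one hy.le
        rw [partialD, this.fderiv_eq]; simp
      simp [cutoff_eq_one hn.le, this]
  have t3 := t1.add (tendsto_finsetSum Finset.univ fun l _ => t2 l)
  simp only [Finset.sum_const_zero, add_zero] at t3
  obtain ⟨n, hn⟩ := ((tendsto_order.1 t3).2 δ hδ).exists
  refine ⟨_, _, 2 * (n + 1), ⟨hm n, hcut n, fun x hx => ?_, fun l x hx => ?_⟩, ?_⟩
  · simp [cutoff_eq_zero hx]
  · simp [cutoff_eq_zero hx, partialD_cutoff_zero hx]
  · rw [h1Sq_sub_eq hA (hm n) h.1 (hcut n) hg]; exact hn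

lemma IsCompactH1.integrable {A : R3 → R3} {φ : R3 → ℂ} {g : Fin 3 → R3 → ℂ} {R : ℝ}
    (h : IsCompactH1 A φ g R) : Integrable φ volume :=
  (integrableOn_iff_integrable_of_support_subset (s := Metric.closedBall (0 : R3) R)
    (fun x hx => by by_contra h'; exact hx (h.zero x h'))).1
    ((h.memLp.locallyIntegrable (by norm_num)).integrableOn_isCompact (isCompact_closedBall _ _))

lemma IsCompactH1.integrable_deriv {A : R3 → R3} (hA : VectorL2Loc A) {φ : R3 → ℂ}
    {g : Fin 3 → R3 → ℂ} {R : ℝ} (h : IsCompactH1 A φ g R) (l : Fin 3) :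
    Integrable (fun x => Complex.I * (g l x - ((A x l : ℝ) : ℂ) * φ x)) volume := by
  have i1 : Integrable (g l) volume :=
    (integrableOn_iff_integrable_of_support_subset (s := Metric.closedBall (0 : R3) R)
      (fun x hx => by by_contra h'; exact hx (h.grad_zero l x h'))).1
      (((h.grad.1 l).locallyIntegrable (by norm_num)).integrableOn_isCompact
        (isCompact_closedBall _ _))
  have m1 : MemLp (fun x => ((A x l : ℝ) : ℂ) * (Metric.closedBall (0 : R3) R).indicator 1 x) 2
      volume :=
    memLp_component_mul hA l (aestronglyMeasurable_const.indicator
      Metric.isClosed_closedBall.measurableSet) 1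
      (fun x => by by_cases hx : x ∈ Metric.closedBall (0 : R3) R <;> simp [Set.indicator, hx])
      (isCompact_closedBall (0 : R3) R) (fun x hx => by simp [Set.indicator, hx])
  have i2 := MemLp.integrable_mul (p := 2) (q := 2) m1 h.memLp
  refine (i1.sub (i2.congr (Eventually.of_forall fun x => ?_))).const_mul _
  by_cases hx : x ∈ Metric.closedBall (0 : R3) R
  · simp only [Pi.mul_apply, Set.indicator_of_mem hx, Pi.one_apply, mul_one]
  · simp [h.zero x hx]

/-- Truncating the values does not disturb the phase, so the new magnetic gradient -i `truncD` (φ, i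
g) contains no A. It is bounded by 3|g| and stays in L² even if Aφ does not. -/
lemma IsCompactH1.exists_bounded {A : R3 → R3} (hA : VectorL2Loc A) {φ : R3 → ℂ}
    {g : Fin 3 → R3 → ℂ} {R : ℝ} (h : IsCompactH1 A φ g R) {δ : ℝ} (hδ : 0 < δ) :
    ∃ χ g' C, IsCompactH1 A χ g' R ∧ (∀ x, ‖χ x‖ ≤ C) ∧ h1Sq A (χ - φ) < δ := by
  have hε : ∀ n : ℕ, (0 : ℝ) < 1 / (n + 1) := fun n => by positivity
  have hm : ∀ n : ℕ, MemLp (fun x => trunc (1 / (n + 1)) (φ x)) 2 volume := fun n =>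
    h.memLp.mono ((trunc_contDiff (hε n).le).continuous.comp_aestronglyMeasurable h.memLp.1)
      (Eventually.of_forall fun x => norm_trunc_le_norm (hε n).le _)
  set g' : ℕ → Fin 3 → R3 → ℂ := fun n l x =>
    -Complex.I * truncD (1 / (n + 1)) (φ x) (Complex.I * g l x) with hg'
  have hg'm : ∀ n l, MemLp (g' n l) 2 volume := fun n l => by
    refine ((h.grad.1 l).const_mul (3 : ℂ)).mono ?_ (Eventually.of_forall fun x => ?_)
    · exact ((continuous_truncD (hε n).le).comp_aestronglyMeasurable
        (h.memLp.1.prodMk ((h.grad.1 l).1.const_mul _))).const_mul _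
    · simp only [hg', norm_mul, norm_neg, Complex.norm_I, one_mul]
      simpa using norm_truncD_le (hε n).le (φ x) (Complex.I * g l x)
  have hgr : ∀ n : ℕ, IsL2MagGrad A (fun x => trunc (1 / ((n : ℝ) + 1)) (φ x)) (g' n) := fun n => by
    refine ⟨hg'm n, ?_⟩
    set d : Fin 3 → R3 → ℂ := fun l x => Complex.I * (g l x - ((A x l : ℝ) : ℂ) * φ x) with hd
    have hdi : ∀ l, Integrable (d l) volume := fun l => h.integrable_deriv hA l
    have hw : ∀ l, WeakD l (fun x => trunc (1 / ((n : ℝ) + 1)) (φ x))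
        (fun x => truncD (1 / ((n : ℝ) + 1)) (φ x) (d l x)) := fun l =>
      (h.grad.weakD hA h.memLp l).trunc h.integrable (hdi l) (hε n)
    have hwm : ∀ l, AEStronglyMeasurable (fun x => truncD (1 / ((n : ℝ) + 1)) (φ x) (d l x)) volume :=
      fun l => (continuous_truncD (hε n).le).comp_aestronglyMeasurable
        (f := fun x => (φ x, d l x)) (h.memLp.1.prodMk (hdi l).1)
    have hwi : ∀ l, Integrable (fun x => truncD (1 / ((n : ℝ) + 1)) (φ x) (d l x)) volume := fun l =>
      ((hdi l).norm.const_mul 3).mono' (hwm l)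
        (Eventually.of_forall fun x => norm_truncD_le (hε n).le _ _)
    intro l f hf
    rw [WeakD.isMagGrad hA (hm n) (fun l => (hwi l).locallyIntegrable) hw l f hf]
    refine integral_congr_ae (Eventually.of_forall fun x => ?_)
    simp only [hd, hg', truncD_magnetic]
  have t1 : Tendsto (fun n : ℕ => l2Sq ((fun x => trunc (1 / ((n : ℝ) + 1)) (φ x)) - φ)) atTop
      (𝓝 0) := by
    refine tendsto_l2Sq_zero (F := fun x => 2 * ‖φ x‖) (fun n => ((hm n).sub h.memLp).1) ?_
      (fun n => Eventually.of_forall fun x => ?_) (Eventually.of_forall fun x => ?_)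
    · simpa [mul_pow] using (integrable_norm_sq h.memLp).const_mul (2 ^ 2)
    · refine (norm_sub_le _ _).trans ?_
      have := norm_trunc_le_norm (hε n).le (φ x)
      linarith
    · simpa using (tendsto_trunc (φ x)).sub_const (φ x)
  have t2 : ∀ l, Tendsto (fun n => l2Sq (g' n l - g l)) atTop (𝓝 0) := fun l => by
    refine tendsto_l2Sq_zero (F := fun x => 4 * ‖g l x‖)
      (fun n => ((hg'm n l).sub (h.grad.1 l)).1) ?_
      (fun n => Eventually.of_forall fun x => ?_) (Eventually.of_forall fun x => ?_)
    · simpa [mul_pow] using (integrable_norm_sq (h.grad.1 l)).const_mul (4 ^ 2)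
    · refine (norm_sub_le _ _).trans ?_
      have : ‖g' n l x‖ ≤ 3 * ‖g l x‖ := by
        simp only [hg', norm_mul, norm_neg, Complex.norm_I, one_mul]
        simpa using norm_truncD_le (hε n).le (φ x) (Complex.I * g l x)
      linarith
    · have := ((tendsto_truncD (φ x) (Complex.I * g l x)).const_mul (-Complex.I)).sub_const (g l x)
      have e : -Complex.I * (Complex.I * g l x) - g l x = 0 := by
        linear_combination (-g l x) * Complex.I_mul_I
      rw [e] at this
      exact this
  have t3 := t1.add (tendsto_finsetSum Finset.univ fun l _ => t2 l)
  simp only [Finset.sum_const_zero, add_zero] at t3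
  obtain ⟨n, hn⟩ := ((tendsto_order.1 t3).2 δ hδ).exists
  refine ⟨_, g' n, _, ⟨hm n, hgr n, fun x hx => ?_, fun l x hx => ?_⟩,
    fun x => norm_trunc_le (hε n) _, ?_⟩
  · simp [h.zero x hx, trunc]
  · simp [hg', h.grad_zero l x hx, truncD]
  · rw [h1Sq_sub_eq hA (hm n) h.memLp (hgr n) h.grad]; exact hn

/-- For bounded φ of bounded support Aφ is in L², hence so is the plain derivative, and its
mollifications converge in L². The remaining term A(moll φ - φ) is dominated by 2C|A| on a ball of
radius R + 2 and tends to 0 almost everywhere. -/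
lemma IsCompactH1.exists_test {A : R3 → R3} (hA : VectorL2Loc A) {φ : R3 → ℂ}
    {g : Fin 3 → R3 → ℂ} {R : ℝ} (h : IsCompactH1 A φ g R) {C : ℝ} (hC : ∀ x, ‖φ x‖ ≤ C) {δ : ℝ}
    (hδ : 0 < δ) : ∃ f, IsTest f ∧ h1Sq A (f - φ) < δ := by
  have hC0 : 0 ≤ C := (norm_nonneg _).trans (hC 0)
  have hloc : LocallyIntegrable φ volume := h.integrable.locallyIntegrable
  have ht : ∀ n, IsTest (moll n φ) := fun n => ⟨moll_contDiff hloc n,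
    HasCompactSupport.intro (isCompact_closedBall (0 : R3) (R + 2)) (moll_eq_zero h.zero n)⟩
  set d : Fin 3 → R3 → ℂ := fun l x => Complex.I * (g l x - ((A x l : ℝ) : ℂ) * φ x) with hd
  have hdm : ∀ l, MemLp (d l) 2 volume := fun l =>
    ((h.grad.1 l).sub (memLp_component_mul hA l h.memLp.1 C hC (isCompact_closedBall (0 : R3) R)
      h.zero)).const_mul _
  have hw : ∀ l, WeakD l φ (d l) := fun l => h.grad.weakD hA h.memLp l
  have hAm : ∀ n l, MemLp (fun x => ((A x l : ℝ) : ℂ) * (moll n φ x - φ x)) 2 volume := fun n l =>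
    memLp_component_mul hA l ((ht n).continuous.aestronglyMeasurable.sub h.memLp.1) (C + C)
      (fun x => (norm_sub_le _ _).trans (add_le_add (norm_moll_le_const hC n x) (hC x)))
      (isCompact_closedBall (0 : R3) (R + 2)) (fun x hx => by
        rw [moll_eq_zero h.zero n x hx, h.zero x fun h' => hx ?_, sub_zero]
        exact Metric.closedBall_subset_closedBall (by linarith) h')
  have hle : ∀ n l, l2Sq (dA A l (moll n φ) - g l) ≤
      2 * l2Sq (moll n (d l) - d l) +
        2 * l2Sq (fun x => ((A x l : ℝ) : ℂ) * (moll n φ x - φ x)) := fun n l => by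
    have e : dA A l (moll n φ) - g l = (-Complex.I) • (moll n (d l) - d l) +
        fun x => ((A x l : ℝ) : ℂ) * (moll n φ x - φ x) := by
      ext x
      simp only [dA, (hw l).partialD_moll hloc, Pi.sub_apply, Pi.add_apply, Pi.smul_apply,
        smul_eq_mul, hd]
      linear_combination (-g l x + ((A x l : ℝ) : ℂ) * φ x) * Complex.I_mul_I
    rw [e]
    refine (l2Sq_add_le ((((moll_memLp (hdm l) n).sub (hdm l))).const_smul _) (hAm n l)).trans ?_
    rw [l2Sq_smul]; simp
  have t1 := tendsto_l2Sq_moll_sub h.memLp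
  have hind : ∀ l, MemLp (fun x => ((A x l : ℝ) : ℂ) *
      (Metric.closedBall (0 : R3) (R + 2)).indicator (fun _ => ((2 * C : ℝ) : ℂ)) x) 2 volume :=
    fun l => memLp_component_mul hA l (aestronglyMeasurable_const.indicator
      Metric.isClosed_closedBall.measurableSet) (2 * C)
      (fun x => by
        by_cases hx : x ∈ Metric.closedBall (0 : R3) (R + 2)
        · rw [Set.indicator_of_mem hx, Complex.norm_real, Real.norm_eq_abs,
            abs_of_nonneg (by positivity)]
        · rw [Set.indicator_of_notMem hx, norm_zero]; positivity)
      (isCompact_closedBall (0 : R3) (R + 2)) (fun x hx => Set.indicator_of_notMem hx _)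
  have t2 : ∀ l, Tendsto (fun n => l2Sq (fun x => ((A x l : ℝ) : ℂ) * (moll n φ x - φ x))) atTop
      (𝓝 0) := fun l => by
    refine tendsto_l2Sq_zero (F := fun x => ‖((A x l : ℝ) : ℂ) *
      (Metric.closedBall (0 : R3) (R + 2)).indicator (fun _ => ((2 * C : ℝ) : ℂ)) x‖)
      (fun n => (hAm n l).1) (integrable_norm_sq (hind l))
      (fun n => Eventually.of_forall fun x => ?_) ?_
    · rw [norm_mul, norm_mul]
      gcongr
      by_cases hx : x ∈ Metric.closedBall (0 : R3) (R + 2)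
      · rw [Set.indicator_of_mem hx, Complex.norm_real, Real.norm_eq_abs,
            abs_of_nonneg (by positivity)]
        have := (norm_sub_le _ _).trans (add_le_add (norm_moll_le_const hC n x) (hC x))
        linarith
      · rw [moll_eq_zero h.zero n x hx, h.zero x fun h' => hx ?_, sub_zero, norm_zero]
        · positivity
        · exact Metric.closedBall_subset_closedBall (by linarith) h'
    · filter_upwards [moll_tendsto_ae hloc] with x hx
      simpa using (hx.sub_const (φ x)).const_mul ((A x l : ℝ) : ℂ)
  have t3 : ∀ l, Tendsto (fun n => l2Sq (dA A l (moll n φ) - g l)) atTop (𝓝 0) := fun l => by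
    refine squeeze_zero (fun n => l2Sq_nonneg _) (fun n => hle n l) ?_
    simpa using ((tendsto_l2Sq_moll_sub (hdm l)).const_mul 2).add ((t2 l).const_mul 2)
  have t4 := t1.add (tendsto_finsetSum Finset.univ fun l _ => t3 l)
  simp only [Finset.sum_const_zero, add_zero] at t4
  obtain ⟨n, hn⟩ := ((tendsto_order.1 t4).2 δ hδ).exists
  refine ⟨moll n φ, ht n, ?_⟩
  rw [h1Sq_sub_eq hA ((ht n).memLp 2) h.memLp ((ht n).isL2MagGrad hA) h.grad]
  exact hn

lemma IsCompactH1.memH1 {A : R3 → R3} {φ : R3 → ℂ} {g : Fin 3 → R3 → ℂ} {R : ℝ}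
    (h : IsCompactH1 A φ g R) : MemH1 A φ := ⟨h.memLp, g, h.grad⟩

/-- Test functions are dense in `H¹_A`. -/
theorem exists_test_h1Sq_sub_lt {A : R3 → R3} (hA : VectorL2Loc A) {φ : R3 → ℂ} (h : MemH1 A φ)
    {δ : ℝ} (hδ : 0 < δ) : ∃ f, IsTest f ∧ h1Sq A (f - φ) < δ := by
  -- Two applications of `h1Sq_add_le` weight the three errors by 4, 4 and 2, in total 10/12 of δ.
  obtain ⟨χ, g, R, h1, d1⟩ := exists_isCompactH1 hA h (δ := δ / 12) (by positivity)
  obtain ⟨χ', g', C, h2, hC, d2⟩ := h1.exists_bounded hA (δ := δ / 12) (by positivity)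
  obtain ⟨f, hf, d3⟩ := h2.exists_test hA hC (δ := δ / 12) (by positivity)
  refine ⟨f, hf, ?_⟩
  have e1 := h1Sq_add_le hA ((hf.memH1 hA).sub hA h2.memH1) (h2.memH1.sub hA h1.memH1)
  have e2 := h1Sq_add_le hA ((hf.memH1 hA).sub hA h1.memH1) (h1.memH1.sub hA h)
  rw [sub_add_sub_cancel] at e1 e2
  linarith

/-! ### The diamagnetic form bound -/

/-- The potential energy of a test function. -/
def potEnergy (V : R3 → ℝ) (f : R3 → ℂ) : ℝ := ∫ x, V x * ‖f x‖ ^ 2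

/-- A locally integrable function times a continuous compactly supported one. -/
lemma integrable_mul_of_locallyIntegrable {V : R3 → ℝ} (hV : LocallyIntegrable V volume)
    {u : R3 → ℝ} (hu : Continuous u) (hc : HasCompactSupport u) :
    Integrable (fun x => V x * u x) volume := by
  refine (hV.integrable_smul_left_of_hasCompactSupport hu hc).congr
    (Eventually.of_forall fun x => ?_)
  simp [mul_comm]

lemma IsTest.hasCompactSupport_norm_sq {f : R3 → ℂ} (hf : IsTest f) :
    HasCompactSupport (fun x => ‖f x‖ ^ 2) :=
  hf.2.comp_left (g := fun z : ℂ => ‖z‖ ^ 2) (by simp)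

lemma IsTest.integrable_potential {V : R3 → ℝ} (hV : LocallyIntegrable V volume) {f : R3 → ℂ}
    (hf : IsTest f) : Integrable (fun x => V x * ‖f x‖ ^ 2) volume :=
  integrable_mul_of_locallyIntegrable hV (hf.continuous.norm.pow 2) hf.hasCompactSupport_norm_sq

/-- A smooth version of the modulus. -/
def regAbs (δ : ℝ) (f : R3 → ℂ) (x : R3) : ℝ := Real.sqrt (‖f x‖ ^ 2 + δ ^ 2) - δ

lemma regAbs_nonneg {δ : ℝ} (f : R3 → ℂ) (x : R3) : 0 ≤ regAbs δ f x :=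
  sub_nonneg.2 (Real.le_sqrt_of_sq_le (by nlinarith [sq_nonneg ‖f x‖]))

lemma regAbs_le {δ : ℝ} (hδ : 0 ≤ δ) (f : R3 → ℂ) (x : R3) : regAbs δ f x ≤ ‖f x‖ := by
  rw [regAbs, sub_le_iff_le_add]
  exact Real.sqrt_le_iff.2 ⟨by positivity, by nlinarith [norm_nonneg (f x)]⟩

lemma isTest_regAbs {δ : ℝ} (hδ : 0 < δ) {f : R3 → ℂ} (hf : IsTest f) :
    IsTest (fun x => (regAbs δ f x : ℂ)) := by
  refine isTest_of_smul_real ?_ ?_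
  · refine ContDiff.sub (ContDiff.sqrt ((hf.1.norm_sq ℝ).add contDiff_const) fun x => ?_)
      contDiff_const
    positivity
  · refine hf.2.comp_left (g := fun z : ℂ => Real.sqrt (‖z‖ ^ 2 + δ ^ 2) - δ) ?_
    simp [Real.sqrt_sq hδ.le]

/-- The pointwise diamagnetic inequality: the derivative of the modulus sees only Re(f̄ ∂f), and
adding iAf to ∂f does not change this number. So ∂f may be replaced by i D_A f before applying
Cauchy-Schwarz. -/
lemma norm_partialD_regAbs_le {δ : ℝ} (hδ : 0 < δ) {f : R3 → ℂ} (hf : IsTest f) (A : R3 → R3)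
    (l : Fin 3) (x : R3) :
    ‖partialD l (fun x => (regAbs δ f x : ℂ)) x‖ ≤ ‖dA A l f x‖ := by
  have hpos : 0 < ‖f x‖ ^ 2 + δ ^ 2 := by positivity
  have h1 := (hf.differentiable x).hasFDerivAt
  have h2 := (((h1.norm_sq.add_const (δ ^ 2)).sqrt hpos.ne').sub_const δ)
  have h3 : HasFDerivAt (fun x => (regAbs δ f x : ℂ)) _ x := Complex.ofRealCLM.hasFDerivAt.comp x h2
  have h4 : partialD l (fun x => (regAbs δ f x : ℂ)) x =
      ((1 / (2 * Real.sqrt (‖f x‖ ^ 2 + δ ^ 2)) * (2 * inner ℝ (f x) (partialD l f x)) : ℝ) : ℂ) := by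
    rw [partialD, h3.fderiv]
    simp only [partialD, ContinuousLinearMap.comp_apply, smul_apply, innerSL_apply_apply,
      Complex.ofRealCLM_apply, smul_eq_mul, nsmul_eq_mul, Nat.cast_ofNat]
  have h5 : inner ℝ (f x) (partialD l f x) = inner ℝ (f x) (Complex.I * dA A l f x) := by
    simp [Complex.inner, dA]; ring
  have hs : 0 < Real.sqrt (‖f x‖ ^ 2 + δ ^ 2) := Real.sqrt_pos.2 hpos
  rw [h4, Complex.norm_real, Real.norm_eq_abs, h5, abs_mul, abs_mul, abs_of_pos (by positivity),
    abs_two]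
  have h6 := abs_real_inner_le_norm (f x) (Complex.I * dA A l f x)
  rw [norm_mul, Complex.norm_I, one_mul] at h6
  have h7 : ‖f x‖ ≤ Real.sqrt (‖f x‖ ^ 2 + δ ^ 2) := Real.le_sqrt_of_sq_le (by nlinarith)
  calc 1 / (2 * Real.sqrt (‖f x‖ ^ 2 + δ ^ 2)) * (2 * |inner ℝ (f x) (Complex.I * dA A l f x)|)
      ≤ 1 / (2 * Real.sqrt (‖f x‖ ^ 2 + δ ^ 2)) *
        (2 * (Real.sqrt (‖f x‖ ^ 2 + δ ^ 2) * ‖dA A l f x‖)) := by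
        gcongr
        exact h6.trans (by gcongr)
    _ = ‖dA A l f x‖ := by field_simp

lemma tendsto_regAbs (f : R3 → ℂ) (x : R3) :
    Tendsto (fun n : ℕ => regAbs (1 / ((n : ℝ) + 1)) f x) atTop (𝓝 ‖f x‖) := by
  have h0 := (tendsto_one_div_add_atTop_nhds_zero_nat (𝕜 := ℝ))
  have := ((Real.continuous_sqrt.tendsto _).comp ((h0.pow 2).const_add (‖f x‖ ^ 2))).sub h0
  simpa [regAbs, Function.comp_def] using this

/-- The hypothesis on V involves the plain gradient. It is applied to the smoothed modulus of f,
which is a test function with gradient at most |D_A f|; then the smoothing parameter tends to 0. The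
constant depends on V and ε but not on A. -/
lemma exists_form_bound {V : R3 → ℝ} (hV : LocallyIntegrable V volume) (hVf : InfFormBounded V)
    {ε : ℝ} (hε : 0 < ε) : ∃ C, 0 ≤ C ∧ ∀ A : R3 → R3, VectorL2Loc A → ∀ f, IsTest f →
      |potEnergy V f| ≤ ε * ∑ l, l2Sq (dA A l f) + C * l2Sq f := by
  obtain ⟨C, hC⟩ := hVf ε hε
  refine ⟨|C|, abs_nonneg _, fun A hA f hf => ?_⟩
  have hb : ∀ n : ℕ, |∫ x, V x * regAbs (1 / ((n : ℝ) + 1)) f x ^ 2| ≤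
      ε * ∑ l, l2Sq (dA A l f) + |C| * l2Sq f := by
    intro n
    have hδ : (0 : ℝ) < 1 / ((n : ℝ) + 1) := by positivity
    have ht := isTest_regAbs hδ hf
    have h1 := hC _ ht
    simp only [Complex.norm_real, Real.norm_eq_abs, sq_abs] at h1
    refine h1.trans ?_
    gcongr with l
    · exact integral_mono_of_nonneg (Eventually.of_forall fun x => by positivity)
        (integrable_norm_sq (hf.memLp_dA hA l))
        (Eventually.of_forall fun x => by
          have := norm_partialD_regAbs_le hδ hf A l x
          simp only
          gcongr)
    · exact le_abs_self _
    · exact integral_mono_of_nonneg (Eventually.of_forall fun x => by positivity)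
        (integrable_norm_sq (hf.memLp 2))
        (Eventually.of_forall fun x => by
          have := regAbs_le hδ.le f x
          have := regAbs_nonneg (δ := 1 / ((n : ℝ) + 1)) f x
          simp only
          gcongr)
  have hlim : Tendsto (fun n : ℕ => ∫ x, V x * regAbs (1 / ((n : ℝ) + 1)) f x ^ 2) atTop
      (𝓝 (potEnergy V f)) := by
    refine tendsto_integral_of_dominated_convergence (bound := fun x => ‖V x * ‖f x‖ ^ 2‖)
      (fun n => ?_) (hf.integrable_potential hV).norm (fun n => Eventually.of_forall fun x => ?_)
      (Eventually.of_forall fun x => ((tendsto_regAbs f x).pow 2).const_mul _)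
    · refine hV.aestronglyMeasurable.mul (Continuous.aestronglyMeasurable ?_)
      have := hf.continuous
      unfold regAbs
      fun_prop
    · rw [norm_mul, norm_mul]
      have h1 := regAbs_le (δ := 1 / ((n : ℝ) + 1)) (by positivity) f x
      have h2 := regAbs_nonneg (δ := 1 / ((n : ℝ) + 1)) f x
      simp only [norm_pow, Real.norm_eq_abs, abs_of_nonneg h2, abs_norm]
      gcongr
  exact le_of_tendsto' hlim.abs hb

/-! ### The extension of the potential form -/

lemma potEnergy_smul (V : R3 → ℝ) (c : ℂ) (f : R3 → ℂ) :
    potEnergy V (c • f) = ‖c‖ ^ 2 * potEnergy V f := by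
  simp only [potEnergy, Pi.smul_apply, norm_smul, mul_pow, ← integral_const_mul]
  congr 1; ext x; ring

/-- The bound that makes the potential form continuous. -/
def FormBounded (A : R3 → R3) (V : R3 → ℝ) (K : ℝ) : Prop :=
  ∀ f, IsTest f → |potEnergy V f| ≤ K * h1Sq A f

lemma exists_formBounded {A : R3 → R3} (hA : VectorL2Loc A) {V : R3 → ℝ}
    (hV : LocallyIntegrable V volume) (hVf : InfFormBounded V) :
    ∃ K, 0 ≤ K ∧ FormBounded A V K := by
  obtain ⟨C, hC0, hC⟩ := exists_form_bound hV hVf one_pos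
  refine ⟨1 + C, by positivity, fun f hf => (hC A hA f hf).trans ?_⟩
  rw [← hf.kinetic_eq hA, h1Sq]
  nlinarith [l2Sq_nonneg f, kinetic_nonneg A f, mul_nonneg hC0 (kinetic_nonneg A f)]

/-- |f|² - |g|² = Re (f - g)‾(f + g) is polarized with u = √s (f - g) and v = (f + g)/√s, and the
form bound is applied to u + v and u - v. The free parameter s balances the small factor f - g
against the bounded factor f + g. -/
lemma abs_potEnergy_sub_le {A : R3 → R3} (hA : VectorL2Loc A) {V : R3 → ℝ}
    (hV : LocallyIntegrable V volume) {K : ℝ} (hK : FormBounded A V K) {f g : R3 → ℂ}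
    (hf : IsTest f) (hg : IsTest g) {s : ℝ} (hs : 0 < s) :
    |potEnergy V f - potEnergy V g| ≤ K / 2 * (s * h1Sq A (f - g) + s⁻¹ * h1Sq A (f + g)) := by
  set r := Real.sqrt s
  have hr : 0 < r := Real.sqrt_pos.2 hs
  have hr2 : r ^ 2 = s := Real.sq_sqrt hs.le
  set u : R3 → ℂ := (r : ℂ) • (f - g) with hu'
  set v : R3 → ℂ := ((r⁻¹ : ℝ) : ℂ) • (f + g) with hv'
  have hu : IsTest u := (hf.sub hg).const_smul _
  have hv : IsTest v := (hf.add hg).const_smul _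
  have e : potEnergy V f - potEnergy V g = (potEnergy V (u + v) - potEnergy V (u - v)) / 4 := by
    rw [potEnergy, potEnergy, potEnergy, potEnergy, ← integral_sub (hf.integrable_potential hV)
      (hg.integrable_potential hV), ← integral_sub ((hu.add hv).integrable_potential hV)
      ((hu.sub hv).integrable_potential hV), ← integral_div]
    congr 1
    ext x
    have h1 : ‖(u + v) x‖ ^ 2 - ‖(u - v) x‖ ^ 2 = 4 * inner ℝ (u x) (v x) := by
      rw [Pi.add_apply, Pi.sub_apply, norm_add_sq_real, norm_sub_sq_real]; ring
    have h2 : inner ℝ (u x) (v x) = ‖f x‖ ^ 2 - ‖g x‖ ^ 2 := by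
      have : inner ℝ (u x) (v x) = inner ℝ (f x - g x) (f x + g x) := by
        simp only [hu', hv', Pi.smul_apply, Pi.sub_apply, Pi.add_apply, smul_eq_mul,
          ← Complex.real_smul, inner_smul_left, inner_smul_right]
        simp only [conj_trivial]
        field_simp
      rw [this]
      simp only [inner_sub_left, inner_add_right, real_inner_self_eq_norm_sq,
        real_inner_comm (f x) (g x)]
      ring
    linear_combination (-(V x) / 4) * h1 - V x * h2
  have p := h1Sq_parallelogram hA (hu.memH1 hA) (hv.memH1 hA)
  rw [h1Sq_smul _ ((hf.sub hg).memH1 hA), h1Sq_smul _ ((hf.add hg).memH1 hA), Complex.norm_real,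
    Complex.norm_real, Real.norm_eq_abs, Real.norm_eq_abs, abs_of_pos hr,
    abs_of_pos (inv_pos.2 hr), inv_pow, hr2] at p
  rw [e, abs_div, abs_of_pos (by norm_num : (0 : ℝ) < 4)]
  have a1 := hK _ (hu.add hv)
  have a2 := hK _ (hu.sub hv)
  have a3 := abs_sub (potEnergy V (u + v)) (potEnergy V (u - v))
  have : |potEnergy V (u + v) - potEnergy V (u - v)| ≤
      K * (2 * (s * h1Sq A (f - g)) + 2 * (s⁻¹ * h1Sq A (f + g))) := by
    rw [← p, mul_add]; linarith
  linarith

/-- A sequence of test functions converging to `φ` in `H¹_A`. -/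
def IsApprox (A : R3 → R3) (f : ℕ → R3 → ℂ) (φ : R3 → ℂ) : Prop :=
  (∀ t, IsTest (f t)) ∧ Tendsto (fun t => h1Sq A (f t - φ)) atTop (𝓝 0)

lemma exists_isApprox {A : R3 → R3} (hA : VectorL2Loc A) {φ : R3 → ℂ} (h : MemH1 A φ) :
    ∃ f, IsApprox A f φ := by
  choose f hf hlt using fun t : ℕ => exists_test_h1Sq_sub_lt hA h
    (δ := 1 / ((t : ℝ) + 1)) (by positivity)
  exact ⟨f, hf, squeeze_zero (fun t => h1Sq_nonneg _ _) (fun t => (hlt t).le)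
    (tendsto_one_div_add_atTop_nhds_zero_nat (𝕜 := ℝ))⟩

lemma IsTest.isApprox {A : R3 → R3} (hA : VectorL2Loc A) {f : R3 → ℂ} (h : IsTest f) :
    IsApprox A (fun _ => f) f := by
  refine ⟨fun _ => h, tendsto_const_nhds.congr fun _ => ?_⟩
  have := h1Sq_smul (A := A) 0 (h.memH1 hA)
  simpa using this.symm

lemma IsApprox.tendsto_coreNhds {A : R3 → R3} {f : ℕ → R3 → ℂ} {φ : R3 → ℂ}
    (h : IsApprox A f φ) : Tendsto f atTop (coreNhds A φ) :=
  tendsto_inf.2 ⟨tendsto_comap_iff.2 h.2, tendsto_principal.2 (Eventually.of_forall h.1)⟩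

/-- The limit defining `potForm` exists: the image filter is Cauchy by `abs_potEnergy_sub_le`, and
it is nontrivial by density of test functions. -/
lemma tendsto_potForm {A : R3 → R3} (hA : VectorL2Loc A) {V : R3 → ℝ}
    (hV : LocallyIntegrable V volume) {K : ℝ} (hK0 : 0 ≤ K) (hK : FormBounded A V K) {φ : R3 → ℂ}
    (h : MemH1 A φ) : Tendsto (potEnergy V) (coreNhds A φ) (𝓝 (potForm A V φ)) := by
  obtain ⟨f₀, hf₀⟩ := exists_isApprox hA h
  have hne : (coreNhds A φ).NeBot := hf₀.tendsto_coreNhds.neBot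
  have hc : Cauchy (map (potEnergy V) (coreNhds A φ)) := by
    rw [Metric.cauchy_iff]
    refine ⟨inferInstance, fun ε hε => ?_⟩
    -- B bounds the squared norm of f + g when f and g are within distance one of φ. Then s makes
    -- the term K B/(2s) less than ε/2, and η makes the term with f - g at most ε/2, where `h1Sq A
    -- (f - g)` ≤ 4η.
    set B := 8 + 8 * h1Sq A φ with hB
    have hB0 : 0 < B := by have := h1Sq_nonneg A φ; positivity
    set s := (K * B + 1) / ε with hs'
    have hs : 0 < s := by positivity
    set η := min 1 (ε / (4 * (K + 1) * s)) with hη'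
    have hη : 0 < η := by positivity
    have hmem : {f | IsTest f ∧ h1Sq A (f - φ) < η} ∈ coreNhds A φ := by
      have h1 : {f | h1Sq A (f - φ) < η} ∈
          comap (fun f => l2Sq (f - φ) + kinetic A (f - φ)) (𝓝 0) :=
        ⟨Set.Iio η, Iio_mem_nhds hη, fun f hf => hf⟩
      filter_upwards [mem_inf_of_left h1, mem_inf_of_right (mem_principal_self _)] with f h2 h3
        using ⟨h3, h2⟩
    refine ⟨_, image_mem_map hmem, ?_⟩
    rintro _ ⟨f, ⟨hf, hfη⟩, rfl⟩ _ ⟨g, ⟨hg, hgη⟩, rfl⟩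
    have hf1 := hf.memH1 hA
    have hg1 := hg.memH1 hA
    have hη1 : η ≤ 1 := min_le_left _ _
    have d1 : h1Sq A (f - g) ≤ 4 * η := by
      have := h1Sq_add_le hA (hf1.sub hA h) ((hg1.sub hA h).const_smul (-1))
      rw [h1Sq_smul _ (hg1.sub hA h)] at this
      have e : f - φ + (-1 : ℂ) • (g - φ) = f - g := by ext x; simp
      rw [e] at this
      simp at this
      linarith
    have d2 : ∀ u, MemH1 A u → h1Sq A (u - φ) < η → h1Sq A u ≤ 2 + 2 * h1Sq A φ := fun u hu hlt => by
      have := h1Sq_add_le hA (hu.sub hA h) h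
      rw [sub_add_cancel] at this
      linarith
    have d3 : h1Sq A (f + g) ≤ B := by
      have := h1Sq_add_le hA hf1 hg1
      have := d2 f hf1 hfη
      have := d2 g hg1 hgη
      linarith
    rw [Real.dist_eq]
    refine (abs_potEnergy_sub_le hA hV hK hf hg hs).trans_lt ?_
    have b1 : K / 2 * (s * h1Sq A (f - g)) ≤ ε / 2 := by
      have h1 : η ≤ ε / (4 * (K + 1) * s) := min_le_right _ _
      calc K / 2 * (s * h1Sq A (f - g)) ≤ K / 2 * (s * (4 * (ε / (4 * (K + 1) * s)))) := by
            gcongr; linarith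
        _ = ε / 2 * (K / (K + 1)) := by field_simp
        _ ≤ ε / 2 * 1 := by gcongr; exact div_le_one_of_le₀ (by linarith) (by linarith)
        _ = ε / 2 := mul_one _
    have b2 : K / 2 * (s⁻¹ * h1Sq A (f + g)) < ε / 2 := by
      calc K / 2 * (s⁻¹ * h1Sq A (f + g)) ≤ K / 2 * (s⁻¹ * B) := by gcongr
        _ = ε / 2 * ((K * B) / (K * B + 1)) := by rw [hs']; field_simp
        _ < ε / 2 * 1 := by
          gcongr
          rw [div_lt_one (by positivity)]; linarith
        _ = ε / 2 := mul_one _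
    rw [mul_add]; linarith
  obtain ⟨y, hy⟩ := CompleteSpace.complete hc
  exact tendsto_nhds_limUnder ⟨y, hy⟩

lemma tendsto_l2Sq_of_sub {f : ℕ → R3 → ℂ} {φ : R3 → ℂ} (hf : ∀ t, MemLp (f t) 2 volume)
    (hφ : MemLp φ 2 volume) (h : Tendsto (fun t => l2Sq (f t - φ)) atTop (𝓝 0)) :
    Tendsto (fun t => l2Sq (f t)) atTop (𝓝 (l2Sq φ)) := by
  have h1 : Tendsto (fun t => ‖(hf t).toLp (f t) - hφ.toLp φ‖) atTop (𝓝 0) := by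
    have := (Real.continuous_sqrt.tendsto 0).comp h
    rw [Real.sqrt_zero] at this
    refine this.congr fun t => ?_
    rw [Function.comp, l2Sq_eq_norm_toLp ((hf t).sub hφ), Real.sqrt_sq (norm_nonneg _),
      MemLp.toLp_sub]
  have h2 := (tendsto_iff_norm_sub_tendsto_zero.2 h1).norm.pow 2
  rw [← l2Sq_eq_norm_toLp] at h2
  exact h2.congr fun t => (l2Sq_eq_norm_toLp _).symm

lemma IsApprox.tendsto_sub {A : R3 → R3} {f : ℕ → R3 → ℂ} {φ : R3 → ℂ}
    (h : IsApprox A f φ) : Tendsto (fun t => l2Sq (f t - φ)) atTop (𝓝 0) :=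
  squeeze_zero (fun _ => l2Sq_nonneg _) (fun _ => le_add_of_nonneg_right (kinetic_nonneg _ _)) h.2

lemma IsApprox.tendsto_l2Sq {A : R3 → R3} {f : ℕ → R3 → ℂ} {φ : R3 → ℂ} (hφ : MemH1 A φ)
    (h : IsApprox A f φ) : Tendsto (fun t => l2Sq (f t)) atTop (𝓝 (l2Sq φ)) :=
  tendsto_l2Sq_of_sub (fun t => (h.1 t).memLp 2) hφ.1 h.tendsto_sub

lemma IsApprox.tendsto_kinetic {A : R3 → R3} (hA : VectorL2Loc A) {f : ℕ → R3 → ℂ} {φ : R3 → ℂ}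
    (hφ : MemH1 A φ) (h : IsApprox A f φ) :
    Tendsto (fun t => kinetic A (f t)) atTop (𝓝 (kinetic A φ)) := by
  refine tendsto_finsetSum _ fun l _ => tendsto_l2Sq_of_sub
    (fun t => ((h.1 t).memH1 hA).isL2MagGrad.1 l) (hφ.isL2MagGrad.1 l) ?_
  refine squeeze_zero (fun _ => l2Sq_nonneg _) (fun t => ?_) h.2
  rw [h1Sq_sub_eq hA ((h.1 t).memLp 2) hφ.1 ((h.1 t).memH1 hA).isL2MagGrad hφ.isL2MagGrad]
  have := Finset.single_le_sum (f := fun l => l2Sq (magGrad A (f t) l - magGrad A φ l))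
    (fun _ _ => l2Sq_nonneg _) (Finset.mem_univ l)
  have := l2Sq_nonneg (f t - φ)
  linarith

lemma IsApprox.add {A : R3 → R3} (hA : VectorL2Loc A) {f g : ℕ → R3 → ℂ} {φ χ : R3 → ℂ}
    (hφ : MemH1 A φ) (hχ : MemH1 A χ) (h : IsApprox A f φ) (h' : IsApprox A g χ) :
    IsApprox A (fun t => f t + g t) (φ + χ) := by
  refine ⟨fun t => (h.1 t).add (h'.1 t), squeeze_zero (fun _ => h1Sq_nonneg _ _) (fun t => ?_)
    (by simpa using (h.2.const_mul 2).add (h'.2.const_mul 2))⟩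
  rw [add_sub_add_comm]
  exact h1Sq_add_le hA (((h.1 t).memH1 hA).sub hA hφ) (((h'.1 t).memH1 hA).sub hA hχ)

lemma IsApprox.const_smul {A : R3 → R3} (hA : VectorL2Loc A) {f : ℕ → R3 → ℂ} {φ : R3 → ℂ} (c : ℂ)
    (hφ : MemH1 A φ) (h : IsApprox A f φ) : IsApprox A (fun t => c • f t) (c • φ) := by
  refine ⟨fun t => (h.1 t).const_smul c, ?_⟩
  have := h.2.const_mul (‖c‖ ^ 2)
  rw [mul_zero] at this
  refine this.congr fun t => ?_
  rw [← smul_sub, h1Sq_smul c (((h.1 t).memH1 hA).sub hA hφ)]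

lemma memH1_zero {A : R3 → R3} (hA : VectorL2Loc A) : MemH1 A 0 := isTest_zero.memH1 hA

lemma memH1_sum {A : R3 → R3} (hA : VectorL2Loc A) {ι : Type*} (s : Finset ι) {φ : ι → R3 → ℂ}
    (h : ∀ i ∈ s, MemH1 A (φ i)) : MemH1 A (∑ i ∈ s, φ i) := by
  classical
  induction s using Finset.induction_on with
  | empty => simpa using memH1_zero hA
  | insert a s ha ih =>
    rw [Finset.sum_insert ha]
    exact (h a (by simp)).add hA (ih fun i hi => h i (by simp [hi]))

lemma isApprox_sum {A : R3 → R3} (hA : VectorL2Loc A) {ι : Type*} (s : Finset ι)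
    {f : ι → ℕ → R3 → ℂ} {φ : ι → R3 → ℂ} (hφ : ∀ i ∈ s, MemH1 A (φ i))
    (h : ∀ i ∈ s, IsApprox A (f i) (φ i)) :
    IsApprox A (fun t => ∑ i ∈ s, f i t) (∑ i ∈ s, φ i) := by
  classical
  induction s using Finset.induction_on with
  | empty => simpa using isTest_zero.isApprox hA
  | insert a s ha ih =>
    simp_rw [Finset.sum_insert ha]
    exact (h a (by simp)).add hA (hφ a (by simp)) (memH1_sum hA s fun i hi => hφ i (by simp [hi]))
      (ih (fun i hi => hφ i (by simp [hi])) fun i hi => h i (by simp [hi]))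

/-- The energy of a test function. -/
def testEnergy (A : R3 → R3) (V : R3 → ℝ) (f : R3 → ℂ) : ℝ :=
  ∑ l, l2Sq (dA A l f) + potEnergy V f

/-- Identities and inequalities for the abstract form can thereby be checked on test functions,
where the potential term is an honest integral. -/
lemma IsApprox.tendsto_testEnergy {A : R3 → R3} (hA : VectorL2Loc A) {V : R3 → ℝ}
    (hV : LocallyIntegrable V volume) (hVf : InfFormBounded V) {f : ℕ → R3 → ℂ} {φ : R3 → ℂ}
    (hφ : MemH1 A φ) (h : IsApprox A f φ) :
    Tendsto (fun t => testEnergy A V (f t)) atTop (𝓝 (schrodingerForm A V φ)) := by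
  obtain ⟨K, hK0, hK⟩ := exists_formBounded hA hV hVf
  refine ((h.tendsto_kinetic hA hφ).add
    ((tendsto_potForm hA hV hK0 hK hφ).comp h.tendsto_coreNhds)).congr fun t => ?_
  rw [testEnergy, (h.1 t).kinetic_eq hA]
  rfl

lemma IsTest.schrodingerForm_eq {A : R3 → R3} (hA : VectorL2Loc A) {V : R3 → ℝ}
    (hV : LocallyIntegrable V volume) (hVf : InfFormBounded V) {f : R3 → ℂ} (hf : IsTest f) :
    schrodingerForm A V f = testEnergy A V f :=
  tendsto_nhds_unique ((hf.isApprox hA).tendsto_testEnergy hA hV hVf (hf.memH1 hA))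
    tendsto_const_nhds

lemma exists_testEnergy_bound {A : R3 → R3} (hA : VectorL2Loc A) {V : R3 → ℝ}
    (hV : LocallyIntegrable V volume) (hVf : InfFormBounded V) :
    ∃ K, 0 ≤ K ∧ ∀ f, IsTest f → |testEnergy A V f| ≤ K * h1Sq A f := by
  obtain ⟨K, hK0, hK⟩ := exists_formBounded hA hV hVf
  refine ⟨1 + K, by positivity, fun f hf => ?_⟩
  rw [testEnergy, ← hf.kinetic_eq hA]
  refine (abs_add_le _ _).trans ?_
  rw [abs_of_nonneg (kinetic_nonneg A f)]
  have := hK f hf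
  have : kinetic A f ≤ h1Sq A f := le_add_of_nonneg_left (l2Sq_nonneg f)
  linarith

lemma IsApprox.tendsto_h1Sq {A : R3 → R3} (hA : VectorL2Loc A) {f : ℕ → R3 → ℂ} {φ : R3 → ℂ}
    (hφ : MemH1 A φ) (h : IsApprox A f φ) :
    Tendsto (fun t => h1Sq A (f t)) atTop (𝓝 (h1Sq A φ)) :=
  (h.tendsto_l2Sq hφ).add (h.tendsto_kinetic hA hφ)

lemma schrodingerForm_smul {A : R3 → R3} (hA : VectorL2Loc A) {V : R3 → ℝ}
    (hV : LocallyIntegrable V volume) (hVf : InfFormBounded V) {φ : R3 → ℂ} (c : ℂ)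
    (hφ : MemH1 A φ) : schrodingerForm A V (c • φ) = ‖c‖ ^ 2 * schrodingerForm A V φ := by
  obtain ⟨f, hf⟩ := exists_isApprox hA hφ
  refine tendsto_nhds_unique
    ((hf.const_smul hA c hφ).tendsto_testEnergy hA hV hVf (hφ.const_smul c))
    (((hf.tendsto_testEnergy hA hV hVf hφ).const_mul (‖c‖ ^ 2)).congr fun t => ?_)
  have h1 : kinetic A (c • f t) = _ := kinetic_smul c ((hf.1 t).memH1 hA)
  rw [testEnergy, testEnergy, ← (hf.1 t).kinetic_eq hA, ← ((hf.1 t).const_smul c).kinetic_eq hA, h1,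
    potEnergy_smul]
  ring

/-! ### Coulomb bounds -/

lemma partialD_ofReal {u : R3 → ℝ} {u' : R3 →L[ℝ] ℝ} {x : R3} (h : HasFDerivAt u u' x)
    (l : Fin 3) : partialD l (fun x => (u x : ℂ)) x = (u' (EuclideanSpace.single l 1) : ℝ) := by
  have h3 : HasFDerivAt (fun x => (u x : ℂ)) _ x := Complex.ofRealCLM.hasFDerivAt.comp x h
  rw [partialD, h3.fderiv]; simp

lemma IsTest.norm_sq {f : R3 → ℂ} (hf : IsTest f) : IsTest (fun x => ((‖f x‖ ^ 2 : ℝ) : ℂ)) :=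
  isTest_of_smul_real (hf.1.norm_sq ℝ) hf.hasCompactSupport_norm_sq

lemma IsTest.partialD_norm_sq {f : R3 → ℂ} (hf : IsTest f) (A : R3 → R3) (l : Fin 3) (x : R3) :
    partialD l (fun x => ((‖f x‖ ^ 2 : ℝ) : ℂ)) x =
      ((2 * inner ℝ (f x) (Complex.I * dA A l f x) : ℝ) : ℂ) := by
  rw [partialD_ofReal (hf.differentiable x).hasFDerivAt.norm_sq]
  have h5 : inner ℝ (f x) (partialD l f x) = inner ℝ (f x) (Complex.I * dA A l f x) := by
    simp [Complex.inner, dA]; ring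
  rw [← h5]
  simp only [partialD, ContinuousLinearMap.comp_apply, smul_apply, innerSL_apply_apply,
    nsmul_eq_mul, Nat.cast_ofNat]

/-- The regularized distance. -/
def regDist (δ : ℝ) (y x : R3) : ℝ := Real.sqrt (‖x - y‖ ^ 2 + δ ^ 2)

lemma regDist_pos {δ : ℝ} (hδ : 0 < δ) (y x : R3) : 0 < regDist δ y x :=
  Real.sqrt_pos.2 (by positivity)

lemma regDist_sq (δ : ℝ) (y x : R3) : regDist δ y x ^ 2 = ‖x - y‖ ^ 2 + δ ^ 2 :=
  Real.sq_sqrt (by positivity)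

lemma contDiff_regDist {δ : ℝ} (hδ : 0 < δ) (y : R3) : ContDiff ℝ ∞ (regDist δ y) := by
  refine ContDiff.sqrt (((contDiff_id.sub contDiff_const).norm_sq ℝ).add contDiff_const)
    fun x => ?_
  positivity

/-- A component of the regularized unit radial field. -/
def radial (δ : ℝ) (y : R3) (l : Fin 3) (x : R3) : ℝ := (x l - y l) * (regDist δ y x)⁻¹

lemma contDiff_radial {δ : ℝ} (hδ : 0 < δ) (y : R3) (l : Fin 3) : ContDiff ℝ ∞ (radial δ y l) := by
  refine ContDiff.mul (ContDiff.sub ?_ contDiff_const)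
    ((contDiff_regDist hδ y).inv fun x => (regDist_pos hδ y x).ne')
  exact (EuclideanSpace.proj (𝕜 := ℝ) l).contDiff

lemma abs_radial_le {δ : ℝ} (hδ : 0 < δ) (y : R3) (l : Fin 3) (x : R3) : |radial δ y l x| ≤ 1 := by
  have hp := regDist_pos hδ y x
  rw [radial, abs_mul, abs_of_pos (inv_pos.2 hp), mul_inv_le_iff₀ hp, one_mul]
  have h1 : |x l - y l| ≤ ‖x - y‖ := by
    have := EuclideanSpace.norm_sq_eq (x - y)
    refine abs_le_of_sq_le_sq ?_ (norm_nonneg _)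
    rw [this]
    have := Finset.single_le_sum (f := fun i => ‖(x - y) i‖ ^ 2) (fun _ _ => by positivity)
      (Finset.mem_univ l)
    simpa using this
  exact h1.trans (Real.le_sqrt_of_sq_le (by nlinarith))

lemma partialD_radial {δ : ℝ} (hδ : 0 < δ) (y : R3) (l : Fin 3) (x : R3) :
    partialD l (fun x => (radial δ y l x : ℂ)) x =
      (((regDist δ y x)⁻¹ - (x l - y l) ^ 2 * ((regDist δ y x)⁻¹) ^ 3 : ℝ) : ℂ) := by
  have hp := regDist_pos hδ y x
  have h0 : HasFDerivAt (fun x : R3 => x - y) (ContinuousLinearMap.id ℝ R3) x :=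
    (hasFDerivAt_id x).sub_const y
  have h1 := ((h0.norm_sq.add_const (δ ^ 2)).sqrt (by positivity))
  have h2 : HasFDerivAt (fun x => (regDist δ y x)⁻¹) _ x :=
    (hasDerivAt_inv hp.ne').comp_hasFDerivAt x h1
  have h3 : HasFDerivAt (fun x : R3 => x l - y l) (EuclideanSpace.proj (𝕜 := ℝ) l) x :=
    (EuclideanSpace.proj (𝕜 := ℝ) l).hasFDerivAt.sub_const (y l)
  have h4 : HasFDerivAt (radial δ y l) _ x := h3.mul h2
  rw [partialD_ofReal h4]
  congr 1
  have e : inner ℝ (x - y) (EuclideanSpace.single l (1 : ℝ)) = x l - y l := by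
    rw [EuclideanSpace.inner_single_right]; simp
  have e' : EuclideanSpace.proj (𝕜 := ℝ) l (EuclideanSpace.single l (1 : ℝ)) = 1 := by simp
  simp only [add_apply, smul_apply, ContinuousLinearMap.comp_apply, innerSL_apply_apply,
    ContinuousLinearMap.id_apply, e, e', smul_eq_mul, nsmul_eq_mul]
  have : Real.sqrt (‖x - y‖ ^ 2 + δ ^ 2) = regDist δ y x := rfl
  rw [this]
  push_cast
  field_simp
  ring

/-- The Coulomb potential energy of a test function, with a regularized kernel. -/
lemma integral_norm_sq_div_regDist_le {A : R3 → R3} (hA : VectorL2Loc A) {f : R3 → ℂ}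
    (hf : IsTest f) (y : R3) {δ : ℝ} (hδ : 0 < δ) :
    ∫ x, ‖f x‖ ^ 2 * (regDist δ y x)⁻¹ ≤
      Real.sqrt (l2Sq f) * ∑ l, Real.sqrt (l2Sq (dA A l f)) := by
  have hinv : Continuous fun x => (regDist δ y x)⁻¹ :=
    (contDiff_regDist hδ y).continuous.inv₀ fun x => (regDist_pos hδ y x).ne'
  have hcoord : ∀ l : Fin 3, Continuous fun x : R3 => x l := fun l =>
    (EuclideanSpace.proj (𝕜 := ℝ) l).continuous
  -- The Coulomb kernel is controlled by the divergence of the radial unit field, integrated by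
  -- parts against |f|². The field has components bounded by 1, and ∂|f|² = 2 Re(f̄ i D_A f), so A
  -- does not appear separately.
  have ibp : ∀ l, ∫ x, ((regDist δ y x)⁻¹ - (x l - y l) ^ 2 * ((regDist δ y x)⁻¹) ^ 3) * ‖f x‖ ^ 2
      = - ∫ x, radial δ y l x * (2 * inner ℝ (f x) (Complex.I * dA A l f x)) := by
    intro l
    have h := integral_mul_partialD (f := fun x => (radial δ y l x : ℂ))
      ((Complex.ofRealCLM.contDiff.comp (contDiff_radial hδ y l)).of_le (by simp)) hf.norm_sq l
    simp_rw [hf.partialD_norm_sq A, partialD_radial hδ, ← Complex.ofReal_mul,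
      integral_complex_ofReal] at h
    rw [← Complex.ofReal_neg, Complex.ofReal_inj] at h
    linarith
  have hint : ∀ l, Integrable (fun x => ‖f x‖ * ‖dA A l f x‖) volume := fun l =>
    MemLp.integrable_mul (p := 2) (q := 2) (hf.memLp 2).norm (hf.memLp_dA hA l).norm
  have hbd : ∀ l, ∫ x, ((regDist δ y x)⁻¹ - (x l - y l) ^ 2 * ((regDist δ y x)⁻¹) ^ 3) * ‖f x‖ ^ 2
      ≤ 2 * (Real.sqrt (l2Sq f) * Real.sqrt (l2Sq (dA A l f))) := by
    intro l
    rw [ibp l, ← integral_neg]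
    refine le_trans ?_ (mul_le_mul_of_nonneg_left
      (integral_norm_mul_norm_le (hf.memLp 2) (hf.memLp_dA hA l)) two_pos.le)
    rw [← integral_const_mul]
    refine (le_abs_self _).trans ((Real.norm_eq_abs _).symm.le.trans
      (norm_integral_le_of_norm_le ((hint l).const_mul 2) (Eventually.of_forall fun x => ?_)))
    have h1 := abs_radial_le hδ y l x
    have h2 := abs_real_inner_le_norm (f x) (Complex.I * dA A l f x)
    rw [norm_mul, Complex.norm_I, one_mul] at h2
    rw [norm_neg, Real.norm_eq_abs, abs_mul, abs_mul, abs_two]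
    calc _ ≤ 1 * (2 * (‖f x‖ * ‖dA A l f x‖)) := by gcongr
      _ = _ := by ring
  have hci : ∀ u : R3 → ℝ, Continuous u → Integrable (fun x => u x * ‖f x‖ ^ 2) volume :=
    fun u hu => (hu.mul (hf.continuous.norm.pow 2)).integrable_of_hasCompactSupport
      hf.hasCompactSupport_norm_sq.mul_left
  -- With r the regularized distance the divergence is 3/r - |x - y|²/r³, which is at least 2/r
  -- because |x - y| ≤ r.
  have hsum : 2 * ∫ x, ‖f x‖ ^ 2 * (regDist δ y x)⁻¹ ≤
      ∑ l, ∫ x, ((regDist δ y x)⁻¹ - (x l - y l) ^ 2 * ((regDist δ y x)⁻¹) ^ 3) * ‖f x‖ ^ 2 := by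
    rw [← integral_finsetSum _ fun l _ => hci _ (by have := hcoord l; fun_prop),
      ← integral_const_mul]
    refine integral_mono ?_ ?_ fun x => ?_
    · refine ((hci _ hinv).const_mul 2).congr (Eventually.of_forall fun x => ?_)
      simp only; ring
    · exact integrable_finsetSum _ fun l _ => hci _ (by have := hcoord l; fun_prop)
    · have hp := regDist_pos hδ y x
      have hs := regDist_sq δ y x
      have hn : ∑ l, (x l - y l) ^ 2 = ‖x - y‖ ^ 2 := by
        rw [EuclideanSpace.norm_sq_eq]; simp
      simp only
      rw [← Finset.sum_mul, Finset.sum_sub_distrib, ← Finset.sum_mul, hn]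
      simp only [Finset.sum_const, Finset.card_univ, Fintype.card_fin, nsmul_eq_mul]
      have h3 : ‖x - y‖ ^ 2 * (regDist δ y x)⁻¹ ^ 3 ≤ (regDist δ y x)⁻¹ := by
        have : ‖x - y‖ ^ 2 ≤ regDist δ y x ^ 2 := by rw [hs]; nlinarith
        calc _ ≤ regDist δ y x ^ 2 * (regDist δ y x)⁻¹ ^ 3 := by gcongr
          _ = _ := by field_simp
      have : 2 * (regDist δ y x)⁻¹ ≤ 3 * (regDist δ y x)⁻¹ - ‖x - y‖ ^ 2 * (regDist δ y x)⁻¹ ^ 3 := by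
        linarith
      calc _ = 2 * (regDist δ y x)⁻¹ * ‖f x‖ ^ 2 := by ring
        _ ≤ _ := by push_cast; gcongr
  have := hsum.trans (Finset.sum_le_sum fun l _ => hbd l)
  rw [← Finset.mul_sum, ← Finset.mul_sum] at this
  linarith

/-- The regularized bound is uniform in δ, so Fatou's lemma removes δ. Uniformity in y is what the
double integral needs next. -/
lemma lintegral_norm_sq_div_le {A : R3 → R3} (hA : VectorL2Loc A) {f : R3 → ℂ} (hf : IsTest f)
    (y : R3) : ∫⁻ x, ENNReal.ofReal (‖f x‖ ^ 2 / ‖x - y‖) ≤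
      ENNReal.ofReal (Real.sqrt (l2Sq f) * ∑ l, Real.sqrt (l2Sq (dA A l f))) := by
  set δ : ℕ → ℝ := fun n => 1 / ((n : ℝ) + 1)
  have hδ : ∀ n, 0 < δ n := fun n => by positivity
  have hc : ∀ n, Continuous fun x => ‖f x‖ ^ 2 * (regDist (δ n) y x)⁻¹ := fun n =>
    (hf.continuous.norm.pow 2).mul ((contDiff_regDist (hδ n) y).continuous.inv₀
      fun x => (regDist_pos (hδ n) y x).ne')
  have h1 : ∀ n, ∫⁻ x, ENNReal.ofReal (‖f x‖ ^ 2 * (regDist (δ n) y x)⁻¹) ≤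
      ENNReal.ofReal (Real.sqrt (l2Sq f) * ∑ l, Real.sqrt (l2Sq (dA A l f))) := fun n => by
    rw [← ofReal_integral_eq_lintegral_ofReal]
    · exact ENNReal.ofReal_le_ofReal (integral_norm_sq_div_regDist_le hA hf y (hδ n))
    · exact (hc n).integrable_of_hasCompactSupport hf.hasCompactSupport_norm_sq.mul_right
    · exact Eventually.of_forall fun x => mul_nonneg (by positivity)
        (inv_nonneg.2 (regDist_pos (hδ n) y x).le)
  refine le_trans ?_ ((lintegral_liminf_le (u := atTop)
    fun n => ((hc n).measurable.ennreal_ofReal)).trans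
    (liminf_le_of_frequently_le' (Frequently.of_forall h1)))
  refine lintegral_mono fun x => ?_
  -- On the diagonal the quotient is 0 by convention, so there is nothing to approximate.
  by_cases hxy : x = y
  · simp [hxy]
  · refine le_of_eq (Tendsto.liminf_eq ?_).symm
    refine ENNReal.tendsto_ofReal ?_
    rw [div_eq_mul_inv]
    refine Tendsto.const_mul _ (Tendsto.inv₀ ?_ (norm_ne_zero_iff.2 (sub_ne_zero.2 hxy)))
    have h0 := (tendsto_one_div_add_atTop_nhds_zero_nat (𝕜 := ℝ))
    have := ((Real.continuous_sqrt.tendsto _).comp ((h0.pow 2).const_add (‖x - y‖ ^ 2)))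
    simpa [δ, regDist, Function.comp_def, Real.sqrt_sq (norm_nonneg _)] using this

/-- The Coulomb energy as an extended real. -/
def coulombE (φ : R3 → ℂ) : ENNReal :=
  ∫⁻ x, ∫⁻ y, ENNReal.ofReal (‖φ x‖ ^ 2 * ‖φ y‖ ^ 2 / ‖x - y‖)

/-- The Coulomb energy. -/
def coulomb (φ : R3 → ℂ) : ℝ := ∫ x, ∫ y, ‖φ x‖ ^ 2 * ‖φ y‖ ^ 2 / ‖x - y‖

lemma coulombE_le {A : R3 → R3} (hA : VectorL2Loc A) {f : R3 → ℂ} (hf : IsTest f) :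
    coulombE f ≤ ENNReal.ofReal
      (l2Sq f * (Real.sqrt (l2Sq f) * ∑ l, Real.sqrt (l2Sq (dA A l f)))) := by
  set B := Real.sqrt (l2Sq f) * ∑ l, Real.sqrt (l2Sq (dA A l f))
  have hB : 0 ≤ B := by positivity
  have h1 : ∀ x, ∫⁻ y, ENNReal.ofReal (‖f x‖ ^ 2 * ‖f y‖ ^ 2 / ‖x - y‖) ≤
      ENNReal.ofReal (‖f x‖ ^ 2) * ENNReal.ofReal B := fun x => by
    simp_rw [mul_div_assoc, ENNReal.ofReal_mul (sq_nonneg ‖f x‖)]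
    rw [lintegral_const_mul' _ _ ENNReal.ofReal_ne_top]
    gcongr
    simp_rw [norm_sub_rev x]
    exact lintegral_norm_sq_div_le hA hf x
  calc coulombE f ≤ ∫⁻ x, ENNReal.ofReal (‖f x‖ ^ 2) * ENNReal.ofReal B := lintegral_mono h1
    _ = ENNReal.ofReal (l2Sq f) * ENNReal.ofReal B := by
      rw [lintegral_mul_const' _ _ ENNReal.ofReal_ne_top, l2Sq,
        ofReal_integral_eq_lintegral_ofReal (integrable_norm_sq (hf.memLp 2))
        (Eventually.of_forall fun x => by positivity)]
    _ = _ := (ENNReal.ofReal_mul (l2Sq_nonneg f)).symm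

lemma coulomb_nonneg (φ : R3 → ℂ) : 0 ≤ coulomb φ :=
  integral_nonneg fun _ => integral_nonneg fun _ => by positivity

/-- No integrability is needed: where a real integral is undefined it equals 0, which is the
favourable value. This serves functions in H¹_A whose Coulomb energy is not yet known to be finite.
-/
lemma ofReal_coulomb_le {φ : R3 → ℂ} : ENNReal.ofReal (coulomb φ) ≤ coulombE φ := by
  have h0 : ∀ x, 0 ≤ ∫ y, ‖φ x‖ ^ 2 * ‖φ y‖ ^ 2 / ‖x - y‖ := fun x =>
    integral_nonneg fun y => by positivity
  have h1 : ∀ x, ENNReal.ofReal (∫ y, ‖φ x‖ ^ 2 * ‖φ y‖ ^ 2 / ‖x - y‖) ≤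
      ∫⁻ y, ENNReal.ofReal (‖φ x‖ ^ 2 * ‖φ y‖ ^ 2 / ‖x - y‖) := fun x => by
    by_cases hi : Integrable (fun y => ‖φ x‖ ^ 2 * ‖φ y‖ ^ 2 / ‖x - y‖) volume
    · exact (ofReal_integral_eq_lintegral_ofReal hi
        (Eventually.of_forall fun y => by positivity)).le
    · simp [integral_undef hi]
  by_cases hi : Integrable (fun x => ∫ y, ‖φ x‖ ^ 2 * ‖φ y‖ ^ 2 / ‖x - y‖) volume
  · rw [coulomb, ofReal_integral_eq_lintegral_ofReal hi (Eventually.of_forall h0)]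
    exact lintegral_mono h1
  · simp [coulomb, integral_undef hi]

lemma IsTest.measurable_coulomb {f : R3 → ℂ} (hf : IsTest f) :
    Measurable (fun p : R3 × R3 => ‖f p.1‖ ^ 2 * ‖f p.2‖ ^ 2 / ‖p.1 - p.2‖) := by
  have h1 : Measurable f := hf.continuous.measurable
  fun_prop

lemma IsTest.ofReal_coulomb {f : R3 → ℂ} (hf : IsTest f) :
    ENNReal.ofReal (coulomb f) = coulombE f := by
  -- Finiteness of the Coulomb energy of f has nothing to do with the magnetic field, so the bound
  -- is used with A = 0.
  have hA : VectorL2Loc (0 : R3 → R3) := fun K _ l => by simp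
  have hfin : coulombE f < ⊤ := (coulombE_le hA hf).trans_lt ENNReal.ofReal_lt_top
  have hm := hf.measurable_coulomb.ennreal_ofReal
  have hm1 : Measurable fun x => ∫⁻ y, ENNReal.ofReal (‖f x‖ ^ 2 * ‖f y‖ ^ 2 / ‖x - y‖) :=
    hm.lintegral_prod_right'
  have h1 : ∀ x, ∫ y, ‖f x‖ ^ 2 * ‖f y‖ ^ 2 / ‖x - y‖ =
      (∫⁻ y, ENNReal.ofReal (‖f x‖ ^ 2 * ‖f y‖ ^ 2 / ‖x - y‖)).toReal := fun x => by
    rw [integral_eq_lintegral_of_nonneg_ae (Eventually.of_forall fun y => by positivity)]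
    exact (hf.measurable_coulomb.comp (measurable_const.prodMk measurable_id)).aestronglyMeasurable
  rw [coulomb]
  simp_rw [h1]
  rw [integral_toReal hm1.aemeasurable (ae_lt_top hm1 hfin.ne)]
  exact ENNReal.ofReal_toReal hfin.ne

lemma coulomb_le {A : R3 → R3} (hA : VectorL2Loc A) {f : R3 → ℂ} (hf : IsTest f) :
    coulomb f ≤ l2Sq f * (Real.sqrt (l2Sq f) * ∑ l, Real.sqrt (l2Sq (dA A l f))) := by
  have h := hf.ofReal_coulomb.le.trans (coulombE_le hA hf)
  have h0 := l2Sq_nonneg f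
  exact (ENNReal.ofReal_le_ofReal_iff (by positivity)).1 h

/-- Lower semicontinuity of the Coulomb energy. -/
lemma coulombE_le_liminf {f : ℕ → R3 → ℂ} {φ : R3 → ℂ} (hf : ∀ t, IsTest (f t))
    (h : ∀ᵐ x, Tendsto (fun t => f t x) atTop (𝓝 (φ x))) :
    coulombE φ ≤ liminf (fun t => coulombE (f t)) atTop := by
  refine le_trans ?_ (lintegral_liminf_le fun t =>
    (hf t).measurable_coulomb.ennreal_ofReal.lintegral_prod_right')
  refine lintegral_mono_ae ?_
  filter_upwards [h] with x hx
  refine le_trans ?_ (lintegral_liminf_le fun t =>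
    ((hf t).measurable_coulomb.comp (measurable_const.prodMk measurable_id)).ennreal_ofReal)
  refine lintegral_mono_ae ?_
  filter_upwards [h] with y hy
  refine le_of_eq (Tendsto.liminf_eq ?_).symm
  exact ENNReal.tendsto_ofReal (((hx.norm.pow 2).mul (hy.norm.pow 2)).div_const _)

lemma exists_isApprox_ae {A : R3 → R3} (hA : VectorL2Loc A) {φ : R3 → ℂ} (hφ : MemH1 A φ) :
    ∃ f, IsApprox A f φ ∧ ∀ᵐ x, Tendsto (fun t => f t x) atTop (𝓝 (φ x)) := by
  obtain ⟨f, hf⟩ := exists_isApprox hA hφ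
  have h1 : Tendsto (fun t => ((hf.1 t).memLp 2).toLp (f t)) atTop (𝓝 (hφ.1.toLp φ)) := by
    rw [tendsto_iff_norm_sub_tendsto_zero]
    have := (Real.continuous_sqrt.tendsto 0).comp hf.tendsto_sub
    rw [Real.sqrt_zero] at this
    refine this.congr fun t => ?_
    rw [Function.comp, l2Sq_eq_norm_toLp (((hf.1 t).memLp 2).sub hφ.1),
      Real.sqrt_sq (norm_nonneg _), MemLp.toLp_sub]
  obtain ⟨ns, hns, hae⟩ := (tendstoInMeasure_of_tendsto_Lp h1).exists_seq_tendsto_ae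
  refine ⟨fun t => f (ns t), ⟨fun t => hf.1 _, hf.2.comp hns.tendsto_atTop⟩, ?_⟩
  have h2 : ∀ᵐ x, ∀ t, ((hf.1 t).memLp 2).toLp (f t) x = f t x :=
    ae_all_iff.2 fun t => ((hf.1 t).memLp 2).coeFn_toLp
  filter_upwards [hae, h2, hφ.1.coeFn_toLp] with x hx h3 h4
  simp_rw [h3, h4] at hx
  exact hx

/-! ### The Coulomb energy in momentum space -/

/-- The Fourier transform of a density. -/
def densityFT (ρ : R3 → ℝ) (k : R3) : ℂ :=
  ∫ x, Complex.exp (Complex.I * ((inner ℝ k x : ℝ) : ℂ)) * (ρ x : ℂ)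

lemma norm_exp_I_mul (t : ℝ) : ‖Complex.exp (Complex.I * (t : ℂ))‖ = 1 := by
  rw [mul_comm]; exact Complex.norm_exp_ofReal_mul_I t

lemma continuous_phase : Continuous fun p : R3 × R3 =>
    Complex.exp (Complex.I * ((inner ℝ p.1 p.2 : ℝ) : ℂ)) := by fun_prop

lemma integrable_phase_mul {ρ : R3 → ℝ} (hρ : Integrable ρ volume) (k : R3) :
    Integrable (fun x => Complex.exp (Complex.I * ((inner ℝ k x : ℝ) : ℂ)) * (ρ x : ℂ)) volume := by
  refine hρ.ofReal.bdd_mul (c := 1) (Continuous.aestronglyMeasurable (by fun_prop)) ?_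
  exact Eventually.of_forall fun x => (norm_exp_I_mul _).le

lemma continuous_densityFT {ρ : R3 → ℝ} (hρ : Integrable ρ volume) : Continuous (densityFT ρ) := by
  refine continuous_of_dominated (bound := fun x => ‖ρ x‖)
    (fun k => (integrable_phase_mul hρ k).1) (fun k => Eventually.of_forall fun x => ?_) hρ.norm
    (Eventually.of_forall fun x => ?_)
  · rw [norm_mul, norm_exp_I_mul, one_mul, Complex.norm_real]
  · fun_prop

lemma norm_densityFT_le {ρ : R3 → ℝ} (k : R3) : ‖densityFT ρ k‖ ≤ ∫ x, ‖ρ x‖ := by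
  refine (norm_integral_le_integral_norm _).trans (le_of_eq ?_)
  congr 1; ext x
  rw [norm_mul, norm_exp_I_mul, one_mul, Complex.norm_real]

/-- The Fourier transform of a Gaussian in three dimensions. -/
lemma integral_gauss_phase {u : ℝ} (hu : 0 < u) (z : R3) :
    ∫ k : R3, (Real.exp (-(1 / (4 * u ^ 2)) * ‖k‖ ^ 2) : ℂ) *
      Complex.exp (Complex.I * ((inner ℝ k z : ℝ) : ℂ)) =
      ((8 * Real.pi * Real.sqrt Real.pi * u ^ 3 * Real.exp (-u ^ 2 * ‖z‖ ^ 2) : ℝ) : ℂ) := by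
  have hb : 0 < ((1 / (4 * u ^ 2) : ℝ) : ℂ).re := by rw [Complex.ofReal_re]; positivity
  have h := GaussianFourier.integral_cexp_neg_mul_sq_norm_add hb Complex.I z
  have e1 : ∀ k : R3, (Real.exp (-(1 / (4 * u ^ 2)) * ‖k‖ ^ 2) : ℂ) *
      Complex.exp (Complex.I * ((inner ℝ k z : ℝ) : ℂ)) =
      Complex.exp (-((1 / (4 * u ^ 2) : ℝ) : ℂ) * (‖k‖ : ℂ) ^ 2 +
        Complex.I * ((inner ℝ z k : ℝ) : ℂ)) := fun k => by
    rw [Complex.exp_add, Complex.ofReal_exp, real_inner_comm]; push_cast; rfl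
  simp_rw [e1]
  rw [h]
  have hr : (0 : ℝ) ≤ 4 * Real.pi * u ^ 2 := by positivity
  have e2 : ((Real.pi : ℂ) / ((1 / (4 * u ^ 2) : ℝ) : ℂ)) = ((4 * Real.pi * u ^ 2 : ℝ) : ℂ) := by
    push_cast; field_simp
  have e3 : ((Module.finrank ℝ R3 : ℂ) / 2) = ((3 / 2 : ℝ) : ℂ) := by
    rw [finrank_euclideanSpace_fin]; push_cast; norm_num
  have e4 : (4 * Real.pi * u ^ 2) ^ (3 / 2 : ℝ) = 8 * Real.pi * Real.sqrt Real.pi * u ^ 3 := by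
    have : 4 * Real.pi * u ^ 2 = (2 * Real.sqrt Real.pi * u) ^ 2 := by
      rw [mul_pow, mul_pow, Real.sq_sqrt Real.pi_pos.le]; ring
    rw [this, ← Real.rpow_natCast, ← Real.rpow_mul (by positivity)]
    norm_num
    rw [mul_pow, mul_pow, pow_succ (Real.sqrt Real.pi), Real.sq_sqrt Real.pi_pos.le]; ring
  rw [e2, e3, ← Complex.ofReal_cpow hr, e4, Complex.I_sq]
  have e5 : (-1 * (‖z‖ : ℂ) ^ 2 / (4 * ((1 / (4 * u ^ 2) : ℝ) : ℂ))) =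
      ((-u ^ 2 * ‖z‖ ^ 2 : ℝ) : ℂ) := by
    push_cast
    have : (u : ℂ) ≠ 0 := by exact_mod_cast hu.ne'
    field_simp
  rw [e5, ← Complex.ofReal_exp, ← Complex.ofReal_mul]

lemma integrable_gauss {b : ℝ} (hb : 0 < b) :
    Integrable (fun k : R3 => Real.exp (-b * ‖k‖ ^ 2)) volume := by
  have := GaussianFourier.integrable_cexp_neg_mul_sq_norm_add (V := R3) (b := (b : ℂ)) (by simpa using hb) 0 0
  refine this.norm.congr (Eventually.of_forall fun k => ?_)
  simp only [zero_mul, add_zero]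
  rw [Complex.norm_exp]
  congr 1
  rw [← Complex.ofReal_neg, ← Complex.ofReal_pow, ← Complex.ofReal_mul, Complex.ofReal_re]

lemma norm_densityFT_sq {ρ : R3 → ℝ} (k : R3) :
    ((‖densityFT ρ k‖ ^ 2 : ℝ) : ℂ) = ∫ p : R3 × R3,
      ((ρ p.1 * ρ p.2 : ℝ) : ℂ) * Complex.exp (Complex.I * ((inner ℝ k (p.1 - p.2) : ℝ) : ℂ)) := by
  have h1 : ((‖densityFT ρ k‖ ^ 2 : ℝ) : ℂ) = densityFT ρ k * (starRingEnd ℂ) (densityFT ρ k) := by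
    rw [Complex.mul_conj, Complex.normSq_eq_norm_sq]
  rw [h1, densityFT, ← integral_conj, ← integral_prod_mul]
  congr 1
  ext p
  rw [map_mul, ← Complex.exp_conj, map_mul, Complex.conj_I, Complex.conj_ofReal,
    Complex.conj_ofReal, inner_sub_right]
  push_cast
  rw [mul_sub, sub_eq_add_neg, Complex.exp_add, neg_mul]
  ring

/-- |ρ̂|² is a double integral of phases. The Gaussian factor makes the triple integral absolutely
convergent, so Fubini's theorem and the Gaussian Fourier transform apply; the prefactor is
(4πu²)^(3/2). -/
lemma integral_gauss_densityFT {ρ : R3 → ℝ} (hρ : Integrable ρ volume) {u : ℝ} (hu : 0 < u) :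
    ∫ k, Real.exp (-(1 / (4 * u ^ 2)) * ‖k‖ ^ 2) * ‖densityFT ρ k‖ ^ 2 =
      8 * Real.pi * Real.sqrt Real.pi * u ^ 3 *
        ∫ p : R3 × R3, ρ p.1 * ρ p.2 * Real.exp (-u ^ 2 * ‖p.1 - p.2‖ ^ 2) := by
  have hb : 0 < 1 / (4 * u ^ 2) := by positivity
  rw [← Complex.ofReal_inj, ← integral_complex_ofReal, Complex.ofReal_mul,
    ← integral_complex_ofReal]
  have hint : Integrable (fun q : R3 × (R3 × R3) =>
      (Real.exp (-(1 / (4 * u ^ 2)) * ‖q.1‖ ^ 2) : ℂ) * (((ρ q.2.1 * ρ q.2.2 : ℝ) : ℂ) *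
        Complex.exp (Complex.I * ((inner ℝ q.1 (q.2.1 - q.2.2) : ℝ) : ℂ))))
      (volume.prod (volume.prod volume)) := by
    have h1 := (integrable_gauss hb).ofReal (𝕜 := ℂ)
    have h2 := (hρ.mul_prod hρ).ofReal (𝕜 := ℂ)
    have h3 := h1.mul_prod h2
    have h4 := h3.mul_bdd (c := 1) (g := fun q : R3 × (R3 × R3) =>
        Complex.exp (Complex.I * ((inner ℝ q.1 (q.2.1 - q.2.2) : ℝ) : ℂ)))
        (Continuous.aestronglyMeasurable (by fun_prop))
        (Eventually.of_forall fun q => (norm_exp_I_mul _).le)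
    refine h4.congr (Eventually.of_forall fun q => ?_)
    simp [mul_assoc]
  calc ∫ k, ((Real.exp (-(1 / (4 * u ^ 2)) * ‖k‖ ^ 2) * ‖densityFT ρ k‖ ^ 2 : ℝ) : ℂ)
      = ∫ k, ∫ p : R3 × R3, (Real.exp (-(1 / (4 * u ^ 2)) * ‖k‖ ^ 2) : ℂ) *
        (((ρ p.1 * ρ p.2 : ℝ) : ℂ) *
          Complex.exp (Complex.I * ((inner ℝ k (p.1 - p.2) : ℝ) : ℂ))) := by
        congr 1; ext k
        rw [Complex.ofReal_mul, norm_densityFT_sq, integral_const_mul]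
    _ = ∫ p : R3 × R3, ∫ k, (Real.exp (-(1 / (4 * u ^ 2)) * ‖k‖ ^ 2) : ℂ) *
        (((ρ p.1 * ρ p.2 : ℝ) : ℂ) *
          Complex.exp (Complex.I * ((inner ℝ k (p.1 - p.2) : ℝ) : ℂ))) :=
        integral_integral_swap hint
    _ = _ := by
        rw [← integral_const_mul]
        congr 1; ext p
        have e : ∀ k : R3, (Real.exp (-(1 / (4 * u ^ 2)) * ‖k‖ ^ 2) : ℂ) *
            (((ρ p.1 * ρ p.2 : ℝ) : ℂ) *
              Complex.exp (Complex.I * ((inner ℝ k (p.1 - p.2) : ℝ) : ℂ))) =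
            ((ρ p.1 * ρ p.2 : ℝ) : ℂ) * ((Real.exp (-(1 / (4 * u ^ 2)) * ‖k‖ ^ 2) : ℂ) *
              Complex.exp (Complex.I * ((inner ℝ k (p.1 - p.2) : ℝ) : ℂ))) := fun k => by ring
        simp_rw [e]
        rw [integral_const_mul, integral_gauss_phase hu]
        push_cast; ring

/-- Subordination: the Coulomb kernel as a superposition of Gaussians, whose Fourier transforms are
explicit. -/
lemma lintegral_gauss_eq_inv {r : ℝ} (hr : 0 < r) :
    ∫⁻ u in Set.Ioi (0 : ℝ), ENNReal.ofReal (2 / Real.sqrt Real.pi * Real.exp (-u ^ 2 * r ^ 2)) =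
      ENNReal.ofReal (1 / r) := by
  have h := integral_gaussian_Ioi (r ^ 2)
  have e : ∀ u : ℝ, Real.exp (-u ^ 2 * r ^ 2) = Real.exp (-r ^ 2 * u ^ 2) := fun u => by
    congr 1; ring
  simp_rw [e]
  rw [← ofReal_integral_eq_lintegral_ofReal, integral_const_mul, h]
  · congr 1
    rw [Real.sqrt_div Real.pi_pos.le, Real.sqrt_sq hr.le]
    have := Real.sqrt_pos.2 Real.pi_pos
    field_simp
  · exact ((integrable_exp_neg_mul_sq (by positivity)).integrableOn).const_mul _
  · exact Eventually.of_forall fun u => by positivity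

/-- The momentum space counterpart: superposing the transformed Gaussians yields the kernel 1/|k|².
The integrand has the explicit primitive (2/r²) exp(-r²/(4u²)). -/
lemma lintegral_inv_cube_gauss {r : ℝ} (hr : 0 < r) :
    ∫⁻ u in Set.Ioi (0 : ℝ), ENNReal.ofReal ((u ^ 3)⁻¹ * Real.exp (-(1 / (4 * u ^ 2)) * r ^ 2)) =
      ENNReal.ofReal (2 / r ^ 2) := by
  -- The value 0 at the origin is the limit of the primitive from the right; without it the
  -- convention 1/0 = 0 would give 2/r² there.
  set F : ℝ → ℝ := fun u => if u = 0 then 0 else 2 / r ^ 2 * Real.exp (-(1 / (4 * u ^ 2)) * r ^ 2)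
  have hd : ∀ u ∈ Set.Ioi (0 : ℝ),
      HasDerivAt F ((u ^ 3)⁻¹ * Real.exp (-(1 / (4 * u ^ 2)) * r ^ 2)) u := by
    intro u hu
    have hu' : u ≠ 0 := (Set.mem_Ioi.1 hu).ne'
    have h1 : HasDerivAt (fun u : ℝ => -(1 / (4 * u ^ 2)) * r ^ 2) ((2 * u ^ 3)⁻¹ * r ^ 2) u := by
      have h2 := (((hasDerivAt_pow 2 u).const_mul 4).inv (by positivity)).neg.mul_const (r ^ 2)
      have e : (fun u : ℝ => -(1 / (4 * u ^ 2)) * r ^ 2) = fun u => -(4 * u ^ 2)⁻¹ * r ^ 2 := by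
        ext u; rw [one_div]
      rw [e]
      refine h2.congr_deriv ?_
      field_simp
      push_cast
      ring
    have h3 := (h1.exp.const_mul (2 / r ^ 2))
    refine (h3.congr_deriv ?_).congr_of_eventuallyEq ?_
    · field_simp
    · filter_upwards [isOpen_ne.mem_nhds hu'] with v hv
      simp only [F, if_neg hv]
  have hpos : ∀ u ∈ Set.Ioi (0 : ℝ), 0 ≤ (u ^ 3)⁻¹ * Real.exp (-(1 / (4 * u ^ 2)) * r ^ 2) :=
    fun u hu => by have : 0 < u := hu; positivity
  have hcont : ContinuousWithinAt F (Set.Ici 0) 0 := by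
    rw [← continuousWithinAt_Ioi_iff_Ici, ContinuousWithinAt]
    have h0 : F 0 = 0 := by simp [F]
    rw [h0]
    have t1 : Tendsto (fun u : ℝ => -(1 / (4 * u ^ 2)) * r ^ 2) (𝓝[>] 0) atBot := by
      have t2 : Tendsto (fun u : ℝ => (4 * u ^ 2)) (𝓝[>] 0) (𝓝[>] 0) := by
        refine tendsto_nhdsWithin_iff.2 ⟨?_, ?_⟩
        · have : Tendsto (fun u : ℝ => 4 * u ^ 2) (𝓝 0) (𝓝 (4 * 0 ^ 2)) :=
            Continuous.tendsto (by fun_prop) 0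
          simpa using this.mono_left nhdsWithin_le_nhds
        · filter_upwards [self_mem_nhdsWithin] with u hu
          have : 0 < u := hu
          exact Set.mem_Ioi.2 (by positivity)
      have t3 := (tendsto_inv_nhdsGT_zero.comp t2).atTop_mul_const (by positivity : 0 < r ^ 2)
      have := tendsto_neg_atTop_atBot.comp t3
      refine this.congr fun u => ?_
      simp only [Function.comp]; rw [one_div]; ring
    have t4 := (Real.tendsto_exp_atBot.comp t1).const_mul (2 / r ^ 2)
    rw [mul_zero] at t4
    refine t4.congr' ?_
    filter_upwards [self_mem_nhdsWithin] with u hu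
    have : u ≠ 0 := (Set.mem_Ioi.1 hu).ne'
    simp [F, this]
  have hlim : Tendsto F atTop (𝓝 (2 / r ^ 2)) := by
    have t1 : Tendsto (fun u : ℝ => -(1 / (4 * u ^ 2)) * r ^ 2) atTop (𝓝 0) := by
      have t2 : Tendsto (fun u : ℝ => 4 * u ^ 2) atTop atTop :=
        (tendsto_pow_atTop (by norm_num)).const_mul_atTop (by norm_num)
      have := (t2.inv_tendsto_atTop.neg).mul_const (r ^ 2)
      simpa [one_div] using this
    have t4 := ((Real.continuous_exp.tendsto 0).comp t1).const_mul (2 / r ^ 2)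
    rw [Real.exp_zero, mul_one] at t4
    refine t4.congr' ?_
    filter_upwards [eventually_gt_atTop 0] with u hu
    simp [F, hu.ne']
  have hi := integrableOn_Ioi_deriv_of_nonneg hcont hd hpos hlim
  rw [← ofReal_integral_eq_lintegral_ofReal hi
    ((ae_restrict_iff' measurableSet_Ioi).2 (Eventually.of_forall hpos)),
    integral_Ioi_of_hasDerivAt_of_tendsto hcont hd hi hlim]
  simp [F]

/-- The Coulomb energy of a density in momentum space. -/
lemma lintegral_coulomb_eq {ρ : R3 → ℝ} (hc : Continuous ρ) (hρ : Integrable ρ volume)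
    (h0 : ∀ x, 0 ≤ ρ x) :
    ∫⁻ x, ∫⁻ y, ENNReal.ofReal (ρ x * ρ y / ‖x - y‖) =
      ∫⁻ k, ENNReal.ofReal (1 / (2 * Real.pi ^ 2) * (‖densityFT ρ k‖ ^ 2 / ‖k‖ ^ 2)) := by
  have hsp := Real.sqrt_pos.2 Real.pi_pos
  set c : ℝ := 2 / Real.sqrt Real.pi
  have hc0 : 0 < c := by positivity
  have hinner : ∀ x, ∫⁻ y, ENNReal.ofReal (ρ x * ρ y / ‖x - y‖) =
      ∫⁻ y, ∫⁻ u in Set.Ioi (0 : ℝ),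
        ENNReal.ofReal (c * (ρ x * ρ y * Real.exp (-u ^ 2 * ‖x - y‖ ^ 2))) := by
    intro x
    refine lintegral_congr_ae ?_
    have : ∀ᵐ y : R3, y ≠ x := by simp [ae_iff, measure_singleton]
    filter_upwards [this] with y hy
    have hr : 0 < ‖x - y‖ := norm_pos_iff.2 (sub_ne_zero.2 (Ne.symm hy))
    have hρρ : 0 ≤ ρ x * ρ y := mul_nonneg (h0 x) (h0 y)
    rw [div_eq_mul_one_div, ENNReal.ofReal_mul hρρ, ← lintegral_gauss_eq_inv hr,
      ← lintegral_const_mul' _ _ ENNReal.ofReal_ne_top]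
    refine lintegral_congr fun u => ?_
    rw [← ENNReal.ofReal_mul hρρ]
    congr 1; ring
  have hmeas : Measurable (fun q : (R3 × R3) × ℝ =>
      ENNReal.ofReal (c * (ρ q.1.1 * ρ q.1.2 * Real.exp (-q.2 ^ 2 * ‖q.1.1 - q.1.2‖ ^ 2)))) :=
    (Continuous.measurable (by fun_prop)).ennreal_ofReal
  have hprod : ∀ u : ℝ, Integrable (fun p : R3 × R3 =>
      ρ p.1 * ρ p.2 * Real.exp (-u ^ 2 * ‖p.1 - p.2‖ ^ 2)) volume := fun u => by
    refine (hρ.mul_prod hρ).mul_bdd (c := 1) (Continuous.aestronglyMeasurable (by fun_prop))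
      (Eventually.of_forall fun p => ?_)
    rw [Real.norm_eq_abs, abs_of_pos (Real.exp_pos _)]
    exact Real.exp_le_one_iff.2 (by nlinarith [sq_nonneg (u * ‖p.1 - p.2‖)])
  have hgi : ∀ u : ℝ, 0 < u → Integrable (fun k : R3 =>
      Real.exp (-(1 / (4 * u ^ 2)) * ‖k‖ ^ 2) * ‖densityFT ρ k‖ ^ 2) volume := fun u hu => by
    refine (integrable_gauss (by positivity)).mul_bdd (c := (∫ x, ‖ρ x‖) ^ 2)
      ((continuous_densityFT hρ).norm.pow 2).aestronglyMeasurable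
      (Eventually.of_forall fun k => ?_)
    rw [Real.norm_eq_abs, abs_of_nonneg (by positivity)]
    have := norm_densityFT_le (ρ := ρ) k
    gcongr
  have hmeas2 : Measurable (fun q : ℝ × R3 => ENNReal.ofReal
      (c * ((8 * Real.pi * Real.sqrt Real.pi * q.1 ^ 3)⁻¹ *
        (Real.exp (-(1 / (4 * q.1 ^ 2)) * ‖q.2‖ ^ 2) * ‖densityFT ρ q.2‖ ^ 2)))) := by
    have := (continuous_densityFT hρ).measurable
    refine Measurable.ennreal_ofReal ?_
    fun_prop
  -- All integrands are nonnegative, so every exchange is Tonelli's theorem. The constants combine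
  -- to (2/√π)·(8π√π)⁻¹·2 = 1/(2π²).
  calc ∫⁻ x, ∫⁻ y, ENNReal.ofReal (ρ x * ρ y / ‖x - y‖)
      = ∫⁻ x, ∫⁻ y, ∫⁻ u in Set.Ioi (0 : ℝ),
        ENNReal.ofReal (c * (ρ x * ρ y * Real.exp (-u ^ 2 * ‖x - y‖ ^ 2))) := by
        simp_rw [hinner]
    _ = ∫⁻ p : R3 × R3, ∫⁻ u in Set.Ioi (0 : ℝ),
        ENNReal.ofReal (c * (ρ p.1 * ρ p.2 * Real.exp (-u ^ 2 * ‖p.1 - p.2‖ ^ 2))) := by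
        rw [Measure.volume_eq_prod, lintegral_prod]
        exact (hmeas.lintegral_prod_right' (ν := volume.restrict (Set.Ioi (0 : ℝ)))).aemeasurable
    _ = ∫⁻ u in Set.Ioi (0 : ℝ), ∫⁻ p : R3 × R3,
        ENNReal.ofReal (c * (ρ p.1 * ρ p.2 * Real.exp (-u ^ 2 * ‖p.1 - p.2‖ ^ 2))) :=
        lintegral_lintegral_swap hmeas.aemeasurable
    _ = ∫⁻ u in Set.Ioi (0 : ℝ), ∫⁻ k : R3, ENNReal.ofReal
      (c * ((8 * Real.pi * Real.sqrt Real.pi * u ^ 3)⁻¹ *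
        (Real.exp (-(1 / (4 * u ^ 2)) * ‖k‖ ^ 2) * ‖densityFT ρ k‖ ^ 2))) := by
        refine setLIntegral_congr_fun measurableSet_Ioi fun u hu => ?_
        have hu' : 0 < u := hu
        rw [← ofReal_integral_eq_lintegral_ofReal ((hprod u).const_mul c)
          (Eventually.of_forall fun p => mul_nonneg hc0.le
            (mul_nonneg (mul_nonneg (h0 _) (h0 _)) (Real.exp_pos _).le)),
          ← ofReal_integral_eq_lintegral_ofReal (((hgi u hu').const_mul _).const_mul c)
          (Eventually.of_forall fun p => by positivity), integral_const_mul, integral_const_mul,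
          integral_const_mul, integral_gauss_densityFT hρ hu']
        congr 2
        field_simp
    _ = ∫⁻ k : R3, ∫⁻ u in Set.Ioi (0 : ℝ), ENNReal.ofReal
      (c * ((8 * Real.pi * Real.sqrt Real.pi * u ^ 3)⁻¹ *
        (Real.exp (-(1 / (4 * u ^ 2)) * ‖k‖ ^ 2) * ‖densityFT ρ k‖ ^ 2))) :=
        lintegral_lintegral_swap hmeas2.aemeasurable
    _ = _ := by
        refine lintegral_congr_ae ?_
        have : ∀ᵐ k : R3, k ≠ 0 := by simp [ae_iff, measure_singleton]
        filter_upwards [this] with k hk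
        have hr : 0 < ‖k‖ := norm_pos_iff.2 hk
        have hK : 0 ≤ c * (8 * Real.pi * Real.sqrt Real.pi)⁻¹ * ‖densityFT ρ k‖ ^ 2 := by positivity
        have e : ∀ u : ℝ, ENNReal.ofReal
          (c * ((8 * Real.pi * Real.sqrt Real.pi * u ^ 3)⁻¹ *
          (Real.exp (-(1 / (4 * u ^ 2)) * ‖k‖ ^ 2) * ‖densityFT ρ k‖ ^ 2))) =
          ENNReal.ofReal (c * (8 * Real.pi * Real.sqrt Real.pi)⁻¹ * ‖densityFT ρ k‖ ^ 2) *
          ENNReal.ofReal ((u ^ 3)⁻¹ * Real.exp (-(1 / (4 * u ^ 2)) * ‖k‖ ^ 2)) := fun u => by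
          rw [← ENNReal.ofReal_mul hK, mul_inv]; congr 1; ring
        simp_rw [e]
        rw [lintegral_const_mul' _ _ ENNReal.ofReal_ne_top, lintegral_inv_cube_gauss hr,
          ← ENNReal.ofReal_mul hK]
        congr 1
        simp only [c]
        have hs2 : Real.sqrt Real.pi ^ 2 = Real.pi := Real.sq_sqrt Real.pi_pos.le
        field_simp
        rw [hs2]; ring

/-- The electron density. -/
def density (f : R3 → ℂ) (x : R3) : ℝ := ‖f x‖ ^ 2

/-- Integrability in momentum space is inferred from the finite Coulomb energy in position space
through the identity of extended integrals. -/
lemma IsTest.integrable_densityFT {f : R3 → ℂ} (hf : IsTest f) :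
    Integrable (fun k => ‖densityFT (density f) k‖ ^ 2 / ‖k‖ ^ 2) volume ∧
      coulomb f = 1 / (2 * Real.pi ^ 2) * ∫ k, ‖densityFT (density f) k‖ ^ 2 / ‖k‖ ^ 2 := by
  have hint : Integrable (density f) volume := integrable_norm_sq (hf.memLp 2)
  have h := lintegral_coulomb_eq (ρ := density f) (hf.continuous.norm.pow 2) hint
    fun x => by simp only [density]; positivity
  have h1 : ∫⁻ x, ∫⁻ y, ENNReal.ofReal (density f x * density f y / ‖x - y‖) = coulombE f := rfl
  rw [h1, ← hf.ofReal_coulomb] at h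
  have hm : Measurable (fun k => 1 / (2 * Real.pi ^ 2) * (‖densityFT (density f) k‖ ^ 2 / ‖k‖ ^ 2)) := by
    have := (continuous_densityFT hint).measurable
    fun_prop
  have hnn : ∀ k, 0 ≤ 1 / (2 * Real.pi ^ 2) * (‖densityFT (density f) k‖ ^ 2 / ‖k‖ ^ 2) :=
    fun k => by positivity
  have hi : Integrable (fun k => 1 / (2 * Real.pi ^ 2) *
      (‖densityFT (density f) k‖ ^ 2 / ‖k‖ ^ 2)) volume := by
    refine ⟨hm.aestronglyMeasurable, ?_⟩
    rw [hasFiniteIntegral_iff_ofReal (Eventually.of_forall hnn), ← h]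
    exact ENNReal.ofReal_lt_top
  refine ⟨?_, ?_⟩
  · refine (hi.const_mul (2 * Real.pi ^ 2)).congr (Eventually.of_forall fun k => ?_)
    have := Real.pi_pos
    simp only
    field_simp
  · rw [← ofReal_integral_eq_lintegral_ofReal hi (Eventually.of_forall hnn)] at h
    rw [← integral_const_mul]
    exact (ENNReal.ofReal_eq_ofReal_iff (coulomb_nonneg f) (integral_nonneg hnn)).1 h

/-! ### Gaussian means of polynomials in a complex variable -/

/-- Polar coordinates, with the squared radius as radial variable. -/
def polarPt (p : ℝ × ℝ) : ℂ := (Real.sqrt p.1 : ℂ) * Complex.exp (p.2 * Complex.I)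

/-- The domain of `polarPt`. -/
def polarMeasure : Measure (ℝ × ℝ) :=
  (volume.restrict (Set.Ioi (0 : ℝ))).prod (volume.restrict (Set.Ioc (0 : ℝ) (2 * Real.pi)))

/-- The Gaussian weight in polar coordinates. -/
def gaussWeight (p : ℝ × ℝ) : ℝ := Real.exp (-p.1) * (2 * Real.pi)⁻¹

/-- `c` is the mean of `F` with respect to the standard complex Gaussian measure. -/
def HasMean (F : ℂ → ℂ) (c : ℂ) : Prop :=
  Integrable (fun p => (gaussWeight p : ℂ) * F (polarPt p)) polarMeasure ∧
    ∫ p, (gaussWeight p : ℂ) * F (polarPt p) ∂polarMeasure = c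

lemma HasMean.add {F G : ℂ → ℂ} {c d : ℂ} (h : HasMean F c) (h' : HasMean G d) :
    HasMean (fun z => F z + G z) (c + d) := by
  simp_rw [HasMean, mul_add]
  exact ⟨h.1.add h'.1, by rw [integral_add h.1 h'.1, h.2, h'.2]⟩

lemma HasMean.const_mul {F : ℂ → ℂ} {c : ℂ} (a : ℂ) (h : HasMean F c) :
    HasMean (fun z => a * F z) (a * c) := by
  have e : (fun p => (gaussWeight p : ℂ) * (a * F (polarPt p))) =
      fun p => a * ((gaussWeight p : ℂ) * F (polarPt p)) := by ext p; ring
  simp only [HasMean, e]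
  exact ⟨h.1.const_mul a, by rw [integral_const_mul, h.2]⟩

lemma hasMean_zero : HasMean (fun _ => 0) 0 := by simp [HasMean]

lemma HasMean.sum {ι : Type*} (s : Finset ι) {F : ι → ℂ → ℂ} {c : ι → ℂ}
    (h : ∀ i ∈ s, HasMean (F i) (c i)) : HasMean (fun z => ∑ i ∈ s, F i z) (∑ i ∈ s, c i) := by
  classical
  induction s using Finset.induction_on with
  | empty => simpa using hasMean_zero
  | insert a s ha ih =>
    simp_rw [Finset.sum_insert ha]
    exact (h a (by simp)).add (ih fun i hi => h i (by simp [hi]))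

lemma HasMean.re_nonneg {F : ℂ → ℂ} {c : ℂ} (h : HasMean F c) (h0 : ∀ z, 0 ≤ (F z).re) :
    0 ≤ c.re := by
  rw [← h.2]
  have e : (∫ p, (gaussWeight p : ℂ) * F (polarPt p) ∂polarMeasure).re =
      ∫ p, ((gaussWeight p : ℂ) * F (polarPt p)).re ∂polarMeasure :=
    (integral_re (𝕜 := ℂ) h.1).symm
  rw [e]
  refine integral_nonneg fun p => ?_
  simp only [Complex.re_ofReal_mul, Pi.zero_apply]
  exact mul_nonneg (by unfold gaussWeight; positivity) (h0 _)

lemma integral_angle (m n : ℕ) : ∫ θ in Set.Ioc (0 : ℝ) (2 * Real.pi),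
    Complex.exp (θ * Complex.I) ^ m * (starRingEnd ℂ) (Complex.exp (θ * Complex.I)) ^ n =
      if m = n then 2 * Real.pi else 0 := by
  have e : ∀ θ : ℝ, Complex.exp (θ * Complex.I) ^ m *
      (starRingEnd ℂ) (Complex.exp (θ * Complex.I)) ^ n =
      Complex.exp ((((m : ℤ) - (n : ℤ) : ℤ) : ℂ) * Complex.I * θ) := fun θ => by
    rw [← Complex.exp_conj, map_mul, Complex.conj_I, Complex.conj_ofReal, ← Complex.exp_nat_mul,
      ← Complex.exp_nat_mul, ← Complex.exp_add]
    congr 1; push_cast; ring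
  simp_rw [e]
  split_ifs with h
  · subst h
    simp [Real.pi_pos.le]
  · rw [← intervalIntegral.integral_of_le (by positivity)]
    have hne : (((m : ℤ) - (n : ℤ) : ℤ) : ℂ) * Complex.I ≠ 0 := by
      refine mul_ne_zero ?_ Complex.I_ne_zero
      exact Int.cast_ne_zero.2 (sub_ne_zero.2 (by exact_mod_cast h))
    rw [integral_exp_mul_complex hne]
    have : Complex.exp ((((m : ℤ) - (n : ℤ) : ℤ) : ℂ) * Complex.I * ((2 * Real.pi : ℝ) : ℂ)) = 1 := by
      rw [← Complex.exp_int_mul_two_pi_mul_I ((m : ℤ) - (n : ℤ))]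
      congr 1; push_cast; ring
    rw [this]; simp

/-- Moments of the complex Gaussian measure. -/
lemma hasMean_monomial (m n : ℕ) : HasMean (fun z => z ^ m * (starRingEnd ℂ) z ^ n)
    (if m = n then (m.factorial : ℂ) else 0) := by
  -- In the variable t = |z|² the measure is e^(-t) dt dθ/(2π). The angular average of exp(i(m -
  -- n)θ) selects m = n, and the radial integral is then Γ(m + 1).
  have hrad : IntegrableOn (fun t : ℝ => Real.exp (-t) * Real.sqrt t ^ (m + n)) (Set.Ioi 0) := by
    have h := Real.GammaIntegral_convergent (s := ((m + n : ℕ) : ℝ) / 2 + 1) (by positivity)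
    refine h.congr_fun (fun t ht => ?_) measurableSet_Ioi
    have ht' : (0 : ℝ) ≤ t := (Set.mem_Ioi.1 ht).le
    simp only [add_sub_cancel_right]
    rw [Real.sqrt_eq_rpow, ← Real.rpow_natCast, ← Real.rpow_mul ht']
    congr 2; ring
  have hang : IntegrableOn (fun θ : ℝ => Complex.exp (θ * Complex.I) ^ m *
      (starRingEnd ℂ) (Complex.exp (θ * Complex.I)) ^ n) (Set.Ioc 0 (2 * Real.pi)) := by
    refine Continuous.integrableOn_Ioc ?_
    fun_prop
  have e : (fun p : ℝ × ℝ => (gaussWeight p : ℂ) *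
      (polarPt p ^ m * (starRingEnd ℂ) (polarPt p) ^ n)) = fun p =>
      ((Real.exp (-p.1) * Real.sqrt p.1 ^ (m + n) : ℝ) : ℂ) *
      (((2 * Real.pi)⁻¹ : ℝ) * (Complex.exp (p.2 * Complex.I) ^ m *
        (starRingEnd ℂ) (Complex.exp (p.2 * Complex.I)) ^ n)) := by
    ext p
    simp only [gaussWeight, polarPt, map_mul, Complex.conj_ofReal, mul_pow]
    push_cast; ring
  simp only [HasMean, e]
  refine ⟨(hrad.ofReal (𝕜 := ℂ)).mul_prod (hang.const_mul _), ?_⟩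
  rw [polarMeasure, integral_prod_mul (μ := volume.restrict (Set.Ioi (0 : ℝ)))
    (ν := volume.restrict (Set.Ioc (0 : ℝ) (2 * Real.pi)))
    (fun t : ℝ => ((Real.exp (-t) * Real.sqrt t ^ (m + n) : ℝ) : ℂ))
    (fun θ : ℝ => (((2 * Real.pi)⁻¹ : ℝ) : ℂ) * (Complex.exp (θ * Complex.I) ^ m *
        (starRingEnd ℂ) (Complex.exp (θ * Complex.I)) ^ n)), integral_const_mul, integral_angle,
    integral_complex_ofReal]
  split_ifs with h
  · subst h
    have h1 : ∫ t in Set.Ioi (0 : ℝ), Real.exp (-t) * Real.sqrt t ^ (m + m) = m.factorial := by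
      rw [← Real.Gamma_nat_eq_factorial, Real.Gamma_eq_integral (by positivity)]
      refine setIntegral_congr_fun measurableSet_Ioi fun t ht => ?_
      have ht' : (0 : ℝ) ≤ t := (Set.mem_Ioi.1 ht).le
      simp only [add_sub_cancel_right]
      rw [← two_mul, pow_mul, Real.sq_sqrt ht', Real.rpow_natCast]
    rw [h1]
    have := Real.pi_pos.ne'
    push_cast
    field_simp
  · simp

/-! ### Coherent states for a canonical pair -/

section CCR

variable {W : Type*} [AddCommGroup W] [Module ℂ W] (B : W →ₗ⋆[ℂ] W →ₗ[ℂ] ℂ)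

/-- The projection onto the kernel of `b`, on vectors killed by `b ^ N`. -/
def vacProj (b c : Module.End ℂ W) (N : ℕ) : Module.End ℂ W :=
  ∑ k ∈ Finset.range N, ((-1 : ℂ) ^ k / (k.factorial : ℂ)) • (c ^ k * b ^ k)

/-- The component of a vector along a coherent state. -/
def cohTr (b c : Module.End ℂ W) (N : ℕ) (z : ℂ) : Module.End ℂ W :=
  ∑ m ∈ Finset.range N, ((starRingEnd ℂ) z ^ m / (m.factorial : ℂ)) • (vacProj b c N * b ^ m)

variable {B} {b c : Module.End ℂ W}

lemma mul_pow_of_ccr (hbc : b * c = c * b + 1) (k : ℕ) :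
    b * c ^ (k + 1) = c ^ (k + 1) * b + ((k + 1 : ℕ) : ℂ) • c ^ k := by
  induction k with
  | zero => simp [hbc]
  | succ k ih =>
    rw [pow_succ c (k + 1), ← mul_assoc, ih, add_mul, mul_assoc, hbc, mul_add, mul_one, smul_mul_assoc,
      ← pow_succ, ← mul_assoc, add_assoc]
    congr 1
    push_cast
    module

/-- The sum telescopes: by [b, c^k] = k c^(k-1), applying b to the partial sum leaves a multiple of
c^n b^(n+1), which kills v. -/
lemma apply_vacProj (hbc : b * c = c * b + 1) {N : ℕ} {v : W} (hv : (b ^ N) v = 0) :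
    b (vacProj b c N v) = 0 := by
  have key : ∀ n, b * vacProj b c (n + 1) =
      ((-1 : ℂ) ^ n / (n.factorial : ℂ)) • (c ^ n * b ^ (n + 1)) := by
    intro n
    induction n with
    | zero => simp [vacProj]
    | succ n ih =>
      rw [vacProj, Finset.sum_range_succ, mul_add]
      have : (∑ k ∈ Finset.range (n + 1), ((-1 : ℂ) ^ k / (k.factorial : ℂ)) • (c ^ k * b ^ k)) =
        vacProj b c (n + 1) := rfl
      rw [this, ih, mul_smul_comm, ← mul_assoc, mul_pow_of_ccr hbc, add_mul, mul_assoc,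
        ← pow_succ' b, smul_mul_assoc, smul_add, smul_smul]
      have h2 : (-1 : ℂ) ^ (n + 1) / ((n + 1).factorial : ℂ) * ((n + 1 : ℕ) : ℂ) =
          - ((-1 : ℂ) ^ n / (n.factorial : ℂ)) := by
        rw [Nat.factorial_succ]
        have : ((n : ℂ) + 1) ≠ 0 := by exact_mod_cast Nat.succ_ne_zero n
        have : (n.factorial : ℂ) ≠ 0 := by exact_mod_cast n.factorial_ne_zero
        push_cast
        field_simp
        ring
      rw [h2]
      module
  cases N with
  | zero => simp [vacProj]
  | succ n =>
    have := LinearMap.congr_fun (key n) v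
    simp only [Module.End.mul_apply, LinearMap.smul_apply] at this
    rw [this, hv]; simp

lemma pow_apply_eq_zero {N n : ℕ} (h : N ≤ n) {v : W} (hv : (b ^ N) v = 0) : (b ^ n) v = 0 := by
  obtain ⟨k, rfl⟩ := Nat.exists_eq_add_of_le' h
  rw [pow_add, Module.End.mul_apply, hv, map_zero]

lemma adj_pow (hadj : ∀ v w, B (c v) w = B v (b w)) (k : ℕ) (v w : W) :
    B ((c ^ k) v) w = B v ((b ^ k) w) := by
  induction k generalizing w with
  | zero => simp
  | succ k ih => rw [pow_succ', Module.End.mul_apply, hadj, ih, pow_succ, Module.End.mul_apply]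

lemma adj_symm (herm : ∀ v w, B v w = (starRingEnd ℂ) (B w v))
    (hadj : ∀ v w, B (c v) w = B v (b w)) (v w : W) : B (b v) w = B v (c w) := by
  rw [herm, ← hadj, ← herm]

/-- Moving c^k to the other side gives b^k w, which vanishes for k ≥ 1; only the identity term
survives. -/
lemma B_vacProj_left (hadj : ∀ v w, B (c v) w = B v (b w)) {N : ℕ} (u : W) {w : W}
    (hw : b w = 0) : B (vacProj b c (N + 1) u) w = B u w := by
  simp only [vacProj, LinearMap.sum_apply, LinearMap.smul_apply, map_sum, Module.End.mul_apply,
    LinearMap.map_smulₛₗ]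
  rw [Finset.sum_range_succ']
  have h1 : ∀ k, B ((c ^ (k + 1)) ((b ^ (k + 1)) u)) w = 0 := fun k => by
    have h2 : (b ^ (k + 1)) w = 0 := by rw [pow_succ, Module.End.mul_apply, hw, map_zero]
    rw [adj_pow hadj, h2, map_zero]
  simp [h1]

/-- The vacuum components determine the inner product. -/
lemma sum_vacProj_eq (herm : ∀ v w, B v w = (starRingEnd ℂ) (B w v))
    (hadj : ∀ v w, B (c v) w = B v (b w)) (hbc : b * c = c * b + 1) {N : ℕ} (e : W) {f : W}
    (hf : (b ^ (N + 1)) f = 0) :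
    ∑ m ∈ Finset.range (N + 1), ((m.factorial : ℂ))⁻¹ *
      B (vacProj b c (N + 1) ((b ^ m) e)) (vacProj b c (N + 1) ((b ^ m) f)) = B e f := by
  have hnil : ∀ m, (b ^ (N + 1)) ((b ^ m) f) = 0 := fun m => by
    rw [← Module.End.mul_apply, ← pow_add]
    exact pow_apply_eq_zero (Nat.le_add_right _ _) hf
  have h1 : ∀ m, B (vacProj b c (N + 1) ((b ^ m) e)) (vacProj b c (N + 1) ((b ^ m) f)) =
      B e ((c ^ m) (vacProj b c (N + 1) ((b ^ m) f))) := fun m => by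
    rw [B_vacProj_left hadj _ (apply_vacProj hbc (hnil m)), herm, ← adj_pow hadj, ← herm]
  simp_rw [h1]
  set S : ℕ → W := fun n => ((n.factorial : ℂ))⁻¹ • (c ^ n) ((b ^ n) f)
  have hS : ∀ n, N + 1 ≤ n → S n = 0 := fun n hn => by
    simp only [S]; rw [pow_apply_eq_zero hn hf]; simp
  -- The coefficient 1/(m! k!) is written as a binomial coefficient over (m + k)!, to prepare for
  -- summation along m + k.
  have h2 : ∀ m, ((m.factorial : ℂ))⁻¹ • (c ^ m) (vacProj b c (N + 1) ((b ^ m) f)) =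
      ∑ k ∈ Finset.range (N + 1), ((-1 : ℂ) ^ k * ((m + k).choose k : ℂ)) • S (m + k) := fun m => by
    simp only [vacProj, LinearMap.sum_apply, map_sum, Finset.smul_sum]
    refine Finset.sum_congr rfl fun k _ => ?_
    simp only [LinearMap.smul_apply, map_smul, Module.End.mul_apply, S, smul_smul]
    rw [← Module.End.mul_apply (c ^ m), ← pow_add, ← Module.End.mul_apply (b ^ k), ← pow_add,
      add_comm k m]
    congr 1
    have hch : (((m + k).choose k : ℕ) : ℂ) * (k.factorial : ℂ) * (m.factorial : ℂ) =
        ((m + k).factorial : ℂ) := by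
      have := Nat.add_choose_mul_factorial_mul_factorial m k
      rw [← this]; push_cast; ring
    have : (k.factorial : ℂ) ≠ 0 := by exact_mod_cast k.factorial_ne_zero
    have : (m.factorial : ℂ) ≠ 0 := by exact_mod_cast m.factorial_ne_zero
    have : ((m + k).factorial : ℂ) ≠ 0 := by exact_mod_cast (m + k).factorial_ne_zero
    field_simp
    rw [← hch]; ring
  -- Terms with m + k > N vanish since b^(m+k) f = 0. For each remaining n = m + k > 0 the
  -- alternating sum of binomial coefficients is 0, which leaves f.
  have h3 : ∑ m ∈ Finset.range (N + 1),
      ((m.factorial : ℂ))⁻¹ • (c ^ m) (vacProj b c (N + 1) ((b ^ m) f)) = f := by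
    simp_rw [h2]
    have h4 : ∑ m ∈ Finset.range (N + 1), ∑ k ∈ Finset.range (N + 1),
        ((-1 : ℂ) ^ k * ((m + k).choose k : ℂ)) • S (m + k) =
        ∑ n ∈ Finset.range (N + 1), ∑ k ∈ Finset.range (n + 1),
          ((-1 : ℂ) ^ k * (n.choose k : ℂ)) • S n := by
      rw [← Finset.sum_product', Finset.sum_sigma']
      rw [← Finset.sum_filter_of_ne (s := Finset.range (N + 1) ×ˢ Finset.range (N + 1))
        (p := fun p => p.1 + p.2 < N + 1)]
      · refine Finset.sum_bij' (fun p _ => (⟨p.1 + p.2, p.2⟩ : (_ : ℕ) × ℕ))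
          (fun q _ => (q.1 - q.2, q.2)) ?_ ?_ ?_ ?_ ?_
        · intro p hp; simp at hp ⊢; omega
        · intro q hq; simp at hq ⊢; omega
        · intro p hp; simp
        · intro q hq; simp at hq ⊢
          ext <;> simp; omega
        · intro p hp; rfl
      · intro p _ hne
        by_contra hlt
        exact hne (by rw [hS _ (not_lt.1 hlt), smul_zero])
    rw [h4, Finset.sum_eq_single 0]
    · simp [S]
    · intro n _ hn
      rw [← Finset.sum_smul]
      have := Int.alternating_sum_range_choose (n := n)
      rw [if_neg hn] at this
      have h5 : ∑ k ∈ Finset.range (n + 1), ((-1 : ℂ) ^ k * (n.choose k : ℂ)) = 0 := by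
        exact_mod_cast this
      rw [h5, zero_smul]
    · simp
  conv_rhs => rw [← h3]
  rw [map_sum]
  exact Finset.sum_congr rfl fun m _ => by rw [map_smul, smul_eq_mul]

lemma B_cohTr (N : ℕ) (z : ℂ) (e f : W) :
    B (cohTr b c N z e) (cohTr b c N z f) = ∑ m ∈ Finset.range N, ∑ n ∈ Finset.range N,
      ((m.factorial : ℂ))⁻¹ * ((n.factorial : ℂ))⁻¹ *
      B (vacProj b c N ((b ^ m) e)) (vacProj b c N ((b ^ n) f)) *
      (z ^ m * (starRingEnd ℂ) z ^ n) := by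
  simp only [cohTr, LinearMap.sum_apply, map_sum, LinearMap.smul_apply, Module.End.mul_apply,
    LinearMap.map_smulₛₗ, map_smul, smul_eq_mul, Finset.mul_sum]
  rw [Finset.sum_comm]
  refine Finset.sum_congr rfl fun m _ => Finset.sum_congr rfl fun n _ => ?_
  simp only [map_div₀, map_pow, Complex.conj_conj, map_natCast]
  ring

lemma hasMean_cohTr (p q N : ℕ) (e f : W) :
    HasMean (fun z => z ^ p * (starRingEnd ℂ) z ^ q * B (cohTr b c N z e) (cohTr b c N z f))
      (∑ m ∈ Finset.range N, ∑ n ∈ Finset.range N,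
      ((m.factorial : ℂ))⁻¹ * ((n.factorial : ℂ))⁻¹ *
      B (vacProj b c N ((b ^ m) e)) (vacProj b c N ((b ^ n) f)) *
      if m + p = n + q then ((m + p).factorial : ℂ) else 0) := by
  simp_rw [B_cohTr, Finset.mul_sum]
  refine HasMean.sum _ fun m _ => HasMean.sum _ fun n _ => ?_
  have := (hasMean_monomial (m + p) (n + q)).const_mul (((m.factorial : ℂ))⁻¹ *
    ((n.factorial : ℂ))⁻¹ * B (vacProj b c N ((b ^ m) e)) (vacProj b c N ((b ^ n) f)))
  convert this using 2 with z
  ring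

/-- The coherent states resolve the identity: orthogonality of monomials under the Gaussian keeps
the terms with equal powers, and these add up by `sum_vacProj_eq`. -/
lemma hasMean_B (herm : ∀ v w, B v w = (starRingEnd ℂ) (B w v))
    (hadj : ∀ v w, B (c v) w = B v (b w)) (hbc : b * c = c * b + 1) {N : ℕ} (e : W) {f : W}
    (hf : (b ^ (N + 1)) f = 0) :
    HasMean (fun z => B (cohTr b c (N + 1) z e) (cohTr b c (N + 1) z f)) (B e f) := by
  have h := hasMean_cohTr (B := B) (b := b) (c := c) 0 0 (N + 1) e f
  simp only [pow_zero, one_mul, add_zero] at h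
  convert h using 1
  rw [← sum_vacProj_eq herm hadj hbc e hf]
  refine Finset.sum_congr rfl fun m hm => ?_
  rw [Finset.sum_eq_single_of_mem m hm fun n _ hn => by rw [if_neg hn.symm, mul_zero], if_pos rfl]
  have : (m.factorial : ℂ) ≠ 0 := by exact_mod_cast m.factorial_ne_zero
  field_simp

/-- Multiplication by z represents the annihilation operator, since the extra power of z pairs the
m-th component of e with the (m + 1)-st component of f. -/
lemma hasMean_z_B (herm : ∀ v w, B v w = (starRingEnd ℂ) (B w v))
    (hadj : ∀ v w, B (c v) w = B v (b w)) (hbc : b * c = c * b + 1) {N : ℕ} (e : W) {f : W}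
    (hf : (b ^ (N + 1)) f = 0) :
    HasMean (fun z => z * B (cohTr b c (N + 1) z e) (cohTr b c (N + 1) z f)) (B e (b f)) := by
  have h := hasMean_cohTr (B := B) (b := b) (c := c) 1 0 (N + 1) e f
  simp only [pow_zero, pow_one, mul_one, add_zero] at h
  convert h using 1
  have hbf : (b ^ (N + 1)) (b f) = 0 := by
    rw [← Module.End.mul_apply, ← pow_succ]
    exact pow_apply_eq_zero (Nat.le_succ _) hf
  rw [← sum_vacProj_eq herm hadj hbc e hbf]
  refine Finset.sum_congr rfl fun m hm => ?_
  rw [← Module.End.mul_apply (b ^ m), ← pow_succ]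
  by_cases hm' : m + 1 < N + 1
  · rw [Finset.sum_eq_single_of_mem (m + 1) (Finset.mem_range.2 hm')
      fun n _ hn => by rw [if_neg hn.symm, mul_zero], if_pos rfl]
    have : ((m + 1).factorial : ℂ) ≠ 0 := by exact_mod_cast (m + 1).factorial_ne_zero
    field_simp
  · rw [pow_apply_eq_zero (not_lt.1 hm') hf, map_zero, map_zero, mul_zero]
    symm
    refine Finset.sum_eq_zero fun n hn => ?_
    rw [if_neg (by have := Finset.mem_range.1 hn; omega), mul_zero]

/-- |z|² represents bb* = b*b + 1, and the additional B e f is the energy lost per mode. In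
coefficients, (m+1)!/(m!)² = 1/m! + m/m!, where the second summand shifts the index and gives B (b
e) (b f). -/
lemma hasMean_normSq_B (herm : ∀ v w, B v w = (starRingEnd ℂ) (B w v))
    (hadj : ∀ v w, B (c v) w = B v (b w)) (hbc : b * c = c * b + 1) {N : ℕ} (e : W) {f : W}
    (hf : (b ^ (N + 1)) f = 0) :
    HasMean (fun z => ((‖z‖ ^ 2 : ℝ) : ℂ) * B (cohTr b c (N + 1) z e) (cohTr b c (N + 1) z f))
      (B e f + B (b e) (b f)) := by
  have h := hasMean_cohTr (B := B) (b := b) (c := c) 1 1 (N + 1) e f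
  have e1 : ∀ z : ℂ, z ^ 1 * (starRingEnd ℂ) z ^ 1 = ((‖z‖ ^ 2 : ℝ) : ℂ) := fun z => by
    rw [pow_one, pow_one, Complex.mul_conj, Complex.normSq_eq_norm_sq]
  simp_rw [e1] at h
  convert h using 1
  have hbf : (b ^ (N + 1)) (b f) = 0 := by
    rw [← Module.End.mul_apply, ← pow_succ]
    exact pow_apply_eq_zero (Nat.le_succ _) hf
  set T : ℕ → ℂ := fun m => B (vacProj b c (N + 1) ((b ^ m) e)) (vacProj b c (N + 1) ((b ^ m) f))
  have s1 : ∑ m ∈ Finset.range (N + 1), ((m.factorial : ℂ))⁻¹ * T m = B e f :=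
    sum_vacProj_eq herm hadj hbc e hf
  have s2 : ∑ m ∈ Finset.range (N + 1), ((m.factorial : ℂ))⁻¹ * T (m + 1) = B (b e) (b f) := by
    rw [← sum_vacProj_eq herm hadj hbc (b e) hbf]
    refine Finset.sum_congr rfl fun m _ => ?_
    simp only [T]
    rw [← Module.End.mul_apply (b ^ m), ← Module.End.mul_apply (b ^ m), ← pow_succ]
  have s3 : ∑ m ∈ Finset.range (N + 1), ((m.factorial : ℂ))⁻¹ * T (m + 1) =
      ∑ m ∈ Finset.range (N + 1), (m : ℂ) * (((m.factorial : ℂ))⁻¹ * T m) := by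
    have hlast : T (N + 1) = 0 := by simp only [T]; rw [hf]; simp
    rw [Finset.sum_range_succ, hlast, mul_zero, add_zero, Finset.sum_range_succ' _ N]
    simp only [Nat.cast_zero, zero_mul, add_zero]
    refine Finset.sum_congr rfl fun m _ => ?_
    rw [Nat.factorial_succ]
    have : ((m : ℂ) + 1) ≠ 0 := by exact_mod_cast Nat.succ_ne_zero m
    have : (m.factorial : ℂ) ≠ 0 := by exact_mod_cast m.factorial_ne_zero
    push_cast
    field_simp
  rw [← s1, ← s2, s3, ← Finset.sum_add_distrib]
  refine Finset.sum_congr rfl fun m hm => ?_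
  rw [Finset.sum_eq_single_of_mem m hm fun n _ hn => by
    rw [if_neg (fun h => hn (by omega)), mul_zero], if_pos rfl, Nat.factorial_succ]
  have : (m.factorial : ℂ) ≠ 0 := by exact_mod_cast m.factorial_ne_zero
  simp only [T]
  push_cast
  field_simp
  ring

lemma cohTr_comm {a : Module.End ℂ W} (hab : Commute a b) (hac : Commute a c) (N : ℕ) (z : ℂ)
    (v : W) : a (cohTr b c N z v) = cohTr b c N z (a v) := by
  have h1 : Commute a (vacProj b c N) := Commute.sum_right _ _ _ fun k _ =>
    ((hac.pow_right k).mul_right (hab.pow_right k)).smul_right _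
  have h2 : Commute a (cohTr b c N z) := Commute.sum_right _ _ _ fun k _ =>
    (h1.mul_right (hab.pow_right k)).smul_right _
  exact LinearMap.congr_fun h2 v

end CCR

/-! ### Coherent state lower bound for finitely many modes -/

section Modes

variable {W : Type*} [AddCommGroup W] [Module ℂ W] {B : W →ₗ⋆[ℂ] W →ₗ[ℂ] ℂ}
variable {J : Type*} [Fintype J]

/-- The bilinear pairing of matrices. -/
def mpair (M G : J → J → ℂ) : ℂ := ∑ i, ∑ j, M i j * G i j

/-- The rank one matrix of a vector. -/
def rankOne (u : J → ℂ) : J → J → ℂ := fun i j => (starRingEnd ℂ) (u i) * u j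

lemma re_two_mul' (z : ℂ) : (2 * z).re = 2 * z.re := by simp

lemma mpair_add_left (M M' G : J → J → ℂ) :
    mpair (fun i j => M i j + M' i j) G = mpair M G + mpair M' G := by
  simp [mpair, add_mul, Finset.sum_add_distrib]

lemma mpair_smul_left (a : ℂ) (M G : J → J → ℂ) :
    mpair (fun i j => a * M i j) G = a * mpair M G := by
  simp [mpair, mul_assoc, Finset.mul_sum]

open scoped MatrixOrder ComplexOrder Matrix.Norms.L2Operator in
-- Gram matrices are positive semidefinite, and such matrices have the form C*C.
lemma exists_gram_factor (herm : ∀ v w, B v w = (starRingEnd ℂ) (B w v))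
    (hpos : ∀ v, 0 ≤ (B v v).re) (e : J → W) :
    ∃ C : J → J → ℂ, ∀ i j, B (e i) (e j) = ∑ k, (starRingEnd ℂ) (C k i) * C k j := by
  classical
  set G : Matrix J J ℂ := Matrix.of fun i j => B (e i) (e j) with hG
  have hps : G.PosSemidef := by
    refine Matrix.PosSemidef.of_dotProduct_mulVec_nonneg ?_ fun x => ?_
    · ext i j
      simp only [Matrix.conjTranspose_apply, hG, Matrix.of_apply]
      exact (herm _ _).symm
    · have h1 : star x ⬝ᵥ (G.mulVec x) = B (∑ i, x i • e i) (∑ j, x j • e j) := by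
        simp only [dotProduct, Matrix.mulVec, hG, Matrix.of_apply, map_sum, LinearMap.map_smulₛₗ,
          LinearMap.sum_apply, LinearMap.smul_apply, smul_eq_mul, Pi.star_apply, Finset.mul_sum]
        rw [Finset.sum_comm]
        refine Finset.sum_congr rfl fun j _ => Finset.sum_congr rfl fun i _ => ?_
        simp only [RCLike.star_def, RingHom.id_apply]
        ring
      rw [h1, Complex.nonneg_iff]
      refine ⟨hpos _, ?_⟩
      have := herm (∑ i, x i • e i) (∑ j, x j • e j)
      exact (Complex.conj_eq_iff_im.1 this.symm).symm
  obtain ⟨C, hC⟩ := CStarAlgebra.nonneg_iff_eq_star_mul_self.mp hps.nonneg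
  refine ⟨C, fun i j => ?_⟩
  have := congrFun (congrFun hC i) j
  simpa [hG, Matrix.mul_apply, Matrix.star_apply] using this

/-- The factorization writes a Gram matrix as a sum of rank one matrices, and the pairing is linear.
So it is enough to know the inequality for one electron function ∑ u_j f_j at a time. -/
lemma re_mpair_gram_le (herm : ∀ v w, B v w = (starRingEnd ℂ) (B w v))
    (hpos : ∀ v, 0 ≤ (B v v).re) {lam : ℝ} {g h : J → J → ℂ}
    (hyp : ∀ u, lam * (mpair g (rankOne u)).re ≤ (mpair h (rankOne u)).re) (e : J → W) :
    lam * (mpair g fun i j => B (e i) (e j)).re ≤ (mpair h fun i j => B (e i) (e j)).re := by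
  obtain ⟨C, hC⟩ := exists_gram_factor herm hpos e
  have key : ∀ M : J → J → ℂ, (mpair M fun i j => B (e i) (e j)) = ∑ k, mpair M (rankOne (C k)) := by
    intro M
    simp only [mpair, hC, rankOne, Finset.mul_sum]
    calc _ = ∑ i, ∑ k, ∑ j, M i j * ((starRingEnd ℂ) (C k i) * C k j) :=
          Finset.sum_congr rfl fun i _ => Finset.sum_comm
      _ = _ := Finset.sum_comm
  rw [key, key, Complex.re_sum, Complex.re_sum, Finset.mul_sum]
  exact Finset.sum_le_sum fun k _ => hyp _

lemma hasMean_mpair {F : J → J → ℂ → ℂ} {G : J → J → ℂ} (h : ∀ i j, HasMean (F i j) (G i j))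
    (M : J → J → ℂ) : HasMean (fun z => mpair M fun i j => F i j z) (mpair M G) :=
  HasMean.sum _ fun i _ => HasMean.sum _ fun j _ => (h i j).const_mul _

/-- Replacing finitely many modes by complex numbers lowers the energy by at most their number. -/
theorem modes_lower_bound {ι : Type*} (herm : ∀ v w, B v w = (starRingEnd ℂ) (B w v))
    (hpos : ∀ v, 0 ≤ (B v v).re) {b c : ι → Module.End ℂ W}
    (hadj : ∀ s v w, B (c s v) w = B v (b s w)) (hccr : ∀ s, b s * c s = c s * b s + 1)
    (hbb : ∀ s t, s ≠ t → Commute (b s) (b t)) (hbc : ∀ s t, s ≠ t → Commute (b s) (c t))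
    (hnil : ∀ s v, ∃ N, (b s ^ N) v = 0) (S : Finset ι) {lam : ℝ} {g h : J → J → ℂ}
    {w : ι → J → J → ℂ}
    (hyp : ∀ (z : ι → ℂ) (u : J → ℂ), lam * (mpair g (rankOne u)).re ≤
      (mpair h (rankOne u)).re + ∑ s ∈ S, (‖z s‖ ^ 2 * (mpair g (rankOne u)).re +
        2 * (z s * mpair (w s) (rankOne u)).re)) (e : J → W) :
    (lam - S.card) * (mpair g fun i j => B (e i) (e j)).re ≤
      (mpair h fun i j => B (e i) (e j)).re +
        ∑ s ∈ S, ((mpair g fun i j => B (b s (e i)) (b s (e j))).re +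
          2 * (mpair (w s) fun i j => B (e i) (b s (e j))).re) := by
  classical
  -- One mode is removed at a time. A fixed value ζ of mode a changes h into h + |ζ|² g + 2ζ w_a and
  -- the vectors into their components along the coherent state ζ, so both must vary in the
  -- induction.
  induction S using Finset.induction_on generalizing h e with
  | empty =>
    simp only [Finset.card_empty, Nat.cast_zero, sub_zero, Finset.sum_empty, add_zero] at hyp ⊢
    exact re_mpair_gram_le herm hpos (fun u => hyp 0 u) e
  | insert a S ha ih =>
    -- The family e is finite, so one power of the annihilator kills all its members and all
    -- coherent sums are finite.
    choose N0 hN0 using hnil a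
    set N := Finset.univ.sup fun j => N0 (e j)
    have hN : ∀ j, (b a ^ (N + 1)) (e j) = 0 := fun j =>
      pow_apply_eq_zero ((Finset.le_sup (f := fun j => N0 (e j)) (Finset.mem_univ j)).trans
        (Nat.le_succ _)) (hN0 _)
    have hNb : ∀ s ∈ S, ∀ j, (b a ^ (N + 1)) (b s (e j)) = 0 := fun s hs j => by
      have hne : s ≠ a := fun h => ha (h ▸ hs)
      rw [← Module.End.mul_apply, ← ((hbb s a hne).pow_right (N + 1)).eq, Module.End.mul_apply, hN,
        map_zero]
    set E : ℂ → J → W := fun ζ j => cohTr (b a) (c a) (N + 1) ζ (e j)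
    have hEb : ∀ s ∈ S, ∀ ζ j, b s (E ζ j) = cohTr (b a) (c a) (N + 1) ζ (b s (e j)) :=
      fun s hs ζ j => by
        have hne : s ≠ a := fun h => ha (h ▸ hs)
        exact cohTr_comm (hbb s a hne) (hbc s a hne) _ _ _
    have hζ : ∀ ζ : ℂ, (lam - S.card) * (mpair g fun i j => B (E ζ i) (E ζ j)).re ≤
        (mpair (fun i j => h i j + (((‖ζ‖ ^ 2 : ℝ) : ℂ) * g i j + 2 * ζ * w a i j))
          fun i j => B (E ζ i) (E ζ j)).re +
        ∑ s ∈ S, ((mpair g fun i j => B (b s (E ζ i)) (b s (E ζ j))).re +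
          2 * (mpair (w s) fun i j => B (E ζ i) (b s (E ζ j))).re) := by
      intro ζ
      refine ih (fun z u => ?_) (E ζ)
      have h1 := hyp (Function.update z a ζ) u
      rw [Finset.sum_insert ha, Function.update_self, ← add_assoc] at h1
      refine h1.trans (le_of_eq ?_)
      congr 1
      · rw [mpair_add_left, mpair_add_left, mpair_smul_left, mpair_smul_left, Complex.add_re,
          Complex.add_re, Complex.re_ofReal_mul, mul_assoc 2 ζ]
        simp
      · refine Finset.sum_congr rfl fun s hs => ?_
        rw [Function.update_of_ne (show s ≠ a from fun h => ha (h ▸ hs))]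
    have m1 : ∀ i j, HasMean (fun ζ => B (E ζ i) (E ζ j)) (B (e i) (e j)) := fun i j =>
      hasMean_B herm (hadj a) (hccr a) (e i) (hN j)
    have m2 : ∀ i j, HasMean (fun ζ => ((‖ζ‖ ^ 2 : ℝ) : ℂ) * B (E ζ i) (E ζ j))
        (B (e i) (e j) + B (b a (e i)) (b a (e j))) := fun i j =>
      hasMean_normSq_B herm (hadj a) (hccr a) (e i) (hN j)
    have m3 : ∀ i j, HasMean (fun ζ => ζ * B (E ζ i) (E ζ j)) (B (e i) (b a (e j))) := fun i j =>
      hasMean_z_B herm (hadj a) (hccr a) (e i) (hN j)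
    have m4 : ∀ s ∈ S, ∀ i j, HasMean (fun ζ => B (b s (E ζ i)) (b s (E ζ j)))
        (B (b s (e i)) (b s (e j))) := fun s hs i j => by
      simp_rw [hEb s hs]
      exact hasMean_B herm (hadj a) (hccr a) _ (hNb s hs j)
    have m5 : ∀ s ∈ S, ∀ i j, HasMean (fun ζ => B (E ζ i) (b s (E ζ j)))
        (B (e i) (b s (e j))) := fun s hs i j => by
      simp_rw [hEb s hs]
      exact hasMean_B herm (hadj a) (hccr a) _ (hNb s hs j)
    -- The inequality for each ζ is averaged over the Gaussian. The term |ζ|² g yields the number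
    -- form of mode a plus one extra copy of g, which accounts for the increase of the cardinality
    -- by one.
    have mean := ((((hasMean_mpair m1 h).add (hasMean_mpair m2 g)).add
      ((hasMean_mpair m3 (w a)).const_mul 2)).add (HasMean.sum S fun s hs =>
        (hasMean_mpair (m4 s hs) g).add ((hasMean_mpair (m5 s hs) (w s)).const_mul 2))).add
      ((hasMean_mpair m1 g).const_mul (-((lam - S.card : ℝ) : ℂ)))
    have h0 := mean.re_nonneg fun ζ => by
      have h2 := hζ ζ
      rw [mpair_add_left, mpair_add_left, mpair_smul_left, mpair_smul_left] at h2
      have e1 : (mpair g fun i j => ((‖ζ‖ ^ 2 : ℝ) : ℂ) * B (E ζ i) (E ζ j)) =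
          ((‖ζ‖ ^ 2 : ℝ) : ℂ) * mpair g fun i j => B (E ζ i) (E ζ j) := by
        simp only [mpair, Finset.mul_sum]
        exact Finset.sum_congr rfl fun i _ => Finset.sum_congr rfl fun j _ => by ring
      have e2 : (mpair (w a) fun i j => ζ * B (E ζ i) (E ζ j)) =
          ζ * mpair (w a) fun i j => B (E ζ i) (E ζ j) := by
        simp only [mpair, Finset.mul_sum]
        exact Finset.sum_congr rfl fun i _ => Finset.sum_congr rfl fun j _ => by ring
      rw [e1, e2]
      simp only [Complex.add_re, Complex.re_sum, ← Complex.ofReal_neg, Complex.re_ofReal_mul,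
        re_two_mul', mul_assoc] at h2 ⊢
      linarith
    rw [Finset.card_insert_of_notMem ha, Finset.sum_insert ha]
    have e3 : (mpair g fun i j => B (e i) (e j) + B (b a (e i)) (b a (e j))) =
        (mpair g fun i j => B (e i) (e j)) + mpair g fun i j => B (b a (e i)) (b a (e j)) := by
      simp [mpair, mul_add, Finset.sum_add_distrib]
    rw [e3] at h0
    simp only [Complex.add_re, Complex.re_sum, ← Complex.ofReal_neg, Complex.re_ofReal_mul,
      re_two_mul'] at h0
    push_cast
    linarith

end Modes

/-! ### The Fock space of bounded wave functions with bounded support -/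

/-- Symmetric bounded measurable wave functions with bounded support, finitely many nonzero. -/
def IsFock (η : FockFn) : Prop :=
  (∀ n, Measurable (η n)) ∧ (∀ n (σ : Equiv.Perm (Fin n)) (K : Fin n → R3), η n (K ∘ σ) = η n K) ∧
  ∃ (N : ℕ) (M R : ℝ), (∀ n, N ≤ n → η n = 0) ∧ (∀ n K, ‖η n K‖ ≤ M) ∧
    ∀ n K i, R < ‖K i‖ → η n K = 0

/-- The space of wave functions satisfying `IsFock`. -/
def Fock : Submodule ℂ FockFn where
  carrier := {η | IsFock η}
  zero_mem' := ⟨fun _ => measurable_const, fun _ _ _ => rfl, 0, 0, 0, fun _ _ => rfl,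
    fun _ _ => by simp, fun _ _ _ _ => rfl⟩
  add_mem' := by
    rintro η θ ⟨hm, hs, N, M, R, h1, h2, h3⟩ ⟨hm', hs', N', M', R', h1', h2', h3'⟩
    refine ⟨fun n => (hm n).add (hm' n), fun n σ K => ?_, max N N', M + M', max R R',
      fun n hn => ?_, fun n K => ?_, fun n K i hi => ?_⟩
    · simp only [Pi.add_apply, hs, hs']
    · simp only [Pi.add_apply, h1 n (le_of_max_le_left hn), h1' n (le_of_max_le_right hn), add_zero]
    · exact (norm_add_le _ _).trans (add_le_add (h2 _ _) (h2' _ _))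
    · simp only [Pi.add_apply, h3 n K i ((le_max_left _ _).trans_lt hi),
        h3' n K i ((le_max_right _ _).trans_lt hi), add_zero]
  smul_mem' := by
    rintro a η ⟨hm, hs, N, M, R, h1, h2, h3⟩
    refine ⟨fun n => (hm n).const_smul a, fun n σ K => ?_, N, ‖a‖ * M, R,
      fun n hn => ?_, fun n K => ?_, fun n K i hi => ?_⟩
    · simp only [Pi.smul_apply, hs]
    · simp only [Pi.smul_apply, h1 n hn, smul_zero]
    · simp only [Pi.smul_apply, norm_smul]
      exact mul_le_mul_of_nonneg_left (h2 _ _) (norm_nonneg _)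
    · simp only [Pi.smul_apply, h3 n K i hi, smul_zero]

/-- Continuity is given up because the modes used later are indicator functions of momentum blocks:
boundedness, measurability and bounded support are preserved by the corresponding creation and
annihilation operators. -/
lemma MemF0.isFock {η : FockFn} (h : MemF0 η) : IsFock η := by
  obtain ⟨h1, h2, h3⟩ := h
  refine ⟨fun n => (h1 n).1.measurable, h2, ?_⟩
  obtain ⟨N, hN⟩ := h3.bddAbove
  have hb : ∀ n, ∃ M, ∀ K, ‖η n K‖ ≤ M := fun n =>
    (h1 n).1.bounded_above_of_compact_support (h1 n).2
  have hR : ∀ n, ∃ R, ∀ K i, R < ‖K i‖ → η n K = 0 := fun n => by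
    obtain ⟨R, hR⟩ := (h1 n).2.isBounded.exists_norm_le
    refine ⟨R, fun K i hi => ?_⟩
    by_contra hne
    exact absurd (hR K (subset_tsupport _ hne)) (not_le.2 (hi.trans_le (norm_le_pi_norm K i)))
  choose M hM using hb
  choose R hR using hR
  have hz : ∀ n, N + 1 ≤ n → η n = 0 := fun n hn => by
    by_contra hne
    exact absurd (hN hne) (by omega)
  have hM0 : ∀ n, 0 ≤ M n := fun n => (norm_nonneg _).trans (hM n 0)
  refine ⟨N + 1, ∑ n ∈ Finset.range (N + 1), M n, ∑ n ∈ Finset.range (N + 1), |R n|, hz,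
    fun n K => ?_, fun n K i hi => ?_⟩
  · by_cases hn : N + 1 ≤ n
    · rw [hz n hn]; simpa using Finset.sum_nonneg fun n _ => hM0 n
    · exact (hM n K).trans (Finset.single_le_sum (f := M) (fun n _ => hM0 n)
        (Finset.mem_range.2 (not_le.1 hn)))
  · by_cases hn : N + 1 ≤ n
    · rw [hz n hn]; rfl
    · refine hR n K i (lt_of_le_of_lt ((le_abs_self _).trans ?_) hi)
      exact Finset.single_le_sum (f := fun n => |R n|) (fun n _ => abs_nonneg _)
        (Finset.mem_range.2 (not_le.1 hn))

/-! #### Integration over phonon momenta -/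

lemma integrable_of_bounded_support {n : ℕ} {F : (Fin n → R3) → ℂ} (hm : Measurable F) {M R : ℝ}
    (hb : ∀ K, ‖F K‖ ≤ M) (hs : ∀ K i, R < ‖K i‖ → F K = 0) : Integrable F := by
  set T : Set (Fin n → R3) := Set.pi Set.univ fun _ => Metric.closedBall 0 R
  have hT : IsCompact T := isCompact_univ_pi fun _ => isCompact_closedBall _ _
  have h1 : IntegrableOn F T := Measure.integrableOn_of_bounded (M := M) hT.measure_lt_top.ne
    hm.aestronglyMeasurable (ae_of_all _ hb)
  refine (integrableOn_iff_integrable_of_support_subset ?_).1 h1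
  intro K hK i _
  by_contra hne
  exact hK (hs K i (by simpa using hne))

lemma integrable_of_bounded_support_R3 {F : R3 → ℂ} (hm : Measurable F) {M R : ℝ}
    (hb : ∀ k, ‖F k‖ ≤ M) (hs : ∀ k, R < ‖k‖ → F k = 0) : Integrable F := by
  have hT : IsCompact (Metric.closedBall (0 : R3) R) := isCompact_closedBall _ _
  have h1 : IntegrableOn F (Metric.closedBall (0 : R3) R) :=
    Measure.integrableOn_of_bounded (M := M) hT.measure_lt_top.ne
    hm.aestronglyMeasurable (ae_of_all _ hb)
  refine (integrableOn_iff_integrable_of_support_subset ?_).1 h1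
  intro K hK
  by_contra hne
  exact hK (hs K (by simpa using hne))

lemma measurable_insertNth {n : ℕ} (i : Fin (n + 1)) :
    Measurable fun p : R3 × (Fin n → R3) => (i.insertNth p.1 p.2 : Fin (n + 1) → R3) :=
  (MeasurableEquiv.piFinSuccAbove (fun _ : Fin (n + 1) => R3) i).symm.measurable

lemma measurable_cons {n : ℕ} :
    Measurable fun p : R3 × (Fin n → R3) => (Fin.cons p.1 p.2 : Fin (n + 1) → R3) := by
  simpa only [Fin.insertNth_zero'] using measurable_insertNth (n := n) 0

lemma measurable_cons_right {n : ℕ} (k : R3) :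
    Measurable fun K : Fin n → R3 => (Fin.cons k K : Fin (n + 1) → R3) :=
  measurable_cons.comp (measurable_const.prodMk measurable_id)

lemma measurePreserving_insertNth {n : ℕ} (i : Fin (n + 1)) :
    MeasurePreserving (fun p : R3 × (Fin n → R3) => (i.insertNth p.1 p.2 : Fin (n + 1) → R3))
      (volume.prod volume) volume :=
  (volume_preserving_piFinSuccAbove (fun _ : Fin (n + 1) => R3) i).symm

lemma integrable_insertNth {n : ℕ} (i : Fin (n + 1)) {F : (Fin (n + 1) → R3) → ℂ}
    (hF : Integrable F) :
    Integrable (fun p : R3 × (Fin n → R3) => F (i.insertNth p.1 p.2)) (volume.prod volume) :=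
  (measurePreserving_insertNth i).integrable_comp_of_integrable hF

lemma integral_insertNth {n : ℕ} (i : Fin (n + 1)) {F : (Fin (n + 1) → R3) → ℂ}
    (hF : Integrable F) : ∫ K, F K = ∫ k : R3, ∫ K : Fin n → R3, F (i.insertNth k K) := by
  rw [← integral_prod _ (integrable_insertNth i hF)]
  exact ((measurePreserving_insertNth i).integral_comp
    (MeasurableEquiv.piFinSuccAbove (fun _ : Fin (n + 1) => R3) i).symm.measurableEmbedding F).symm

lemma integrable_cons {n : ℕ} {F : (Fin (n + 1) → R3) → ℂ} (hF : Integrable F) :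
    Integrable (fun p : R3 × (Fin n → R3) => F (Fin.cons p.1 p.2)) (volume.prod volume) := by
  simpa only [Fin.insertNth_zero'] using integrable_insertNth 0 hF

/-- Moving an entry to the front is a permutation. -/
lemma exists_perm_insertNth {n : ℕ} (i : Fin (n + 1)) :
    ∃ σ : Equiv.Perm (Fin (n + 1)), ∀ (k : R3) (K : Fin n → R3),
      (i.insertNth k K : Fin (n + 1) → R3) = Fin.cons k K ∘ σ := by
  refine ⟨(finSuccEquiv' i).trans (finSuccEquiv' 0).symm, fun k K => ?_⟩
  ext1 j
  refine Fin.succAboveCases i ?_ (fun j => ?_) j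
  · simp [finSuccEquiv'_at]
  · simp [finSuccEquiv'_succAbove]

lemma IsFock.insertNth {η : FockFn} (h : IsFock η) {n : ℕ} (i : Fin (n + 1)) (k : R3)
    (K : Fin n → R3) : η (n + 1) (i.insertNth k K) = η (n + 1) (Fin.cons k K) := by
  obtain ⟨σ, hσ⟩ := exists_perm_insertNth i
  rw [hσ, h.2.1]

lemma cons_comp_perm {n : ℕ} (σ : Equiv.Perm (Fin n)) (k : R3) (K : Fin n → R3) :
    (Fin.cons k (K ∘ σ) : Fin (n + 1) → R3) =
      Fin.cons k K ∘ (Equiv.Perm.decomposeFin.symm (0, σ)) := by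
  ext1 j
  refine Fin.cases ?_ (fun j => ?_) j <;> simp

lemma exists_perm_succAbove {n : ℕ} (σ : Equiv.Perm (Fin (n + 1))) (i : Fin (n + 1)) :
    ∃ τ : Equiv.Perm (Fin n), ∀ j, σ (i.succAbove j) = (σ i).succAbove (τ j) := by
  have h : ∀ j, ∃ j', (σ i).succAbove j' = σ (i.succAbove j) := fun j =>
    Fin.exists_succAbove_eq fun h => Fin.succAbove_ne i j (σ.injective h)
  choose τ hτ using h
  have hinj : Function.Injective τ := fun a b hab => by
    have := (hτ a).symm.trans ((congrArg _ hab).trans (hτ b))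
    exact Fin.succAbove_right_injective (σ.injective this)
  exact ⟨Equiv.ofBijective τ (Finite.injective_iff_bijective.1 hinj), fun j => (hτ j).symm⟩

/-! #### Annihilation and creation operators -/

/-- The annihilation operator `a(k)` on Fock space wave functions. -/
def annFn (k : R3) : FockFn →ₗ[ℂ] FockFn where
  toFun η := fun n K => (Real.sqrt (n + 1) : ℂ) * η (n + 1) (Fin.cons k K)
  map_add' η θ := by ext n K; simp [mul_add]
  map_smul' a η := by ext n K; simp; ring

lemma IsFock.annFn {η : FockFn} (h : IsFock η) (k : R3) : IsFock (annFn k η) := by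
  obtain ⟨hm, hs, N, M, R, h1, h2, h3⟩ := h
  refine ⟨fun n => ((hm (n + 1)).comp (measurable_cons_right k)).const_mul _, fun n σ K => ?_, N,
    Real.sqrt (N + 1) * M, R, fun n hn => ?_, fun n K => ?_, fun n K i hi => ?_⟩
  · simp only [Polaron.annFn, LinearMap.coe_mk, AddHom.coe_mk, cons_comp_perm, hs]
  · ext K
    simp only [Polaron.annFn, LinearMap.coe_mk, AddHom.coe_mk, h1 (n + 1) (by omega)]
    simp
  · have hM : 0 ≤ M := (norm_nonneg _).trans (h2 0 0)
    simp only [Polaron.annFn, LinearMap.coe_mk, AddHom.coe_mk]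
    by_cases hn : N ≤ n
    · rw [h1 (n + 1) (by omega)]; simp; positivity
    · rw [norm_mul, Complex.norm_real, Real.norm_of_nonneg (Real.sqrt_nonneg _)]
      refine mul_le_mul (Real.sqrt_le_sqrt ?_) (h2 _ _) (norm_nonneg _) (Real.sqrt_nonneg _)
      have : n ≤ N := by omega
      have : (n : ℝ) ≤ N := by exact_mod_cast this
      linarith
  · simp only [Polaron.annFn, LinearMap.coe_mk, AddHom.coe_mk]
    rw [h3 (n + 1) _ i.succ (by simpa using hi), mul_zero]

/-- The annihilation operator `a(k)`. -/
def ann (k : R3) : Module.End ℂ Fock := (annFn k).restrict fun _ h => IsFock.annFn h k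

lemma ann_apply (k : R3) (v : Fock) (n : ℕ) (K : Fin n → R3) :
    (ann k v : FockFn) n K = (Real.sqrt (n + 1) : ℂ) * (v : FockFn) (n + 1) (Fin.cons k K) := rfl

/-- Bounded measurable functions with bounded support. -/
def IsMode (g : R3 → ℂ) : Prop :=
  Measurable g ∧ ∃ M R : ℝ, (∀ k, ‖g k‖ ≤ M) ∧ ∀ k, R < ‖k‖ → g k = 0

lemma IsMode.integrable {g : R3 → ℂ} (h : IsMode g) : Integrable g := by
  obtain ⟨hm, M, R, hb, hs⟩ := h
  exact integrable_of_bounded_support_R3 hm hb hs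

lemma IsMode.conj {g : R3 → ℂ} (h : IsMode g) : IsMode fun k => (starRingEnd ℂ) (g k) := by
  obtain ⟨hm, M, R, hb, hs⟩ := h
  refine ⟨Complex.continuous_conj.measurable.comp hm, M, R, fun k => ?_, fun k hk => ?_⟩
  · simpa using hb k
  · simp [hs k hk]

lemma IsMode.mul_bounded {g f : R3 → ℂ} (h : IsMode g) (hf : Measurable f) {C : ℝ}
    (hC : ∀ k, ‖f k‖ ≤ C) : IsMode fun k => g k * f k := by
  obtain ⟨hm, M, R, hb, hs⟩ := h
  refine ⟨hm.mul hf, M * C, R, fun k => ?_, fun k hk => ?_⟩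
  · rw [norm_mul]
    exact mul_le_mul (hb k) (hC k) (norm_nonneg _) ((norm_nonneg _).trans (hb k))
  · simp [hs k hk]

lemma IsMode.mul {g f : R3 → ℂ} (h : IsMode g) (hf : IsMode f) : IsMode fun k => g k * f k := by
  obtain ⟨hm, M, R, hb, -⟩ := hf
  exact h.mul_bounded hm hb

lemma IsFock.isMode_cons {η : FockFn} (h : IsFock η) {n : ℕ} (K : Fin n → R3) :
    IsMode fun k => η (n + 1) (Fin.cons k K) := by
  obtain ⟨hm, hs, N, M, R, h1, h2, h3⟩ := h
  refine ⟨(hm _).comp (measurable_cons.comp (measurable_id.prodMk measurable_const)), M, R,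
    fun k => h2 _ _, fun k hk => h3 _ _ 0 (by simpa using hk)⟩

lemma IsFock.integrable_mode_mul {η : FockFn} (h : IsFock η) {g : R3 → ℂ} (hg : IsMode g) {n : ℕ}
    (K : Fin n → R3) : Integrable fun k => (starRingEnd ℂ) (g k) * η (n + 1) (Fin.cons k K) :=
  (hg.conj.mul (h.isMode_cons K)).integrable

/-- The smeared annihilation operator `a(g)` on wave functions. -/
def lowerFn (g : R3 → ℂ) (η : FockFn) : FockFn := fun n K =>
  (Real.sqrt (n + 1) : ℂ) * ∫ k, (starRingEnd ℂ) (g k) * η (n + 1) (Fin.cons k K)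

/-- The smeared creation operator `a*(g)` on wave functions. -/
def raiseFn (g : R3 → ℂ) (η : FockFn) : FockFn
  | 0 => 0
  | n + 1 => fun K => ((Real.sqrt (n + 1) : ℂ))⁻¹ * ∑ i, g (K i) * η n (K ∘ i.succAbove)

lemma IsFock.lowerFn {η : FockFn} (h : IsFock η) {g : R3 → ℂ} (hg : IsMode g) :
    IsFock (lowerFn g η) := by
  have h' := h
  obtain ⟨hm, hs, N, M, R, h1, h2, h3⟩ := h
  have hgi := hg.integrable.norm
  refine ⟨fun n => ?_, fun n σ K => ?_, N, Real.sqrt (N + 1) * ((∫ k, ‖g k‖) * M), R,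
    fun n hn => ?_, fun n K => ?_, fun n K i hi => ?_⟩
  · refine Measurable.const_mul ?_ _
    have : StronglyMeasurable fun p : (Fin n → R3) × R3 =>
        (starRingEnd ℂ) (g p.2) * η (n + 1) (Fin.cons p.2 p.1) :=
      Measurable.stronglyMeasurable ((hg.conj.1.comp measurable_snd).mul
        ((hm _).comp (measurable_cons.comp measurable_swap)))
    exact this.integral_prod_right'.measurable
  · simp only [Polaron.lowerFn, cons_comp_perm, hs]
  · ext K
    simp only [Polaron.lowerFn, h1 (n + 1) (by omega)]
    simp
  · have hM : 0 ≤ M := (norm_nonneg _).trans (h2 0 0)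
    have hI : 0 ≤ ∫ k, ‖g k‖ := integral_nonneg fun _ => norm_nonneg _
    simp only [Polaron.lowerFn]
    by_cases hn : N ≤ n
    · rw [h1 (n + 1) (by omega)]; simp; positivity
    · rw [norm_mul, Complex.norm_real, Real.norm_of_nonneg (Real.sqrt_nonneg _)]
      refine mul_le_mul (Real.sqrt_le_sqrt ?_) ?_ (norm_nonneg _) (Real.sqrt_nonneg _)
      · have : n ≤ N := by omega
        have : (n : ℝ) ≤ N := by exact_mod_cast this
        linarith
      · rw [← integral_mul_const]
        refine norm_integral_le_of_norm_le (hgi.mul_const M) (ae_of_all _ fun k => ?_)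
        rw [norm_mul, RCLike.norm_conj]
        exact mul_le_mul_of_nonneg_left (h2 _ _) (norm_nonneg _)
  · simp only [Polaron.lowerFn]
    have : ∀ k, η (n + 1) (Fin.cons k K) = 0 := fun k => h3 (n + 1) _ i.succ (by simpa using hi)
    simp [this]

lemma IsFock.raiseFn {η : FockFn} (h : IsFock η) {g : R3 → ℂ} (hg : IsMode g) :
    IsFock (raiseFn g η) := by
  obtain ⟨hm, hs, N, M, R, h1, h2, h3⟩ := h
  obtain ⟨hgm, Mg, Rg, hgb, hgs⟩ := hg
  have hM : 0 ≤ M := (norm_nonneg _).trans (h2 0 0)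
  have hMg : 0 ≤ Mg := (norm_nonneg _).trans (hgb 0)
  refine ⟨fun n => ?_, fun n σ K => ?_, N + 1, N * (Mg * M), max R Rg,
    fun n hn => ?_, fun n K => ?_, fun n K i hi => ?_⟩
  · cases n with
    | zero => exact measurable_const
    | succ n =>
      refine Measurable.const_mul (Finset.measurable_sum _ fun i _ => ?_) _
      refine (hgm.comp (measurable_pi_apply i)).mul ((hm n).comp ?_)
      exact measurable_pi_iff.2 fun j => measurable_pi_apply _
  · cases n with
    | zero => rfl
    | succ n =>
      simp only [Polaron.raiseFn]
      congr 1
      refine Fintype.sum_equiv σ _ _ fun i => ?_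
      obtain ⟨τ, hτ⟩ := exists_perm_succAbove σ i
      have : (K ∘ σ) ∘ i.succAbove = (K ∘ (σ i).succAbove) ∘ τ := by
        ext1 j; simp [hτ]
      rw [this, hs]; rfl
  · cases n with
    | zero => rfl
    | succ n =>
      ext K
      simp [Polaron.raiseFn, h1 n (by omega)]
  · cases n with
    | zero => simp [Polaron.raiseFn]; positivity
    | succ n =>
      simp only [Polaron.raiseFn]
      by_cases hn : N ≤ n
      · simp [h1 n hn]; positivity
      · rw [norm_mul, norm_inv, Complex.norm_real, Real.norm_of_nonneg (Real.sqrt_nonneg _)]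
        have hn' : ((n + 1 : ℕ) : ℝ) ≤ N := by exact_mod_cast not_le.1 hn
        have e1 : (Real.sqrt (n + 1))⁻¹ ≤ 1 := inv_le_one_of_one_le₀ (by
          rw [Real.one_le_sqrt]; linarith [Nat.cast_nonneg (α := ℝ) n])
        have e2 : ‖∑ i, g (K i) * η n (K ∘ i.succAbove)‖ ≤ ∑ _i : Fin (n + 1), Mg * M :=
          norm_sum_le_of_le _ fun i _ => by
            rw [norm_mul]; exact mul_le_mul (hgb _) (h2 _ _) (norm_nonneg _) hMg
        rw [Finset.sum_const, Finset.card_univ, Fintype.card_fin, nsmul_eq_mul] at e2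
        calc _ ≤ 1 * ‖∑ i, g (K i) * η n (K ∘ i.succAbove)‖ :=
              mul_le_mul_of_nonneg_right e1 (norm_nonneg _)
          _ ≤ ((n + 1 : ℕ) : ℝ) * (Mg * M) := by rw [one_mul]; exact e2
          _ ≤ _ := mul_le_mul_of_nonneg_right hn' (by positivity)
  · cases n with
    | zero => exact i.elim0
    | succ n =>
      simp only [Polaron.raiseFn]
      rw [Finset.sum_eq_zero, mul_zero]
      intro j _
      by_cases hij : i = j
      · subst hij
        have hlt : Rg < ‖K i‖ := lt_of_le_of_lt (le_max_right R Rg) hi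
        rw [hgs _ hlt, zero_mul]
      · obtain ⟨i', rfl⟩ := Fin.exists_succAbove_eq hij
        have hlt : R < ‖(K ∘ j.succAbove) i'‖ := lt_of_le_of_lt (le_max_left R Rg) hi
        rw [h3 n _ i' hlt, mul_zero]

/-- The smeared annihilation operator. -/
def lower (g : R3 → ℂ) (hg : IsMode g) : Module.End ℂ Fock where
  toFun v := ⟨lowerFn g v, IsFock.lowerFn v.2 hg⟩
  map_add' v w := by
    ext n K
    simp only [lowerFn, Submodule.coe_add, Pi.add_apply, mul_add]
    rw [integral_add (IsFock.integrable_mode_mul v.2 hg K) (IsFock.integrable_mode_mul w.2 hg K),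
      mul_add]
  map_smul' a v := by
    ext n K
    simp only [lowerFn, SetLike.val_smul, Pi.smul_apply, smul_eq_mul, RingHom.id_apply]
    simp_rw [mul_left_comm _ a]
    rw [integral_const_mul]; ring

/-- The smeared creation operator. -/
def raise (g : R3 → ℂ) (hg : IsMode g) : Module.End ℂ Fock where
  toFun v := ⟨raiseFn g v, IsFock.raiseFn v.2 hg⟩
  map_add' v w := by
    ext n K
    cases n with
    | zero => simp [raiseFn]
    | succ n => simp [raiseFn, mul_add, Finset.sum_add_distrib]
  map_smul' a v := by
    ext n K
    cases n with
    | zero => simp [raiseFn]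
    | succ n =>
      simp only [raiseFn, SetLike.val_smul, Pi.smul_apply, smul_eq_mul, RingHom.id_apply]
      simp_rw [mul_left_comm _ a]
      rw [← Finset.mul_sum]; ring

lemma lower_apply (g : R3 → ℂ) (hg : IsMode g) (v : Fock) (n : ℕ) (K : Fin n → R3) :
    (lower g hg v : FockFn) n K = (Real.sqrt (n + 1) : ℂ) *
      ∫ k, (starRingEnd ℂ) (g k) * (v : FockFn) (n + 1) (Fin.cons k K) := rfl

lemma raise_apply_succ (g : R3 → ℂ) (hg : IsMode g) (v : Fock) (n : ℕ) (K : Fin (n + 1) → R3) :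
    (raise g hg v : FockFn) (n + 1) K =
      ((Real.sqrt (n + 1) : ℂ))⁻¹ * ∑ i, g (K i) * (v : FockFn) n (K ∘ i.succAbove) := rfl

lemma raise_apply_zero (g : R3 → ℂ) (hg : IsMode g) (v : Fock) (K : Fin 0 → R3) :
    (raise g hg v : FockFn) 0 K = 0 := rfl

/-! ### The inner product of Fock space -/

lemma IsFock.integrable_inner {η θ : FockFn} (h : IsFock η) (h' : IsFock θ) (n : ℕ) :
    Integrable fun K => (starRingEnd ℂ) (η n K) * θ n K := by
  obtain ⟨hm, -, N, M, R, -, h2, h3⟩ := h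
  obtain ⟨hm', -, N', M', R', -, h2', -⟩ := h'
  refine integrable_of_bounded_support (M := M * M') (R := R)
    ((Complex.continuous_conj.measurable.comp (hm n)).mul (hm' n)) (fun K => ?_) fun K i hi => ?_
  · rw [norm_mul, RCLike.norm_conj]
    exact mul_le_mul (h2 _ _) (h2' _ _) (norm_nonneg _) ((norm_nonneg _).trans (h2 n K))
  · rw [h3 n K i hi]; simp

lemma IsFock.integrable {η : FockFn} (h : IsFock η) (n : ℕ) : Integrable (η n) := by
  obtain ⟨hm, -, N, M, R, -, h2, h3⟩ := h
  exact integrable_of_bounded_support (hm n) (h2 n) (h3 n)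

lemma fock_exists_bound (v : Fock) : ∃ N : ℕ, ∀ n, N ≤ n → (v : FockFn) n = 0 :=
  let ⟨_, _, N, _, _, h, _⟩ := v.2
  ⟨N, h⟩

/-- The inner product of Fock space wave functions. -/
def fip (η θ : FockFn) : ℂ := ∑' n, ∫ K, (starRingEnd ℂ) (η n K) * θ n K

lemma fip_eq_sum (η : FockFn) {θ : FockFn} {N : ℕ} (h : ∀ n, N ≤ n → θ n = 0) :
    fip η θ = ∑ n ∈ Finset.range N, ∫ K, (starRingEnd ℂ) (η n K) * θ n K :=
  tsum_eq_sum fun n hn => by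
    rw [h n (by simpa using hn)]; simp

lemma fip_eq_sum_left {η : FockFn} (θ : FockFn) {N : ℕ} (h : ∀ n, N ≤ n → η n = 0) :
    fip η θ = ∑ n ∈ Finset.range N, ∫ K, (starRingEnd ℂ) (η n K) * θ n K :=
  tsum_eq_sum fun n hn => by
    rw [h n (by simpa using hn)]; simp

/-- The inner product as a sesquilinear form. -/
def fockForm : Fock →ₗ⋆[ℂ] Fock →ₗ[ℂ] ℂ :=
  LinearMap.mk₂'ₛₗ (starRingEnd ℂ) (RingHom.id ℂ) (fun v w => fip v w)
    (fun v v' w => by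
      obtain ⟨N, hN⟩ := fock_exists_bound w
      simp only [fip_eq_sum _ hN, ← Finset.sum_add_distrib]
      refine Finset.sum_congr rfl fun n _ => ?_
      rw [← integral_add (v.2.integrable_inner w.2 n) (v'.2.integrable_inner w.2 n)]
      simp only [Submodule.coe_add, Pi.add_apply, map_add, add_mul])
    (fun a v w => by
      obtain ⟨N, hN⟩ := fock_exists_bound w
      simp only [fip_eq_sum _ hN, Finset.smul_sum]
      refine Finset.sum_congr rfl fun n _ => ?_
      rw [smul_eq_mul, ← integral_const_mul]
      simp only [SetLike.val_smul, Pi.smul_apply, smul_eq_mul, map_mul, mul_assoc])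
    (fun v w w' => by
      obtain ⟨N, hN⟩ := fock_exists_bound v
      simp only [fip_eq_sum_left _ hN, ← Finset.sum_add_distrib]
      refine Finset.sum_congr rfl fun n _ => ?_
      rw [← integral_add (v.2.integrable_inner w.2 n) (v.2.integrable_inner w'.2 n)]
      simp only [Submodule.coe_add, Pi.add_apply, mul_add])
    (fun a v w => by
      obtain ⟨N, hN⟩ := fock_exists_bound v
      simp only [fip_eq_sum_left _ hN, Finset.smul_sum]
      refine Finset.sum_congr rfl fun n _ => ?_
      rw [smul_eq_mul, RingHom.id_apply, ← integral_const_mul]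
      simp only [SetLike.val_smul, Pi.smul_apply, smul_eq_mul, mul_left_comm _ a])

lemma fockForm_eq_sum (v : Fock) {w : Fock} {N : ℕ} (h : ∀ n, N ≤ n → (w : FockFn) n = 0) :
    fockForm v w = ∑ n ∈ Finset.range N,
      ∫ K, (starRingEnd ℂ) ((v : FockFn) n K) * (w : FockFn) n K := fip_eq_sum _ h

lemma fockForm_eq_sum_left {v : Fock} (w : Fock) {N : ℕ} (h : ∀ n, N ≤ n → (v : FockFn) n = 0) :
    fockForm v w = ∑ n ∈ Finset.range N,
      ∫ K, (starRingEnd ℂ) ((v : FockFn) n K) * (w : FockFn) n K := fip_eq_sum_left _ h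

lemma fockForm_herm (v w : Fock) : fockForm v w = (starRingEnd ℂ) (fockForm w v) := by
  obtain ⟨N, hN⟩ := fock_exists_bound w
  rw [fockForm_eq_sum v hN, fockForm_eq_sum_left v hN, map_sum]
  refine Finset.sum_congr rfl fun n _ => ?_
  rw [← integral_conj]
  refine integral_congr_ae (ae_of_all _ fun K => ?_)
  simp [mul_comm]

lemma fockForm_pos (v : Fock) : 0 ≤ (fockForm v v).re := by
  obtain ⟨N, hN⟩ := fock_exists_bound v
  rw [fockForm_eq_sum v hN, Complex.re_sum]
  refine Finset.sum_nonneg fun n _ => ?_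
  have e : (fun K => (starRingEnd ℂ) ((v : FockFn) n K) * (v : FockFn) n K) =
      fun K => ((‖(v : FockFn) n K‖ ^ 2 : ℝ) : ℂ) := by
    ext K; rw [mul_comm, Complex.mul_conj, Complex.normSq_eq_norm_sq]
  rw [e, integral_complex_ofReal, Complex.ofReal_re]
  exact integral_nonneg fun K => by positivity

lemma two_mul_norm_fockForm_le (v w : Fock) {s : ℝ} (hs : 0 < s) :
    2 * ‖fockForm v w‖ ≤ s * (fockForm v v).re + s⁻¹ * (fockForm w w).re := by
  by_cases h0 : fockForm v w = 0
  · rw [h0, norm_zero, mul_zero]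
    have := fockForm_pos v
    have := fockForm_pos w
    positivity
  set X := fockForm v w
  have hX : (‖X‖ : ℂ) ≠ 0 := by simpa using h0
  set a : ℂ := -((s⁻¹ : ℝ) : ℂ) * ((starRingEnd ℂ) X / (‖X‖ : ℂ))
  have h1 : a * X = ((-(s⁻¹ * ‖X‖) : ℝ) : ℂ) := by
    have : (starRingEnd ℂ) X * X = (‖X‖ : ℂ) ^ 2 := by
      rw [mul_comm, Complex.mul_conj, Complex.normSq_eq_norm_sq]; push_cast; rfl
    simp only [a]
    rw [mul_assoc, div_mul_eq_mul_div, this]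
    push_cast
    field_simp
  have h2 : (starRingEnd ℂ) a * a = ((s⁻¹ ^ 2 : ℝ) : ℂ) := by
    rw [mul_comm, Complex.mul_conj, Complex.normSq_eq_norm_sq]
    congr 1
    simp only [a, norm_mul, norm_neg, Complex.norm_real, norm_div, RCLike.norm_conj, norm_norm]
    rw [div_self (by simpa using h0), mul_one, Real.norm_of_nonneg (by positivity)]
  have h3 := fockForm_pos (v + a • w)
  have h4 : fockForm (v + a • w) (v + a • w) =
      fockForm v v + a * X + (starRingEnd ℂ) (a * X) + (starRingEnd ℂ) a * a * fockForm w w := by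
    simp only [map_add, LinearMap.add_apply, map_smul, LinearMap.map_smulₛₗ, LinearMap.smul_apply,
      smul_eq_mul, map_mul, X]
    rw [fockForm_herm w v]; ring
  rw [h4, h1, h2, Complex.conj_ofReal, Complex.add_re, Complex.add_re, Complex.add_re,
    Complex.ofReal_re, Complex.re_ofReal_mul] at h3
  have h5 : 0 ≤ s * ((fockForm v v).re + -(s⁻¹ * ‖X‖) + -(s⁻¹ * ‖X‖) +
      s⁻¹ ^ 2 * (fockForm w w).re) := mul_nonneg hs.le h3
  have h6 : s * ((fockForm v v).re + -(s⁻¹ * ‖X‖) + -(s⁻¹ * ‖X‖) + s⁻¹ ^ 2 * (fockForm w w).re) =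
      s * (fockForm v v).re - 2 * ‖X‖ + s⁻¹ * (fockForm w w).re := by
    field_simp; ring
  linarith

/-! #### The canonical commutation relations -/

lemma fock_integrable_smear (v w : Fock) {g : R3 → ℂ} (hg : IsMode g) (n : ℕ) :
    Integrable (fun p : R3 × (Fin n → R3) => (starRingEnd ℂ) ((v : FockFn) n p.2) *
      ((starRingEnd ℂ) (g p.1) * (w : FockFn) (n + 1) (Fin.cons p.1 p.2)))
      (volume.prod volume) := by
  have h1 : Integrable (fun p : R3 × (Fin n → R3) =>
      (starRingEnd ℂ) (g p.1) * (starRingEnd ℂ) ((v : FockFn) n p.2)) (volume.prod volume) :=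
    hg.conj.integrable.mul_prod (f := fun k => (starRingEnd ℂ) (g k))
      (g := fun K => (starRingEnd ℂ) ((v : FockFn) n K))
      (by simpa using (Complex.conjCLE.toContinuousLinearMap.integrable_comp (v.2.integrable n)))
  obtain ⟨hm, -, N, M, R, -, h2, -⟩ := w.2
  refine (h1.mul_bdd (c := M) ((hm (n + 1)).comp measurable_cons).aestronglyMeasurable
    (ae_of_all _ fun p => h2 _ _)).congr (ae_of_all _ fun p => ?_)
  simp only [Function.comp]; ring

/-- By symmetry of w each of the n + 1 summands of the creation operator gives the same integral,
and (n + 1)/√(n + 1) = √(n + 1). -/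
lemma fockForm_raise_left {g : R3 → ℂ} (hg : IsMode g) (v w : Fock) :
    fockForm (raise g hg v) w = fockForm v (lower g hg w) := by
  obtain ⟨N, hN⟩ := fock_exists_bound w
  have hN' : ∀ n, N ≤ n → (lower g hg w : FockFn) n = 0 := fun n hn => by
    ext K; rw [lower_apply, hN (n + 1) (by omega)]; simp
  rw [fockForm_eq_sum (raise g hg v) (N := N + 1) fun n hn => hN n (by omega),
    fockForm_eq_sum v hN', Finset.sum_range_succ']
  simp only [raise_apply_zero, map_zero, zero_mul, integral_zero, add_zero]
  refine Finset.sum_congr rfl fun n _ => ?_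
  have hsq : (Real.sqrt (n + 1) : ℂ) ≠ 0 := by
    rw [Ne, Complex.ofReal_eq_zero, Real.sqrt_eq_zero (by positivity)]; positivity
  have hterm : ∀ i : Fin (n + 1), Integrable (fun K : Fin (n + 1) → R3 =>
      (starRingEnd ℂ) (g (K i) * (v : FockFn) n (K ∘ i.succAbove)) * (w : FockFn) (n + 1) K) := by
    intro i
    obtain ⟨hgm, Mg, Rg, hgb, hgs⟩ := hg
    obtain ⟨hm, -, -, M, R, -, h2, -⟩ := v.2
    obtain ⟨hm', -, -, M', R', -, h2', h3'⟩ := w.2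
    refine integrable_of_bounded_support (M := Mg * M * M') (R := R') ?_ (fun K => ?_)
      fun K j hj => by rw [h3' _ _ j hj, mul_zero]
    · refine (Complex.continuous_conj.measurable.comp ((hgm.comp (measurable_pi_apply i)).mul
        ((hm n).comp ?_))).mul (hm' _)
      exact measurable_pi_iff.2 fun j => measurable_pi_apply _
    · rw [norm_mul, RCLike.norm_conj, norm_mul]
      have a1 : 0 ≤ Mg := (norm_nonneg _).trans (hgb 0)
      have a2 : 0 ≤ M := (norm_nonneg _).trans (h2 0 0)
      exact mul_le_mul (mul_le_mul (hgb _) (h2 _ _) (norm_nonneg _) a1) (h2' _ _) (norm_nonneg _)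
        (by positivity)
  have e1 : ∀ i : Fin (n + 1), ∫ K : Fin (n + 1) → R3,
      (starRingEnd ℂ) (g (K i) * (v : FockFn) n (K ∘ i.succAbove)) * (w : FockFn) (n + 1) K =
      ∫ K : Fin n → R3, (starRingEnd ℂ) ((v : FockFn) n K) *
        ∫ k, (starRingEnd ℂ) (g k) * (w : FockFn) (n + 1) (Fin.cons k K) := by
    intro i
    rw [integral_insertNth i (hterm i)]
    have : ∀ (k : R3) (K : Fin n → R3), (i.insertNth k K : Fin (n + 1) → R3) ∘ i.succAbove = K :=
      fun k K => by ext1 j; simp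
    simp only [Fin.insertNth_apply_same, this, IsFock.insertNth w.2]
    have hre : ∀ (k : R3) (K : Fin n → R3), (starRingEnd ℂ) (g k * (v : FockFn) n K) *
        (w : FockFn) (n + 1) (Fin.cons k K) = (starRingEnd ℂ) ((v : FockFn) n K) *
        ((starRingEnd ℂ) (g k) * (w : FockFn) (n + 1) (Fin.cons k K)) := fun k K => by
      rw [map_mul]; ring
    simp_rw [hre]
    rw [integral_integral_swap (fock_integrable_smear v w hg n)]
    simp_rw [integral_const_mul]
  simp_rw [raise_apply_succ, lower_apply, Finset.mul_sum, map_sum, Finset.sum_mul]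
  have e2 : ∀ (i : Fin (n + 1)) (K : Fin (n + 1) → R3),
      (starRingEnd ℂ) ((Real.sqrt (n + 1) : ℂ)⁻¹ *
        (g (K i) * (v : FockFn) n (K ∘ i.succAbove))) * (w : FockFn) (n + 1) K =
      (Real.sqrt (n + 1) : ℂ)⁻¹ * ((starRingEnd ℂ) (g (K i) *
        (v : FockFn) n (K ∘ i.succAbove)) * (w : FockFn) (n + 1) K) := fun i K => by
    rw [map_mul, map_inv₀, Complex.conj_ofReal, mul_assoc]
  simp_rw [e2]
  rw [integral_finsetSum _ fun i _ => (hterm i).const_mul _]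
  simp_rw [integral_const_mul, e1, mul_left_comm _ (Real.sqrt (n + 1) : ℂ), integral_const_mul]
  rw [Finset.sum_const, Finset.card_univ, Fintype.card_fin, nsmul_eq_mul, ← mul_assoc]
  congr 1
  have h : (Real.sqrt (n + 1) : ℂ) * (Real.sqrt (n + 1) : ℂ) = ((n + 1 : ℕ) : ℂ) := by
    rw [← Complex.ofReal_mul, Real.mul_self_sqrt (by positivity)]; push_cast; rfl
  rw [← h]; field_simp

/-- In a(g)a*(g')v the summand with g' evaluated at the integrated momentum is ⟨g, g'⟩v; the other
summands form a*(g')a(g)v. -/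
lemma lower_mul_raise {g g' : R3 → ℂ} (hg : IsMode g) (hg' : IsMode g') :
    lower g hg * raise g' hg' =
      raise g' hg' * lower g hg + (∫ k, (starRingEnd ℂ) (g k) * g' k) • 1 := by
  ext v n K
  simp only [Module.End.mul_apply, LinearMap.add_apply, LinearMap.smul_apply, Module.End.one_apply,
    Submodule.coe_add, SetLike.val_smul, Pi.add_apply, Pi.smul_apply, smul_eq_mul]
  have hsq : ∀ n : ℕ, (Real.sqrt (n + 1) : ℂ) ≠ 0 := fun n => by
    rw [Ne, Complex.ofReal_eq_zero, Real.sqrt_eq_zero (by positivity)]; positivity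
  rw [lower_apply]
  simp_rw [raise_apply_succ, Fin.sum_univ_succ, Fin.cons_zero, Fin.cons_succ,
    mul_left_comm ((starRingEnd ℂ) (g _)), integral_const_mul, ← mul_assoc]
  rw [mul_inv_cancel₀ (hsq n), one_mul]
  have c0 : ∀ k : R3, (Fin.cons k K : Fin (n + 1) → R3) ∘ (0 : Fin (n + 1)).succAbove = K :=
    fun k => by ext1 j; simp
  simp_rw [c0, mul_add]
  have i0 : Integrable fun k => (starRingEnd ℂ) (g k) * (g' k * (v : FockFn) n K) := by
    simp_rw [← mul_assoc]
    exact (hg.conj.mul hg').integrable.mul_const _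
  cases n with
  | zero =>
    simp only [Finset.univ_eq_empty, Finset.sum_empty, mul_zero, add_zero]
    simp_rw [← mul_assoc]
    rw [integral_mul_const]
    simp [raise_apply_zero]
  | succ n =>
    have cs : ∀ (i : Fin (n + 1)) (k : R3),
        (Fin.cons k K : Fin (n + 1 + 1) → R3) ∘ i.succ.succAbove =
        Fin.cons k (K ∘ i.succAbove) := fun i k => by
      ext1 j; refine Fin.cases ?_ (fun j => ?_) j <;> simp
    simp_rw [cs, Finset.mul_sum]
    have i1 : ∀ i : Fin (n + 1), Integrable fun k => (starRingEnd ℂ) (g k) *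
        (g' (K i) * (v : FockFn) (n + 1) (Fin.cons k (K ∘ i.succAbove))) := fun i => by
      simp_rw [mul_left_comm _ (g' (K i))]
      exact (v.2.integrable_mode_mul hg _).const_mul _
    rw [integral_add i0 (integrable_finsetSum _ fun i _ => i1 i),
      integral_finsetSum _ fun i _ => i1 i, raise_apply_succ]
    simp_rw [lower_apply, mul_left_comm _ (g' (K _)), integral_const_mul,
      mul_left_comm _ (Real.sqrt (n + 1) : ℂ), ← Finset.mul_sum]
    rw [← mul_assoc, inv_mul_cancel₀ (hsq n), one_mul, add_comm]
    congr 1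
    simp_rw [← mul_assoc]
    rw [integral_mul_const]

/-- Fubini's theorem together with symmetry of the wave function in its first two momenta. -/
lemma commute_lower {g g' : R3 → ℂ} (hg : IsMode g) (hg' : IsMode g') :
    Commute (lower g hg) (lower g' hg') := by
  ext v n K
  simp only [Module.End.mul_apply, lower_apply]
  simp_rw [mul_left_comm _ (Real.sqrt _ : ℂ), integral_const_mul]
  congr 2
  have hsw : ∀ k k' : R3, (v : FockFn) (n + 1 + 1) (Fin.cons k (Fin.cons k' K)) =
      (v : FockFn) (n + 1 + 1) (Fin.cons k' (Fin.cons k K)) := fun k k' => by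
    have h := IsFock.insertNth v.2 (1 : Fin (n + 1 + 1)) k (Fin.cons k' K)
    rw [← h]
    refine congrArg _ (funext fun j => ?_)
    refine Fin.cases ?_ (fun j => ?_) j
    · have : (0 : Fin (n + 1 + 1)) = (1 : Fin (n + 1 + 1)).succAbove 0 := by
        rw [Fin.succAbove_of_castSucc_lt]
        · rfl
        · simp
      conv_lhs => rw [this]
      rw [Fin.insertNth_apply_succAbove]; simp
    · refine Fin.cases ?_ (fun j => ?_) j
      · have : (Fin.succ 0 : Fin (n + 1 + 1)) = 1 := rfl
        rw [this, Fin.insertNth_apply_same]; rfl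
      · have : (j.succ.succ : Fin (n + 1 + 1)) = (1 : Fin (n + 1 + 1)).succAbove j.succ := by
          rw [Fin.succAbove_of_lt_succ]; simp [Fin.lt_def]
        rw [this, Fin.insertNth_apply_succAbove, ← this]; simp
  simp_rw [← integral_const_mul]
  rw [integral_integral_swap]
  · refine integral_congr_ae (ae_of_all _ fun k' => integral_congr_ae (ae_of_all _ fun k => ?_))
    simp only
    rw [hsw]; ring
  · obtain ⟨hm, -, -, M, R, -, h2, -⟩ := v.2
    have h1 := hg.conj.integrable.mul_prod hg'.conj.integrable
    have hmeas : Measurable fun p : R3 × R3 =>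
        (v : FockFn) (n + 1 + 1) (Fin.cons p.2 (Fin.cons p.1 K)) :=
      (hm _).comp (measurable_cons.comp (measurable_snd.prodMk
        (measurable_cons.comp (measurable_fst.prodMk measurable_const))))
    refine (h1.mul_bdd (c := M) hmeas.aestronglyMeasurable (ae_of_all _ fun p => h2 _ _)).congr
      (ae_of_all _ fun p => ?_)
    simp only [Function.uncurry]; ring

/-- Vectors have finitely many phonons, so annihilation operators are locally nilpotent. This is
what keeps the coherent state calculus algebraic. -/
lemma lower_pow_apply_eq_zero {g : R3 → ℂ} (hg : IsMode g) (v : Fock) :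
    ∃ N, (lower g hg ^ N) v = 0 := by
  obtain ⟨N, hN⟩ := fock_exists_bound v
  have : ∀ j n, N ≤ n + j → ((lower g hg ^ j) v : Fock).1 n = 0 := by
    intro j
    induction j with
    | zero => intro n hn; simpa using hN n hn
    | succ j ih =>
      intro n hn
      ext K
      rw [pow_succ', Module.End.mul_apply]
      change (lower g hg _ : FockFn) n K = 0
      rw [lower_apply]
      rw [ih (n + 1) (by omega)]; simp
  exact ⟨N, Subtype.ext (funext fun n => this N n (by omega))⟩

/-! #### Forms of the pointwise annihilation operators -/

lemma fock_exists_radius (v : Fock) : ∃ R : ℝ, ∀ k, R < ‖k‖ → ann k v = 0 := by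
  obtain ⟨-, -, -, -, R, -, -, h3⟩ := v.2
  refine ⟨R, fun k hk => Subtype.ext (funext fun n => funext fun K => ?_)⟩
  rw [ann_apply, h3 (n + 1) _ 0 (by simpa using hk), mul_zero]; rfl

lemma ann_bound {w : Fock} {N : ℕ} (hN : ∀ n, N ≤ n → (w : FockFn) n = 0) (k : R3) :
    ∀ n, N ≤ n → (ann k w : FockFn) n = 0 := fun n hn => by
  ext K; rw [ann_apply, hN (n + 1) (by omega)]; simp

lemma isMode_fockForm_ann (v w : Fock) : IsMode fun k => fockForm v (ann k w) := by
  obtain ⟨N, hN⟩ := fock_exists_bound w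
  obtain ⟨R, hR⟩ := fock_exists_radius w
  obtain ⟨hm, -, -, M, -, -, h2, -⟩ := w.2
  have hM : 0 ≤ M := (norm_nonneg _).trans (h2 0 0)
  have e : ∀ k, fockForm v (ann k w) = ∑ n ∈ Finset.range N, ∫ K,
      (starRingEnd ℂ) ((v : FockFn) n K) *
        ((Real.sqrt (n + 1) : ℂ) * (w : FockFn) (n + 1) (Fin.cons k K)) :=
    fun k => fockForm_eq_sum v (ann_bound hN k)
  refine ⟨?_, ∑ n ∈ Finset.range N, ∫ K, ‖(v : FockFn) n K‖ * (Real.sqrt (n + 1) * M), R,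
    fun k => ?_, fun k hk => by simp only [hR k hk, map_zero]⟩
  · simp_rw [e]
    refine Finset.measurable_sum _ fun n _ => ?_
    have : StronglyMeasurable fun p : R3 × (Fin n → R3) => (starRingEnd ℂ) ((v : FockFn) n p.2) *
        ((Real.sqrt (n + 1) : ℂ) * (w : FockFn) (n + 1) (Fin.cons p.1 p.2)) :=
      Measurable.stronglyMeasurable ((Complex.continuous_conj.measurable.comp
        ((v.2.1 n).comp measurable_snd)).mul (((hm (n + 1)).comp measurable_cons).const_mul _))
    exact this.integral_prod_right'.measurable
  · simp only [e]
    refine norm_sum_le_of_le _ fun n _ => ?_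
    refine norm_integral_le_of_norm_le ((v.2.integrable n).norm.mul_const _)
      (ae_of_all _ fun K => ?_)
    rw [norm_mul, norm_mul, RCLike.norm_conj, Complex.norm_real,
      Real.norm_of_nonneg (Real.sqrt_nonneg _)]
    exact mul_le_mul_of_nonneg_left (mul_le_mul_of_nonneg_left (h2 _ _) (Real.sqrt_nonneg _))
      (norm_nonneg _)

lemma integrable_fockForm_ann_ann (v w : Fock) :
    Integrable fun k => fockForm (ann k v) (ann k w) := by
  obtain ⟨N, hN⟩ := fock_exists_bound w
  have e : ∀ k, fockForm (ann k v) (ann k w) = ∑ n ∈ Finset.range N, ∫ K,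
      ((n + 1 : ℕ) : ℂ) * ((starRingEnd ℂ) ((v : FockFn) (n + 1) (Fin.cons k K)) *
        (w : FockFn) (n + 1) (Fin.cons k K)) := fun k => by
    rw [fockForm_eq_sum _ (ann_bound hN k)]
    refine Finset.sum_congr rfl fun n _ => integral_congr_ae (ae_of_all _ fun K => ?_)
    have h : (Real.sqrt (n + 1) : ℂ) * (Real.sqrt (n + 1) : ℂ) = ((n + 1 : ℕ) : ℂ) := by
      rw [← Complex.ofReal_mul, Real.mul_self_sqrt (by positivity)]; push_cast; rfl
    simp only [ann_apply, map_mul, Complex.conj_ofReal]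
    rw [← h]; ring
  simp_rw [e]
  refine integrable_finsetSum _ fun n _ => ?_
  exact ((integrable_cons (v.2.integrable_inner w.2 (n + 1))).const_mul _).integral_prod_left

lemma fockForm_lower_right {g : R3 → ℂ} (hg : IsMode g) (v w : Fock) :
    fockForm v (lower g hg w) = ∫ k, (starRingEnd ℂ) (g k) * fockForm v (ann k w) := by
  obtain ⟨N, hN⟩ := fock_exists_bound w
  have hN' : ∀ n, N ≤ n → (lower g hg w : FockFn) n = 0 := fun n hn => by
    ext K; rw [lower_apply, hN (n + 1) (by omega)]; simp
  rw [fockForm_eq_sum v hN']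
  simp_rw [fockForm_eq_sum v (ann_bound hN _), Finset.mul_sum]
  have hint : ∀ n, Integrable (fun p : R3 × (Fin n → R3) => (starRingEnd ℂ) (g p.1) *
      ((starRingEnd ℂ) ((v : FockFn) n p.2) * (ann p.1 w : FockFn) n p.2))
      (volume.prod volume) := fun n => by
    refine ((fock_integrable_smear v w hg n).const_mul (Real.sqrt (n + 1) : ℂ)).congr
      (ae_of_all _ fun p => ?_)
    simp only [ann_apply]; ring
  simp_rw [← integral_const_mul]
  rw [integral_finsetSum _ fun n _ => (hint n).integral_prod_left]
  refine Finset.sum_congr rfl fun n _ => ?_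
  rw [integral_integral_swap (hint n)]
  refine integral_congr_ae (ae_of_all _ fun K => ?_)
  simp only [lower_apply, ann_apply]
  rw [← integral_const_mul, ← integral_const_mul]
  exact integral_congr_ae (ae_of_all _ fun k => by simp only; ring)

/-- Cauchy-Schwarz in k for a(g)w = ∫ ḡ(k) a(k)w dk, tested against u = a(g)w itself. The pointwise
weight |g(k)|/G is chosen so that the terms with ‖u‖² add up to at most ‖u‖², half of the left side.
-/
lemma fockForm_lower_lower_le {g : R3 → ℂ} (hg : IsMode g) {S : Set R3} (hS : MeasurableSet S)
    (hgS : ∀ k, k ∉ S → g k = 0) {G : ℝ} (hG : 0 < G) (hle : ∫ k, ‖g k‖ ^ 2 ≤ G) (w : Fock) :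
    (fockForm (lower g hg w) (lower g hg w)).re ≤
      G * ∫ k in S, (fockForm (ann k w) (ann k w)).re := by
  set u := lower g hg w
  set X := (fockForm u u).re
  have hX : 0 ≤ X := fockForm_pos u
  have hgi : Integrable fun k => ‖g k‖ ^ 2 := by
    refine ((hg.conj.mul hg).integrable.norm).congr (ae_of_all _ fun k => ?_)
    simp [sq]
  have hni : Integrable (S.indicator fun k => (fockForm (ann k w) (ann k w)).re) :=
    ((integrable_fockForm_ann_ann w w).re).indicator hS
  have h1 : 2 * ‖fockForm u u‖ ≤ ∫ k, (G⁻¹ * X * ‖g k‖ ^ 2 +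
      G * S.indicator (fun k => (fockForm (ann k w) (ann k w)).re) k) := by
    have e : fockForm u u = ∫ k, (starRingEnd ℂ) (g k) * fockForm u (ann k w) :=
      fockForm_lower_right hg u w
    rw [e]
    have : (2 : ℝ) * ‖∫ k, (starRingEnd ℂ) (g k) * fockForm u (ann k w)‖ =
        ‖∫ k, 2 * ((starRingEnd ℂ) (g k) * fockForm u (ann k w))‖ := by
      rw [integral_const_mul, norm_mul]; simp
    rw [this]
    refine norm_integral_le_of_norm_le ((hgi.const_mul _).add (hni.const_mul _))
      (ae_of_all _ fun k => ?_)
    rw [norm_mul, norm_mul, RCLike.norm_conj, Complex.norm_two]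
    by_cases hk : k ∈ S
    · rw [Set.indicator_of_mem hk]
      by_cases hg0 : ‖g k‖ = 0
      · rw [hg0]
        have := fockForm_pos (ann k w)
        simp; positivity
      have hgp : 0 < ‖g k‖ := lt_of_le_of_ne (norm_nonneg _) (Ne.symm hg0)
      have := two_mul_norm_fockForm_le u (ann k w) (s := G⁻¹ * ‖g k‖) (by positivity)
      have h2 := mul_le_mul_of_nonneg_left this hgp.le
      calc _ = ‖g k‖ * (2 * ‖fockForm u (ann k w)‖) := by ring
        _ ≤ _ := h2
        _ = _ := by simp only [X]; field_simp
    · rw [Set.indicator_of_notMem hk, hgS k hk]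
      simp
  rw [integral_add (hgi.const_mul _) (hni.const_mul _), integral_const_mul, integral_const_mul,
    integral_indicator hS] at h1
  have h2 : X ≤ ‖fockForm u u‖ := Complex.re_le_norm _
  have h3 : G⁻¹ * X * ∫ k, ‖g k‖ ^ 2 ≤ X := by
    calc _ ≤ G⁻¹ * X * G := mul_le_mul_of_nonneg_left hle (by positivity)
      _ = X := by field_simp
  linarith

lemma fockForm_raise_raise {g : R3 → ℂ} (hg : IsMode g) (v : Fock) :
    (fockForm (raise g hg v) (raise g hg v)).re =
      (fockForm (lower g hg v) (lower g hg v)).re + (∫ k, ‖g k‖ ^ 2) * (fockForm v v).re := by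
  have h := LinearMap.congr_fun (lower_mul_raise hg hg) v
  simp only [Module.End.mul_apply, LinearMap.add_apply, LinearMap.smul_apply,
    Module.End.one_apply] at h
  rw [fockForm_raise_left, h, map_add, map_smul, smul_eq_mul, Complex.add_re,
    ← adj_symm fockForm_herm (fun v w => fockForm_raise_left hg v w)]
  have e : ∫ k, (starRingEnd ℂ) (g k) * g k = ((∫ k, ‖g k‖ ^ 2 : ℝ) : ℂ) := by
    rw [← integral_complex_ofReal]
    refine integral_congr_ae (ae_of_all _ fun k => ?_)
    simp only
    rw [mul_comm, Complex.mul_conj, Complex.normSq_eq_norm_sq]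
  rw [e, Complex.re_ofReal_mul]

/-! ### Radial integrals -/

/-- The area of the unit sphere. -/
def sphereArea : ℝ := 3 * volume.real (Metric.ball (0 : R3) 1)

lemma sphereArea_nonneg : 0 ≤ sphereArea := by unfold sphereArea; positivity

lemma integrable_radial {f : ℝ → ℝ} (h : IntegrableOn (fun y => y ^ 2 * f y) (Set.Ioi 0)) :
    Integrable (fun k : R3 => f ‖k‖) := by
  rw [integrable_fun_norm_addHaar]
  simpa using h

lemma integral_radial (f : ℝ → ℝ) :
    ∫ k : R3, f ‖k‖ = sphereArea * ∫ y in Set.Ioi (0 : ℝ), y ^ 2 * f y := by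
  rw [integral_fun_norm_addHaar volume f]
  simp [sphereArea, mul_assoc]

lemma integral_ball_inv_sq {r : ℝ} (hr : 0 ≤ r) :
    IntegrableOn (fun k : R3 => 1 / ‖k‖ ^ 2) {k | ‖k‖ < r} ∧
      ∫ k in {k : R3 | ‖k‖ < r}, 1 / ‖k‖ ^ 2 = sphereArea * r := by
  have hm : MeasurableSet {k : R3 | ‖k‖ < r} := measurableSet_lt measurable_norm measurable_const
  have e : ∀ k : R3, ({k : R3 | ‖k‖ < r}.indicator (fun k : R3 => 1 / ‖k‖ ^ 2)) k =
      (Set.Iio r).indicator (fun y => 1 / y ^ 2) ‖k‖ := fun k => rfl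
  have e2 : Set.EqOn (fun y : ℝ => y ^ 2 * (Set.Iio r).indicator (fun y => 1 / y ^ 2) y)
      ((Set.Iio r).indicator fun _ => 1) (Set.Ioi 0) := fun y hy => by
    by_cases h : y ∈ Set.Iio r
    · simp only [Set.indicator_of_mem h]
      have : y ≠ 0 := (Set.mem_Ioi.1 hy).ne'
      field_simp
    · simp only [Set.indicator_of_notMem h, mul_zero]
  have hI : Set.Iio r ∩ Set.Ioi 0 = Set.Ioo 0 r := by ext; simp [and_comm]
  have h1 : IntegrableOn ((Set.Iio r).indicator fun _ => (1 : ℝ)) (Set.Ioi 0) := by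
    rw [IntegrableOn, integrable_indicator_iff measurableSet_Iio, IntegrableOn,
      Measure.restrict_restrict measurableSet_Iio, hI]
    exact integrableOn_const (by simp)
  constructor
  · rw [← integrable_indicator_iff hm]
    simp_rw [show ({k : R3 | ‖k‖ < r}.indicator (fun k : R3 => 1 / ‖k‖ ^ 2)) =
      fun k => (Set.Iio r).indicator (fun y => 1 / y ^ 2) ‖k‖ from funext e]
    exact integrable_radial (h1.congr_fun e2.symm measurableSet_Ioi)
  · rw [← integral_indicator hm]
    simp_rw [e]
    rw [integral_radial, setIntegral_congr_fun measurableSet_Ioi e2,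
      integral_indicator measurableSet_Iio, Measure.restrict_restrict measurableSet_Iio, hI]
    simp [hr]

lemma integral_compl_ball_inv_pow {r : ℝ} (hr : 0 < r) :
    IntegrableOn (fun k : R3 => 1 / ‖k‖ ^ 4) {k | r ≤ ‖k‖} ∧
      ∫ k in {k : R3 | r ≤ ‖k‖}, 1 / ‖k‖ ^ 4 = sphereArea / r := by
  have hm : MeasurableSet {k : R3 | r ≤ ‖k‖} := measurableSet_le measurable_const measurable_norm
  have e : ∀ k : R3, ({k : R3 | r ≤ ‖k‖}.indicator (fun k : R3 => 1 / ‖k‖ ^ 4)) k =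
      (Set.Ici r).indicator (fun y => 1 / y ^ 4) ‖k‖ := fun k => rfl
  have e2 : Set.EqOn (fun y : ℝ => y ^ 2 * (Set.Ici r).indicator (fun y => 1 / y ^ 4) y)
      ((Set.Ici r).indicator fun y => y ^ (-2 : ℝ)) (Set.Ioi 0) := fun y hy => by
    by_cases h : y ∈ Set.Ici r
    · simp only [Set.indicator_of_mem h]
      have : y ≠ 0 := (Set.mem_Ioi.1 hy).ne'
      rw [Real.rpow_neg (Set.mem_Ioi.1 hy).le, show (2 : ℝ) = ((2 : ℕ) : ℝ) by norm_num,
        Real.rpow_natCast]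
      field_simp
    · simp only [Set.indicator_of_notMem h, mul_zero]
  have hI : Set.Ici r ∩ Set.Ioi 0 = Set.Ici r :=
    Set.inter_eq_left.2 fun y hy => hr.trans_le hy
  have h1 : IntegrableOn ((Set.Ici r).indicator fun y : ℝ => y ^ (-2 : ℝ)) (Set.Ioi 0) := by
    rw [IntegrableOn, integrable_indicator_iff measurableSet_Ici, IntegrableOn,
      Measure.restrict_restrict measurableSet_Ici, hI]
    exact (integrableOn_Ici_iff_integrableOn_Ioi).2
      (integrableOn_Ioi_rpow_of_lt (by norm_num) hr)
  constructor
  · rw [← integrable_indicator_iff hm]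
    simp_rw [show ({k : R3 | r ≤ ‖k‖}.indicator (fun k : R3 => 1 / ‖k‖ ^ 4)) =
      fun k => (Set.Ici r).indicator (fun y => 1 / y ^ 4) ‖k‖ from funext e]
    exact integrable_radial (h1.congr_fun e2.symm measurableSet_Ioi)
  · rw [← integral_indicator hm]
    simp_rw [e]
    rw [integral_radial, setIntegral_congr_fun measurableSet_Ioi e2,
      integral_indicator measurableSet_Ici, Measure.restrict_restrict measurableSet_Ici, hI,
      integral_Ici_eq_integral_Ioi, integral_Ioi_rpow_of_lt (by norm_num) hr]
    norm_num
    rw [Real.rpow_neg_one, div_eq_mul_inv]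

/-- 1/|k| ≤ 1 + 1/|k|², and the right side is integrable on balls in three dimensions. -/
lemma IsMode.integrable_inv_norm_mul {g : R3 → ℂ} (hg : IsMode g) :
    Integrable fun k => (1 / ‖k‖ : ℝ) * g k := by
  obtain ⟨hm, M, R, hb, hs⟩ := hg
  set S : Set R3 := {k | ‖k‖ < |R| + 1}
  have hSm : MeasurableSet S := measurableSet_lt measurable_norm measurable_const
  have hSf : volume S < ⊤ := by
    have : S = Metric.ball 0 (|R| + 1) := by ext; simp [S]
    rw [this]; exact measure_ball_lt_top
  have h1 : IntegrableOn (fun k : R3 => 1 + 1 / ‖k‖ ^ 2) S :=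
    (integrableOn_const hSf.ne).add (integral_ball_inv_sq (by positivity)).1
  have h2 : Integrable (S.indicator fun k => (1 + 1 / ‖k‖ ^ 2) * M) := by
    rw [integrable_indicator_iff hSm]; exact h1.mul_const M
  have hme : Measurable fun k : R3 => (((1 / ‖k‖ : ℝ) : ℝ) : ℂ) * g k :=
    (Complex.measurable_ofReal.comp (by fun_prop)).mul hm
  refine h2.mono' hme.aestronglyMeasurable (ae_of_all _ fun k => ?_)
  by_cases hk : k ∈ S
  · rw [Set.indicator_of_mem hk, norm_mul, Complex.norm_real, Real.norm_of_nonneg (by positivity)]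
    refine mul_le_mul ?_ (hb k) (norm_nonneg _) (by positivity)
    rw [one_div, one_div]
    have h3 : ‖k‖⁻¹ ^ 2 = (‖k‖ ^ 2)⁻¹ := inv_pow _ _
    nlinarith [sq_nonneg (‖k‖⁻¹ - 1)]
  · have : R < ‖k‖ := by
      have : |R| + 1 ≤ ‖k‖ := by simpa [S] using hk
      linarith [le_abs_self R]
    rw [Set.indicator_of_notMem hk, hs k this]; simp

/-! ### Finite sums of products -/

/-- The inner product of `L²(ℝ³)`. -/
def eip (φ χ : R3 → ℂ) : ℂ := ∫ x, (starRingEnd ℂ) (φ x) * χ x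

/-- Multiplication by a plane wave. -/
def waveMul (k : R3) (φ : R3 → ℂ) : R3 → ℂ :=
  fun x => Complex.exp (Complex.I * ((inner ℝ k x : ℝ) : ℂ)) * φ x

lemma memLp_waveMul {φ : R3 → ℂ} (h : MemLp φ 2 volume) (k : R3) : MemLp (waveMul k φ) 2 volume :=
  h.of_le ((Continuous.aestronglyMeasurable (by fun_prop)).mul h.1)
    (ae_of_all _ fun x => by rw [waveMul, norm_mul, norm_exp_I_mul, one_mul])

lemma l2Sq_waveMul (k : R3) (φ : R3 → ℂ) : l2Sq (waveMul k φ) = l2Sq φ := by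
  simp only [l2Sq, waveMul, norm_mul, norm_exp_I_mul, one_mul]

lemma eip_conj (φ χ : R3 → ℂ) : (starRingEnd ℂ) (eip φ χ) = eip χ φ := by
  rw [eip, ← integral_conj, eip]
  congr 1; ext x; simp [mul_comm]

lemma tendsto_eip {f g : ℕ → R3 → ℂ} {φ χ : R3 → ℂ} (hf : ∀ t, MemLp (f t) 2 volume)
    (hg : ∀ t, MemLp (g t) 2 volume) (hφ : MemLp φ 2 volume) (hχ : MemLp χ 2 volume)
    (h : Tendsto (fun t => l2Sq (f t - φ)) atTop (𝓝 0))
    (h' : Tendsto (fun t => l2Sq (g t - χ)) atTop (𝓝 0)) :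
    Tendsto (fun t => eip (f t) (g t)) atTop (𝓝 (eip φ χ)) := by
  have key : ∀ {f : ℕ → R3 → ℂ} {φ : R3 → ℂ} (hf : ∀ t, MemLp (f t) 2 volume)
      (hφ : MemLp φ 2 volume), Tendsto (fun t => l2Sq (f t - φ)) atTop (𝓝 0) →
      Tendsto (fun t => (hf t).toLp (f t)) atTop (𝓝 (hφ.toLp φ)) := by
    intro f φ hf hφ h
    rw [tendsto_iff_norm_sub_tendsto_zero]
    have := (Real.continuous_sqrt.tendsto 0).comp h
    rw [Real.sqrt_zero] at this
    refine this.congr fun t => ?_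
    rw [Function.comp, l2Sq_eq_norm_toLp ((hf t).sub hφ), Real.sqrt_sq (norm_nonneg _),
      MemLp.toLp_sub]
  have := (key hf hφ h).inner (𝕜 := ℂ) (key hg hχ h')
  simp_rw [inner_toLp] at this
  exact this

section Tens

variable {J : Type*} [Fintype J]

/-- The vector `∑ φ_j ⊗ η_j`. -/
def tens (φ : J → R3 → ℂ) (η : J → Fock) : PolaronFn :=
  fun n x K => ∑ j, φ j x * (η j : FockFn) n K

lemma ip_tens {φ φ' : J → R3 → ℂ} (hφ : ∀ j, MemLp (φ j) 2 volume)
    (hφ' : ∀ j, MemLp (φ' j) 2 volume) (η η' : J → Fock) :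
    ip (tens φ η) (tens φ' η') =
      mpair (fun i j => eip (φ i) (φ' j)) fun i j => fockForm (η i) (η' j) := by
  choose N hN using fun j => fock_exists_bound (η' j)
  set M := Finset.univ.sup N
  have hM : ∀ j n, M ≤ n → (η' j : FockFn) n = 0 := fun j n hn =>
    hN j n ((Finset.le_sup (f := N) (Finset.mem_univ j)).trans hn)
  have h1 : ∀ n, ∫ p : R3 × (Fin n → R3), (starRingEnd ℂ) (tens φ η n p.1 p.2) *
      tens φ' η' n p.1 p.2 = ∑ i, ∑ j, eip (φ i) (φ' j) *
        ∫ K, (starRingEnd ℂ) ((η i : FockFn) n K) * (η' j : FockFn) n K := fun n => by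
    have e : ∀ p : R3 × (Fin n → R3), (starRingEnd ℂ) (tens φ η n p.1 p.2) *
        tens φ' η' n p.1 p.2 = ∑ i, ∑ j, ((starRingEnd ℂ) (φ i p.1) * φ' j p.1) *
        ((starRingEnd ℂ) ((η i : FockFn) n p.2) * (η' j : FockFn) n p.2) := fun p => by
      simp only [tens, map_sum, map_mul, Finset.sum_mul_sum]
      exact Finset.sum_congr rfl fun i _ => Finset.sum_congr rfl fun j _ => by ring
    have hint : ∀ i j, Integrable (fun p : R3 × (Fin n → R3) =>
        ((starRingEnd ℂ) (φ i p.1) * φ' j p.1) *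
        ((starRingEnd ℂ) ((η i : FockFn) n p.2) * (η' j : FockFn) n p.2)) :=
      fun i j => (integrable_conj_mul (hφ i) (hφ' j)).mul_prod
        (IsFock.integrable_inner (η i).2 (η' j).2 n)
    simp_rw [e]
    rw [integral_finsetSum _ fun i _ => integrable_finsetSum _ fun j _ => hint i j]
    refine Finset.sum_congr rfl fun i _ => ?_
    rw [integral_finsetSum _ fun j _ => hint i j]
    refine Finset.sum_congr rfl fun j _ => ?_
    rw [Measure.volume_eq_prod, integral_prod_mul (fun x => (starRingEnd ℂ) (φ i x) * φ' j x)
      (fun K => (starRingEnd ℂ) ((η i : FockFn) n K) * (η' j : FockFn) n K)]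
    rfl
  rw [ip, tsum_eq_sum (s := Finset.range M)]
  · simp_rw [h1]
    rw [Finset.sum_comm, mpair]
    refine Finset.sum_congr rfl fun i _ => ?_
    rw [Finset.sum_comm]
    refine Finset.sum_congr rfl fun j _ => ?_
    rw [fockForm_eq_sum _ (hM j), Finset.mul_sum]
  · intro n hn
    rw [h1]
    refine Finset.sum_eq_zero fun i _ => Finset.sum_eq_zero fun j _ => ?_
    rw [hM j n (by simpa using hn)]; simp

lemma annihilate_tens (k : R3) (φ : J → R3 → ℂ) (η : J → Fock) :
    annihilate k (tens φ η) = tens φ fun j => ann k (η j) := by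
  ext n x K
  simp only [annihilate, tens, ann_apply, Finset.mul_sum]
  exact Finset.sum_congr rfl fun j _ => by ring

lemma planeWave_tens (k : R3) (φ : J → R3 → ℂ) (η : J → Fock) :
    planeWave k (tens φ η) = tens (fun j => waveMul k (φ j)) η := by
  ext n x K
  simp only [planeWave, tens, waveMul, Finset.mul_sum]
  exact Finset.sum_congr rfl fun j _ => by ring

lemma normSqH_tens {φ : J → R3 → ℂ} (hφ : ∀ j, MemLp (φ j) 2 volume) (η : J → Fock) :
    normSqH (tens φ η) =
      (mpair (fun i j => eip (φ i) (φ j)) fun i j => fockForm (η i) (η j)).re := by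
  rw [normSqH, ip_tens hφ hφ]

lemma numberForm_tens {φ : J → R3 → ℂ} (hφ : ∀ j, MemLp (φ j) 2 volume) (η : J → Fock) :
    numberForm (tens φ η) = ∫ k, (mpair (fun i j => eip (φ i) (φ j)) fun i j =>
      fockForm (ann k (η i)) (ann k (η j))).re := by
  simp only [numberForm, annihilate_tens, normSqH_tens hφ]

/-- The density in momentum space of the interaction. -/
def intDensity (φ : J → R3 → ℂ) (η : J → Fock) (k : R3) : ℂ :=
  mpair (fun i j => eip (φ i) (waveMul k (φ j))) fun i j => fockForm (η i) (ann k (η j))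

lemma interactionForm_tens {φ : J → R3 → ℂ} (hφ : ∀ j, MemLp (φ j) 2 volume) (η : J → Fock) :
    interactionForm (tens φ η) = 1 / (Real.sqrt 2 * Real.pi) *
      ∫ k, 1 / ‖k‖ * (2 * (intDensity φ η k).re) := by
  rw [interactionForm]
  congr 2
  ext k
  have h2 := fun j => memLp_waveMul (hφ j) k
  rw [annihilate_tens, planeWave_tens, ip_tens hφ h2, ip_tens h2 hφ]
  have e : mpair (fun i j => eip (waveMul k (φ i)) (φ j)) (fun i j => fockForm (ann k (η i)) (η j)) =
      (starRingEnd ℂ) (intDensity φ η k) := by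
    simp only [intDensity, mpair, map_sum, map_mul, eip_conj]
    rw [Finset.sum_comm]
    refine Finset.sum_congr rfl fun i _ => Finset.sum_congr rfl fun j _ => ?_
    rw [fockForm_herm]
  rw [e, Complex.add_re, Complex.conj_re, two_mul]
  rfl

/-! #### The electron form -/

lemma integral_weight_norm_sq {w : R3 → ℝ} {g : J → R3 → ℂ}
    (h : ∀ i j, Integrable fun x => (w x : ℂ) * ((starRingEnd ℂ) (g i x) * g j x)) (u : J → ℂ) :
    ∫ x, w x * ‖∑ j, u j * g j x‖ ^ 2 =
      (mpair (fun i j => ∫ x, (w x : ℂ) * ((starRingEnd ℂ) (g i x) * g j x)) (rankOne u)).re := by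
  have e : ∀ x, ((w x * ‖∑ j, u j * g j x‖ ^ 2 : ℝ) : ℂ) = ∑ i, ∑ j,
      ((w x : ℂ) * ((starRingEnd ℂ) (g i x) * g j x)) * rankOne u i j := fun x => by
    have : ((‖∑ j, u j * g j x‖ ^ 2 : ℝ) : ℂ) =
        (starRingEnd ℂ) (∑ j, u j * g j x) * ∑ j, u j * g j x := by
      rw [mul_comm, Complex.mul_conj, Complex.normSq_eq_norm_sq]
    rw [Complex.ofReal_mul, this, map_sum, Finset.sum_mul_sum, Finset.mul_sum]
    refine Finset.sum_congr rfl fun i _ => ?_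
    rw [Finset.mul_sum]
    refine Finset.sum_congr rfl fun j _ => ?_
    rw [rankOne, map_mul]; ring
  have : ((∫ x, w x * ‖∑ j, u j * g j x‖ ^ 2 : ℝ) : ℂ) =
      mpair (fun i j => ∫ x, (w x : ℂ) * ((starRingEnd ℂ) (g i x) * g j x)) (rankOne u) := by
    rw [← integral_complex_ofReal]
    simp_rw [e]
    rw [integral_finsetSum _ fun i _ => integrable_finsetSum _ fun j _ => (h i j).mul_const _]
    refine Finset.sum_congr rfl fun i _ => ?_
    rw [integral_finsetSum _ fun j _ => (h i j).mul_const _]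
    exact Finset.sum_congr rfl fun j _ => integral_mul_const _ _
  rw [← this, Complex.ofReal_re]

lemma l2Sq_sum {g : J → R3 → ℂ} (h : ∀ j, MemLp (g j) 2 volume) (u : J → ℂ) :
    l2Sq (fun x => ∑ j, u j * g j x) =
      (mpair (fun i j => eip (g i) (g j)) (rankOne u)).re := by
  have := integral_weight_norm_sq (w := fun _ => 1) (g := g)
    (fun i j => by simpa using integrable_conj_mul (h i) (h j)) u
  simpa [l2Sq, eip] using this

/-- The matrix of the potential. -/
def potMat (V : R3 → ℝ) (f : J → R3 → ℂ) (i j : J) : ℂ :=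
  ∫ x, (V x : ℂ) * ((starRingEnd ℂ) (f i x) * f j x)

/-- The matrix of the kinetic energy. -/
def kinMat (A : R3 → R3) (f : J → R3 → ℂ) (i j : J) : ℂ :=
  ∑ l, eip (dA A l (f i)) (dA A l (f j))

lemma IsTest.integrable_pot_mul {V : R3 → ℝ} (hV : LocallyIntegrable V volume) {f g : R3 → ℂ}
    (hf : IsTest f) (hg : IsTest g) :
    Integrable fun x => (V x : ℂ) * ((starRingEnd ℂ) (f x) * g x) := by
  have hre : Continuous fun x => ‖(starRingEnd ℂ) (f x) * g x‖ :=
    ((Complex.continuous_conj.comp hf.continuous).mul hg.continuous).norm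
  have hc : HasCompactSupport fun x => ‖(starRingEnd ℂ) (f x) * g x‖ := by
    refine hg.2.mono fun x hx => ?_
    simp only [Function.mem_support, norm_mul] at hx ⊢
    intro h0; simp [h0] at hx
  have h1 := integrable_mul_of_locallyIntegrable hV hre hc
  refine h1.mono ?_ (ae_of_all _ fun x => by simp)
  refine (Complex.continuous_ofReal.comp_aestronglyMeasurable hV.aestronglyMeasurable).mul ?_
  exact ((Complex.continuous_conj.comp hf.continuous).mul hg.continuous).aestronglyMeasurable

lemma dA_sum {A : R3 → R3} {f : J → R3 → ℂ} (hf : ∀ j, IsTest (f j)) (u : J → ℂ) (l : Fin 3) :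
    dA A l (fun x => ∑ j, u j * f j x) = fun x => ∑ j, u j * dA A l (f j) x := by
  ext x
  have : partialD l (fun x => ∑ j, u j * f j x) x = ∑ j, u j * partialD l (f j) x := by
    simp only [partialD]
    rw [fderiv_fun_sum fun j _ => ((hf j).differentiable x).const_mul (u j), sum_apply]
    refine Finset.sum_congr rfl fun j _ => ?_
    rw [fderiv_const_mul ((hf j).differentiable x), smul_apply, smul_eq_mul]
  simp only [dA, this, Finset.mul_sum, ← Finset.sum_add_distrib]
  exact Finset.sum_congr rfl fun j _ => by ring

lemma isTest_lincomb {f : J → R3 → ℂ} (hf : ∀ j, IsTest (f j)) (u : J → ℂ) :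
    IsTest (fun x => ∑ j, u j * f j x) := by
  have := isTest_sum Finset.univ fun j _ => (hf j).const_smul (u j)
  convert this using 1
  ext x; simp

lemma sum_kinetic_lincomb {A : R3 → R3} (hA : VectorL2Loc A) {f : J → R3 → ℂ}
    (hf : ∀ j, IsTest (f j)) (u : J → ℂ) :
    ∑ l, l2Sq (dA A l (fun x => ∑ j, u j * f j x)) = (mpair (kinMat A f) (rankOne u)).re := by
  have : mpair (kinMat A f) (rankOne u) =
      ∑ l, mpair (fun i j => eip (dA A l (f i)) (dA A l (f j))) (rankOne u) := by
    simp only [mpair, kinMat, Finset.sum_mul]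
    rw [Finset.sum_comm]
    calc _ = ∑ j, ∑ l, ∑ i, eip (dA A l (f i)) (dA A l (f j)) * rankOne u i j :=
          Finset.sum_congr rfl fun i _ => Finset.sum_comm
      _ = ∑ l, ∑ j, ∑ i, eip (dA A l (f i)) (dA A l (f j)) * rankOne u i j := Finset.sum_comm
      _ = _ := Finset.sum_congr rfl fun l _ => Finset.sum_comm
  rw [this, Complex.re_sum]
  refine Finset.sum_congr rfl fun l _ => ?_
  rw [dA_sum hf, l2Sq_sum fun j => (hf j).memLp_dA hA l]

lemma potEnergy_lincomb {V : R3 → ℝ} (hV : LocallyIntegrable V volume) {f : J → R3 → ℂ}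
    (hf : ∀ j, IsTest (f j)) (u : J → ℂ) :
    potEnergy V (fun x => ∑ j, u j * f j x) = (mpair (potMat V f) (rankOne u)).re :=
  integral_weight_norm_sq (fun i j => (hf i).integrable_pot_mul hV (hf j)) u

/-- The electron form is defined fibrewise in the phonon momenta. Integrating the fibres turns rank
one matrices of momentum amplitudes into the Gram matrix of the Fock factors. -/
lemma integral_rankOne (M : J → J → ℂ) (η : J → Fock) :
    ∑' n, ∫ K, (mpair M (rankOne fun j => (η j : FockFn) n K)).re =
      (mpair M fun i j => fockForm (η i) (η j)).re := by
  choose N hN using fun j => fock_exists_bound (η j)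
  set L := Finset.univ.sup N
  have hL : ∀ j n, L ≤ n → (η j : FockFn) n = 0 := fun j n hn =>
    hN j n ((Finset.le_sup (f := N) (Finset.mem_univ j)).trans hn)
  rw [tsum_eq_sum (s := Finset.range L) fun n hn => by
    have : ∀ j, (η j : FockFn) n = 0 := fun j => hL j n (by simpa using hn)
    simp [this, mpair, rankOne]]
  have hi : ∀ n i j, Integrable fun K => M i j *
      rankOne (fun j => (η j : FockFn) n K) i j :=
    fun n i j => (IsFock.integrable_inner (η i).2 (η j).2 n).const_mul _
  have h1 : ∀ n, ∫ K, (mpair M (rankOne fun j => (η j : FockFn) n K)).re =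
      (∑ i, ∑ j, M i j * ∫ K, (starRingEnd ℂ) ((η i : FockFn) n K) * (η j : FockFn) n K).re := by
    intro n
    have h2 : ∫ K, mpair M (rankOne fun j => (η j : FockFn) n K) =
        ∑ i, ∑ j, M i j * ∫ K, (starRingEnd ℂ) ((η i : FockFn) n K) * (η j : FockFn) n K := by
      simp only [mpair]
      rw [integral_finsetSum _ fun i _ => integrable_finsetSum _ fun j _ => hi n i j]
      refine Finset.sum_congr rfl fun i _ => ?_
      rw [integral_finsetSum _ fun j _ => hi n i j]
      exact Finset.sum_congr rfl fun j _ => integral_const_mul _ _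
    rw [← h2]
    exact integral_re (𝕜 := ℂ)
      (integrable_finsetSum _ fun i _ => integrable_finsetSum _ fun j _ => hi n i j)
  simp_rw [h1]
  rw [← Complex.re_sum, Finset.sum_comm, mpair]
  congr 1
  refine Finset.sum_congr rfl fun i _ => ?_
  rw [Finset.sum_comm]
  refine Finset.sum_congr rfl fun j _ => ?_
  rw [fockForm_eq_sum _ (hL j), Finset.mul_sum]

lemma electronForm_tens {A : R3 → R3} (hA : VectorL2Loc A) {V : R3 → ℝ}
    (hV : LocallyIntegrable V volume) (hVf : InfFormBounded V) {f : J → R3 → ℂ}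
    (hf : ∀ j, IsTest (f j)) (η : J → Fock) :
    electronForm A V (tens f η) = (mpair (kinMat A f) fun i j => fockForm (η i) (η j)).re +
      (mpair (potMat V f) fun i j => fockForm (η i) (η j)).re := by
  have h : ∀ n (K : Fin n → R3), schrodingerForm A V (fun x => tens f η n x K) =
      (mpair (fun i j => kinMat A f i j + potMat V f i j)
        (rankOne fun j => (η j : FockFn) n K)).re := fun n K => by
    have e : (fun x => tens f η n x K) = fun x => ∑ j, (η j : FockFn) n K * f j x := by
      ext x; simp only [tens, mul_comm]
    rw [e, (isTest_lincomb hf _).schrodingerForm_eq hA hV hVf, testEnergy,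
      sum_kinetic_lincomb hA hf, potEnergy_lincomb hV hf, mpair_add_left, Complex.add_re]
  simp only [electronForm, h]
  rw [integral_rankOne, mpair_add_left, Complex.add_re]

end Tens

/-! ### Continuity of the Fröhlich form in the electron factors -/

/-- The exponential constant is harmless: only some uniform majorant is needed for dominated
convergence. -/
lemma h1Sq_sum_le {A : R3 → R3} (hA : VectorL2Loc A) {ι : Type*} (s : Finset ι)
    {g : ι → R3 → ℂ} (h : ∀ i ∈ s, MemH1 A (g i)) :
    h1Sq A (∑ i ∈ s, g i) ≤ 2 ^ s.card * ∑ i ∈ s, h1Sq A (g i) := by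
  classical
  induction s using Finset.induction_on with
  | empty =>
    have := h1Sq_smul (A := A) 0 (memH1_zero hA)
    simpa using this.le
  | insert a s ha ih =>
    rw [Finset.sum_insert ha, Finset.sum_insert ha, Finset.card_insert_of_notMem ha]
    have h1 := ih fun i hi => h i (by simp [hi])
    have h2 := h1Sq_add_le hA (h a (by simp)) (memH1_sum hA s fun i hi => h i (by simp [hi]))
    have h3 : (1 : ℝ) ≤ 2 ^ s.card := one_le_pow₀ (by norm_num)
    have h4 := h1Sq_nonneg A (g a)
    rw [pow_succ]
    nlinarith [mul_le_mul_of_nonneg_right h3 h4]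

section Approx

variable {J : Type*} [Fintype J]

lemma IsApprox.lincomb {A : R3 → R3} (hA : VectorL2Loc A) {f : J → ℕ → R3 → ℂ} {φ : J → R3 → ℂ}
    (hφ : ∀ j, MemH1 A (φ j)) (h : ∀ j, IsApprox A (f j) (φ j)) (u : J → ℂ) :
    IsApprox A (fun t => ∑ j, u j • f j t) (∑ j, u j • φ j) :=
  isApprox_sum hA Finset.univ (fun j _ => (hφ j).const_smul (u j))
    fun j _ => (h j).const_smul hA (u j) (hφ j)

lemma tens_eq_sum_smul (φ : J → R3 → ℂ) (η : J → Fock) (n : ℕ) (K : Fin n → R3) :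
    (fun x => tens φ η n x K) = ∑ j, (η j : FockFn) n K • φ j := by
  ext x; simp [tens, mul_comm]

/-- For fixed momenta the fibre is a fixed linear combination of the electron factors, so its form
converges. The majorant in the momenta comes from the boundedness of the form in the H¹_A norm. -/
lemma tendsto_electronForm {A : R3 → R3} (hA : VectorL2Loc A) {V : R3 → ℝ}
    (hV : LocallyIntegrable V volume) (hVf : InfFormBounded V) {f : J → ℕ → R3 → ℂ}
    {φ : J → R3 → ℂ} (hφ : ∀ j, MemH1 A (φ j)) (h : ∀ j, IsApprox A (f j) (φ j)) (η : J → Fock) :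
    Tendsto (fun t => electronForm A V (tens (fun j => f j t) η)) atTop
      (𝓝 (electronForm A V (tens φ η))) := by
  choose N hN using fun j => fock_exists_bound (η j)
  set L := Finset.univ.sup N
  have hL : ∀ j n, L ≤ n → (η j : FockFn) n = 0 := fun j n hn =>
    hN j n ((Finset.le_sup (f := N) (Finset.mem_univ j)).trans hn)
  -- The fibres above the maximal phonon number are zero functions; this identity is needed to drop
  -- them from the infinite sum.
  have h0 : schrodingerForm A V 0 = 0 := by
    have := schrodingerForm_smul hA hV hVf 0 (memH1_zero hA)
    simpa using this
  have hsum : ∀ χ : J → R3 → ℂ, electronForm A V (tens χ η) = ∑ n ∈ Finset.range L,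
      ∫ K : Fin n → R3, schrodingerForm A V (∑ j, (η j : FockFn) n K • χ j) := fun χ => by
    simp only [electronForm, tens_eq_sum_smul]
    refine tsum_eq_sum fun n hn => ?_
    have : ∀ j, (η j : FockFn) n = 0 := fun j => hL j n (by simpa using hn)
    simp [this, h0]
  simp only [hsum]
  obtain ⟨C, hC0, hC⟩ := exists_testEnergy_bound hA hV hVf
  have hb : ∀ j, ∃ b, ∀ t, h1Sq A (f j t) ≤ b := fun j => by
    obtain ⟨b, hb⟩ := ((h j).tendsto_h1Sq hA (hφ j)).bddAbove_range
    exact ⟨b, fun t => hb ⟨t, rfl⟩⟩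
  choose b hb using hb
  refine tendsto_finsetSum _ fun n _ => ?_
  have htest : ∀ t (K : Fin n → R3), IsTest (∑ j, (η j : FockFn) n K • f j t) := fun t K =>
    isTest_sum _ fun j _ => ((h j).1 t).const_smul _
  refine tendsto_integral_of_dominated_convergence
    (fun K => C * (2 ^ Fintype.card J * ∑ j, ‖(η j : FockFn) n K‖ ^ 2 * b j)) (fun t => ?_) ?_
    (fun t => ae_of_all _ fun K => ?_) (ae_of_all _ fun K => ?_)
  · have e : (fun K => schrodingerForm A V (∑ j, (η j : FockFn) n K • f j t)) =
        fun K => (mpair (fun i j => kinMat A (fun j => f j t) i j +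
          potMat V (fun j => f j t) i j) (rankOne fun j => (η j : FockFn) n K)).re := by
      ext K
      have e1 : (∑ j, (η j : FockFn) n K • f j t) =
          fun x => ∑ j, (η j : FockFn) n K * f j t x := by ext x; simp
      rw [(htest t K).schrodingerForm_eq hA hV hVf, e1, testEnergy,
        sum_kinetic_lincomb hA (fun j => (h j).1 t), potEnergy_lincomb hV (fun j => (h j).1 t),
        mpair_add_left, Complex.add_re]
    rw [e]
    refine Measurable.aestronglyMeasurable (Complex.measurable_re.comp ?_)
    refine Finset.measurable_sum _ fun i _ => Finset.measurable_sum _ fun j _ => ?_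
    exact ((Complex.continuous_conj.measurable.comp ((η i).2.1 n)).mul ((η j).2.1 n)).const_mul _
  · refine ((integrable_finsetSum _ fun j _ => ?_).const_mul _).const_mul _
    refine Integrable.mul_const ?_ _
    refine (IsFock.integrable_inner (η j).2 (η j).2 n).norm.congr (ae_of_all _ fun K => ?_)
    simp [sq]
  · rw [(htest t K).schrodingerForm_eq hA hV hVf, Real.norm_eq_abs]
    refine (hC _ (htest t K)).trans (mul_le_mul_of_nonneg_left ?_ hC0)
    refine (h1Sq_sum_le hA Finset.univ fun j _ =>
      (((h j).1 t).const_smul _).memH1 hA).trans ?_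
    rw [Finset.card_univ]
    refine mul_le_mul_of_nonneg_left (Finset.sum_le_sum fun j _ => ?_) (by positivity)
    rw [h1Sq_smul _ (((h j).1 t).memH1 hA)]
    exact mul_le_mul_of_nonneg_left (hb j t) (by positivity)
  · have hap := IsApprox.lincomb hA hφ h fun j => (η j : FockFn) n K
    refine (hap.tendsto_testEnergy hA hV hVf
      (memH1_sum hA _ fun j _ => (hφ j).const_smul _)).congr fun t => ?_
    rw [(htest t K).schrodingerForm_eq hA hV hVf]

lemma tendsto_mpair {M : ℕ → J → J → ℂ} {M' : J → J → ℂ} (G : J → J → ℂ)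
    (h : ∀ i j, Tendsto (fun t => M t i j) atTop (𝓝 (M' i j))) :
    Tendsto (fun t => mpair (M t) G) atTop (𝓝 (mpair M' G)) :=
  tendsto_finsetSum _ fun i _ => tendsto_finsetSum _ fun j _ => (h i j).mul_const _

lemma tendsto_normSqH {A : R3 → R3} {f : J → ℕ → R3 → ℂ}
    {φ : J → R3 → ℂ} (hφ : ∀ j, MemH1 A (φ j)) (h : ∀ j, IsApprox A (f j) (φ j)) (η : J → Fock) :
    Tendsto (fun t => normSqH (tens (fun j => f j t) η)) atTop (𝓝 (normSqH (tens φ η))) := by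
  rw [normSqH_tens fun j => (hφ j).1]
  simp_rw [fun t => normSqH_tens (fun j => ((h j).1 t).memLp 2) η]
  refine (Complex.continuous_re.tendsto _).comp (tendsto_mpair _ fun i j => ?_)
  exact tendsto_eip (fun t => ((h i).1 t).memLp 2) (fun t => ((h j).1 t).memLp 2) (hφ i).1 (hφ j).1
    (h i).tendsto_sub (h j).tendsto_sub

lemma integral_mpair_re (M : J → J → ℂ) {G : R3 → J → J → ℂ}
    (hG : ∀ i j, Integrable fun k => G k i j) :
    ∫ k, (mpair M (G k)).re = (mpair M fun i j => ∫ k, G k i j).re := by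
  have hi : ∀ i j, Integrable fun k => M i j * G k i j := fun i j => (hG i j).const_mul _
  have h2 : ∫ k, mpair M (G k) = mpair M fun i j => ∫ k, G k i j := by
    simp only [mpair]
    rw [integral_finsetSum _ fun i _ => integrable_finsetSum _ fun j _ => hi i j]
    refine Finset.sum_congr rfl fun i _ => ?_
    rw [integral_finsetSum _ fun j _ => hi i j]
    exact Finset.sum_congr rfl fun j _ => integral_const_mul _ _
  rw [← h2]
  exact integral_re (𝕜 := ℂ)
    (integrable_finsetSum _ fun i _ => integrable_finsetSum _ fun j _ => hi i j)

lemma tendsto_numberForm {A : R3 → R3} {f : J → ℕ → R3 → ℂ}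
    {φ : J → R3 → ℂ} (hφ : ∀ j, MemH1 A (φ j)) (h : ∀ j, IsApprox A (f j) (φ j)) (η : J → Fock) :
    Tendsto (fun t => numberForm (tens (fun j => f j t) η)) atTop (𝓝 (numberForm (tens φ η))) := by
  have hG := fun i j => integrable_fockForm_ann_ann (η i) (η j)
  rw [numberForm_tens (fun j => (hφ j).1), integral_mpair_re _ hG]
  simp_rw [fun t => numberForm_tens (fun j => ((h j).1 t).memLp 2) η,
    fun t => integral_mpair_re (fun i j => eip (f i t) (f j t)) hG]
  refine (Complex.continuous_re.tendsto _).comp (tendsto_mpair _ fun i j => ?_)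
  exact tendsto_eip (fun t => ((h i).1 t).memLp 2) (fun t => ((h j).1 t).memLp 2) (hφ i).1 (hφ j).1
    (h i).tendsto_sub (h j).tendsto_sub

lemma norm_eip_le {φ χ : R3 → ℂ} (h : MemLp φ 2 volume) (h' : MemLp χ 2 volume) :
    ‖eip φ χ‖ ≤ Real.sqrt (l2Sq φ) * Real.sqrt (l2Sq χ) := norm_integral_conj_mul_le h h'

lemma continuous_eip_waveMul {φ χ : R3 → ℂ} (h : MemLp φ 2 volume) (h' : MemLp χ 2 volume) :
    Continuous fun k => eip φ (waveMul k χ) := by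
  refine continuous_of_dominated (bound := fun x => ‖(starRingEnd ℂ) (φ x) * χ x‖)
    (fun k => (integrable_conj_mul h (memLp_waveMul h' k)).1) (fun k => ae_of_all _ fun x => ?_)
    (integrable_conj_mul h h').norm (ae_of_all _ fun x => ?_)
  · rw [waveMul, norm_mul, norm_mul, norm_mul, norm_exp_I_mul, one_mul]
  · unfold waveMul; fun_prop

lemma measurable_intDensity {φ : J → R3 → ℂ} (hφ : ∀ j, MemLp (φ j) 2 volume) (η : J → Fock) :
    Measurable (intDensity φ η) :=
  Finset.measurable_sum _ fun i _ => Finset.measurable_sum _ fun j _ =>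
    (continuous_eip_waveMul (hφ i) (hφ j)).measurable.mul (isMode_fockForm_ann _ _).1

lemma tendsto_interactionForm {A : R3 → R3} {f : J → ℕ → R3 → ℂ}
    {φ : J → R3 → ℂ} (hφ : ∀ j, MemH1 A (φ j)) (h : ∀ j, IsApprox A (f j) (φ j)) (η : J → Fock) :
    Tendsto (fun t => interactionForm (tens (fun j => f j t) η)) atTop
      (𝓝 (interactionForm (tens φ η))) := by
  have hL2 := fun t j => ((h j).1 t).memLp 2
  rw [interactionForm_tens fun j => (hφ j).1]
  simp_rw [fun t => interactionForm_tens (hL2 t) η]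
  refine Tendsto.const_mul _ ?_
  have hb : ∀ j, ∃ b, ∀ t, Real.sqrt (l2Sq (f j t)) ≤ b := fun j => by
    obtain ⟨b, hb⟩ := ((Real.continuous_sqrt.tendsto _).comp
      ((h j).tendsto_l2Sq (hφ j))).bddAbove_range
    exact ⟨b, fun t => hb ⟨t, rfl⟩⟩
  choose b hb using hb
  refine tendsto_integral_of_dominated_convergence
    (fun k => ∑ i, ∑ j, 2 * (b i * b j) * ‖((1 / ‖k‖ : ℝ) : ℂ) * fockForm (η i) (ann k (η j))‖)
    (fun t => ?_) ?_ (fun t => ae_of_all _ fun k => ?_) (ae_of_all _ fun k => ?_)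
  · refine Measurable.aestronglyMeasurable (Measurable.mul (by fun_prop) ?_)
    exact (Complex.measurable_re.comp (measurable_intDensity (hL2 t) η)).const_mul 2
  · exact integrable_finsetSum _ fun i _ => integrable_finsetSum _ fun j _ =>
      (isMode_fockForm_ann (η i) (η j)).integrable_inv_norm_mul.norm.const_mul _
  · rw [norm_mul, norm_mul, Real.norm_of_nonneg (by positivity : (0 : ℝ) ≤ 1 / ‖k‖),
      Real.norm_ofNat, Real.norm_eq_abs]
    have h1 : |(intDensity (fun j => f j t) η k).re| ≤
        ∑ i, ∑ j, b i * b j * ‖fockForm (η i) (ann k (η j))‖ := by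
      refine (Complex.abs_re_le_norm _).trans ?_
      refine norm_sum_le_of_le _ fun i _ => norm_sum_le_of_le _ fun j _ => ?_
      rw [norm_mul]
      refine mul_le_mul_of_nonneg_right ?_ (norm_nonneg _)
      refine (norm_eip_le (hL2 t i) (memLp_waveMul (hL2 t j) k)).trans ?_
      rw [l2Sq_waveMul]
      exact mul_le_mul (hb i t) (hb j t) (Real.sqrt_nonneg _)
        ((Real.sqrt_nonneg _).trans (hb i t))
    calc _ ≤ 1 / ‖k‖ * (2 * ∑ i, ∑ j, b i * b j * ‖fockForm (η i) (ann k (η j))‖) := by gcongr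
      _ = _ := by
        simp only [Finset.mul_sum]
        refine Finset.sum_congr rfl fun i _ => Finset.sum_congr rfl fun j _ => ?_
        rw [norm_mul, Complex.norm_real, Real.norm_of_nonneg (by positivity : (0 : ℝ) ≤ 1 / ‖k‖)]
        ring
  · refine (((Complex.continuous_re.tendsto _).comp
      (tendsto_mpair _ fun i j => ?_)).const_mul 2).const_mul _
    refine tendsto_eip (fun t => hL2 t i) (fun t => memLp_waveMul (hL2 t j) k) (hφ i).1
      (memLp_waveMul (hφ j).1 k) (h i).tendsto_sub ((h j).tendsto_sub.congr fun t => ?_)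
    have : waveMul k (f j t) - waveMul k (φ j) = waveMul k (f j t - φ j) := by
      ext x; simp [waveMul, mul_sub]
    rw [this, l2Sq_waveMul]

/-- A lower bound on products of test functions extends to the form domain. -/
theorem frohlichForm_ge_of_test {A : R3 → R3} (hA : VectorL2Loc A) {V : R3 → ℝ}
    (hV : LocallyIntegrable V volume) (hVf : InfFormBounded V) {α E : ℝ}
    (H : ∀ (m : ℕ) (f : Fin m → R3 → ℂ) (η : Fin m → Fock), (∀ j, IsTest (f j)) →
      E * normSqH (tens f η) ≤ frohlichForm A V α (tens f η))
    {ψ : PolaronFn} (hψ : MemQ A ψ) : E * normSqH ψ ≤ frohlichForm A V α ψ := by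
  obtain ⟨m, φ, η, hφ, hη, hψ⟩ := hψ
  set η' : Fin m → Fock := fun j => ⟨η j, (hη j).isFock⟩
  have e : ψ = tens φ η' := by ext n x K; rw [hψ]; rfl
  choose f hf using fun j => exists_isApprox hA (hφ j)
  rw [e]
  refine le_of_tendsto_of_tendsto' ((tendsto_normSqH hφ hf η').const_mul E)
    (((tendsto_electronForm hA hV hVf hφ hf η').add (tendsto_numberForm hφ hf η')).add
      ((tendsto_interactionForm hφ hf η').const_mul (Real.sqrt α))) fun t => ?_
  exact H m (fun j => f j t) η' fun j => (hf j).1 t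

end Approx

/-! ### The ultraviolet cutoff -/

lemma sphereArea_pos : 0 < sphereArea :=
  mul_pos (by norm_num) (ENNReal.toReal_pos (Metric.measure_ball_pos volume _ one_pos).ne'
    measure_ball_lt_top.ne)

section Pointwise

variable {J : Type*} [Fintype J]

/-- The Fock space vector at the electron position `x`. -/
def pv (f : J → R3 → ℂ) (η : J → Fock) (x : R3) : Fock := ∑ j, f j x • η j

lemma map_pv (T : Module.End ℂ Fock) (f : J → R3 → ℂ) (η : J → Fock) (x : R3) :
    T (pv f η x) = pv f (fun j => T (η j)) x := by
  simp [pv, map_sum]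

lemma fockForm_pv (f g : J → R3 → ℂ) (η θ : J → Fock) (x : R3) :
    fockForm (pv f η x) (pv g θ x) =
      mpair (fun i j => (starRingEnd ℂ) (f i x) * g j x) fun i j => fockForm (η i) (θ j) := by
  simp only [pv, map_sum, LinearMap.sum_apply, LinearMap.map_smulₛₗ, LinearMap.smul_apply,
    map_smul, smul_eq_mul, mpair]
  rw [Finset.sum_comm]
  refine Finset.sum_congr rfl fun i _ => ?_
  rw [Finset.mul_sum]
  exact Finset.sum_congr rfl fun j _ => by ring

/-- The inner product of finite sums of products. -/
def tip (f : J → R3 → ℂ) (η : J → Fock) (g : J → R3 → ℂ) (θ : J → Fock) : ℂ :=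
  mpair (fun i j => eip (f i) (g j)) fun i j => fockForm (η i) (θ j)

lemma integrable_fockForm_pv {f g : J → R3 → ℂ} (hf : ∀ j, MemLp (f j) 2 volume)
    (hg : ∀ j, MemLp (g j) 2 volume) (η θ : J → Fock) :
    Integrable fun x => fockForm (pv f η x) (pv g θ x) := by
  simp_rw [fockForm_pv]
  exact integrable_finsetSum _ fun i _ => integrable_finsetSum _ fun j _ =>
    (integrable_conj_mul (hf i) (hg j)).mul_const _

lemma tip_eq_integral {f g : J → R3 → ℂ} (hf : ∀ j, MemLp (f j) 2 volume)
    (hg : ∀ j, MemLp (g j) 2 volume) (η θ : J → Fock) :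
    tip f η g θ = ∫ x, fockForm (pv f η x) (pv g θ x) := by
  have hi := fun i j => (integrable_conj_mul (hf i) (hg j)).mul_const (fockForm (η i) (θ j))
  simp_rw [fockForm_pv, mpair]
  rw [integral_finsetSum _ fun i _ => integrable_finsetSum _ fun j _ => hi i j]
  refine Finset.sum_congr rfl fun i _ => ?_
  rw [integral_finsetSum _ fun j _ => hi i j]
  exact Finset.sum_congr rfl fun j _ => (integral_mul_const _ _).symm

lemma tip_self_re {f : J → R3 → ℂ} (hf : ∀ j, MemLp (f j) 2 volume) (η : J → Fock) :
    (tip f η f η).re = ∫ x, (fockForm (pv f η x) (pv f η x)).re := by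
  rw [tip_eq_integral hf hf]
  exact (integral_re (𝕜 := ℂ) (integrable_fockForm_pv hf hf η η)).symm

lemma tip_self_nonneg {f : J → R3 → ℂ} (hf : ∀ j, MemLp (f j) 2 volume) (η : J → Fock) :
    0 ≤ (tip f η f η).re := by
  rw [tip_self_re hf]
  exact integral_nonneg fun x => fockForm_pos _

lemma two_mul_norm_tip_le {f g : J → R3 → ℂ} (hf : ∀ j, MemLp (f j) 2 volume)
    (hg : ∀ j, MemLp (g j) 2 volume) (η θ : J → Fock) {s : ℝ} (hs : 0 < s) :
    2 * ‖tip f η g θ‖ ≤ s * (tip f η f η).re + s⁻¹ * (tip g θ g θ).re := by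
  have i1 : Integrable fun x => (fockForm (pv f η x) (pv f η x)).re :=
    (integrable_fockForm_pv hf hf η η).re
  have i2 : Integrable fun x => (fockForm (pv g θ x) (pv g θ x)).re :=
    (integrable_fockForm_pv hg hg θ θ).re
  rw [tip_self_re hf, tip_self_re hg, tip_eq_integral hf hg, ← integral_const_mul,
    ← integral_const_mul, ← integral_add (i1.const_mul _) (i2.const_mul _)]
  have : (2 : ℝ) * ‖∫ x, fockForm (pv f η x) (pv g θ x)‖ =
      ‖∫ x, 2 * fockForm (pv f η x) (pv g θ x)‖ := by
    rw [integral_const_mul, norm_mul]; simp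
  rw [this]
  refine norm_integral_le_of_norm_le ((i1.const_mul _).add (i2.const_mul _))
    (ae_of_all _ fun x => ?_)
  rw [norm_mul, Complex.norm_two]
  exact two_mul_norm_fockForm_le _ _ hs

lemma tip_waveMul_self (f : J → R3 → ℂ) (η : J → Fock) (k : R3) :
    tip (fun j => waveMul k (f j)) η (fun j => waveMul k (f j)) η = tip f η f η := by
  simp only [tip]
  congr 1
  ext i j
  refine integral_congr_ae (ae_of_all _ fun x => ?_)
  simp only [waveMul, map_mul]
  have : (starRingEnd ℂ) (Complex.exp (Complex.I * ((inner ℝ k x : ℝ) : ℂ))) *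
      Complex.exp (Complex.I * ((inner ℝ k x : ℝ) : ℂ)) = 1 := by
    rw [mul_comm, Complex.mul_conj, Complex.normSq_eq_norm_sq, norm_exp_I_mul]; simp
  linear_combination ((starRingEnd ℂ) (f i x) * f j x) * this

/-- The density of phonons in momentum space. -/
def phDensity (f : J → R3 → ℂ) (η : J → Fock) (k : R3) : ℝ :=
  (tip f (fun j => ann k (η j)) f fun j => ann k (η j)).re

lemma phDensity_nonneg {f : J → R3 → ℂ} (hf : ∀ j, MemLp (f j) 2 volume) (η : J → Fock) (k : R3) :
    0 ≤ phDensity f η k := tip_self_nonneg hf _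

lemma integrable_phDensity (f : J → R3 → ℂ) (η : J → Fock) : Integrable (phDensity f η) := by
  have h : Integrable fun k => tip f (fun j => ann k (η j)) f fun j => ann k (η j) :=
    integrable_finsetSum _ fun i _ => integrable_finsetSum _ fun j _ =>
    (integrable_fockForm_ann_ann (η i) (η j)).const_mul _
  exact h.re

lemma intDensity_eq_tip (f : J → R3 → ℂ) (η : J → Fock) (k : R3) :
    intDensity f η k = tip f η (fun j => waveMul k (f j)) fun j => ann k (η j) := rfl

lemma exists_radius_family (η : J → Fock) : ∃ R : ℝ, ∀ k, R < ‖k‖ → ∀ j, ann k (η j) = 0 := by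
  choose R hR using fun j => fock_exists_radius (η j)
  refine ⟨∑ j, |R j|, fun k hk j => hR j k (lt_of_le_of_lt ?_ hk)⟩
  exact (le_abs_self _).trans
    (Finset.single_le_sum (f := fun j => |R j|) (fun j _ => abs_nonneg _) (Finset.mem_univ j))

lemma integrable_inv_norm_mul_tip {f g : J → R3 → ℂ} (hf : ∀ j, MemLp (f j) 2 volume)
    (hg : ∀ j, MemLp (g j) 2 volume) (η : J → Fock) :
    Integrable fun k => ((1 / ‖k‖ : ℝ) : ℂ) *
      tip f η (fun j => waveMul k (g j)) fun j => ann k (η j) := by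
  simp only [tip, mpair, Finset.mul_sum]
  refine integrable_finsetSum _ fun i _ => integrable_finsetSum _ fun j _ => ?_
  refine ((isMode_fockForm_ann (η i) (η j)).integrable_inv_norm_mul.bdd_mul
    (f := fun k => eip (f i) (waveMul k (g j)))
    (c := Real.sqrt (l2Sq (f i)) * Real.sqrt (l2Sq (g j)))
    (continuous_eip_waveMul (hf i) (hg j)).aestronglyMeasurable
    (ae_of_all _ fun k => ?_)).congr (ae_of_all _ fun k => by simp only; ring)
  refine (norm_eip_le (hf i) (memLp_waveMul (hg j) k)).trans ?_
  rw [l2Sq_waveMul]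

/-! #### Integration by parts -/

lemma partialD_conj {u : R3 → ℂ} (l : Fin 3) (x : R3) :
    partialD l (fun x => (starRingEnd ℂ) (u x)) x = (starRingEnd ℂ) (partialD l u x) := by
  have h : (fun x => (starRingEnd ℂ) (u x)) = Complex.conjCLE ∘ u := by ext x; simp
  simp only [partialD]
  rw [h, ContinuousLinearEquiv.comp_fderiv]
  simp

lemma contDiff_phase (k : R3) :
    ContDiff ℝ ∞ fun x : R3 => Complex.exp (Complex.I * ((inner ℝ k x : ℝ) : ℂ)) := by
  have : ContDiff ℝ ∞ fun x : R3 => ((inner ℝ k x : ℝ) : ℂ) :=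
    Complex.ofRealCLM.contDiff.comp (contDiff_const.inner ℝ contDiff_id)
  exact (contDiff_const.mul this).cexp

lemma partialD_phase (k : R3) (l : Fin 3) (x : R3) :
    partialD l (fun x : R3 => Complex.exp (Complex.I * ((inner ℝ k x : ℝ) : ℂ))) x =
      Complex.I * (k l : ℂ) * Complex.exp (Complex.I * ((inner ℝ k x : ℝ) : ℂ)) := by
  have h1 : HasFDerivAt (fun x : R3 => ((inner ℝ k x : ℝ) : ℂ))
      (Complex.ofRealCLM.comp (innerSL ℝ k)) x :=
    (Complex.ofRealCLM.comp (innerSL ℝ k)).hasFDerivAt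
  have h2 := (h1.const_mul Complex.I).cexp
  rw [partialD, h2.fderiv]
  simp [EuclideanSpace.inner_single_right]
  ring

lemma IsTest.conj {f : R3 → ℂ} (hf : IsTest f) : IsTest fun x => (starRingEnd ℂ) (f x) :=
  ⟨Complex.conjCLE.contDiff.comp hf.1, hf.2.comp_left (g := fun z : ℂ => (starRingEnd ℂ) z)
    (by simp)⟩

/-- The plane wave shifts D_A by k: D_A e^(ikx) = e^(ikx)(D_A + k). The potential A commutes with
the plane wave, so the plain derivative may be completed to D_A at no cost. -/
lemma eip_waveMul_by_parts {A : R3 → R3} (hA : VectorL2Loc A) {u v : R3 → ℂ} (hu : IsTest u)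
    (hv : IsTest v) (k : R3) (l : Fin 3) :
    (k l : ℂ) * eip u (waveMul k v) =
      eip (dA A l u) (waveMul k v) - eip u (waveMul k (dA A l v)) := by
  have huv : IsTest ((fun x => (starRingEnd ℂ) (u x)) * v) := hu.conj.mul hv.1
  have h := integral_mul_partialD ((contDiff_phase k).of_le (by simp)) huv l
  have h1 : ∀ x, partialD l ((fun x => (starRingEnd ℂ) (u x)) * v) x =
      (starRingEnd ℂ) (u x) * partialD l v x + (starRingEnd ℂ) (partialD l u x) * v x := fun x => by
    rw [partialD_mul hu.conj.differentiable hv.differentiable, partialD_conj]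
  simp only [h1, partialD_phase, Pi.mul_apply] at h
  have i1 := integrable_conj_mul (hu.memLp_dA hA l) (memLp_waveMul (hv.memLp 2) k)
  have i2 := integrable_conj_mul (hu.memLp 2) (memLp_waveMul (hv.memLp_dA hA l) k)
  rw [eip, eip, eip, ← integral_sub i1 i2]
  have e1 : ∀ x, (starRingEnd ℂ) (dA A l u x) * waveMul k v x -
      (starRingEnd ℂ) (u x) * waveMul k (dA A l v) x = Complex.I *
      (Complex.exp (Complex.I * ((inner ℝ k x : ℝ) : ℂ)) * ((starRingEnd ℂ) (u x) * partialD l v x +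
        (starRingEnd ℂ) (partialD l u x) * v x)) := fun x => by
    simp only [dA, waveMul, map_add, map_mul, map_neg, Complex.conj_I, Complex.conj_ofReal]
    ring
  simp_rw [e1]
  rw [integral_const_mul, h, ← integral_const_mul]
  have e2 : ∀ x, Complex.I * (k l : ℂ) * Complex.exp (Complex.I * ((inner ℝ k x : ℝ) : ℂ)) *
      ((starRingEnd ℂ) (u x) * v x) =
      (Complex.I * (k l : ℂ)) * ((starRingEnd ℂ) (u x) * waveMul k v x) := fun x => by
    simp only [waveMul]; ring
  simp_rw [e2]
  rw [integral_const_mul, integral_const_mul]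
  linear_combination ((k l : ℂ) * ∫ x, (starRingEnd ℂ) (u x) * waveMul k v x) * Complex.I_mul_I

/-- Since ∑ k_l²/|k|² = 1, the commutator identity gains a factor 1/|k|. The coupling 1/|k| then
becomes 1/|k|², which is square integrable at infinity. -/
lemma intDensity_by_parts {A : R3 → R3} (hA : VectorL2Loc A) {f : J → R3 → ℂ}
    (hf : ∀ j, IsTest (f j)) (η : J → Fock) {k : R3} (hk : k ≠ 0) :
    intDensity f η k = ∑ l, ((k l / ‖k‖ ^ 2 : ℝ) : ℂ) *
      (tip (fun j => dA A l (f j)) η (fun j => waveMul k (f j)) (fun j => ann k (η j)) -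
        tip f η (fun j => waveMul k (dA A l (f j))) fun j => ann k (η j)) := by
  have h1 : ∀ l, tip (fun j => dA A l (f j)) η (fun j => waveMul k (f j)) (fun j => ann k (η j)) -
      tip f η (fun j => waveMul k (dA A l (f j))) (fun j => ann k (η j)) =
      (k l : ℂ) * intDensity f η k := fun l => by
    simp only [intDensity, tip, mpair, Finset.mul_sum, ← Finset.sum_sub_distrib]
    refine Finset.sum_congr rfl fun i _ => Finset.sum_congr rfl fun j _ => ?_
    rw [← mul_assoc, eip_waveMul_by_parts hA (hf i) (hf j)]; ring
  simp_rw [h1, ← mul_assoc, ← Complex.ofReal_mul]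
  rw [← Finset.sum_mul, ← Complex.ofReal_sum]
  have h2 : ∑ l, k l / ‖k‖ ^ 2 * k l = 1 := by
    have : ∑ l, k l / ‖k‖ ^ 2 * k l = (∑ l, k l ^ 2) / ‖k‖ ^ 2 := by
      rw [Finset.sum_div]; exact Finset.sum_congr rfl fun l _ => by ring
    rw [this, EuclideanSpace.real_norm_sq_eq]
    refine div_self ?_
    rw [← EuclideanSpace.real_norm_sq_eq]
    simpa using hk
  rw [h2]; simp

/-! #### Exchanging position and momentum integrals -/

lemma integral_mul_tip_waveMul {f g : J → R3 → ℂ} (hf : ∀ j, MemLp (f j) 2 volume)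
    (hg : ∀ j, MemLp (g j) 2 volume) (η : J → Fock) {c : R3 → ℂ} (hc : IsMode c) :
    ∫ k, c k * tip f η (fun j => waveMul k (g j)) (fun j => ann k (η j)) =
      ∫ x, mpair (fun i j => (starRingEnd ℂ) (f i x) * g j x) fun i j =>
        ∫ k, c k * Complex.exp (Complex.I * ((inner ℝ k x : ℝ) : ℂ)) *
          fockForm (η i) (ann k (η j)) := by
  have hint : ∀ i j, Integrable (fun p : R3 × R3 => ((starRingEnd ℂ) (f i p.2) * g j p.2) *
      (c p.1 * Complex.exp (Complex.I * ((inner ℝ p.1 p.2 : ℝ) : ℂ)) *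
        fockForm (η i) (ann p.1 (η j)))) (volume.prod volume) := fun i j => by
    have h1 := (hc.mul (isMode_fockForm_ann (η i) (η j))).integrable.mul_prod
      (integrable_conj_mul (hf i) (hg j))
    refine (h1.mul_bdd (c := 1) continuous_phase.aestronglyMeasurable
      (ae_of_all _ fun p => (norm_exp_I_mul _).le)).congr (ae_of_all _ fun p => ?_)
    simp only; ring
  have e : ∀ k, c k * tip f η (fun j => waveMul k (g j)) (fun j => ann k (η j)) =
      ∑ i, ∑ j, ∫ x, ((starRingEnd ℂ) (f i x) * g j x) *
      (c k * Complex.exp (Complex.I * ((inner ℝ k x : ℝ) : ℂ)) *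
        fockForm (η i) (ann k (η j))) := fun k => by
    simp only [tip, mpair, Finset.mul_sum]
    refine Finset.sum_congr rfl fun i _ => Finset.sum_congr rfl fun j _ => ?_
    rw [eip, mul_comm, mul_assoc, ← integral_mul_const]
    refine integral_congr_ae (ae_of_all _ fun x => ?_)
    simp only [waveMul]; ring
  simp_rw [e, mpair, ← integral_const_mul]
  have i1 := fun i j => (hint i j).integral_prod_left
  have i2 := fun i j => (hint i j).integral_prod_right
  rw [integral_finsetSum _ fun i _ => integrable_finsetSum _ fun j _ => i1 i j,
    integral_finsetSum _ fun i _ => integrable_finsetSum _ fun j _ => i2 i j]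
  refine Finset.sum_congr rfl fun i _ => ?_
  rw [integral_finsetSum _ fun j _ => i1 i j, integral_finsetSum _ fun j _ => i2 i j]
  exact Finset.sum_congr rfl fun j _ => integral_integral_swap (hint i j)

/-- The conjugate of `c` times a plane wave. -/
def waveMode (c : R3 → ℂ) (x : R3) : R3 → ℂ :=
  fun k => (starRingEnd ℂ) (c k * Complex.exp (Complex.I * ((inner ℝ k x : ℝ) : ℂ)))

lemma isMode_waveMode {c : R3 → ℂ} (hc : IsMode c) (x : R3) : IsMode (waveMode c x) :=
  (hc.mul_bounded (C := 1) (Continuous.measurable (by fun_prop))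
    fun k => (norm_exp_I_mul _).le).conj

lemma norm_waveMode (c : R3 → ℂ) (x k : R3) : ‖waveMode c x k‖ = ‖c k‖ := by
  rw [waveMode, RCLike.norm_conj, norm_mul, norm_exp_I_mul, mul_one]

/-- At each electron position the smeared interaction is an annihilation operator with a position
dependent mode, so adjoints and commutation relations can be used pointwise in x. -/
lemma integral_mul_tip_eq_lower {f g : J → R3 → ℂ} (hf : ∀ j, MemLp (f j) 2 volume)
    (hg : ∀ j, MemLp (g j) 2 volume) (η : J → Fock) {c : R3 → ℂ} (hc : IsMode c) :
    ∫ k, c k * tip f η (fun j => waveMul k (g j)) (fun j => ann k (η j)) =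
      ∫ x, fockForm (pv f η x) (lower (waveMode c x) (isMode_waveMode hc x) (pv g η x)) := by
  rw [integral_mul_tip_waveMul hf hg η hc]
  refine integral_congr_ae (ae_of_all _ fun x => ?_)
  simp only
  rw [map_pv, fockForm_pv]
  congr 1
  ext i j
  rw [fockForm_lower_right]
  simp [waveMode]

lemma integral_phDensity_pv {f : J → R3 → ℂ} (hf : ∀ j, MemLp (f j) 2 volume) (η : J → Fock)
    (S : Set R3) :
    Integrable (fun x => ∫ k in S, (fockForm (ann k (pv f η x)) (ann k (pv f η x))).re) ∧
    ∫ x, ∫ k in S, (fockForm (ann k (pv f η x)) (ann k (pv f η x))).re =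
      ∫ k in S, phDensity f η k := by
  have hi : ∀ i j, Integrable (fun k => fockForm (ann k (η i)) (ann k (η j)))
      (volume.restrict S) := fun i j => (integrable_fockForm_ann_ann (η i) (η j)).restrict
  set G : J → J → ℂ := fun i j => ∫ k in S, fockForm (ann k (η i)) (ann k (η j))
  have key : ∀ M : J → J → ℂ, ∫ k in S, (mpair M fun i j =>
      fockForm (ann k (η i)) (ann k (η j))).re = (mpair M G).re := fun M => by
    have h2 : ∫ k in S, mpair M (fun i j => fockForm (ann k (η i)) (ann k (η j))) = mpair M G := by
      simp only [mpair]
      rw [integral_finsetSum _ fun i _ => integrable_finsetSum _ fun j _ => (hi i j).const_mul _]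
      refine Finset.sum_congr rfl fun i _ => ?_
      rw [integral_finsetSum _ fun j _ => (hi i j).const_mul _]
      exact Finset.sum_congr rfl fun j _ => integral_const_mul _ _
    rw [← h2]
    exact integral_re (𝕜 := ℂ) (integrable_finsetSum _ fun i _ => integrable_finsetSum _ fun j _ =>
      (hi i j).const_mul _)
  have e : ∀ x, ∫ k in S, (fockForm (ann k (pv f η x)) (ann k (pv f η x))).re =
      (mpair (fun i j => (starRingEnd ℂ) (f i x) * f j x) G).re := fun x => by
    rw [← key]
    simp_rw [map_pv, fockForm_pv]
  have hint : Integrable fun x => mpair (fun i j => (starRingEnd ℂ) (f i x) * f j x) G :=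
    integrable_finsetSum _ fun i _ => integrable_finsetSum _ fun j _ =>
      (integrable_conj_mul (hf i) (hf j)).mul_const _
  simp_rw [e]
  refine ⟨hint.re, ?_⟩
  have h3 : ∫ x, mpair (fun i j => (starRingEnd ℂ) (f i x) * f j x) G =
      mpair (fun i j => eip (f i) (f j)) G := by
    simp only [mpair]
    rw [integral_finsetSum _ fun i _ => integrable_finsetSum _ fun j _ =>
      (integrable_conj_mul (hf i) (hf j)).mul_const _]
    refine Finset.sum_congr rfl fun i _ => ?_
    rw [integral_finsetSum _ fun j _ => (integrable_conj_mul (hf i) (hf j)).mul_const _]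
    exact Finset.sum_congr rfl fun j _ => integral_mul_const _ _
  have h4 : ∫ x, (mpair (fun i j => (starRingEnd ℂ) (f i x) * f j x) G).re =
      (∫ x, mpair (fun i j => (starRingEnd ℂ) (f i x) * f j x) G).re :=
    integral_re (𝕜 := ℂ) hint
  rw [h4, h3, ← key]
  rfl

/-- The smeared annihilation operator acting behind a derivative. -/
lemma norm_integral_mul_tip_le {f g : J → R3 → ℂ} (hf : ∀ j, MemLp (f j) 2 volume)
    (hg : ∀ j, MemLp (g j) 2 volume) (η : J → Fock) {c : R3 → ℂ} (hc : IsMode c) {S : Set R3}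
    (hS : MeasurableSet S) (hcS : ∀ k, k ∉ S → c k = 0) {M : ℝ} (hM : 0 < M)
    (hle : ∫ k, ‖c k‖ ^ 2 ≤ M) {s : ℝ} (hs : 0 < s) :
    2 * ‖∫ k, c k * tip f η (fun j => waveMul k (g j)) (fun j => ann k (η j))‖ ≤
      s * (M * ((∫ k in S, phDensity f η k) + (tip f η f η).re)) + s⁻¹ * (tip g η g η).re := by
  obtain ⟨hi, he⟩ := integral_phDensity_pv hf η S
  have i1 : Integrable fun x => (fockForm (pv f η x) (pv f η x)).re :=
    (integrable_fockForm_pv hf hf η η).re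
  have i2 : Integrable fun x => (fockForm (pv g η x) (pv g η x)).re :=
    (integrable_fockForm_pv hg hg η η).re
  have i3 : Integrable fun x => (∫ k in S, (fockForm (ann k (pv f η x)) (ann k (pv f η x))).re) +
      (fockForm (pv f η x) (pv f η x)).re := hi.add i1
  rw [integral_mul_tip_eq_lower hf hg η hc, ← he, tip_self_re hf, tip_self_re hg,
    ← integral_add hi i1, ← integral_const_mul, ← integral_const_mul, ← integral_const_mul,
    ← integral_add ((i3.const_mul _).const_mul _) (i2.const_mul _)]
  have : ∀ F : R3 → ℂ, (2 : ℝ) * ‖∫ x, F x‖ = ‖∫ x, 2 * F x‖ := fun F => by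
    rw [integral_const_mul, norm_mul]; simp
  rw [this]
  refine norm_integral_le_of_norm_le (((i3.const_mul _).const_mul _).add
    (i2.const_mul _)) (ae_of_all _ fun x => ?_)
  -- The factor g carries the derivative and must be estimated without phonons, so the annihilator
  -- is moved to the other side. There ‖a*(c)v‖² = ‖a(c)v‖² + ‖c‖²‖v‖², the source of the additional
  -- norm term.
  rw [norm_mul, Complex.norm_two, ← fockForm_raise_left]
  refine (two_mul_norm_fockForm_le _ _ hs).trans ?_
  have hn : ∫ k, ‖waveMode c x k‖ ^ 2 ≤ M := by simpa only [norm_waveMode] using hle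
  have h1 := fockForm_lower_lower_le (isMode_waveMode hc x) hS
    (fun k hk => by simp [waveMode, hcS k hk]) hM hn (pv f η x)
  have h2 := fockForm_raise_raise (isMode_waveMode hc x) (pv f η x)
  have h3 := mul_le_mul_of_nonneg_right hn (fockForm_pos (pv f η x))
  refine add_le_add (mul_le_mul_of_nonneg_left ?_ hs.le) le_rfl
  rw [h2]; linarith

end Pointwise

/-- The cube `[-Λ, Λ)³` in momentum space. -/
def cube (Λ : ℝ) : Set R3 := {k | ∀ l, -Λ ≤ k l ∧ k l < Λ}

/-- The cube without the unit ball. -/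
def midCube (Λ : ℝ) : Set R3 := cube Λ \ {k | ‖k‖ < 1}

lemma measurableSet_cube (Λ : ℝ) : MeasurableSet (cube Λ) := by
  have : cube Λ = ⋂ l : Fin 3, {k : R3 | -Λ ≤ k l} ∩ {k | k l < Λ} := by
    ext k; simp [cube]
  rw [this]
  refine MeasurableSet.iInter fun l => ?_
  have hm : Measurable fun k : R3 => k l := (by fun_prop : Continuous fun k : R3 => k l).measurable
  exact (measurableSet_le measurable_const hm).inter (measurableSet_lt hm measurable_const)

lemma measurableSet_unitBall : MeasurableSet {k : R3 | ‖k‖ < 1} :=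
  measurableSet_lt measurable_norm measurable_const

lemma abs_apply_le_norm (k : R3) (l : Fin 3) : |k l| ≤ ‖k‖ := by
  simpa using PiLp.norm_apply_le k l

lemma le_norm_of_notMem_cube {Λ : ℝ} {k : R3} (h : k ∉ cube Λ) : Λ ≤ ‖k‖ := by
  simp only [cube, Set.mem_ofPred_eq, not_forall, not_and_or, not_le, not_lt] at h
  obtain ⟨l, h | h⟩ := h
  · have := abs_apply_le_norm k l
    have := neg_abs_le (k l)
    linarith
  · exact h.trans ((le_abs_self _).trans (abs_apply_le_norm k l))

/-! ### Phonons in the unit ball and outside the cube -/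

section Cut

variable {J : Type*} [Fintype J]

/-- The kinetic energy of a finite sum of products. -/
def kinT (A : R3 → R3) (f : J → R3 → ℂ) (η : J → Fock) : ℝ :=
  (mpair (kinMat A f) fun i j => fockForm (η i) (η j)).re

/-- The potential energy of a finite sum of products. -/
def potT (V : R3 → ℝ) (f : J → R3 → ℂ) (η : J → Fock) : ℝ :=
  (mpair (potMat V f) fun i j => fockForm (η i) (η j)).re

/-- The Fröhlich form with phonons restricted to `S` and reduced kinetic energy. -/
def cutForm (A : R3 → R3) (V : R3 → ℝ) (κ ε : ℝ) (S : Set R3) (f : J → R3 → ℂ)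
    (η : J → Fock) : ℝ :=
  (1 - ε) * kinT A f η + potT V f η +
    ∫ k in S, (phDensity f η k + κ * (1 / ‖k‖ * (2 * (intDensity f η k).re)))

lemma kinT_eq (A : R3 → R3) (f : J → R3 → ℂ) (η : J → Fock) :
    kinT A f η = ∑ l, (tip (fun j => dA A l (f j)) η (fun j => dA A l (f j)) η).re := by
  have : mpair (kinMat A f) (fun i j => fockForm (η i) (η j)) =
      ∑ l, tip (fun j => dA A l (f j)) η (fun j => dA A l (f j)) η := by
    simp only [mpair, kinMat, Finset.sum_mul, tip]
    rw [Finset.sum_comm]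
    calc _ = ∑ j, ∑ l, ∑ i, eip (dA A l (f i)) (dA A l (f j)) * fockForm (η i) (η j) :=
          Finset.sum_congr rfl fun i _ => Finset.sum_comm
      _ = ∑ l, ∑ j, ∑ i, eip (dA A l (f i)) (dA A l (f j)) * fockForm (η i) (η j) :=
          Finset.sum_comm
      _ = _ := Finset.sum_congr rfl fun l _ => Finset.sum_comm
  rw [kinT, this, Complex.re_sum]

lemma integrable_intDensity {f : J → R3 → ℂ} (hf : ∀ j, MemLp (f j) 2 volume) (η : J → Fock) :
    Integrable fun k => 1 / ‖k‖ * (2 * (intDensity f η k).re) := by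
  have h : Integrable fun k => (((1 / ‖k‖ : ℝ) : ℂ) * intDensity f η k).re :=
    (integrable_inv_norm_mul_tip hf hf η).re
  refine (h.const_mul 2).congr (ae_of_all _ fun k => ?_)
  simp only [Complex.re_ofReal_mul]; ring

lemma frohlichForm_tens {A : R3 → R3} (hA : VectorL2Loc A) {V : R3 → ℝ}
    (hV : LocallyIntegrable V volume) (hVf : InfFormBounded V) {f : J → R3 → ℂ}
    (hf : ∀ j, IsTest (f j)) (η : J → Fock) (α : ℝ) :
    frohlichForm A V α (tens f η) = kinT A f η + potT V f η +
      ∫ k, (phDensity f η k +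
        Real.sqrt α / (Real.sqrt 2 * Real.pi) * (1 / ‖k‖ * (2 * (intDensity f η k).re))) := by
  have hL := fun j => (hf j).memLp 2
  rw [integral_add (integrable_phDensity f η) ((integrable_intDensity hL η).const_mul _),
    integral_const_mul, frohlichForm, electronForm_tens hA hV hVf hf, numberForm_tens hL,
    interactionForm_tens hL, kinT, potT]
  have : ∫ k, phDensity f η k = ∫ k, (mpair (fun i j => eip (f i) (f j)) fun i j =>
      fockForm (ann k (η i)) (ann k (η j))).re := rfl
  rw [this]; ring

/-- Completing the square at each k with weight κ/|k|: all the phonon density at k is spent. The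
remainder 1/|k|² is integrable on the unit ball, with a loss proportional to κ². -/
lemma low_density_bound {f : J → R3 → ℂ} (hf : ∀ j, MemLp (f j) 2 volume) (η : J → Fock) {κ : ℝ}
    (hκ : 0 < κ) (k : R3) : -(κ ^ 2 * (tip f η f η).re * (1 / ‖k‖ ^ 2)) ≤
      phDensity f η k + κ * (1 / ‖k‖ * (2 * (intDensity f η k).re)) := by
  have h0 := phDensity_nonneg hf η k
  by_cases hk : ‖k‖ = 0
  · simp [hk, h0]
  have hk' : 0 < ‖k‖ := lt_of_le_of_ne (norm_nonneg _) (Ne.symm hk)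
  have h1 := two_mul_norm_tip_le hf (fun j => memLp_waveMul (hf j) k) η
    (fun j => ann k (η j)) (s := κ / ‖k‖) (by positivity)
  rw [← intDensity_eq_tip, tip_waveMul_self] at h1
  have h2 : -‖intDensity f η k‖ ≤ (intDensity f η k).re :=
    (abs_le.1 (Complex.abs_re_le_norm _)).1
  have h3 : κ / ‖k‖ * (2 * ‖intDensity f η k‖) ≤
      κ / ‖k‖ * (κ / ‖k‖ * (tip f η f η).re + (κ / ‖k‖)⁻¹ * phDensity f η k) :=
    mul_le_mul_of_nonneg_left h1 (by positivity)
  have h4 : κ / ‖k‖ * (κ / ‖k‖ * (tip f η f η).re + (κ / ‖k‖)⁻¹ * phDensity f η k) =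
      κ ^ 2 * (tip f η f η).re * (1 / ‖k‖ ^ 2) + phDensity f η k := by
    field_simp
  have h5 : κ * (1 / ‖k‖ * (2 * (intDensity f η k).re)) =
      κ / ‖k‖ * (2 * (intDensity f η k).re) := by ring
  have h6 : κ / ‖k‖ * (2 * -‖intDensity f η k‖) ≤ κ / ‖k‖ * (2 * (intDensity f η k).re) := by
    gcongr
  linarith

/-- Integration by parts produces six terms, two for each component. Each is bounded by 1/6 of the
phonon number outside the cube plus 6κ²σ/Λ times one component of the kinetic energy, with σ the
area of the unit sphere, so the phonon number is used up exactly. The three terms whose derivative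
sits with the annihilator each add 1/6 of the norm, whence the 1/2. -/
lemma uv_bound {A : R3 → R3} (hA : VectorL2Loc A) {f : J → R3 → ℂ} (hf : ∀ j, IsTest (f j))
    (η : J → Fock) {κ Λ : ℝ} (hκ : 0 < κ) (hΛ : 0 < Λ) :
    -(12 * κ ^ 2 * (sphereArea / Λ) * kinT A f η + 1 / 2 * (tip f η f η).re) ≤
      ∫ k in (cube Λ)ᶜ, (phDensity f η k + κ * (1 / ‖k‖ * (2 * (intDensity f η k).re))) := by
  have hL := fun j => (hf j).memLp 2
  have hD := fun l j => (hf j).memLp_dA hA l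
  obtain ⟨R, hR⟩ := exists_radius_family η
  set S : Set R3 := (cube Λ)ᶜ
  have hS : MeasurableSet S := (measurableSet_cube Λ).compl
  have hSΛ : S ⊆ {k | Λ ≤ ‖k‖} := fun k hk => le_norm_of_notMem_cube hk
  set M : ℝ := sphereArea / Λ
  have hM : 0 < M := div_pos sphereArea_pos hΛ
  -- All a(k)η_j vanish beyond R, so restricting the coefficients to this ball changes nothing and
  -- makes them bounded modes of bounded support.
  set S' : Set R3 := S ∩ {k | ‖k‖ ≤ R}
  have hS' : MeasurableSet S' := hS.inter (measurableSet_le measurable_norm measurable_const)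
  obtain ⟨hi4, he4⟩ := integral_compl_ball_inv_pow hΛ
  have hi4S : IntegrableOn (fun k : R3 => 1 / ‖k‖ ^ 4) S := hi4.mono_set hSΛ
  have hMS : ∫ k in S, 1 / ‖k‖ ^ 4 ≤ M := by
    simp only [M]
    rw [← he4]
    exact setIntegral_mono_set hi4 (ae_of_all _ fun k => by positivity) hSΛ.eventuallyLE
  set c : Fin 3 → R3 → ℂ := fun l => S'.indicator fun k => ((k l / ‖k‖ ^ 3 : ℝ) : ℂ)
  have hcle : ∀ l k, ‖c l k‖ ≤ S.indicator (fun k => 1 / ‖k‖ ^ 2) k := fun l k => by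
    by_cases hk : k ∈ S'
    · simp only [c, Set.indicator_of_mem hk, Set.indicator_of_mem hk.1, Complex.norm_real]
      have hk0 : 0 < ‖k‖ := hΛ.trans_le (hSΛ hk.1)
      rw [Real.norm_eq_abs, abs_div, abs_of_pos (by positivity : 0 < ‖k‖ ^ 3),
        div_le_div_iff₀ (by positivity) (by positivity)]
      have := abs_apply_le_norm k l
      nlinarith [mul_le_mul_of_nonneg_right this (by positivity : 0 ≤ ‖k‖ ^ 2)]
    · simp only [c, Set.indicator_of_notMem hk, norm_zero]
      exact Set.indicator_nonneg (fun k _ => by positivity) k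
  have hcm : ∀ l, IsMode (c l) := fun l => by
    refine ⟨Measurable.indicator ?_ hS', 1 / Λ ^ 2, R, fun k => ?_, fun k hk => ?_⟩
    · have : Measurable fun k : R3 => k l / ‖k‖ ^ 3 :=
        ((by fun_prop : Continuous fun k : R3 => k l).measurable).div
          ((by fun_prop : Continuous fun k : R3 => ‖k‖ ^ 3).measurable)
      exact Complex.measurable_ofReal.comp this
    · refine (hcle l k).trans ?_
      by_cases hk : k ∈ S
      · rw [Set.indicator_of_mem hk]
        have := hSΛ hk
        simp only [Set.mem_ofPred_eq] at this
        gcongr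
      · rw [Set.indicator_of_notMem hk]; positivity
    · refine Set.indicator_of_notMem (fun h => ?_) _
      exact absurd h.2 (not_le.2 hk)
  have hcS : ∀ l k, k ∉ S → c l k = 0 := fun l k hk =>
    Set.indicator_of_notMem (fun h => hk h.1) _
  have hc2 : ∀ l, ∫ k, ‖c l k‖ ^ 2 ≤ M := fun l => by
    refine le_trans ?_ hMS
    rw [← integral_indicator hS]
    refine integral_mono_of_nonneg (ae_of_all _ fun k => by positivity)
      ((integrable_indicator_iff hS).2 hi4S) (ae_of_all _ fun k => ?_)
    by_cases hk : k ∈ S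
    · have h := hcle l k
      simp only [Set.indicator_of_mem hk] at h ⊢
      calc ‖c l k‖ ^ 2 ≤ (1 / ‖k‖ ^ 2) ^ 2 := by gcongr
        _ = _ := by rw [div_pow, ← pow_mul]; norm_num
    · simp only [Set.indicator_of_notMem hk, hcS l k hk, norm_zero]; norm_num
  set t1 : Fin 3 → R3 → ℂ := fun l k =>
    tip (fun j => dA A l (f j)) η (fun j => waveMul k (f j)) (fun j => ann k (η j))
  set t2 : Fin 3 → R3 → ℂ := fun l k =>
    tip f η (fun j => waveMul k (dA A l (f j))) fun j => ann k (η j)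
  have hint : ∀ {g g' : J → R3 → ℂ}, (∀ j, MemLp (g j) 2 volume) → (∀ j, MemLp (g' j) 2 volume) →
      ∀ l, Integrable fun k => c l k * tip g η (fun j => waveMul k (g' j)) fun j => ann k (η j) := by
    intro g g' hg hg' l
    simp only [tip, mpair, Finset.mul_sum]
    refine integrable_finsetSum _ fun i _ => integrable_finsetSum _ fun j _ => ?_
    refine (((hcm l).mul (isMode_fockForm_ann (η i) (η j))).integrable.bdd_mul
      (f := fun k => eip (g i) (waveMul k (g' j)))
      (c := Real.sqrt (l2Sq (g i)) * Real.sqrt (l2Sq (g' j)))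
      (continuous_eip_waveMul (hg i) (hg' j)).aestronglyMeasurable
      (ae_of_all _ fun k => ?_)).congr (ae_of_all _ fun k => by simp only; ring)
    refine (norm_eip_le (hg i) (memLp_waveMul (hg' j) k)).trans ?_
    rw [l2Sq_waveMul]
  have hI : ∫ k in S, ((1 / ‖k‖ : ℝ) : ℂ) * intDensity f η k =
      ∑ l, ((∫ k, c l k * t1 l k) - ∫ k, c l k * t2 l k) := by
    have j1 : ∀ l, Integrable fun k => c l k * t1 l k := fun l => hint (hD l) hL l
    have j2 : ∀ l, Integrable fun k => c l k * t2 l k := fun l => hint hL (hD l) l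
    have j3 : ∀ l, (∫ k, c l k * t1 l k) - ∫ k, c l k * t2 l k =
        ∫ k, (c l k * t1 l k - c l k * t2 l k) := fun l => (integral_sub (j1 l) (j2 l)).symm
    have j4 : ∀ l, Integrable fun k => c l k * t1 l k - c l k * t2 l k :=
      fun l => (j1 l).sub (j2 l)
    simp_rw [j3]
    rw [← integral_finsetSum _ fun l _ => j4 l,
      ← integral_indicator hS]
    refine integral_congr_ae (ae_of_all _ fun k => ?_)
    by_cases hk : k ∈ S
    · simp only [Set.indicator_of_mem hk]
      have hk0 : 0 < ‖k‖ := hΛ.trans_le (hSΛ hk)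
      by_cases hkR : ‖k‖ ≤ R
      · have hkS' : k ∈ S' := ⟨hk, hkR⟩
        rw [intDensity_by_parts hA hf η (norm_pos_iff.1 hk0), Finset.mul_sum]
        refine Finset.sum_congr rfl fun l _ => ?_
        simp only [c, Set.indicator_of_mem hkS', t1, t2]
        rw [← mul_sub, ← mul_assoc, ← Complex.ofReal_mul]
        congr 2
        field_simp
      · have hz : ∀ j, ann k (η j) = 0 := hR k (not_le.1 hkR)
        simp [intDensity, tip, mpair, hz, t1, t2]
    · simp [Set.indicator_of_notMem hk, hcS _ k hk]
  have hN0 : ∀ k, 0 ≤ phDensity f η k := phDensity_nonneg hL η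
  have hNi := integrable_phDensity f η
  set N : ℝ := ∫ k in S, phDensity f η k
  set T : Fin 3 → ℝ := fun l => (tip (fun j => dA A l (f j)) η (fun j => dA A l (f j)) η).re
  have hT0 : ∀ l, 0 ≤ T l := fun l => tip_self_nonneg (hD l) η
  have b1 : ∀ l, 2 * κ * ‖∫ k, c l k * t1 l k‖ ≤ 6 * κ ^ 2 * M * T l + 1 / 6 * N := fun l => by
    have : 2 * κ * ‖∫ k, c l k * t1 l k‖ = ‖∫ k, ((2 * κ : ℝ) : ℂ) * (c l k * t1 l k)‖ := by
      rw [integral_const_mul, norm_mul, Complex.norm_real, Real.norm_of_nonneg (by positivity)]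
    rw [this]
    have hi : Integrable (S.indicator fun k => 6 * κ ^ 2 * T l * (1 / ‖k‖ ^ 4) +
        1 / 6 * phDensity f η k) := (integrable_indicator_iff hS).2
      ((hi4S.const_mul _).add (hNi.integrableOn.const_mul _))
    refine (norm_integral_le_of_norm_le hi (ae_of_all _ fun k => ?_)).trans ?_
    · by_cases hk : k ∈ S
      · rw [Set.indicator_of_mem hk]
        have hk0 : 0 < ‖k‖ := hΛ.trans_le (hSΛ hk)
        have h1 := two_mul_norm_tip_le (hD l) (fun j => memLp_waveMul (hL j) k) η
          (fun j => ann k (η j)) (s := 6 * κ / ‖k‖ ^ 2) (by positivity)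
        rw [tip_waveMul_self] at h1
        have h2 := hcle l k
        rw [Set.indicator_of_mem hk] at h2
        rw [norm_mul, norm_mul, Complex.norm_real, Real.norm_of_nonneg (by positivity)]
        calc 2 * κ * (‖c l k‖ * ‖t1 l k‖) ≤ 2 * κ * (1 / ‖k‖ ^ 2 * ‖t1 l k‖) := by gcongr
          _ = κ * (1 / ‖k‖ ^ 2) * (2 * ‖t1 l k‖) := by ring
          _ ≤ κ * (1 / ‖k‖ ^ 2) * (6 * κ / ‖k‖ ^ 2 * T l +
              (6 * κ / ‖k‖ ^ 2)⁻¹ * phDensity f η k) :=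
            mul_le_mul_of_nonneg_left h1 (by positivity)
          _ = _ := by field_simp
      · rw [Set.indicator_of_notMem hk, hcS l k hk]; simp
    · rw [integral_indicator hS, integral_add (hi4S.const_mul _) (hNi.integrableOn.const_mul _),
        integral_const_mul, integral_const_mul]
      have := mul_le_mul_of_nonneg_left hMS (by have := hT0 l; positivity : 0 ≤ 6 * κ ^ 2 * T l)
      simp only [N]
      linarith
  -- Here the derivative and the annihilator are on the same side. The weight s = 1/(6κM) again
  -- leaves 1/6 of the phonon number.
  have b2 : ∀ l, 2 * κ * ‖∫ k, c l k * t2 l k‖ ≤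
      1 / 6 * (N + (tip f η f η).re) + 6 * κ ^ 2 * M * T l := fun l => by
    have h1 := norm_integral_mul_tip_le hL (hD l) η (hcm l) hS (hcS l) hM (hc2 l)
      (s := 1 / (6 * κ * M)) (by positivity)
    have h2 := mul_le_mul_of_nonneg_left h1 hκ.le
    calc _ = κ * (2 * ‖∫ k, c l k * t2 l k‖) := by ring
      _ ≤ _ := h2
      _ = _ := by simp only [N, T]; field_simp
  have hre : ∫ k in S, κ * (1 / ‖k‖ * (2 * (intDensity f η k).re)) =
      2 * κ * (∫ k in S, ((1 / ‖k‖ : ℝ) : ℂ) * intDensity f η k).re := by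
    have h1 : (∫ k in S, ((1 / ‖k‖ : ℝ) : ℂ) * intDensity f η k).re =
        ∫ k in S, (((1 / ‖k‖ : ℝ) : ℂ) * intDensity f η k).re :=
      (integral_re (𝕜 := ℂ) (integrable_inv_norm_mul_tip hL hL η).integrableOn).symm
    rw [h1, ← integral_const_mul]
    refine integral_congr_ae (ae_of_all _ fun k => ?_)
    simp only [Complex.re_ofReal_mul]; ring
  rw [integral_add hNi.integrableOn ((integrable_intDensity hL η).const_mul _).integrableOn, hre, hI]
  have h7 : -(∑ l, (‖∫ k, c l k * t1 l k‖ + ‖∫ k, c l k * t2 l k‖)) ≤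
      (∑ l, ((∫ k, c l k * t1 l k) - ∫ k, c l k * t2 l k)).re := by
    refine (abs_le.1 ((Complex.abs_re_le_norm _).trans ?_)).1
    exact norm_sum_le_of_le _ fun l _ => norm_sub_le _ _
  have h8 : ∑ l, (2 * κ * ‖∫ k, c l k * t1 l k‖ + 2 * κ * ‖∫ k, c l k * t2 l k‖) ≤
      ∑ l, ((6 * κ ^ 2 * M * T l + 1 / 6 * N) +
        (1 / 6 * (N + (tip f η f η).re) + 6 * κ ^ 2 * M * T l)) :=
    Finset.sum_le_sum fun l _ => add_le_add (b1 l) (b2 l)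
  have h9 : ∑ l, ((6 * κ ^ 2 * M * T l + 1 / 6 * N) +
        (1 / 6 * (N + (tip f η f η).re) + 6 * κ ^ 2 * M * T l)) =
      12 * κ ^ 2 * M * kinT A f η + N + 1 / 2 * (tip f η f η).re := by
    rw [kinT_eq]
    simp only [Fin.sum_univ_three, T]; ring
  have h10 : ∑ l, (2 * κ * ‖∫ k, c l k * t1 l k‖ + 2 * κ * ‖∫ k, c l k * t2 l k‖) =
      2 * κ * ∑ l, (‖∫ k, c l k * t1 l k‖ + ‖∫ k, c l k * t2 l k‖) := by
    rw [Finset.mul_sum]; exact Finset.sum_congr rfl fun l _ => by ring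
  have h11 := mul_le_mul_of_nonneg_left h7 (by positivity : 0 ≤ 2 * κ)
  rw [mul_neg, ← h10] at h11
  rw [h9] at h8
  change _ ≤ N + _
  linarith

/-- Phonons of small and large momentum can be dropped. -/
theorem frohlichForm_ge_cutForm {A : R3 → R3} (hA : VectorL2Loc A) {V : R3 → ℝ}
    (hV : LocallyIntegrable V volume) (hVf : InfFormBounded V) {f : J → R3 → ℂ}
    (hf : ∀ j, IsTest (f j)) (η : J → Fock) {α κ Λ : ℝ} (hκ : 0 < κ)
    (hκα : κ = Real.sqrt α / (Real.sqrt 2 * Real.pi)) (hΛ : 1 ≤ Λ) :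
    cutForm A V κ (12 * κ ^ 2 * (sphereArea / Λ)) (midCube Λ) f η -
      (κ ^ 2 * sphereArea + 1 / 2) * (tip f η f η).re ≤ frohlichForm A V α (tens f η) := by
  have hL := fun j => (hf j).memLp 2
  rw [frohlichForm_tens hA hV hVf hf, ← hκα]
  have hh : Integrable fun k => phDensity f η k + κ * (1 / ‖k‖ * (2 * (intDensity f η k).re)) :=
    (integrable_phDensity f η).add ((integrable_intDensity hL η).const_mul _)
  rw [← integral_add_compl (measurableSet_cube Λ) hh,
    ← integral_inter_add_sdiff measurableSet_unitBall hh.integrableOn]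
  have h1 := uv_bound hA hf η hκ (by linarith : 0 < Λ)
  -- Λ ≥ 1 puts the unit ball inside the cube, so momentum space splits into ball, cube without
  -- ball, and exterior.
  have hsub : cube Λ ∩ {k | ‖k‖ < 1} = {k : R3 | ‖k‖ < 1} := by
    refine Set.inter_eq_right.2 fun k hk l => ?_
    have h2 := abs_le.1 (abs_apply_le_norm k l)
    have h3 : ‖k‖ < 1 := hk
    exact ⟨by linarith [h2.1], by linarith [h2.2]⟩
  obtain ⟨hi2, he2⟩ := integral_ball_inv_sq (zero_le_one)
  have h2 : -(κ ^ 2 * sphereArea * (tip f η f η).re) ≤ ∫ k in {k : R3 | ‖k‖ < 1},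
      (phDensity f η k + κ * (1 / ‖k‖ * (2 * (intDensity f η k).re))) := by
    have h3 : ∫ k in {k : R3 | ‖k‖ < 1}, -(κ ^ 2 * (tip f η f η).re * (1 / ‖k‖ ^ 2)) =
        -(κ ^ 2 * sphereArea * (tip f η f η).re) := by
      rw [integral_neg, integral_const_mul, he2]; ring
    rw [← h3]
    exact setIntegral_mono (hi2.const_mul _).neg hh.integrableOn fun k => low_density_bound hL η hκ k
  rw [hsub]
  simp only [cutForm, midCube]
  linarith

end Cut

/-! ### Block modes for localized electrons -/

/-- Multiplication by a plane wave centred at `y`. -/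
def shiftWave (y p : R3) (φ : R3 → ℂ) : R3 → ℂ :=
  fun x => Complex.exp (Complex.I * ((inner ℝ p (x - y) : ℝ) : ℂ)) * φ x

lemma memLp_shiftWave {φ : R3 → ℂ} (h : MemLp φ 2 volume) (y p : R3) :
    MemLp (shiftWave y p φ) 2 volume :=
  h.of_le ((Continuous.aestronglyMeasurable (by fun_prop)).mul h.1)
    (ae_of_all _ fun x => by rw [shiftWave, norm_mul, norm_exp_I_mul, one_mul])

lemma waveMul_eq_shiftWave (y k : R3) (φ : R3 → ℂ) (x : R3) :
    waveMul k φ x = Complex.exp (Complex.I * ((inner ℝ k y : ℝ) : ℂ)) * shiftWave y k φ x := by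
  rw [waveMul, shiftWave, ← mul_assoc, ← Complex.exp_add, inner_sub_right]
  congr 2; push_cast; ring

lemma norm_phase_sub_le (a b : ℝ) :
    ‖Complex.exp (Complex.I * (a : ℂ)) - Complex.exp (Complex.I * (b : ℂ))‖ ≤ |a - b| := by
  have h : Complex.exp (Complex.I * (a : ℂ)) - Complex.exp (Complex.I * (b : ℂ)) =
      Complex.exp (Complex.I * (b : ℂ)) * (Complex.exp (Complex.I * ((a - b : ℝ) : ℂ)) - 1) := by
    rw [mul_sub, ← Complex.exp_add, mul_one]
    congr 2; push_cast; ring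
  rw [h, norm_mul, norm_exp_I_mul, one_mul]
  exact Real.norm_exp_I_mul_ofReal_sub_one_le

lemma norm_phase_sub_le_of_near {y k p x : R3} {D L : ℝ} (hD : ‖k - p‖ ≤ D) (hx : ‖x - y‖ ≤ L) :
    ‖Complex.exp (Complex.I * ((inner ℝ k (x - y) : ℝ) : ℂ)) -
      Complex.exp (Complex.I * ((inner ℝ p (x - y) : ℝ) : ℂ))‖ ≤ D * L := by
  refine (norm_phase_sub_le _ _).trans ?_
  rw [← inner_sub_left]
  exact (abs_real_inner_le_norm _ _).trans
    (mul_le_mul hD hx (norm_nonneg _) ((norm_nonneg _).trans hD))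

/-- Centring at y changes the matrix element by a phase only. This lets the expansion of the plane
wave be centred at the electron while the Coulomb energy still appears. -/
lemma norm_eip_shiftWave (φ : R3 → ℂ) (y p : R3) :
    ‖eip φ (shiftWave y p φ)‖ = ‖densityFT (density φ) p‖ := by
  have h : eip φ (shiftWave y p φ) =
      Complex.exp (Complex.I * ((-(inner ℝ p y : ℝ) : ℝ) : ℂ)) * densityFT (density φ) p := by
    rw [eip, densityFT, ← integral_const_mul]
    refine integral_congr_ae (ae_of_all _ fun x => ?_)
    have e1 : ((density φ x : ℝ) : ℂ) = (starRingEnd ℂ) (φ x) * φ x := by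
      rw [density, mul_comm, Complex.mul_conj, Complex.normSq_eq_norm_sq]
    have e2 : Complex.exp (Complex.I * ((inner ℝ p (x - y) : ℝ) : ℂ)) =
        Complex.exp (Complex.I * ((-(inner ℝ p y : ℝ) : ℝ) : ℂ)) *
          Complex.exp (Complex.I * ((inner ℝ p x : ℝ) : ℂ)) := by
      rw [← Complex.exp_add, inner_sub_right]; congr 1; push_cast; ring
    simp only [shiftWave]
    rw [e1, e2]; ring
  rw [h, norm_mul, norm_exp_I_mul, one_mul]

lemma norm_eip_shiftWave_sub_le {φ : R3 → ℂ} (hφ : MemLp φ 2 volume) {y k p : R3} {D L : ℝ}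
    (hs : ∀ x, L < ‖x - y‖ → φ x = 0) (hD : ‖k - p‖ ≤ D) :
    ‖eip φ (shiftWave y k φ) - eip φ (shiftWave y p φ)‖ ≤ D * L * l2Sq φ := by
  rw [eip, eip, ← integral_sub (integrable_conj_mul hφ (memLp_shiftWave hφ y k))
    (integrable_conj_mul hφ (memLp_shiftWave hφ y p)), l2Sq, ← integral_const_mul]
  refine norm_integral_le_of_norm_le ((integrable_norm_sq hφ).const_mul _)
    (ae_of_all _ fun x => ?_)
  by_cases hx : L < ‖x - y‖
  · simp [hs x hx]
  · have h := norm_phase_sub_le_of_near (y := y) (x := x) hD (not_lt.1 hx)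
    rw [shiftWave, shiftWave, ← mul_sub, ← sub_mul, norm_mul, norm_mul, RCLike.norm_conj]
    nlinarith [mul_le_mul_of_nonneg_right h (sq_nonneg ‖φ x‖)]

/-- A finite disjoint family of small sets away from the origin. -/
structure IsBlockFamily {ι : Type*} (blk : ι → Set R3) (p : ι → R3) (D R : ℝ) : Prop where
  meas : ∀ s, MeasurableSet (blk s)
  disj : Pairwise (Function.onFun Disjoint blk)
  far : ∀ s, ∀ k ∈ blk s, 1 ≤ ‖k‖
  bdd : ∀ s, ∀ k ∈ blk s, ‖k‖ ≤ R
  near : ∀ s, ∀ k ∈ blk s, ‖k - p s‖ ≤ D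
  pos : ∀ s, 0 < ∫ k in blk s, 1 / ‖k‖ ^ 2

/-! ### One electron in classical block fields -/

section Blocks

variable {ι : Type*} {blk : ι → Set R3} {p : ι → R3} {D R : ℝ}

/-- The squared weight of a block. -/
def blkWeight (blk : ι → Set R3) (s : ι) : ℝ := ∫ k in blk s, 1 / ‖k‖ ^ 2

lemma IsBlockFamily.integrableOn (h : IsBlockFamily blk p D R) (s : ι) :
    IntegrableOn (fun k : R3 => 1 / ‖k‖ ^ 2) (blk s) := by
  refine (integral_ball_inv_sq (r := |R| + 1) (by positivity)).1.mono_set fun k hk => ?_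
  have := h.bdd s k hk
  have := le_abs_self R
  simp only [Set.mem_ofPred_eq]; linarith

variable [Fintype ι]

/-- The one-particle problem with classical block fields. -/
lemma one_particle_bound (hb : IsBlockFamily blk p D R) {L : ℝ}
    {κ δ E₀ Q : ℝ} (hδ : 0 < δ) (hδ2 : δ ≤ 1 / 2) {φ : R3 → ℂ} (hφ : IsTest φ) {y : R3}
    (hs : ∀ x, L < ‖x - y‖ → φ x = 0)
    (hE : E₀ * l2Sq φ ≤ Q - (1 + 4 * δ) * κ ^ 2 *
      ((∫ k, ‖densityFT (density φ) k‖ ^ 2 / ‖k‖ ^ 2) / l2Sq φ)) (z : ι → ℂ) :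
    (E₀ - 4 * κ ^ 2 * (D * L) ^ 2 * (∑ s, blkWeight blk s) / δ) * l2Sq φ ≤
      Q + ∑ s, (‖z s‖ ^ 2 * ((1 - δ) * l2Sq φ) + 2 * (z s * (((κ * Real.sqrt (blkWeight blk s) : ℝ) : ℂ) *
        eip φ (shiftWave y (p s) φ))).re) := by
  set r := l2Sq φ
  set Z := ∫ k, ‖densityFT (density φ) k‖ ^ 2 / ‖k‖ ^ 2
  have hr0 : 0 ≤ r := l2Sq_nonneg φ
  have hφL := hφ.memLp 2
  have hw0 : ∀ s, 0 < blkWeight blk s := hb.pos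
  have hm2 : ∀ s, Real.sqrt (blkWeight blk s) ^ 2 = blkWeight blk s := fun s =>
    Real.sq_sqrt (hw0 s).le
  have hdens : ∀ k, ‖eip φ (shiftWave y k φ)‖ = ‖densityFT (density φ) k‖ := norm_eip_shiftWave φ y
  have hle : ∀ k, ‖eip φ (shiftWave y k φ)‖ ≤ r := fun k => by
    have h1 := norm_eip_le hφL (memLp_shiftWave hφL y k)
    have h2 : l2Sq (shiftWave y k φ) = r := by
      simp only [l2Sq, shiftWave, norm_mul, norm_exp_I_mul, one_mul, r]
    rwa [h2, Real.mul_self_sqrt hr0] at h1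
  -- If φ has norm 0 the quotient in the hypothesis is 0 by convention, so Q ≥ 0, and all matrix
  -- elements vanish.
  rcases hr0.eq_or_lt with hr | hr
  · rw [← hr] at hE hle ⊢
    have h0 : ∀ s, eip φ (shiftWave y (p s) φ) = 0 := fun s =>
      norm_eq_zero.1 (le_antisymm (hle _) (norm_nonneg _))
    simp only [mul_zero, div_zero, sub_zero] at hE
    simp [h0]; exact hE
  obtain ⟨hZi, -⟩ := hφ.integrable_densityFT
  have hδ1 : 0 < 1 - δ := by linarith
  -- The square is completed in z s, the coefficient of |z s|² being (1 - δ) r.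
  have key : ∀ s, -(κ ^ 2 * (blkWeight blk s * ‖densityFT (density φ) (p s)‖ ^ 2) / ((1 - δ) * r)) ≤
      ‖z s‖ ^ 2 * ((1 - δ) * r) + 2 * (z s * (((κ * Real.sqrt (blkWeight blk s) : ℝ) : ℂ) *
        eip φ (shiftWave y (p s) φ))).re := fun s => by
    set m := Real.sqrt (blkWeight blk s)
    set q := ‖densityFT (density φ) (p s)‖
    have h1 : -(‖z s‖ * (|κ * m| * q)) ≤ (z s * (((κ * m : ℝ) : ℂ) *
        eip φ (shiftWave y (p s) φ))).re := by
      refine (abs_le.1 ((Complex.abs_re_le_norm _).trans (le_of_eq ?_))).1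
      rw [norm_mul, norm_mul, Complex.norm_real, Real.norm_eq_abs, hdens]
    have h2 : κ ^ 2 * (blkWeight blk s * q ^ 2) = (|κ * m| * q) ^ 2 := by
      rw [mul_pow, sq_abs, mul_pow, hm2]; ring
    rw [h2]
    set a := |κ * m| * q
    have hpos : 0 < (1 - δ) * r := by positivity
    have h3 : 0 ≤ (‖z s‖ * ((1 - δ) * r) - a) ^ 2 / ((1 - δ) * r) := by positivity
    have h4 : (‖z s‖ * ((1 - δ) * r) - a) ^ 2 / ((1 - δ) * r) =
        ‖z s‖ ^ 2 * ((1 - δ) * r) - 2 * (‖z s‖ * a) + a ^ 2 / ((1 - δ) * r) := by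
      field_simp; ring
    linarith
  -- The transform at the block centre is compared with its values on the block, from which it
  -- differs by at most D L r. Young's inequality costs a factor 1 + δ and the remainder (1 +
  -- 1/δ)(DLr)² ≤ (2/δ)(DLr)².
  have hblk : ∀ s, blkWeight blk s * ‖densityFT (density φ) (p s)‖ ^ 2 ≤
      (1 + δ) * (∫ k in blk s, ‖densityFT (density φ) k‖ ^ 2 / ‖k‖ ^ 2) +
        2 / δ * (D * L * r) ^ 2 * blkWeight blk s := fun s => by
    have hi := hb.integrableOn s
    rw [blkWeight, mul_comm, ← integral_const_mul, ← integral_const_mul, ← integral_const_mul,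
      ← integral_add (hZi.integrableOn.const_mul _) (hi.const_mul _)]
    refine setIntegral_mono_on (hi.const_mul _)
      ((hZi.integrableOn.const_mul _).add (hi.const_mul _)) (hb.meas s) fun k hk => ?_
    have h1 := norm_eip_shiftWave_sub_le hφL hs (hb.near s k hk)
    rw [← hdens, ← hdens]
    set a := eip φ (shiftWave y k φ)
    set b := eip φ (shiftWave y (p s) φ)
    have h2 : ‖b‖ ≤ ‖a‖ + D * L * r := by
      have := norm_sub_norm_le b a
      rw [norm_sub_rev] at this
      linarith
    have h3 : ‖b‖ ^ 2 ≤ (1 + δ) * ‖a‖ ^ 2 + 2 / δ * (D * L * r) ^ 2 := by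
      have h4 : ‖b‖ ^ 2 ≤ (‖a‖ + D * L * r) ^ 2 := by gcongr
      have h5 : 0 ≤ (δ * ‖a‖ - D * L * r) ^ 2 / δ := by positivity
      have h6 : (δ * ‖a‖ - D * L * r) ^ 2 / δ =
          δ * ‖a‖ ^ 2 - 2 * (‖a‖ * (D * L * r)) + (D * L * r) ^ 2 / δ := by field_simp; ring
      have h7 : (D * L * r) ^ 2 + (D * L * r) ^ 2 / δ ≤ 2 / δ * (D * L * r) ^ 2 := by
        have : (D * L * r) ^ 2 ≤ (D * L * r) ^ 2 / δ := by
          rw [le_div_iff₀ hδ]; nlinarith [sq_nonneg (D * L * r)]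
        have h8 : 2 / δ * (D * L * r) ^ 2 = (D * L * r) ^ 2 / δ + (D * L * r) ^ 2 / δ := by ring
        linarith
      nlinarith
    have hk0 : 0 ≤ 1 / ‖k‖ ^ 2 := by positivity
    calc ‖b‖ ^ 2 * (1 / ‖k‖ ^ 2) ≤ ((1 + δ) * ‖a‖ ^ 2 + 2 / δ * (D * L * r) ^ 2) * (1 / ‖k‖ ^ 2) :=
          mul_le_mul_of_nonneg_right h3 hk0
      _ = _ := by ring
  have hsumZ : ∑ s, ∫ k in blk s, ‖densityFT (density φ) k‖ ^ 2 / ‖k‖ ^ 2 ≤ Z := by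
    rw [← integral_iUnion_fintype hb.meas hb.disj fun s => hZi.integrableOn]
    exact setIntegral_le_integral hZi (ae_of_all _ fun k => by positivity)
  have hZ0 : 0 ≤ Z := integral_nonneg fun k => by positivity
  set W := ∑ s, blkWeight blk s
  have hW0 : 0 ≤ W := Finset.sum_nonneg fun s _ => (hw0 s).le
  have hsum : ∑ s, κ ^ 2 * (blkWeight blk s * ‖densityFT (density φ) (p s)‖ ^ 2) / ((1 - δ) * r) ≤
      (1 + 4 * δ) * κ ^ 2 * (Z / r) + 4 * κ ^ 2 * (D * L) ^ 2 * W / δ * r := by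
    have h1 : ∑ s, blkWeight blk s * ‖densityFT (density φ) (p s)‖ ^ 2 ≤
        (1 + δ) * Z + 2 / δ * (D * L * r) ^ 2 * W := by
      refine (Finset.sum_le_sum fun s _ => hblk s).trans ?_
      rw [Finset.sum_add_distrib, ← Finset.mul_sum, ← Finset.mul_sum]
      gcongr
    have h2 : ∑ s, κ ^ 2 * (blkWeight blk s * ‖densityFT (density φ) (p s)‖ ^ 2) / ((1 - δ) * r) =
        κ ^ 2 / ((1 - δ) * r) * ∑ s, blkWeight blk s * ‖densityFT (density φ) (p s)‖ ^ 2 := by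
      rw [Finset.mul_sum]; exact Finset.sum_congr rfl fun s _ => by ring
    rw [h2]
    refine (mul_le_mul_of_nonneg_left h1 (by positivity)).trans ?_
    have h3 : κ ^ 2 / ((1 - δ) * r) * ((1 + δ) * Z + 2 / δ * (D * L * r) ^ 2 * W) =
        κ ^ 2 * (Z / r) * ((1 + δ) / (1 - δ)) +
          2 * κ ^ 2 * (D * L) ^ 2 * W / δ * r * (1 / (1 - δ)) := by
      field_simp
    rw [h3]
    -- This is where δ ≤ 1/2 is needed, and the origin of the factor 1 + 4δ in the Coulomb term.
    have h4 : (1 + δ) / (1 - δ) ≤ 1 + 4 * δ := by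
      rw [div_le_iff₀ hδ1]; nlinarith
    have h5 : 1 / (1 - δ) ≤ 2 := by
      rw [div_le_iff₀ hδ1]; linarith
    have h6 : κ ^ 2 * (Z / r) * ((1 + δ) / (1 - δ)) ≤ κ ^ 2 * (Z / r) * (1 + 4 * δ) := by gcongr
    have h7 : 2 * κ ^ 2 * (D * L) ^ 2 * W / δ * r * (1 / (1 - δ)) ≤
      2 * κ ^ 2 * (D * L) ^ 2 * W / δ * r * 2 := by gcongr
    have h8 : 2 * κ ^ 2 * (D * L) ^ 2 * W / δ * r * 2 = 4 * κ ^ 2 * (D * L) ^ 2 * W / δ * r := by ring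
    linarith
  have hfin := Finset.sum_le_sum fun s (_ : s ∈ Finset.univ) => key s
  rw [Finset.sum_neg_distrib] at hfin
  linarith

end Blocks

/-! ### Block modes and the energy of a localized electron -/

section BlockForm

variable {ι : Type*} {blk : ι → Set R3} {p : ι → R3} {D R : ℝ}

/-- The normalized mode of a block, centred at `y`. -/
def blkMode (blk : ι → Set R3) (y : R3) (s : ι) : R3 → ℂ := (blk s).indicator fun k =>
  (starRingEnd ℂ) (((1 / (‖k‖ * Real.sqrt (blkWeight blk s)) : ℝ) : ℂ) *
    Complex.exp (Complex.I * ((inner ℝ k y : ℝ) : ℂ)))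

lemma IsBlockFamily.norm_blkMode (y : R3) (s : ι) (k : R3) :
    ‖blkMode blk y s k‖ =
      (blk s).indicator (fun k => 1 / (‖k‖ * Real.sqrt (blkWeight blk s))) k := by
  by_cases hk : k ∈ blk s
  · rw [blkMode, Set.indicator_of_mem hk, Set.indicator_of_mem hk, RCLike.norm_conj, norm_mul,
      norm_exp_I_mul, mul_one, Complex.norm_real, Real.norm_of_nonneg (by positivity)]
  · rw [blkMode, Set.indicator_of_notMem hk, Set.indicator_of_notMem hk, norm_zero]

lemma IsBlockFamily.isMode (h : IsBlockFamily blk p D R) (y : R3) (s : ι) :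
    IsMode (blkMode blk y s) := by
  refine ⟨Measurable.indicator ?_ (h.meas s), 1 / Real.sqrt (blkWeight blk s), R, fun k => ?_,
    fun k hk => ?_⟩
  · refine Complex.continuous_conj.measurable.comp (Measurable.mul ?_ ?_)
    · exact Complex.measurable_ofReal.comp (by fun_prop)
    · exact Continuous.measurable (by fun_prop)
  · rw [IsBlockFamily.norm_blkMode]
    have hw := Real.sqrt_pos.2 (h.pos s)
    by_cases hk : k ∈ blk s
    · rw [Set.indicator_of_mem hk]
      have h1 := h.far s k hk
      have : Real.sqrt (blkWeight blk s) ≤ ‖k‖ * Real.sqrt (blkWeight blk s) :=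
        le_mul_of_one_le_left (Real.sqrt_nonneg _) h1
      exact one_div_le_one_div_of_le hw this
    · rw [Set.indicator_of_notMem hk]; positivity
  · exact Set.indicator_of_notMem (fun hk' => absurd (h.bdd s k hk') (not_le.2 hk)) _

lemma IsBlockFamily.integral_norm_sq (h : IsBlockFamily blk p D R) (y : R3) (s : ι) :
    ∫ k, ‖blkMode blk y s k‖ ^ 2 = 1 := by
  have hw : 0 < blkWeight blk s := h.pos s
  have e : ∀ k, ‖blkMode blk y s k‖ ^ 2 =
      (blk s).indicator (fun k => (blkWeight blk s)⁻¹ * (1 / ‖k‖ ^ 2)) k := fun k => by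
    rw [IsBlockFamily.norm_blkMode]
    by_cases hk : k ∈ blk s
    · rw [Set.indicator_of_mem hk, Set.indicator_of_mem hk, div_pow, mul_pow, Real.sq_sqrt hw.le]
      rw [one_pow, one_div, one_div, mul_inv, mul_comm]
    · rw [Set.indicator_of_notMem hk, Set.indicator_of_notMem hk]; norm_num
  simp_rw [e]
  rw [integral_indicator (h.meas s), integral_const_mul]
  exact inv_mul_cancel₀ hw.ne'

lemma IsBlockFamily.inner_blkMode (h : IsBlockFamily blk p D R) (y : R3) (s t : ι) [DecidableEq ι] :
    ∫ k, (starRingEnd ℂ) (blkMode blk y s k) * blkMode blk y t k = if s = t then 1 else 0 := by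
  split_ifs with hst
  · subst hst
    have : ((∫ k, ‖blkMode blk y s k‖ ^ 2 : ℝ) : ℂ) = 1 := by rw [h.integral_norm_sq]; simp
    rw [← this, ← integral_complex_ofReal]
    refine integral_congr_ae (ae_of_all _ fun k => ?_)
    simp only
    rw [mul_comm, Complex.mul_conj, Complex.normSq_eq_norm_sq]
  · have : ∀ k, (starRingEnd ℂ) (blkMode blk y s k) * blkMode blk y t k = 0 := fun k => by
      by_cases hk : k ∈ blk s
      · have hk' : k ∉ blk t := Set.disjoint_left.1 (h.disj hst) hk
        rw [blkMode, blkMode, Set.indicator_of_notMem hk', mul_zero]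
      · rw [blkMode, Set.indicator_of_notMem hk, map_zero, zero_mul]
    simp [this]

variable {J : Type*} [Fintype J]

/-- Multiplication by c acts pointwise in x. Its size matters only on the supports of the f_j, which
is how localization makes the phase error small. -/
lemma tip_phase_le {f : J → R3 → ℂ} (hf : ∀ j, MemLp (f j) 2 volume) (θ : J → Fock) {c : R3 → ℂ}
    {C : ℝ} (hcC : ∀ x, (∃ j, f j x ≠ 0) → ‖c x‖ ≤ C)
    (hcf : ∀ j, MemLp (fun x => c x * f j x) 2 volume) :
    (tip (fun j x => c x * f j x) θ (fun j x => c x * f j x) θ).re ≤ C ^ 2 * (tip f θ f θ).re := by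
  rw [tip_self_re hcf, tip_self_re hf, ← integral_const_mul]
  refine integral_mono (integrable_fockForm_pv hcf hcf θ θ).re
    ((integrable_fockForm_pv hf hf θ θ).re.const_mul _) fun x => ?_
  have e : pv (fun j x => c x * f j x) θ x = c x • pv f θ x := by
    simp [pv, Finset.smul_sum, smul_smul]
  change (fockForm (pv (fun j x => c x * f j x) θ x) (pv (fun j x => c x * f j x) θ x)).re ≤
    C ^ 2 * (fockForm (pv f θ x) (pv f θ x)).re
  have h0 := fockForm_pos (pv f θ x)
  rw [e, map_smul, LinearMap.map_smulₛₗ, LinearMap.smul_apply, smul_eq_mul, smul_eq_mul, ← mul_assoc,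
    Complex.mul_conj, Complex.normSq_eq_norm_sq, Complex.re_ofReal_mul]
  by_cases hx : ∃ j, f j x ≠ 0
  · have := hcC x hx
    gcongr
  · push Not at hx
    have : pv f θ x = 0 := by simp [pv, hx]
    rw [this]; simp

lemma tip_smul_right (f : J → R3 → ℂ) (η : J → Fock) (g : J → R3 → ℂ) (θ : J → Fock) (a : ℂ) :
    tip f η (fun j x => a * g j x) θ = a * tip f η g θ := by
  simp only [tip, mpair, Finset.mul_sum]
  refine Finset.sum_congr rfl fun i _ => Finset.sum_congr rfl fun j _ => ?_
  have : eip (f i) (fun x => a * g j x) = a * eip (f i) (g j) := by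
    simp only [eip, ← integral_const_mul]
    exact integral_congr_ae (ae_of_all _ fun x => by simp only; ring)
  rw [this]; ring

lemma tip_add_right {f g g' : J → R3 → ℂ} (hf : ∀ j, MemLp (f j) 2 volume)
    (hg : ∀ j, MemLp (g j) 2 volume) (hg' : ∀ j, MemLp (g' j) 2 volume) (η θ : J → Fock) :
    tip f η (fun j x => g j x + g' j x) θ = tip f η g θ + tip f η g' θ := by
  simp only [tip, mpair, ← Finset.sum_add_distrib]
  refine Finset.sum_congr rfl fun i _ => Finset.sum_congr rfl fun j _ => ?_
  have : eip (f i) (fun x => g j x + g' j x) = eip (f i) (g j) + eip (f i) (g' j) := by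
    simp only [eip, mul_add]
    exact integral_add (integrable_conj_mul (hf i) (hg j)) (integrable_conj_mul (hf i) (hg' j))
  rw [this, add_mul]

/-- On a block, the plane wave can be replaced by the one of the block centre. -/
lemma block_density_bound {f : J → R3 → ℂ} (hf : ∀ j, MemLp (f j) 2 volume) (η : J → Fock)
    {y k q : R3} {D L κ δ : ℝ} (hD : 0 < D) (hL : 0 < L) (hκ : 0 < κ) (hδ : 0 < δ)
    (hs : ∀ j x, L < ‖x - y‖ → f j x = 0) (hkq : ‖k - q‖ ≤ D) (hk : 1 ≤ ‖k‖) :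
    (1 - δ) * phDensity f η k + 2 * (((κ * (1 / ‖k‖) : ℝ) : ℂ) *
      (Complex.exp (Complex.I * ((inner ℝ k y : ℝ) : ℂ)) *
        tip f η (fun j => shiftWave y q (f j)) fun j => ann k (η j))).re -
      κ ^ 2 * (D * L) ^ 2 / δ * (1 / ‖k‖ ^ 2) * (tip f η f η).re ≤
      phDensity f η k + κ * (1 / ‖k‖ * (2 * (intDensity f η k).re)) := by
  set θ : J → Fock := fun j => ann k (η j)
  set ph := Complex.exp (Complex.I * ((inner ℝ k y : ℝ) : ℂ))
  set c : R3 → ℂ := fun x => Complex.exp (Complex.I * ((inner ℝ k (x - y) : ℝ) : ℂ)) -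
      Complex.exp (Complex.I * ((inner ℝ q (x - y) : ℝ) : ℂ))
  have hcc : Continuous c := by fun_prop
  have hcf : ∀ j, MemLp (fun x => c x * f j x) 2 volume := fun j => by
    have := (memLp_shiftWave (hf j) y k).sub (memLp_shiftWave (hf j) y q)
    refine this.ae_eq (ae_of_all _ fun x => ?_)
    simp [shiftWave, c, sub_mul]
  have hdec : intDensity f η k = ph * tip f η (fun j => shiftWave y q (f j)) θ +
      ph * tip f η (fun j x => c x * f j x) θ := by
    rw [intDensity_eq_tip, ← mul_add,
      ← tip_add_right hf (fun j => memLp_shiftWave (hf j) y q) hcf, ← tip_smul_right]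
    congr 1
    ext j x
    rw [waveMul_eq_shiftWave y]
    simp only [shiftWave, c, ph]; ring
  have hrem : (tip (fun j x => c x * f j x) θ (fun j x => c x * f j x) θ).re ≤
      (D * L) ^ 2 * phDensity f η k := by
    refine tip_phase_le hf θ (fun x hx => ?_) hcf
    obtain ⟨j, hj⟩ := hx
    refine norm_phase_sub_le_of_near hkq (not_lt.1 fun h => hj (hs j x h))
  have hk0 : 0 < ‖k‖ := by linarith
  -- The weight is chosen so that the remainder consumes exactly the fraction δ of the phonon
  -- density at k.
  have h1 := two_mul_norm_tip_le hf hcf η θ (s := κ * (D * L) ^ 2 / (δ * ‖k‖)) (by positivity)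
  set r := tip f η (fun j x => c x * f j x) θ
  have h2 : -‖r‖ ≤ (ph * r).re := by
    refine (abs_le.1 ((Complex.abs_re_le_norm _).trans (le_of_eq ?_))).1
    rw [norm_mul, norm_exp_I_mul, one_mul]
  have h3 : κ * (1 / ‖k‖) * (2 * ‖r‖) ≤ κ * (1 / ‖k‖) * (κ * (D * L) ^ 2 / (δ * ‖k‖) *
      (tip f η f η).re + (κ * (D * L) ^ 2 / (δ * ‖k‖))⁻¹ * ((D * L) ^ 2 * phDensity f η k)) := by
    refine mul_le_mul_of_nonneg_left (h1.trans ?_) (by positivity)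
    gcongr
  have h4 : κ * (1 / ‖k‖) * (κ * (D * L) ^ 2 / (δ * ‖k‖) *
      (tip f η f η).re + (κ * (D * L) ^ 2 / (δ * ‖k‖))⁻¹ * ((D * L) ^ 2 * phDensity f η k)) =
      κ ^ 2 * (D * L) ^ 2 / δ * (1 / ‖k‖ ^ 2) * (tip f η f η).re + δ * phDensity f η k := by
    field_simp
  rw [hdec, Complex.re_ofReal_mul, Complex.add_re]
  have h5 : κ * (1 / ‖k‖) * (2 * -‖r‖) ≤ κ * (1 / ‖k‖) * (2 * (ph * r).re) := by gcongr
  linarith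

variable [Fintype ι]

/-- The energy of an electron localized near `y`. -/
theorem cutForm_blocks_ge (hb : IsBlockFamily blk p D R) {A : R3 → R3} (hA : VectorL2Loc A)
    {V : R3 → ℝ} (hV : LocallyIntegrable V volume) {f : J → R3 → ℂ} (hf : ∀ j, IsTest (f j))
    (η : J → Fock) {y : R3} {L κ δ ε E₀ : ℝ} (hD : 0 < D) (hL : 0 < L) (hκ : 0 < κ) (hδ : 0 < δ)
    (hδ2 : δ ≤ 1 / 2) (hs : ∀ j x, L < ‖x - y‖ → f j x = 0)
    (hE : ∀ φ, IsTest φ → E₀ * l2Sq φ ≤ (1 - ε) * ∑ l, l2Sq (dA A l φ) + potEnergy V φ -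
      (1 + 4 * δ) * κ ^ 2 * ((∫ k, ‖densityFT (density φ) k‖ ^ 2 / ‖k‖ ^ 2) / l2Sq φ)) :
    (E₀ - 5 * κ ^ 2 * (D * L) ^ 2 * (∑ s, blkWeight blk s) / δ - Fintype.card ι) *
      (tip f η f η).re ≤ cutForm A V κ ε (⋃ s, blk s) f η := by
  classical
  have hLp := fun j => (hf j).memLp 2
  set W := ∑ s, blkWeight blk s
  set X := (tip f η f η).re
  have hX : 0 ≤ X := tip_self_nonneg hLp η
  have hδ1 : 0 < 1 - δ := by linarith
  set b : ι → Module.End ℂ Fock := fun s => lower (blkMode blk y s) (hb.isMode y s)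
  set c : ι → Module.End ℂ Fock := fun s => raise (blkMode blk y s) (hb.isMode y s)
  set m : ι → ℝ := fun s => Real.sqrt (blkWeight blk s)
  have hm : ∀ s, 0 < m s := fun s => Real.sqrt_pos.2 (hb.pos s)
  set E₁ := E₀ - 4 * κ ^ 2 * (D * L) ^ 2 * W / δ
  set g0 : J → J → ℂ := fun i j => eip (f i) (f j)
  set gs : ι → J → J → ℂ := fun s i j => eip (f i) (shiftWave y (p s) (f j))
  -- Only the fraction 1 - δ of the phonon number is left for the block modes, hence the factor 1 -
  -- δ in g, compensated in lam. The hypothesis on classical fields is `one_particle_bound` for ∑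
  -- u_j f_j; disjoint normalized blocks give independent canonical pairs.
  have hmodes := modes_lower_bound (B := fockForm) (b := b) (c := c) fockForm_herm fockForm_pos
    (fun s v w => fockForm_raise_left (hb.isMode y s) v w)
    (fun s => by
      have := lower_mul_raise (hb.isMode y s) (hb.isMode y s)
      rwa [hb.inner_blkMode, if_pos rfl, one_smul] at this)
    (fun s t _ => commute_lower _ _)
    (fun s t hst => by
      have := lower_mul_raise (hb.isMode y s) (hb.isMode y t)
      rw [hb.inner_blkMode, if_neg hst, zero_smul, add_zero] at this
      exact this)
    (fun s v => lower_pow_apply_eq_zero (hb.isMode y s) v) Finset.univ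
    (lam := E₁ / (1 - δ)) (g := fun i j => ((1 - δ : ℝ) : ℂ) * g0 i j)
    (h := fun i j => ((1 - ε : ℝ) : ℂ) * kinMat A f i j + potMat V f i j)
    (w := fun s i j => ((κ * m s : ℝ) : ℂ) * gs s i j)
    (fun z u => by
      set φ : R3 → ℂ := fun x => ∑ j, u j * f j x
      have hφ : IsTest φ := isTest_lincomb hf u
      have e1 : (mpair g0 (rankOne u)).re = l2Sq φ := (l2Sq_sum hLp u).symm
      have e2 : ∀ s, mpair (gs s) (rankOne u) = eip φ (shiftWave y (p s) φ) := fun s => by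
        have e3 : ∀ x, (starRingEnd ℂ) (φ x) * shiftWave y (p s) φ x = ∑ i, ∑ j,
            ((starRingEnd ℂ) (f i x) * shiftWave y (p s) (f j) x) * rankOne u i j := fun x => by
          simp only [φ, shiftWave, map_sum, map_mul, Finset.mul_sum, Finset.sum_mul, rankOne]
          rw [Finset.sum_comm]
          exact Finset.sum_congr rfl fun i _ => Finset.sum_congr rfl fun j _ => by ring
        have hi := fun i j => (integrable_conj_mul (hLp i)
          (memLp_shiftWave (hLp j) y (p s))).mul_const (rankOne u i j)
        simp only [eip, e3]
        rw [integral_finsetSum _ fun i _ => integrable_finsetSum _ fun j _ => hi i j]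
        refine Finset.sum_congr rfl fun i _ => ?_
        rw [integral_finsetSum _ fun j _ => hi i j]
        exact Finset.sum_congr rfl fun j _ => (integral_mul_const _ _).symm
      have h1 := one_particle_bound hb hδ hδ2 hφ (L := L) (y := y) (fun x hx => by
        simp [φ, hs _ x hx]) (hE φ hφ) z
      rw [mpair_smul_left, mpair_add_left, mpair_smul_left, Complex.re_ofReal_mul, Complex.add_re,
        Complex.re_ofReal_mul, e1, ← sum_kinetic_lincomb hA hf, ← potEnergy_lincomb hV hf,
        ← mul_assoc, div_mul_cancel₀ _ hδ1.ne']
      simp only [mpair_smul_left, e2]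
      exact h1) η
  rw [mpair_smul_left, mpair_add_left, mpair_smul_left, Complex.re_ofReal_mul, Complex.add_re,
    Complex.re_ofReal_mul, Finset.card_univ] at hmodes
  simp only [mpair_smul_left, Complex.re_ofReal_mul] at hmodes
  set N : ι → ℝ := fun s => ∫ k in blk s, phDensity f η k
  -- A normalized mode supported in a block holds at most the phonons of that block.
  have hN : ∀ s, (mpair g0 fun i j => fockForm (b s (η i)) (b s (η j))).re ≤ N s := fun s => by
    have h1 : (mpair g0 fun i j => fockForm (b s (η i)) (b s (η j))).re =
        ∫ x, (fockForm (b s (pv f η x)) (b s (pv f η x))).re := by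
      have := tip_self_re hLp fun j => b s (η j)
      simp_rw [map_pv]
      exact this
    obtain ⟨hi, he⟩ := integral_phDensity_pv hLp η (blk s)
    rw [h1]
    simp only [N]
    rw [← he]
    refine integral_mono ?_ hi fun x => ?_
    · simp_rw [map_pv]
      exact (integrable_fockForm_pv hLp hLp _ _).re
    · have := fockForm_lower_lower_le (hb.isMode y s) (hb.meas s)
        (fun k hk => Set.indicator_of_notMem hk _) one_pos (hb.integral_norm_sq y s).le (pv f η x)
      rwa [one_mul] at this
  have hint : ∀ s, (mpair (gs s) fun i j => fockForm (η i) (b s (η j))) =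
      ∫ k in blk s, ((1 / (‖k‖ * m s) : ℝ) : ℂ) *
        (Complex.exp (Complex.I * ((inner ℝ k y : ℝ) : ℂ)) *
        tip f η (fun j => shiftWave y (p s) (f j)) fun j => ann k (η j)) ∧
      IntegrableOn (fun k => ((1 / (‖k‖ * m s) : ℝ) : ℂ) *
        (Complex.exp (Complex.I * ((inner ℝ k y : ℝ) : ℂ)) *
        tip f η (fun j => shiftWave y (p s) (f j)) fun j => ann k (η j))) (blk s) := fun s => by
    have hi : ∀ i j, Integrable fun k => (starRingEnd ℂ) (blkMode blk y s k) *
        fockForm (η i) (ann k (η j)) := fun i j =>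
      ((hb.isMode y s).conj.mul (isMode_fockForm_ann (η i) (η j))).integrable
    have e1 : ∀ k, (blk s).indicator (fun k => ((1 / (‖k‖ * m s) : ℝ) : ℂ) *
        (Complex.exp (Complex.I * ((inner ℝ k y : ℝ) : ℂ)) *
        tip f η (fun j => shiftWave y (p s) (f j)) fun j => ann k (η j))) k =
        ∑ i, ∑ j, gs s i j * ((starRingEnd ℂ) (blkMode blk y s k) *
        fockForm (η i) (ann k (η j))) := fun k => by
      by_cases hk : k ∈ blk s
      · simp only [blkMode, Set.indicator_of_mem hk, tip, mpair, Finset.mul_sum, Complex.conj_conj]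
        exact Finset.sum_congr rfl fun i _ => Finset.sum_congr rfl fun j _ => by ring
      · simp [blkMode, Set.indicator_of_notMem hk]
    refine ⟨?_, ?_⟩
    · rw [← integral_indicator (hb.meas s)]
      simp_rw [e1]
      rw [integral_finsetSum _ fun i _ => integrable_finsetSum _ fun j _ => (hi i j).const_mul _]
      refine Finset.sum_congr rfl fun i _ => ?_
      rw [integral_finsetSum _ fun j _ => (hi i j).const_mul _]
      refine Finset.sum_congr rfl fun j _ => ?_
      rw [integral_const_mul, ← fockForm_lower_right (hb.isMode y s)]
    · rw [← integrable_indicator_iff (hb.meas s)]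
      rw [show ((blk s).indicator fun k => ((1 / (‖k‖ * m s) : ℝ) : ℂ) *
        (Complex.exp (Complex.I * ((inner ℝ k y : ℝ) : ℂ)) *
        tip f η (fun j => shiftWave y (p s) (f j)) fun j => ann k (η j))) = _ from funext e1]
      exact integrable_finsetSum _ fun i _ => integrable_finsetSum _ fun j _ => (hi i j).const_mul _
  have hh : Integrable fun k => phDensity f η k + κ * (1 / ‖k‖ * (2 * (intDensity f η k).re)) :=
    (integrable_phDensity f η).add ((integrable_intDensity hLp η).const_mul _)
  have hblk : ∀ s, (1 - δ) * N s + 2 * (κ * m s *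
      (mpair (gs s) fun i j => fockForm (η i) (b s (η j))).re) -
      κ ^ 2 * (D * L) ^ 2 / δ * blkWeight blk s * X ≤
      ∫ k in blk s, (phDensity f η k + κ * (1 / ‖k‖ * (2 * (intDensity f η k).re))) := fun s => by
    obtain ⟨he, hi⟩ := hint s
    have i1 : IntegrableOn (fun k => (1 - δ) * phDensity f η k) (blk s) :=
      ((integrable_phDensity f η).const_mul _).integrableOn
    have i2 : IntegrableOn (fun k => 2 * κ * m s * (((1 / (‖k‖ * m s) : ℝ) : ℂ) *
        (Complex.exp (Complex.I * ((inner ℝ k y : ℝ) : ℂ)) *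
        tip f η (fun j => shiftWave y (p s) (f j)) fun j => ann k (η j))).re) (blk s) :=
      hi.re.const_mul _
    have i3 : IntegrableOn (fun k : R3 => κ ^ 2 * (D * L) ^ 2 / δ * X * (1 / ‖k‖ ^ 2)) (blk s) :=
      (hb.integrableOn s).const_mul _
    have e1 : (1 - δ) * N s + 2 * (κ * m s *
        (mpair (gs s) fun i j => fockForm (η i) (b s (η j))).re) -
        κ ^ 2 * (D * L) ^ 2 / δ * blkWeight blk s * X = ∫ k in blk s,
        ((1 - δ) * phDensity f η k + 2 * κ * m s * (((1 / (‖k‖ * m s) : ℝ) : ℂ) *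
        (Complex.exp (Complex.I * ((inner ℝ k y : ℝ) : ℂ)) *
        tip f η (fun j => shiftWave y (p s) (f j)) fun j => ann k (η j))).re -
        κ ^ 2 * (D * L) ^ 2 / δ * X * (1 / ‖k‖ ^ 2)) := by
      have i12 : IntegrableOn (fun k => (1 - δ) * phDensity f η k +
          2 * κ * m s * (((1 / (‖k‖ * m s) : ℝ) : ℂ) *
        (Complex.exp (Complex.I * ((inner ℝ k y : ℝ) : ℂ)) *
        tip f η (fun j => shiftWave y (p s) (f j)) fun j => ann k (η j))).re) (blk s) := i1.add i2
      rw [integral_sub i12 i3, integral_add i1 i2, integral_const_mul, integral_const_mul,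
        integral_const_mul, he]
      have h1 : ∫ k in blk s, (((1 / (‖k‖ * m s) : ℝ) : ℂ) *
        (Complex.exp (Complex.I * ((inner ℝ k y : ℝ) : ℂ)) *
        tip f η (fun j => shiftWave y (p s) (f j)) fun j => ann k (η j))).re =
        (∫ k in blk s, ((1 / (‖k‖ * m s) : ℝ) : ℂ) *
        (Complex.exp (Complex.I * ((inner ℝ k y : ℝ) : ℂ)) *
        tip f η (fun j => shiftWave y (p s) (f j)) fun j => ann k (η j))).re :=
        integral_re (𝕜 := ℂ) hi
      rw [h1]
      simp only [N, blkWeight]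
      ring
    rw [e1]
    refine setIntegral_mono_on ((i1.add i2).sub i3) hh.integrableOn (hb.meas s) fun k hk => ?_
    have h2 := block_density_bound hLp η hD hL hκ hδ hs (hb.near s k hk) (hb.far s k hk)
    refine le_trans (le_of_eq ?_) h2
    have hk0 : ‖k‖ ≠ 0 := by have := hb.far s k hk; linarith
    have hms := (hm s).ne'
    rw [Complex.re_ofReal_mul, Complex.re_ofReal_mul]
    simp only [X]
    field_simp
  have hsum := Finset.sum_le_sum fun s (_ : s ∈ Finset.univ) => hblk s
  rw [← integral_iUnion_fintype hb.meas hb.disj fun s => hh.integrableOn, Finset.sum_sub_distrib,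
    ← Finset.sum_mul, ← Finset.mul_sum] at hsum
  have hsum2 : ∑ s, ((1 - δ) * (mpair g0 fun i j => fockForm (b s (η i)) (b s (η j))).re +
      2 * (κ * m s * (mpair (gs s) fun i j => fockForm (η i) (b s (η j))).re)) ≤
      ∑ s, ((1 - δ) * N s + 2 * (κ * m s *
        (mpair (gs s) fun i j => fockForm (η i) (b s (η j))).re)) :=
    Finset.sum_le_sum fun s _ => by
      have := mul_le_mul_of_nonneg_left (hN s) hδ1.le
      linarith
  have hX' : (mpair g0 fun i j => fockForm (η i) (η j)).re = X := rfl
  rw [hX'] at hmodes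
  -- The modes cost (1 - δ) times their number, which is bounded by the number itself.
  have hlam : (E₁ / (1 - δ) - Fintype.card ι) * ((1 - δ) * X) =
      E₁ * X - (1 - δ) * (Fintype.card ι * X) := by
    field_simp
  rw [hlam] at hmodes
  have hcard : 0 ≤ δ * (Fintype.card ι * X) := by positivity
  have hE1 : E₁ * X = E₀ * X - 4 * κ ^ 2 * (D * L) ^ 2 * W / δ * X := by simp only [E₁]; ring
  -- Of the constant 5, a share 4 comes from the classical problem and 1 from replacing plane waves
  -- in the quantum form.
  have hfin : (E₀ - 5 * κ ^ 2 * (D * L) ^ 2 * W / δ - Fintype.card ι) * X =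
      E₀ * X - 4 * κ ^ 2 * (D * L) ^ 2 * W / δ * X - κ ^ 2 * (D * L) ^ 2 / δ * W * X -
      Fintype.card ι * X := by ring
  rw [hfin]
  simp only [cutForm, kinT, potT]
  linarith

end BlockForm

/-! ### Partition of the cube into blocks -/

lemma norm_le_two_mul_of_abs_le {k : R3} {P : ℝ} (hP : 0 ≤ P) (h : ∀ l, |k l| ≤ P) :
    ‖k‖ ≤ 2 * P := by
  rw [EuclideanSpace.norm_eq, Real.sqrt_le_left (by positivity), Fin.sum_univ_three]
  have h' : ∀ l, ‖k l‖ ^ 2 ≤ P ^ 2 := fun l => by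
    rw [Real.norm_eq_abs]; exact pow_le_pow_left₀ (abs_nonneg _) (h l) 2
  nlinarith [h' 0, h' 1, h' 2, sq_nonneg P]

/-- The part of `midCube Λ` in a cube of the grid of mesh `P`. -/
def gridBlock (Λ P : ℝ) {n : ℕ} (q : Fin 3 → Fin n) : Set R3 :=
  midCube Λ ∩ {k | ∀ l, ⌊(k l + Λ) / P⌋ = (q l : ℤ)}

/-- The corner of a grid cube. -/
def gridCorner (Λ P : ℝ) {n : ℕ} (q : Fin 3 → Fin n) : R3 :=
  WithLp.toLp 2 fun l => P * (q l : ℝ) - Λ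

lemma measurableSet_midCube (Λ : ℝ) : MeasurableSet (midCube Λ) :=
  (measurableSet_cube Λ).diff measurableSet_unitBall

lemma measurableSet_gridBlock (Λ P : ℝ) {n : ℕ} (q : Fin 3 → Fin n) :
    MeasurableSet (gridBlock Λ P q) := by
  refine (measurableSet_midCube Λ).inter ?_
  rw [Set.ofPred_forall]
  refine MeasurableSet.iInter fun l => ?_
  have hm : Measurable fun k : R3 => ⌊(k l + Λ) / P⌋ := Int.measurable_floor.comp
    (by fun_prop : Continuous fun k : R3 => (k l + Λ) / P).measurable
  exact hm (measurableSet_singleton _)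

/-- The cube is half open: k_l < Λ and P n = 2Λ keep the index strictly below n. -/
lemma exists_mem_gridBlock {Λ P : ℝ} (hP : 0 < P) {n : ℕ} (hn : P * n = 2 * Λ) {k : R3}
    (hk : k ∈ midCube Λ) : ∃ q : Fin 3 → Fin n, k ∈ gridBlock Λ P q := by
  have h0 : ∀ l, 0 ≤ ⌊(k l + Λ) / P⌋ := fun l =>
    Int.floor_nonneg.2 (div_nonneg (by linarith [(hk.1 l).1]) hP.le)
  have h1 : ∀ l, ⌊(k l + Λ) / P⌋.toNat < n := fun l => by
    have : ⌊(k l + Λ) / P⌋ < (n : ℤ) := Int.floor_lt.2 (by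
      rw [div_lt_iff₀ hP, Int.cast_natCast, mul_comm, hn]; linarith [(hk.1 l).2])
    have := h0 l
    omega
  exact ⟨fun l => ⟨_, h1 l⟩, hk, fun l => (Int.toNat_of_nonneg (h0 l)).symm⟩

lemma norm_sub_gridCorner_le {Λ P : ℝ} (hP : 0 < P) {n : ℕ} {q : Fin 3 → Fin n} {k : R3}
    (hk : k ∈ gridBlock Λ P q) : ‖k - gridCorner Λ P q‖ ≤ 2 * P := by
  refine norm_le_two_mul_of_abs_le hP.le fun l => ?_
  have h := Int.floor_eq_iff.1 (hk.2 l)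
  rw [le_div_iff₀ hP, div_lt_iff₀ hP, Int.cast_natCast] at h
  have e : (k - gridCorner Λ P q) l = k l + Λ - (q l : ℝ) * P := by
    simp [gridCorner]; ring
  rw [e, abs_le]
  exact ⟨by linarith [h.1], by linarith [h.2]⟩

lemma norm_le_of_mem_midCube {Λ : ℝ} (hΛ : 0 ≤ Λ) {k : R3} (hk : k ∈ midCube Λ) :
    ‖k‖ ≤ 2 * Λ :=
  norm_le_two_mul_of_abs_le hΛ fun l => abs_le.2 ⟨(hk.1 l).1, (hk.1 l).2.le⟩

variable {J : Type*} [Fintype J]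

/-- Lower bound for the cut form on functions supported in a ball of radius `L`. -/
theorem cutForm_midCube_ge {A : R3 → R3} (hA : VectorL2Loc A) {V : R3 → ℝ}
    (hV : LocallyIntegrable V volume) {f : J → R3 → ℂ} (hf : ∀ j, IsTest (f j)) (η : J → Fock)
    {E₀ ε κ δ L Λ P : ℝ} {y : R3} {n : ℕ} (hΛ : 1 ≤ Λ) (hP : 0 < P) (hn : P * n = 2 * Λ)
    (hL : 0 < L) (hκ : 0 < κ) (hδ : 0 < δ) (hδ2 : δ ≤ 1 / 2)
    (hs : ∀ j x, L < ‖x - y‖ → f j x = 0)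
    (hE : ∀ φ, IsTest φ → E₀ * l2Sq φ ≤ (1 - ε) * ∑ l, l2Sq (dA A l φ) + potEnergy V φ -
      (1 + 4 * δ) * κ ^ 2 * ((∫ k, ‖densityFT (density φ) k‖ ^ 2 / ‖k‖ ^ 2) / l2Sq φ)) :
    (E₀ - 5 * κ ^ 2 * (2 * P * L) ^ 2 * (sphereArea * (3 * Λ)) / δ - (n : ℝ) ^ 3) *
      (tip f η f η).re ≤ cutForm A V κ ε (midCube Λ) f η := by
  -- Points of the cube have norm at most 2Λ, so they lie in the open ball of radius 3Λ, which
  -- bounds the total weight of the blocks.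
  have hball := integral_ball_inv_sq (r := 3 * Λ) (by linarith)
  have hsub : midCube Λ ⊆ {k : R3 | ‖k‖ < 3 * Λ} := fun k hk =>
    (norm_le_of_mem_midCube (by linarith) hk).trans_lt (by linarith)
  have hint : IntegrableOn (fun k : R3 => 1 / ‖k‖ ^ 2) (midCube Λ) := hball.1.mono_set hsub
  have hpos : ∀ k ∈ midCube Λ, 0 < 1 / ‖k‖ ^ 2 := fun k hk => by
    have : 1 ≤ ‖k‖ := not_lt.1 hk.2
    positivity
  have hgs : ∀ q : Fin 3 → Fin n, gridBlock Λ P q ⊆ midCube Λ := fun q => Set.inter_subset_left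
  classical
  -- A block of zero weight has no normalized mode. Such blocks are null sets, so dropping them does
  -- not change integrals over the cube.
  let ι := {q : Fin 3 → Fin n // 0 < ∫ k in gridBlock Λ P q, 1 / ‖k‖ ^ 2}
  let blk : ι → Set R3 := fun s => gridBlock Λ P s.1
  have hdisj : Pairwise (Function.onFun Disjoint blk) := fun s t hst => by
    refine Set.disjoint_left.2 fun k hk hk' => hst (Subtype.ext (funext fun l => Fin.ext ?_))
    have := (hk.2 l).symm.trans (hk'.2 l)
    exact_mod_cast this
  have hb : IsBlockFamily blk (fun s => gridCorner Λ P s.1) (2 * P) (2 * Λ) :=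
    { meas := fun s => measurableSet_gridBlock _ _ _
      disj := hdisj
      far := fun s k hk => not_lt.1 hk.1.2
      bdd := fun s k hk => norm_le_of_mem_midCube (by linarith) hk.1
      near := fun s k hk => norm_sub_gridCorner_le hP hk
      pos := fun s => s.2 }
  have hU : (⋃ s, blk s) ⊆ midCube Λ := Set.iUnion_subset fun s => hgs s.1
  have hnull : ∀ q : Fin 3 → Fin n, ¬ 0 < ∫ k in gridBlock Λ P q, 1 / ‖k‖ ^ 2 →
      volume (gridBlock Λ P q) = 0 := fun q hq => by
    by_contra hne
    refine hq ((setIntegral_pos_iff_support_of_nonneg_ae (ae_of_all _ fun k => by positivity)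
      (hint.mono_set (hgs q))).2 ?_)
    have hsu : gridBlock Λ P q ⊆ Function.support fun k : R3 => 1 / ‖k‖ ^ 2 :=
      fun k hk => (hpos k (hgs q hk)).ne'
    rw [Set.inter_eq_right.2 hsu]
    exact pos_iff_ne_zero.2 hne
  have hae : (⋃ s, blk s) =ᵐ[volume] midCube Λ := by
    refine hU.eventuallyLE.antisymm (ae_le_set.2 (measure_mono_null (t := ⋃ q ∈
      {q : Fin 3 → Fin n | ¬ 0 < ∫ k in gridBlock Λ P q, 1 / ‖k‖ ^ 2}, gridBlock Λ P q) ?_ ?_))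
    · rintro k ⟨hk, hk'⟩
      obtain ⟨q, hq⟩ := exists_mem_gridBlock hP hn hk
      refine Set.mem_biUnion (x := q) (fun h => hk' (Set.mem_iUnion.2 ⟨⟨q, h⟩, hq⟩)) hq
    · exact (measure_biUnion_null_iff (Set.to_countable _)).2 hnull
  have hcut : cutForm A V κ ε (⋃ s, blk s) f η = cutForm A V κ ε (midCube Λ) f η := by
    rw [cutForm, cutForm, setIntegral_congr_set hae]
  have hw : ∑ s, blkWeight blk s ≤ sphereArea * (3 * Λ) := by
    have : ∑ s, blkWeight blk s = ∫ k in ⋃ s, blk s, 1 / ‖k‖ ^ 2 :=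
      (integral_iUnion_fintype hb.meas hdisj fun s => hint.mono_set (hgs s.1)).symm
    rw [this, ← hball.2]
    exact setIntegral_mono_set hball.1 (ae_of_all _ fun k => by positivity)
      (hU.trans hsub).eventuallyLE
  have hcard : (Fintype.card ι : ℝ) ≤ (n : ℝ) ^ 3 := by
    have : Fintype.card ι ≤ n ^ 3 :=
      (Fintype.card_subtype_le _).trans (by simp)
    exact_mod_cast this
  have h := cutForm_blocks_ge hb hA hV hf η (by positivity) hL hκ hδ hδ2 hs hE
  rw [hcut] at h
  refine le_trans (mul_le_mul_of_nonneg_right ?_ (tip_self_nonneg (fun j => (hf j).memLp 2) η)) h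
  have : 5 * κ ^ 2 * (2 * P * L) ^ 2 * (∑ s, blkWeight blk s) / δ ≤
      5 * κ ^ 2 * (2 * P * L) ^ 2 * (sphereArea * (3 * Λ)) / δ := by gcongr
  linarith

/-! ### Localization of the electron -/

/-- Averaging a density against the translates of a weight. -/
lemma integral_translates_mul {w h : R3 → ℝ} (hw : Integrable w) (hh : Integrable h) :
    Integrable (fun y => ∫ x, w (x - y) * h x) ∧
      ∫ y, ∫ x, w (x - y) * h x = (∫ x, w x) * ∫ x, h x := by
  have h1 : Integrable (fun p : R3 × R3 => h p.1 * w (-p.2)) (volume.prod volume) :=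
    hh.mul_prod hw.comp_neg
  have h2 := (measurePreserving_prod_neg_add (volume : Measure R3) (volume : Measure R3)
    ).integrable_comp_of_integrable h1
  have h3 : Integrable (fun p : R3 × R3 => w (p.1 - p.2) * h p.1) (volume.prod volume) :=
    h2.congr (ae_of_all _ fun p => by
      simp only [Function.comp]; rw [mul_comm]; congr 2; abel)
  refine ⟨h3.integral_prod_right, ?_⟩
  rw [← integral_integral_swap h3]
  simp_rw [integral_mul_const, integral_sub_left_eq_self w]
  rw [integral_const_mul]

/-- Multiplication by a translated real function. -/
def loc (χ : R3 → ℝ) (y : R3) (f : R3 → ℂ) : R3 → ℂ := fun x => (χ (x - y) : ℂ) * f x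

variable {χ : R3 → ℝ}

lemma contDiff_translate (hχ : ContDiff ℝ ∞ χ) (y : R3) :
    ContDiff ℝ ∞ fun x => (χ (x - y) : ℂ) :=
  Complex.ofRealCLM.contDiff.comp (hχ.comp (contDiff_id.sub contDiff_const))

lemma IsTest.loc (hχ : ContDiff ℝ ∞ χ) (y : R3) {f : R3 → ℂ} (hf : IsTest f) :
    IsTest (loc χ y f) :=
  ⟨(contDiff_translate hχ y).mul hf.1, hf.2.mul_left⟩

/-- The partial derivative of a real function. -/
def realD (l : Fin 3) (χ : R3 → ℝ) (x : R3) : ℝ := fderiv ℝ χ x (EuclideanSpace.single l 1)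

lemma partialD_translate (hχ : ContDiff ℝ ∞ χ) (y : R3) (l : Fin 3) (x : R3) :
    partialD l (fun x => (χ (x - y) : ℂ)) x = realD l χ (x - y) := by
  have h1 : HasFDerivAt (fun x => χ (x - y)) (fderiv ℝ χ (x - y)) x := by
    have := (hχ.differentiable (by simp) (x - y)).hasFDerivAt.comp x
      ((hasFDerivAt_id x).sub_const y)
    rw [ContinuousLinearMap.comp_id] at this
    exact this
  have h2 := Complex.ofRealCLM.hasFDerivAt.comp x h1
  have h3 : partialD l (fun x => (χ (x - y) : ℂ)) x =
      (Complex.ofRealCLM.comp (fderiv ℝ χ (x - y))) (EuclideanSpace.single l 1) := by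
    rw [partialD, ← h2.fderiv]; rfl
  rw [h3]; rfl

lemma dA_loc (hχ : ContDiff ℝ ∞ χ) (y : R3) {A : R3 → R3} {f : R3 → ℂ} (hf : IsTest f)
    (l : Fin 3) (x : R3) :
    dA A l (loc χ y f) x = (χ (x - y) : ℂ) * dA A l f x - Complex.I * realD l χ (x - y) * f x := by
  have h := partialD_mul ((contDiff_translate hχ y).differentiable (by simp)) hf.differentiable l x
  have e : loc χ y f = (fun x => (χ (x - y) : ℂ)) * f := rfl
  rw [dA, dA, e, h, partialD_translate hχ, Pi.mul_apply]
  ring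

lemma continuous_realD (hχ : ContDiff ℝ ∞ χ) (l : Fin 3) : Continuous (realD l χ) :=
  (hχ.continuous_fderiv (by simp)).clm_apply continuous_const

lemma hasCompactSupport_realD (hc : HasCompactSupport χ) (l : Fin 3) :
    HasCompactSupport (realD l χ) := hc.fderiv_apply (𝕜 := ℝ) _

lemma hasCompactSupport_sq {g : R3 → ℝ} (h : HasCompactSupport g) :
    HasCompactSupport fun x => g x ^ 2 := h.comp_left (g := fun t : ℝ => t ^ 2) (by simp)

/-- χ∂χ is half the derivative of χ². This removes the cross term of the localization formula after
averaging over all centres. -/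
lemma integral_mul_realD (hχ : ContDiff ℝ ∞ χ) (hc : HasCompactSupport χ) (l : Fin 3) :
    ∫ x, χ x * realD l χ x = 0 := by
  have h : ∫ x, χ x * realD l χ x = - ∫ x, realD l χ x * χ x := by
    refine integral_mul_fderiv_eq_neg_fderiv_mul_of_integrable ?_ ?_ ?_
      (fun x _ => hχ.differentiable (by simp) x) (fun x _ => hχ.differentiable (by simp) x)
    · exact ((continuous_realD hχ l).mul hχ.continuous).integrable_of_hasCompactSupport hc.mul_left
    · exact (hχ.continuous.mul (continuous_realD hχ l)).integrable_of_hasCompactSupport hc.mul_right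
    · exact (hχ.continuous.mul hχ.continuous).integrable_of_hasCompactSupport hc.mul_left
  simp_rw [mul_comm (realD l χ _)] at h
  linarith

variable {J : Type*} [Fintype J]

lemma pv_loc (y : R3) (f : J → R3 → ℂ) (η : J → Fock) (x : R3) :
    pv (fun j => loc χ y (f j)) η x = (χ (x - y) : ℂ) • pv f η x := by
  simp only [pv, loc, Finset.smul_sum, smul_smul]

lemma fockForm_ofReal_smul (a : ℝ) (u v : Fock) :
    fockForm ((a : ℂ) • u) ((a : ℂ) • v) = ((a ^ 2 : ℝ) : ℂ) * fockForm u v := by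
  simp only [map_smulₛₗ, LinearMap.smul_apply, RingHom.id_apply, Complex.conj_ofReal, smul_eq_mul]
  push_cast; ring

lemma tip_loc (hχ : ContDiff ℝ ∞ χ) (y : R3) {f : J → R3 → ℂ} (hf : ∀ j, IsTest (f j))
    (η : J → Fock) :
    (tip (fun j => loc χ y (f j)) η (fun j => loc χ y (f j)) η).re =
      ∫ x, χ (x - y) ^ 2 * (fockForm (pv f η x) (pv f η x)).re := by
  rw [tip_self_re fun j => ((hf j).loc hχ y).memLp 2]
  simp_rw [pv_loc, fockForm_ofReal_smul, Complex.re_ofReal_mul]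

lemma phDensity_loc (hχ : ContDiff ℝ ∞ χ) (y : R3) {f : J → R3 → ℂ} (hf : ∀ j, IsTest (f j))
    (η : J → Fock) (S : Set R3) :
    ∫ k in S, phDensity (fun j => loc χ y (f j)) η k = ∫ x, χ (x - y) ^ 2 *
      ∫ k in S, (fockForm (ann k (pv f η x)) (ann k (pv f η x))).re := by
  rw [← (integral_phDensity_pv (fun j => ((hf j).loc hχ y).memLp 2) η S).2]
  refine integral_congr_ae (ae_of_all _ fun x => ?_)
  simp only
  rw [← integral_const_mul]
  have : ∀ k (a : ℂ) (v : Fock), ann k (a • v) = a • ann k v := fun k a v => map_smul _ a v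
  simp_rw [pv_loc, this, fockForm_ofReal_smul, Complex.re_ofReal_mul]

lemma potT_eq {V : R3 → ℝ} (hV : LocallyIntegrable V volume) {f : J → R3 → ℂ}
    (hf : ∀ j, IsTest (f j)) (η : J → Fock) :
    Integrable (fun x => V x * (fockForm (pv f η x) (pv f η x)).re) ∧
      potT V f η = ∫ x, V x * (fockForm (pv f η x) (pv f η x)).re := by
  have hi := fun i j => ((hf i).integrable_pot_mul hV (hf j)).mul_const (fockForm (η i) (η j))
  have e : ∀ x, V x * (fockForm (pv f η x) (pv f η x)).re =
      (∑ i, ∑ j, (V x : ℂ) * ((starRingEnd ℂ) (f i x) * f j x) * fockForm (η i) (η j)).re :=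
    fun x => by
      rw [fockForm_pv, ← Complex.re_ofReal_mul, mpair, Finset.mul_sum]
      congr 1
      refine Finset.sum_congr rfl fun i _ => ?_
      rw [Finset.mul_sum]
      exact Finset.sum_congr rfl fun j _ => by ring
  have hI := integrable_finsetSum Finset.univ fun i _ =>
    integrable_finsetSum Finset.univ fun j _ => hi i j
  simp_rw [e]
  refine ⟨hI.re, ?_⟩
  have h2 : ∫ x, (∑ i, ∑ j, (V x : ℂ) * ((starRingEnd ℂ) (f i x) * f j x) *
      fockForm (η i) (η j)).re = (∫ x, ∑ i, ∑ j, (V x : ℂ) * ((starRingEnd ℂ) (f i x) * f j x) *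
      fockForm (η i) (η j)).re := integral_re (𝕜 := ℂ) hI
  rw [h2, potT, mpair]
  congr 1
  rw [integral_finsetSum _ fun i _ => integrable_finsetSum _ fun j _ => hi i j]
  refine Finset.sum_congr rfl fun i _ => ?_
  rw [integral_finsetSum _ fun j _ => hi i j]
  exact Finset.sum_congr rfl fun j _ => (integral_mul_const _ _).symm

/-- For a = χ, b = ∂χ, u = D_A f and v = f this is the square of D_A(χf), with the cross term
proportional to χ∂χ displayed. -/
lemma re_fockForm_add (u v : Fock) (a b : ℝ) :
    (fockForm ((a : ℂ) • u - (Complex.I * b) • v) ((a : ℂ) • u - (Complex.I * b) • v)).re =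
      a ^ 2 * (fockForm u u).re + b ^ 2 * (fockForm v v).re +
        a * b * (2 * (fockForm u v).im) := by
  have h := fockForm_herm v u
  simp only [map_sub, LinearMap.sub_apply, map_smulₛₗ, LinearMap.smul_apply, smul_eq_mul,
    map_mul, Complex.conj_ofReal, Complex.conj_I, RingHom.id_apply]
  rw [h]
  simp only [Complex.sub_re, Complex.sub_im, Complex.mul_re, Complex.ofReal_re, Complex.ofReal_im, Complex.I_re,
    Complex.I_im, Complex.neg_re, Complex.neg_im, Complex.mul_im, Complex.conj_re, Complex.conj_im]
  ring

lemma integrable_fockForm_lower {f : J → R3 → ℂ} (hf : ∀ j, MemLp (f j) 2 volume) (η : J → Fock)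
    {c : R3 → ℂ} (hc : IsMode c) : Integrable fun x =>
      fockForm (pv f η x) (lower (waveMode c x) (isMode_waveMode hc x) (pv f η x)) := by
  have hG : ∀ i j, Continuous fun x : R3 => ∫ k, c k *
      Complex.exp (Complex.I * ((inner ℝ k x : ℝ) : ℂ)) * fockForm (η i) (ann k (η j)) :=
    fun i j => by
      have hi := (hc.mul (isMode_fockForm_ann (η i) (η j))).integrable
      refine continuous_of_dominated (F := fun (x k : R3) => c k *
        Complex.exp (Complex.I * ((inner ℝ k x : ℝ) : ℂ)) * fockForm (η i) (ann k (η j)))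
        (bound := fun k => ‖c k * fockForm (η i) (ann k (η j))‖) (fun x => ?_) (fun x => ?_) hi.norm
        (ae_of_all _ fun k => by fun_prop)
      · exact ((hc.1.mul (Continuous.measurable (by fun_prop))).mul
          (isMode_fockForm_ann (η i) (η j)).1).aestronglyMeasurable
      · refine ae_of_all _ fun k => ?_
        rw [norm_mul, norm_mul, norm_exp_I_mul, mul_one, norm_mul]
  have hb : ∀ i j, ∀ x : R3, ‖∫ k, c k *
      Complex.exp (Complex.I * ((inner ℝ k x : ℝ) : ℂ)) * fockForm (η i) (ann k (η j))‖ ≤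
      ∫ k, ‖c k * fockForm (η i) (ann k (η j))‖ := fun i j x => by
    refine (norm_integral_le_integral_norm _).trans (le_of_eq ?_)
    refine integral_congr_ae (ae_of_all _ fun k => ?_)
    simp only
    rw [norm_mul, norm_mul, norm_exp_I_mul, mul_one, norm_mul]
  have := integrable_finsetSum Finset.univ fun i _ => integrable_finsetSum Finset.univ fun j _ =>
    (integrable_conj_mul (hf i) (hf j)).mul_bdd (hG i j).aestronglyMeasurable
      (ae_of_all _ (hb i j))
  refine this.congr (ae_of_all _ fun x => ?_)
  simp only
  rw [map_pv, fockForm_pv, mpair]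
  refine Finset.sum_congr rfl fun i _ => Finset.sum_congr rfl fun j _ => ?_
  rw [fockForm_lower_right]
  simp [waveMode]

/-- The coupling function restricted to `S`. -/
def coupling (S : Set R3) : R3 → ℂ := S.indicator fun k => ((1 / ‖k‖ : ℝ) : ℂ)

lemma isMode_coupling {S : Set R3} (hS : MeasurableSet S) {R : ℝ}
    (h : ∀ k ∈ S, 1 ≤ ‖k‖ ∧ ‖k‖ ≤ R) : IsMode (coupling S) := by
  refine ⟨(Complex.measurable_ofReal.comp (by fun_prop)).indicator hS, 1, R, fun k => ?_,
    fun k hk => Set.indicator_of_notMem (fun hk' => absurd (h k hk').2 (not_le.2 hk)) _⟩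
  by_cases hk : k ∈ S
  · rw [coupling, Set.indicator_of_mem hk, Complex.norm_real, Real.norm_of_nonneg (by positivity)]
    exact div_le_one_of_le₀ (h k hk).1 (norm_nonneg _)
  · rw [coupling, Set.indicator_of_notMem hk]; simp

lemma cutForm_eq {S : Set R3} (hS : MeasurableSet S) {f : J → R3 → ℂ}
    (hf : ∀ j, MemLp (f j) 2 volume) (η : J → Fock) (A : R3 → R3) (V : R3 → ℝ) (κ ε : ℝ)
    (hc : IsMode (coupling S)) :
    cutForm A V κ ε S f η = (1 - ε) * kinT A f η + potT V f η + (∫ k in S, phDensity f η k) +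
      2 * κ * ∫ x, (fockForm (pv f η x)
        (lower (waveMode (coupling S) x) (isMode_waveMode hc x) (pv f η x))).re := by
  have h1 : ∫ x, (fockForm (pv f η x)
        (lower (waveMode (coupling S) x) (isMode_waveMode hc x) (pv f η x))).re =
      (∫ x, fockForm (pv f η x)
        (lower (waveMode (coupling S) x) (isMode_waveMode hc x) (pv f η x))).re :=
    integral_re (𝕜 := ℂ) (integrable_fockForm_lower hf η hc)
  have h2 : (∫ k, coupling S k * intDensity f η k) =
      ∫ k in S, ((1 / ‖k‖ : ℝ) : ℂ) * intDensity f η k := by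
    rw [← integral_indicator hS]
    refine integral_congr_ae (ae_of_all _ fun k => ?_)
    by_cases hk : k ∈ S <;> simp [coupling, hk]
  have h3 : (∫ k in S, ((1 / ‖k‖ : ℝ) : ℂ) * intDensity f η k).re =
      ∫ k in S, (((1 / ‖k‖ : ℝ) : ℂ) * intDensity f η k).re :=
    (integral_re (𝕜 := ℂ) (integrable_inv_norm_mul_tip hf hf η).integrableOn).symm
  rw [h1, ← integral_mul_tip_eq_lower hf hf η hc]
  simp_rw [← intDensity_eq_tip]
  rw [h2, h3, cutForm, integral_add (integrable_phDensity f η).integrableOn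
    ((integrable_intDensity hf η).const_mul _).integrableOn, add_assoc, add_assoc, add_assoc,
    ← integral_const_mul]
  congr 3
  refine integral_congr_ae (ae_of_all _ fun k => ?_)
  simp only [Complex.re_ofReal_mul]; ring

lemma integral_ineq_of_pointwise {F₀ F₄ F₅ F₆ : R3 → ℝ} {F₁ F₂ F₃ : Fin 3 → R3 → ℝ}
    (h0 : Integrable F₀) (h1 : ∀ l, Integrable (F₁ l)) (h2 : ∀ l, Integrable (F₂ l))
    (h3 : ∀ l, Integrable (F₃ l)) (h4 : Integrable F₄) (h5 : Integrable F₅) (h6 : Integrable F₆)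
    {a b c : ℝ} (h : ∀ y, a * F₀ y ≤ b * ∑ l, (F₁ l y + F₂ l y + F₃ l y) + F₄ y + F₅ y + c * F₆ y) :
    a * ∫ y, F₀ y ≤ b * ∑ l, ((∫ y, F₁ l y) + (∫ y, F₂ l y) + ∫ y, F₃ l y) + (∫ y, F₄ y) +
      (∫ y, F₅ y) + c * ∫ y, F₆ y := by
  have i12 : ∀ l, Integrable fun y => F₁ l y + F₂ l y := fun l => (h1 l).add (h2 l)
  have i123 : ∀ l, Integrable fun y => F₁ l y + F₂ l y + F₃ l y := fun l => (i12 l).add (h3 l)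
  have i1 : Integrable fun y => b * ∑ l, (F₁ l y + F₂ l y + F₃ l y) :=
    (integrable_finsetSum _ fun l _ => i123 l).const_mul b
  have i2 : Integrable fun y => b * ∑ l, (F₁ l y + F₂ l y + F₃ l y) + F₄ y := i1.add h4
  have i3 : Integrable fun y => b * ∑ l, (F₁ l y + F₂ l y + F₃ l y) + F₄ y + F₅ y := i2.add h5
  have i4 : Integrable fun y => b * ∑ l, (F₁ l y + F₂ l y + F₃ l y) + F₄ y + F₅ y + c * F₆ y :=
    i3.add (h6.const_mul c)
  have key := integral_mono (h0.const_mul a) i4 h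
  rw [integral_add i3 (h6.const_mul c), integral_add i2 h5, integral_add i1 h4, integral_const_mul,
    integral_const_mul, integral_const_mul, integral_finsetSum _ fun l _ => i123 l] at key
  have e : ∀ l, ∫ y, (F₁ l y + F₂ l y + F₃ l y) = (∫ y, F₁ l y) + (∫ y, F₂ l y) + ∫ y, F₃ l y :=
    fun l => by rw [integral_add (i12 l) (h3 l), integral_add (h1 l) (h2 l)]
  simpa only [e] using key

/-- A lower bound for localized functions gives one for all functions, up to the localization
error. -/
theorem cutForm_ge_of_loc (hχ : ContDiff ℝ ∞ χ) (hcs : HasCompactSupport χ)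
    (hχ1 : ∫ x, χ x ^ 2 = 1) {S : Set R3} (hS : MeasurableSet S) {R : ℝ}
    (hSR : ∀ k ∈ S, 1 ≤ ‖k‖ ∧ ‖k‖ ≤ R) {A : R3 → R3} (hA : VectorL2Loc A) {V : R3 → ℝ}
    (hV : LocallyIntegrable V volume) {f : J → R3 → ℂ} (hf : ∀ j, IsTest (f j)) (η : J → Fock)
    {κ ε lam : ℝ} (h : ∀ y, lam *
      (tip (fun j => loc χ y (f j)) η (fun j => loc χ y (f j)) η).re ≤
        cutForm A V κ ε S (fun j => loc χ y (f j)) η) :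
    (lam - (1 - ε) * ∑ l, ∫ x, realD l χ x ^ 2) * (tip f η f η).re ≤ cutForm A V κ ε S f η := by
  have hL := fun j => (hf j).memLp 2
  have hc := isMode_coupling hS hSR
  have hw1 : Integrable fun x => χ x ^ 2 :=
    (hχ.continuous.pow 2).integrable_of_hasCompactSupport (hasCompactSupport_sq hcs)
  have hw2 : ∀ l, Integrable fun x => realD l χ x ^ 2 := fun l =>
    ((continuous_realD hχ l).pow 2).integrable_of_hasCompactSupport 
      (hasCompactSupport_sq (hasCompactSupport_realD hcs l))
  have hw3 : ∀ l, Integrable fun x => χ x * realD l χ x := fun l =>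
    (hχ.continuous.mul (continuous_realD hχ l)).integrable_of_hasCompactSupport hcs.mul_right
  have hb : Integrable fun x => (fockForm (pv f η x) (pv f η x)).re :=
    (integrable_fockForm_pv hL hL η η).re
  set d : Fin 3 → J → R3 → ℂ := fun l j => dA A l (f j)
  have hd : ∀ l j, MemLp (d l j) 2 volume := fun l j => (hf j).memLp_dA hA l
  have hk1 : ∀ l, Integrable fun x => (fockForm (pv (d l) η x) (pv (d l) η x)).re := fun l =>
    (integrable_fockForm_pv (hd l) (hd l) η η).re
  have hk3 : ∀ l, Integrable fun x => 2 * (fockForm (pv (d l) η x) (pv f η x)).im := fun l =>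
    (integrable_fockForm_pv (hd l) hL η η).im.const_mul 2
  have hp := integral_phDensity_pv hL η S
  have hi : Integrable fun x => (fockForm (pv f η x)
      (lower (waveMode (coupling S) x) (isMode_waveMode hc x) (pv f η x))).re :=
    (integrable_fockForm_lower hL η hc).re
  obtain ⟨hv, hv'⟩ := potT_eq hV hf η
  -- Potential, phonon number and interaction act pointwise in x, so χ enters them through χ(x - y)²
  -- only, and averaging over y reproduces the original forms. The kinetic energy does so too, up to
  -- a2, the localization error; a3 averages to 0.
  have a0 := integral_translates_mul hw1 hb
  have a1 := fun l => integral_translates_mul hw1 (hk1 l)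
  have a2 := fun l => integral_translates_mul (hw2 l) hb
  have a3 := fun l => integral_translates_mul (hw3 l) (hk3 l)
  have a4 := integral_translates_mul hw1 hv
  have a5 := integral_translates_mul hw1 hp.1
  have a6 := integral_translates_mul hw1 hi
  simp only [hχ1, one_mul, integral_mul_realD hχ hcs, zero_mul] at a0 a1 a3 a4 a5 a6
  have bdd : ∀ {g : R3 → ℝ}, Continuous g → HasCompactSupport g → ∀ {H : R3 → ℝ}, Integrable H →
      ∀ y, Integrable fun x => g (x - y) * H x := fun hg hgc H hH y => by
    obtain ⟨C, hC⟩ := hgc.exists_bound_of_continuous hg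
    exact hH.bdd_mul (c := C) (hg.comp (continuous_id.sub continuous_const)).aestronglyMeasurable
      (ae_of_all _ fun x => hC _)
  have ek : ∀ y, kinT A (fun j => loc χ y (f j)) η = ∑ l,
      ((∫ x, χ (x - y) ^ 2 * (fockForm (pv (d l) η x) (pv (d l) η x)).re) +
        (∫ x, realD l χ (x - y) ^ 2 * (fockForm (pv f η x) (pv f η x)).re) +
        ∫ x, χ (x - y) * realD l χ (x - y) * (2 * (fockForm (pv (d l) η x) (pv f η x)).im)) :=
    fun y => by
      rw [kinT_eq]
      refine Finset.sum_congr rfl fun l _ => ?_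
      have c1 := bdd (g := fun x => χ x ^ 2) (hχ.continuous.pow 2) 
        (hasCompactSupport_sq hcs) (hk1 l) y
      have c2 := bdd (g := fun x => realD l χ x ^ 2) ((continuous_realD hχ l).pow 2) 
        (hasCompactSupport_sq (hasCompactSupport_realD hcs l)) hb y
      have c3 := bdd (g := fun x => χ x * realD l χ x) (hχ.continuous.mul (continuous_realD hχ l))
        hcs.mul_right (hk3 l) y
      have c12 : Integrable fun x => χ (x - y) ^ 2 * (fockForm (pv (d l) η x) (pv (d l) η x)).re +
        realD l χ (x - y) ^ 2 * (fockForm (pv f η x) (pv f η x)).re := c1.add c2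
      rw [tip_self_re (fun j => ((hf j).loc hχ y).memLp_dA hA l), ← integral_add c1 c2,
        ← integral_add c12 c3]
      refine integral_congr_ae (ae_of_all _ fun x => ?_)
      have : pv (fun j => dA A l (loc χ y (f j))) η x = (χ (x - y) : ℂ) • pv (d l) η x -
          (Complex.I * (realD l χ (x - y) : ℂ)) • pv f η x := by
        simp only [pv, dA_loc hχ y (hf _), Finset.smul_sum, smul_smul, d]
        rw [← Finset.sum_sub_distrib]
        exact Finset.sum_congr rfl fun j _ => sub_smul (R := ℂ) (M := Fock) _ _ _
      simp only
      rw [this, re_fockForm_add]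
  have ev : ∀ y, potT V (fun j => loc χ y (f j)) η =
      ∫ x, χ (x - y) ^ 2 * (V x * (fockForm (pv f η x) (pv f η x)).re) := fun y => by
    rw [(potT_eq hV (fun j => (hf j).loc hχ y) η).2]
    refine integral_congr_ae (ae_of_all _ fun x => ?_)
    simp only [pv_loc, fockForm_ofReal_smul, Complex.re_ofReal_mul]; ring
  have ei : ∀ y, ∫ x, (fockForm (pv (fun j => loc χ y (f j)) η x) (lower (waveMode (coupling S) x)
      (isMode_waveMode hc x) (pv (fun j => loc χ y (f j)) η x))).re =
      ∫ x, χ (x - y) ^ 2 * (fockForm (pv f η x) (lower (waveMode (coupling S) x)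
      (isMode_waveMode hc x) (pv f η x))).re := fun y => by
    refine integral_congr_ae (ae_of_all _ fun x => ?_)
    simp only
    rw [pv_loc, LinearMap.map_smul (lower _ _), fockForm_ofReal_smul, Complex.re_ofReal_mul]
  have key := integral_ineq_of_pointwise a0.1 (fun l => (a1 l).1) (fun l => (a2 l).1)
    (fun l => (a3 l).1) a4.1 a5.1 a6.1 (a := lam) (b := 1 - ε) (c := 2 * κ) fun y => by
      -- For each centre y the averaged integrands recombine into the cut form of the localized
      -- family, where the hypothesis applies.
      rw [← ek, ← ev, ← phDensity_loc hχ y hf, ← ei, ← tip_loc hχ y hf,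
        ← cutForm_eq hS (fun j => ((hf j).loc hχ y).memLp 2) η A V κ ε hc]
      exact h y
  simp only [fun l => (a1 l).2, fun l => (a2 l).2, fun l => (a3 l).2, a0.2, a4.2, a5.2, a6.2,
    ← hv', hp.2, ← tip_self_re hL, ← tip_self_re (hd _), add_zero, Finset.sum_add_distrib,
    ← Finset.sum_mul] at key
  rw [cutForm_eq hS hL η A V κ ε hc, kinT_eq]
  linarith

/-! ### Scaling -/

/-- Dilation of a function. -/
def dil (a : ℝ) (u : R3 → ℂ) : R3 → ℂ := fun x => u (a • x)

lemma integral_dil (g : R3 → ℝ) {a : ℝ} (ha : 0 < a) :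
    ∫ x, g (a • x) = (a ^ 3)⁻¹ * ∫ x, g x := by
  rw [Measure.integral_comp_smul]
  simp [abs_of_pos ha]

lemma l2Sq_dil (u : R3 → ℂ) {a : ℝ} (ha : 0 < a) : l2Sq (dil a u) = (a ^ 3)⁻¹ * l2Sq u :=
  integral_dil (fun x => ‖u x‖ ^ 2) ha

lemma IsTest.dil {u : R3 → ℂ} (hu : IsTest u) {a : ℝ} (ha : 0 < a) : IsTest (dil a u) :=
  ⟨hu.1.comp (contDiff_const_smul a), hu.2.comp_smul ha.ne'⟩

lemma partialD_dil (u : R3 → ℂ) (a : ℝ) (l : Fin 3) (x : R3) :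
    partialD l (dil a u) x = a * partialD l u (a • x) := by
  have : fderiv ℝ (dil a u) x = a • fderiv ℝ u (a • x) := fderiv_comp_smul a
  rw [partialD, this, smul_apply, partialD, Complex.real_smul]

lemma dA_dil (A : R3 → R3) (u : R3 → ℂ) (a : ℝ) (l : Fin 3) :
    dA (scaledA a A) l (dil a u) = (a : ℂ) • dil a (dA A l u) := by
  ext x
  simp only [dA, partialD_dil, scaledA, dil, Pi.smul_apply, PiLp.smul_apply, smul_eq_mul]
  push_cast; ring

lemma l2Sq_ofReal_smul (a : ℝ) (u : R3 → ℂ) : l2Sq ((a : ℂ) • u) = a ^ 2 * l2Sq u := by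
  simp only [l2Sq, Pi.smul_apply, norm_smul, mul_pow, Complex.norm_real, Real.norm_eq_abs, sq_abs,
    integral_const_mul]

lemma sum_l2Sq_dA_dil (A : R3 → R3) (u : R3 → ℂ) {a : ℝ} (ha : 0 < a) :
    ∑ l, l2Sq (dA (scaledA a A) l (dil a u)) = a ^ 2 * (a ^ 3)⁻¹ * ∑ l, l2Sq (dA A l u) := by
  rw [Finset.mul_sum]
  refine Finset.sum_congr rfl fun l _ => ?_
  rw [dA_dil, l2Sq_ofReal_smul, l2Sq_dil _ ha, mul_assoc]

lemma potEnergy_dil (V : R3 → ℝ) (u : R3 → ℂ) {a : ℝ} (ha : 0 < a) :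
    potEnergy (scaledV a V) (dil a u) = a ^ 2 * (a ^ 3)⁻¹ * potEnergy V u := by
  simp only [potEnergy, scaledV, dil]
  rw [integral_dil (fun x => a ^ 2 * V x * ‖u x‖ ^ 2) ha]
  simp only [mul_assoc, integral_const_mul]
  ring

lemma coulomb_dil (u : R3 → ℂ) {a : ℝ} (ha : 0 < a) :
    coulomb (dil a u) = a * (a ^ 3)⁻¹ ^ 2 * coulomb u := by
  simp only [coulomb, dil]
  have h1 : ∀ x y : R3, ‖u (a • x)‖ ^ 2 * ‖u (a • y)‖ ^ 2 / ‖x - y‖ =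
      a * (‖u (a • x)‖ ^ 2 * ‖u (a • y)‖ ^ 2 / ‖a • x - a • y‖) := fun x y => by
    rw [← smul_sub, norm_smul, Real.norm_of_nonneg ha.le]
    by_cases h : ‖x - y‖ = 0
    · simp [h]
    · field_simp
  simp_rw [h1, integral_const_mul]
  have h2 := fun x : R3 => integral_dil (fun y => ‖u (a • x)‖ ^ 2 * ‖u y‖ ^ 2 / ‖a • x - y‖) ha
  simp only [h2, integral_const_mul]
  rw [integral_dil (fun x => ∫ y, ‖u x‖ ^ 2 * ‖u y‖ ^ 2 / ‖x - y‖) ha]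
  ring

lemma dil_dil_inv (u : R3 → ℂ) {a : ℝ} (ha : 0 < a) : dil a (dil a⁻¹ u) = u := by
  ext x; simp [dil, smul_smul, inv_mul_cancel₀ ha.ne']

lemma VectorL2Loc.scaled {A : R3 → R3} (hA : VectorL2Loc A) {a : ℝ} (ha : 0 < a) :
    VectorL2Loc (scaledA a A) := fun K hK l => by
  have hK' : IsCompact ((a • · : R3 → R3) '' K) := hK.image (continuous_const_smul a)
  have h1 := (memLp_indicator_iff_restrict hK'.measurableSet).2 (hA _ hK' l)
  have h2 : MemLp (((a • · : R3 → R3) '' K).indicator fun x => A x l) 2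
      (Measure.map (a • · : R3 → R3) volume) := by
    rw [Measure.map_addHaar_smul volume ha.ne']
    exact h1.smul_measure ENNReal.ofReal_ne_top
  have h3 := (h2.comp_of_map (measurable_const_smul a).aemeasurable).const_mul a
  refine (h3.restrict K).ae_eq ((ae_restrict_iff' hK.measurableSet).2 (ae_of_all _ fun x hx => ?_))
  simp only [Function.comp, scaledA, PiLp.smul_apply, smul_eq_mul]
  rw [Set.indicator_of_mem (Set.mem_image_of_mem _ hx)]

lemma locallyIntegrable_scaledV {V : R3 → ℝ} (hV : LocallyIntegrable V volume) {a : ℝ}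
    (ha : 0 < a) : LocallyIntegrable (scaledV a V) volume := by
  refine locallyIntegrable_iff.2 fun K hK => ?_
  have hK' : IsCompact ((a • · : R3 → R3) '' K) := hK.image (continuous_const_smul a)
  have h1 := (integrable_indicator_iff hK'.measurableSet).2 (hV.integrableOn_isCompact hK')
  refine ((h1.comp_smul ha.ne').const_mul (a ^ 2)).integrableOn.congr_fun (fun x hx => ?_)
    hK.measurableSet
  simp only [scaledV]
  rw [Set.indicator_of_mem (Set.mem_image_of_mem _ hx)]

lemma InfFormBounded.scaled {V : R3 → ℝ} (hV : InfFormBounded V) {a : ℝ} (ha : 0 < a) :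
    InfFormBounded (scaledV a V) := fun ε hε => by
  obtain ⟨C, hC⟩ := hV ε hε
  refine ⟨C * a ^ 2, fun f hf => ?_⟩
  set u := dil a⁻¹ f
  have hu : IsTest u := hf.dil (inv_pos.2 ha)
  have h0 : f = dil a u := (dil_dil_inv f ha).symm
  have h1 := potEnergy_dil V u ha
  have h2 : ∀ l, ∫ x, ‖partialD l (dil a u) x‖ ^ 2 =
      a ^ 2 * (a ^ 3)⁻¹ * ∫ x, ‖partialD l u x‖ ^ 2 := fun l => by
    simp only [partialD_dil, norm_mul, mul_pow, Complex.norm_real, Real.norm_eq_abs, sq_abs,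
      integral_const_mul]
    rw [integral_dil (fun x => ‖partialD l u x‖ ^ 2) ha, mul_assoc]
  have h3 := l2Sq_dil u ha
  simp only [potEnergy, l2Sq] at h1 h3
  rw [h0, h1, h3, abs_mul, abs_of_pos (by positivity)]
  simp only [h2, ← Finset.mul_sum]
  calc _ ≤ a ^ 2 * (a ^ 3)⁻¹ * _ := mul_le_mul_of_nonneg_left (hC u hu) (by positivity)
    _ = _ := by ring

/-! ### The Pekar functional on test functions -/

/-- Young's inequality applied to the square root bound. The coefficient 1/12 is such that six times
this term uses only half of the kinetic energy, as required in `exists_perturbed_pekar_bound`. -/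
lemma coulomb_div_le {A : R3 → R3} (hA : VectorL2Loc A) {f : R3 → ℂ} (hf : IsTest f) :
    coulomb f / l2Sq f ≤ 1 / 12 * ∑ l, l2Sq (dA A l f) + 9 * l2Sq f := by
  have h0 := l2Sq_nonneg f
  have hT : ∀ l, Real.sqrt (l2Sq f) * Real.sqrt (l2Sq (dA A l f)) ≤
      1 / 12 * l2Sq (dA A l f) + 3 * l2Sq f := fun l => by
    have h1 := Real.sq_sqrt h0
    have h2 := Real.sq_sqrt (l2Sq_nonneg (dA A l f))
    nlinarith [sq_nonneg (6 * Real.sqrt (l2Sq f) - Real.sqrt (l2Sq (dA A l f)))]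
  have h3 : coulomb f / l2Sq f ≤ Real.sqrt (l2Sq f) * ∑ l, Real.sqrt (l2Sq (dA A l f)) :=
    div_le_of_le_mul₀ h0 (by positivity) ((coulomb_le hA hf).trans_eq (mul_comm _ _))
  rw [Finset.mul_sum] at h3
  refine h3.trans ((Finset.sum_le_sum fun l _ => hT l).trans_eq ?_)
  rw [Finset.sum_add_distrib, Finset.mul_sum, Finset.sum_const]
  simp; ring

/-- A bound below the Pekar functional on test functions holds on `H¹_A`. -/
lemma le_pekarFunctional {A : R3 → R3} (hA : VectorL2Loc A) {V : R3 → ℝ}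
    (hV : LocallyIntegrable V volume) (hVf : InfFormBounded V) {E : ℝ}
    (h : ∀ f, IsTest f → 0 < l2Sq f →
      E * l2Sq f ≤ testEnergy A V f - coulomb f / l2Sq f) {φ : R3 → ℂ}
    (hφ : MemH1 A φ) (h1 : l2Sq φ = 1) : E ≤ pekarFunctional A V φ := by
  obtain ⟨f, hf, hae⟩ := exists_isApprox_ae hA hφ
  have hl := hf.tendsto_l2Sq hφ
  rw [h1] at hl
  have hu : Tendsto (fun t => l2Sq (f t) * (testEnergy A V (f t) - E * l2Sq (f t))) atTop
      (𝓝 (schrodingerForm A V φ - E)) := by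
    have := hl.mul ((hf.tendsto_testEnergy hA hV hVf hφ).sub (hl.const_mul E))
    simpa using this
  have hle : ∀ᶠ t in atTop, coulomb (f t) ≤
      l2Sq (f t) * (testEnergy A V (f t) - E * l2Sq (f t)) := by
    filter_upwards [hl.eventually (lt_mem_nhds one_pos)] with t ht
    have h2 := h (f t) (hf.1 t) ht
    have h3 : coulomb (f t) = l2Sq (f t) * (coulomb (f t) / l2Sq (f t)) := by field_simp
    rw [h3]
    exact mul_le_mul_of_nonneg_left (by linarith) ht.le
  have h0 : 0 ≤ schrodingerForm A V φ - E :=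
    ge_of_tendsto hu (hle.mono fun t ht => (coulomb_nonneg _).trans ht)
  -- The attractive Coulomb term must be bounded from above in the limit, and lower semicontinuity
  -- gives just that. Extended reals are used because integrability for φ itself is not known.
  have h4 : ENNReal.ofReal (coulomb φ) ≤ ENNReal.ofReal (schrodingerForm A V φ - E) := by
    refine ofReal_coulomb_le.trans ((coulombE_le_liminf hf.1 hae).trans ?_)
    rw [← (ENNReal.tendsto_ofReal hu).liminf_eq]
    refine liminf_le_liminf ?_
    filter_upwards [hle] with t ht
    rw [← (hf.1 t).ofReal_coulomb]
    exact ENNReal.ofReal_le_ofReal ht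
  have h5 := (ENNReal.ofReal_le_ofReal_iff h0).1 h4
  rw [pekarFunctional]
  change E ≤ schrodingerForm A V φ - coulomb φ
  linarith

/-- Normalized localization functions at every scale. -/
lemma exists_localizer : ∃ G : ℝ, ∀ M : ℝ, 0 < M → ∃ χ : R3 → ℝ, ContDiff ℝ ∞ χ ∧
    HasCompactSupport χ ∧ ∫ x, χ x ^ 2 = 1 ∧ (∀ x, 1 / M < ‖x‖ → χ x = 0) ∧
      ∑ l, ∫ x, realD l χ x ^ 2 = M ^ 2 * G := by
  let b : ContDiffBump (0 : R3) := ⟨1 / 2, 1, by norm_num, by norm_num⟩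
  have hb : ContDiff ℝ ∞ b := b.contDiff
  have hpos : 0 < ∫ x, b x ^ 2 := by
    refine (b.continuous.pow 2).integral_pos_of_hasCompactSupport_nonneg_nonzero
      (hasCompactSupport_sq b.hasCompactSupport) (fun x => by positivity) (x := 0) ?_
    rw [b.one_of_mem_closedBall (by simp [b])]
    norm_num
  set c := ∫ x, b x ^ 2
  refine ⟨∑ l, ∫ x, (realD l b x) ^ 2 / c, fun M hM => ⟨fun x => Real.sqrt (M ^ 3 / c) * b (M • x),
    contDiff_const.mul (hb.comp (contDiff_const_smul M)),
    (b.hasCompactSupport.comp_smul hM.ne').mul_left, ?_, fun x hx => ?_, ?_⟩⟩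
  · simp only [mul_pow, integral_const_mul]
    rw [integral_dil (fun x => b x ^ 2) hM, Real.sq_sqrt (by positivity)]
    change M ^ 3 / c * ((M ^ 3)⁻¹ * c) = 1
    field_simp
  · simp only
    rw [b.zero_of_le_dist, mul_zero]
    rw [dist_zero_right, norm_smul, Real.norm_of_nonneg hM.le]
    rw [div_lt_iff₀ hM] at hx
    change 1 ≤ _
    linarith
  · rw [Finset.mul_sum]
    refine Finset.sum_congr rfl fun l _ => ?_
    have h : ∀ x, realD l (fun x => Real.sqrt (M ^ 3 / c) * b (M • x)) x =
        Real.sqrt (M ^ 3 / c) * (M * realD l b (M • x)) := fun x => by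
      have h1 : fderiv ℝ (fun x => b (M • x)) x = M • fderiv ℝ b (M • x) := fderiv_comp_smul M
      have h2 : DifferentiableAt ℝ (fun x => b (M • x)) x :=
        (hb.comp (contDiff_const_smul M)).differentiable (by simp) x
      rw [realD, fderiv_const_mul h2, h1]
      rfl
    simp only [h, mul_pow, integral_const_mul, integral_div]
    rw [integral_dil (fun x => realD l b x ^ 2) hM, Real.sq_sqrt (by positivity)]
    field_simp

lemma exists_isTest_norm_one : ∃ f : R3 → ℂ, IsTest f ∧ l2Sq f = 1 := by
  obtain ⟨G, hG⟩ := exists_localizer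
  obtain ⟨χ, h1, h2, h3, -⟩ := hG 1 one_pos
  refine ⟨fun x => χ x, ⟨Complex.ofRealCLM.contDiff.comp h1, 
    h2.comp_left (g := fun t : ℝ => (t : ℂ)) Complex.ofReal_zero⟩, ?_⟩
  simpa only [l2Sq, Complex.norm_real, Real.norm_eq_abs, sq_abs] using h3

/-- The potential uses a quarter and the Coulomb term a twelfth of the kinetic energy, so the
remainder is nonnegative. -/
lemma bddBelow_pekarValues {A : R3 → R3} (hA : VectorL2Loc A) {V : R3 → ℝ}
    (hV : LocallyIntegrable V volume) (hVf : InfFormBounded V) : BddBelow (pekarValues A V) := by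
  obtain ⟨K, -, hK⟩ := exists_form_bound hV hVf (ε := 1 / 4) (by norm_num)
  refine ⟨-(K + 9), ?_⟩
  rintro _ ⟨φ, hφ, h1, rfl⟩
  refine le_pekarFunctional hA hV hVf (fun f hf _ => ?_) hφ h1
  have h2 := (abs_le.1 (hK A hA f hf)).1
  have h3 := coulomb_div_le hA hf
  have h4 : 0 ≤ ∑ l, l2Sq (dA A l f) := Finset.sum_nonneg fun l _ => l2Sq_nonneg _
  rw [testEnergy]
  linarith

lemma coulomb_smul (c : ℂ) (f : R3 → ℂ) : coulomb (c • f) = ‖c‖ ^ 4 * coulomb f := by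
  simp only [coulomb, ← integral_const_mul, Pi.smul_apply, norm_smul]
  refine integral_congr_ae (ae_of_all _ fun x => integral_congr_ae (ae_of_all _ fun y => ?_))
  simp only; ring

/-- A unit multiple of a function. -/
lemma l2Sq_normalize {f : R3 → ℂ} (h : 0 < l2Sq f) :
    l2Sq (((1 / Real.sqrt (l2Sq f) : ℝ) : ℂ) • f) = 1 := by
  rw [l2Sq_ofReal_smul, div_pow, Real.sq_sqrt h.le, one_pow, one_div, inv_mul_cancel₀ h.ne']

lemma pekarEnergy_mul_le {A : R3 → R3} (hA : VectorL2Loc A) {V : R3 → ℝ}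
    (hV : LocallyIntegrable V volume) (hVf : InfFormBounded V) {f : R3 → ℂ} (hf : IsTest f) :
    pekarEnergy A V * l2Sq f ≤ testEnergy A V f - coulomb f / l2Sq f := by
  rcases (l2Sq_nonneg f).eq_or_lt with h0 | h0
  -- At norm zero the Coulomb quotient is 0 by convention, and the potential is dominated by the
  -- kinetic energy alone.
  · obtain ⟨K, hK⟩ := exists_form_bound hV hVf (ε := 1 / 4) (by norm_num)
    have h2 := (abs_le.1 (hK.2 A hA f hf)).1
    have h4 : 0 ≤ ∑ l, l2Sq (dA A l f) := Finset.sum_nonneg fun l _ => l2Sq_nonneg _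
    rw [← h0] at h2 ⊢
    rw [testEnergy]
    simp only [div_zero]
    linarith
  · set c : ℂ := ((1 / Real.sqrt (l2Sq f) : ℝ) : ℂ)
    have hc : ‖c‖ ^ 2 = (l2Sq f)⁻¹ := by
      simp only [c, Complex.norm_real, Real.norm_eq_abs, sq_abs, div_pow, Real.sq_sqrt h0.le]
      simp
    have h1 : pekarEnergy A V ≤ pekarFunctional A V (c • f) :=
      csInf_le (bddBelow_pekarValues hA hV hVf)
        ⟨_, (hf.const_smul c).memH1 hA, l2Sq_normalize h0, rfl⟩
    have h2 : pekarFunctional A V (c • f) = ‖c‖ ^ 2 * testEnergy A V f - ‖c‖ ^ 4 * coulomb f := by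
      rw [pekarFunctional, schrodingerForm_smul hA hV hVf c (hf.memH1 hA),
        hf.schrodingerForm_eq hA hV hVf, ← coulomb_smul]
      rfl
    rw [h2, show ‖c‖ ^ 4 = (‖c‖ ^ 2) ^ 2 by ring, hc] at h1
    calc _ ≤ _ := mul_le_mul_of_nonneg_right h1 h0.le
      _ = _ := by field_simp

/-- The Pekar functional with slightly reduced kinetic and increased Coulomb energy. -/
lemma exists_perturbed_pekar_bound {A : R3 → R3} (hA : VectorL2Loc A) {V : R3 → ℝ}
    (hV : LocallyIntegrable V volume) (hVf : InfFormBounded V) :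
    ∃ C, 0 ≤ C ∧ ∀ s, 0 ≤ s → s ≤ 1 / 2 → ∀ f, IsTest f →
      (pekarEnergy A V - C * s) * l2Sq f ≤ (1 - s) * ∑ l, l2Sq (dA A l f) + potEnergy V f -
        (1 + 4 * s) * (coulomb f / l2Sq f) := by
  obtain ⟨K, hK0, hK⟩ := exists_form_bound hV hVf (ε := 1 / 4) (by norm_num)
  refine ⟨2 * |pekarEnergy A V| + 2 * K + 54, by positivity, fun s hs hs2 f hf => ?_⟩
  have h1 := pekarEnergy_mul_le hA hV hVf hf
  have h2 := (abs_le.1 (hK A hA f hf)).1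
  have h3 := coulomb_div_le hA hf
  have hN := l2Sq_nonneg f
  rw [testEnergy] at h1
  set E := pekarEnergy A V
  set T := ∑ l, l2Sq (dA A l f)
  set q := potEnergy V f
  set D := coulomb f / l2Sq f
  -- With T, q, D the kinetic, potential and Coulomb terms, the perturbed functional equals (1 -
  -- 2s)(T + q - D) + s(T + 2q - 6D). The second bracket is bounded below because 2q and 6D use up
  -- half of T each.
  have h4 := mul_le_mul_of_nonneg_left h1 (by linarith : 0 ≤ 1 - 2 * s)
  have h5 : 0 ≤ s * (T + 2 * q - 6 * D + (2 * K + 54) * l2Sq f) :=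
    mul_nonneg hs (by linarith)
  have h6 : -(|E| * (s * l2Sq f)) ≤ -(E * (s * l2Sq f)) :=
    neg_le_neg (mul_le_mul_of_nonneg_right (le_abs_self E) (by positivity))
  linarith

/-! ### The lower bound -/

/-- The perturbed Pekar bound in the scaled fields. -/
lemma scaled_pekar_bound {A : R3 → R3} {V : R3 → ℝ} {E s α κ ε : ℝ} (hα : 0 < α)
    (hκ : κ ^ 2 = α / (2 * Real.pi ^ 2)) (hε : ε ≤ s)
    (h : ∀ f, IsTest f → E * l2Sq f ≤ (1 - s) * ∑ l, l2Sq (dA A l f) + potEnergy V f -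
        (1 + 4 * s) * (coulomb f / l2Sq f)) {φ : R3 → ℂ} (hφ : IsTest φ) :
    α ^ 2 * E * l2Sq φ ≤ (1 - ε) * ∑ l, l2Sq (dA (scaledA α A) l φ) + potEnergy (scaledV α V) φ -
      (1 + 4 * s) * κ ^ 2 * ((∫ k, ‖densityFT (density φ) k‖ ^ 2 / ‖k‖ ^ 2) / l2Sq φ) := by
  set u := dil α⁻¹ φ
  have hu : IsTest u := hφ.dil (inv_pos.2 hα)
  have h0 : φ = dil α u := (dil_dil_inv φ hα).symm
  have h1 := h u hu
  -- The coupling normalization κ² = α/(2π²) absorbs the constant of the momentum space Coulomb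
  -- formula. Under dilation by α kinetic, potential and α times the Coulomb quotient all scale
  -- alike, by α²·α⁻³.
  have h2 : κ ^ 2 * ((∫ k, ‖densityFT (density φ) k‖ ^ 2 / ‖k‖ ^ 2) / l2Sq φ) =
      α * (coulomb φ / l2Sq φ) := by
    rw [hφ.integrable_densityFT.2, hκ]
    have := Real.pi_pos
    field_simp
  rw [mul_assoc (1 + 4 * s), h2, h0, l2Sq_dil u hα, sum_l2Sq_dA_dil A u hα, potEnergy_dil V u hα,
    coulomb_dil u hα]
  have h3 : α * (α * (α ^ 3)⁻¹ ^ 2 * coulomb u / ((α ^ 3)⁻¹ * l2Sq u)) =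
      α ^ 2 * (α ^ 3)⁻¹ * (coulomb u / l2Sq u) := by
    rw [mul_div_mul_comm]; field_simp
  rw [h3]
  have h4 := mul_le_mul_of_nonneg_left h1 (by positivity : 0 ≤ α ^ 2 * (α ^ 3)⁻¹)
  have h5 : 0 ≤ α ^ 2 * (α ^ 3)⁻¹ * ((s - ε) * ∑ l, l2Sq (dA A l u)) :=
    mul_nonneg (by positivity) (mul_nonneg (by linarith)
      (Finset.sum_nonneg fun l _ => l2Sq_nonneg _))
  linarith

/-- The lower bound on sums of products of test functions. -/
lemma exists_frohlichForm_ge {A : R3 → R3} (hA : VectorL2Loc A) {V : R3 → ℝ}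
    (hV : LocallyIntegrable V volume) (hVf : InfFormBounded V) :
    ∃ C β₀ : ℝ, 1 ≤ β₀ ∧ ∀ β, β₀ ≤ β → ∀ ψ, MemQ (scaledA (β ^ 10) A) ψ →
      ((β ^ 10) ^ 2 * pekarEnergy A V - C * β ^ 18) * normSqH ψ ≤
        frohlichForm (scaledA (β ^ 10) A) (scaledV (β ^ 10) V) (β ^ 10) ψ := by
  obtain ⟨C₁, hC₁, hP⟩ := exists_perturbed_pekar_bound hA hV hVf
  obtain ⟨G, hG⟩ := exists_localizer
  have hσ := sphereArea_nonneg
  set σ := sphereArea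
  have hπ : 1 ≤ Real.pi := by linarith [Real.pi_gt_three]
  set c : ℝ := 1 + 12 * σ
  have hc : 1 ≤ c := by simp only [c]; linarith
  -- The summands of the constant come in turn from the perturbed functional, the block
  -- approximation, the number of modes, the localization, and the low and high momenta. The
  -- threshold 2c makes s at most 1/2.
  refine ⟨C₁ * c + 240 * σ + 8 + |G| + σ + 1 / 2, 2 * c, by linarith, fun β hβ ψ hψ => ?_⟩
  have hβ1 : 1 ≤ β := by linarith
  have hβ0 : 0 < β := by linarith
  set α := β ^ 10 with hα_def
  have hα : 0 < α := by positivity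
  set κ := Real.sqrt α / (Real.sqrt 2 * Real.pi) with hκ_def
  have hκ0 : 0 < κ := by have := Real.sqrt_pos.2 hα; positivity
  have hκ2 : κ ^ 2 = α / (2 * Real.pi ^ 2) := by
    rw [hκ_def, div_pow, mul_pow, Real.sq_sqrt hα.le, Real.sq_sqrt (by norm_num)]
  have hκα : κ ^ 2 ≤ β ^ 10 := by
    rw [hκ2]
    exact div_le_self hα.le (by nlinarith)
  -- The same s serves as δ of the block estimate and as perturbation of the Pekar functional. It
  -- dominates ε ≤ 12σ/β², and α²s is of order β^18.
  set s := c / β ^ 2 with hs_def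
  have hs0 : 0 < s := by positivity
  have hs2 : s ≤ 1 / 2 := by
    rw [hs_def, div_le_iff₀ (by positivity)]; nlinarith
  set n := ⌈β ^ 6⌉₊ with hn_def
  have hn1 : β ^ 6 ≤ n := Nat.le_ceil _
  have hβ6 : 1 ≤ β ^ 6 := one_le_pow₀ hβ1
  have hn2 : (n : ℝ) ≤ 2 * β ^ 6 := by
    have := Nat.ceil_lt_add_one (by positivity : 0 ≤ β ^ 6)
    linarith
  have hn0 : (0 : ℝ) < n := by linarith
  set P := 2 * β ^ 12 / n with hP_def
  have hP0 : 0 < P := by positivity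
  have hP2 : P ≤ 2 * β ^ 6 := by
    rw [hP_def, div_le_iff₀ hn0]
    nlinarith [mul_le_mul_of_nonneg_left hn1 (by positivity : 0 ≤ 2 * β ^ 6)]
  set ε := 12 * κ ^ 2 * (σ / β ^ 12) with hε_def
  have hε0 : 0 ≤ ε := by positivity
  have hε : ε ≤ s := by
    calc ε ≤ 12 * β ^ 10 * (σ / β ^ 12) := by rw [hε_def]; gcongr
      _ = 12 * σ / β ^ 2 := by field_simp
      _ ≤ s := by rw [hs_def]; gcongr; simp only [c]; linarith
  have hA' := hA.scaled hα
  have hV' := locallyIntegrable_scaledV hV hα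
  -- Localization to radius β^(-9) costs a multiple of β^18.
  obtain ⟨χ, hχ, hχc, hχ1, hχs, hχG⟩ := hG (β ^ 9) (by positivity)
  refine frohlichForm_ge_of_test hA' hV' (hVf.scaled hα) (fun m f η hf => ?_) hψ
  have hL := fun j => (hf j).memLp 2
  rw [normSqH_tens hL η]
  change _ * (tip f η f η).re ≤ _
  set X := (tip f η f η).re
  have hX : 0 ≤ X := tip_self_nonneg hL η
  refine le_trans ?_ (frohlichForm_ge_cutForm hA' hV' (hVf.scaled hα) hf η hκ0 hκ_def
    (one_le_pow₀ hβ1 : 1 ≤ β ^ 12))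
  have h1 := cutForm_ge_of_loc hχ hχc hχ1 (measurableSet_midCube (β ^ 12)) (R := 2 * β ^ 12)
    (fun k hk => ⟨not_lt.1 hk.2, norm_le_of_mem_midCube (by positivity) hk⟩) hA' hV' hf η
    (κ := κ) (ε := ε) (lam := _) (fun y => cutForm_midCube_ge hA' hV'
      (fun j => (hf j).loc hχ y) η (E₀ := α ^ 2 * (pekarEnergy A V - C₁ * s)) (δ := s)
      (L := 1 / β ^ 9) (y := y) (P := P) (n := n) (one_le_pow₀ hβ1) hP0
      (div_mul_cancel₀ _ hn0.ne') (by positivity) hκ0 hs0 hs2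
      (fun j x hx => by rw [loc, hχs _ hx]; simp)
      (fun φ hφ => scaled_pekar_bound hα hκ2 hε (hP s hs0.le hs2) hφ))
  rw [hχG] at h1
  -- The powers add up as 10 + 2(6 - 9) + 12 + 2 = 18, and 240 = 5·16·3.
  have e1 : 5 * κ ^ 2 * (2 * P * (1 / β ^ 9)) ^ 2 * (σ * (3 * β ^ 12)) / s ≤ 240 * σ * β ^ 18 := by
    have hcs : 1 / s ≤ β ^ 2 := by
      rw [hs_def, one_div_div]; exact div_le_self (by positivity) hc
    calc 5 * κ ^ 2 * (2 * P * (1 / β ^ 9)) ^ 2 * (σ * (3 * β ^ 12)) / s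
        = 5 * κ ^ 2 * (2 * P * (1 / β ^ 9)) ^ 2 * (σ * (3 * β ^ 12)) * (1 / s) := by ring
      _ ≤ 5 * β ^ 10 * (2 * (2 * β ^ 6) * (1 / β ^ 9)) ^ 2 * (σ * (3 * β ^ 12)) * β ^ 2 := by gcongr
      _ = 240 * σ * β ^ 18 := by field_simp; ring
  have e2 : (n : ℝ) ^ 3 ≤ 8 * β ^ 18 := by
    calc (n : ℝ) ^ 3 ≤ (2 * β ^ 6) ^ 3 := by gcongr
      _ = _ := by ring
  have e3 : (1 - ε) * ((β ^ 9) ^ 2 * G) ≤ |G| * β ^ 18 := by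
    have : (1 - ε) * G ≤ |G| := by
      refine (le_abs_self _).trans ?_
      rw [abs_mul, abs_of_nonneg (by linarith : 0 ≤ 1 - ε)]
      exact mul_le_of_le_one_left (abs_nonneg _) (by linarith)
    nlinarith [mul_le_mul_of_nonneg_right this (by positivity : 0 ≤ β ^ 18)]
  have e4 : κ ^ 2 * σ + 1 / 2 ≤ (σ + 1 / 2) * β ^ 18 := by
    have h10 : β ^ 10 ≤ β ^ 18 := pow_le_pow_right₀ hβ1 (by norm_num)
    have h18 : 1 ≤ β ^ 18 := one_le_pow₀ hβ1
    nlinarith [mul_le_mul_of_nonneg_right (hκα.trans h10) hσ]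
  have e5 : α ^ 2 * (C₁ * s) = C₁ * c * β ^ 18 := by
    rw [hs_def, hα_def]; field_simp
  refine le_trans ?_ (sub_le_sub_right h1 _)
  rw [← sub_mul]
  refine mul_le_mul_of_nonneg_right ?_ hX
  linarith

/-! ### The upper bound -/

/-- The coherent state of `z`, without normalization, truncated to less than `M` phonons. -/
def cohFn (z : R3 → ℂ) (M : ℕ) : FockFn := fun n K =>
  if n < M then ((Real.sqrt n.factorial)⁻¹ : ℂ) * ∏ i, z (K i) else 0

lemma memF0_cohFn {z : R3 → ℂ} (hz : Continuous z) (hc : HasCompactSupport z) (M : ℕ) :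
    MemF0 (cohFn z M) := by
  refine ⟨fun n => ?_, fun n σ K => ?_, (Set.finite_lt_nat M).subset fun n hn => ?_⟩
  · by_cases h : n < M
    · rw [show cohFn z M n = fun K => ((Real.sqrt n.factorial)⁻¹ : ℂ) * ∏ i, z (K i) from
        funext fun K => if_pos h]
      refine ⟨continuous_const.mul (continuous_finsetProd _ fun i _ =>
        hz.comp (continuous_apply i)), ?_⟩
      refine HasCompactSupport.intro (isCompact_univ_pi fun _ : Fin n => hc) fun K hK => ?_
      simp only [Set.mem_univ_pi, not_forall] at hK
      obtain ⟨i, hi⟩ := hK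
      have h0 : z (K i) = 0 := image_eq_zero_of_notMem_tsupport hi
      rw [Finset.prod_eq_zero (Finset.mem_univ i) h0, mul_zero]
    · rw [show cohFn z M n = 0 from funext fun K => if_neg h]
      exact ⟨continuous_const, HasCompactSupport.zero⟩
  · simp only [cohFn, Function.comp]
    rw [Equiv.prod_comp σ fun i => z (K i)]
  · by_contra h
    exact hn (funext fun K => if_neg h)

/-! ### Homogeneity in the Fock factors -/

section Scaling

variable {J : Type*} [Fintype J]

lemma mpair_mul_right (M G : J → J → ℂ) (a : ℂ) :
    mpair M (fun i j => a * G i j) = a * mpair M G := by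
  simp only [mpair, Finset.mul_sum]
  exact Finset.sum_congr rfl fun i _ => Finset.sum_congr rfl fun j _ => by ring

lemma frohlichForm_tens_smul {A : R3 → R3} (hA : VectorL2Loc A) {V : R3 → ℝ}
    (hV : LocallyIntegrable V volume) (hVf : InfFormBounded V) {f : J → R3 → ℂ}
    (hf : ∀ j, IsTest (f j)) (η : J → Fock) (α c : ℝ) :
    normSqH (tens f fun j => (c : ℂ) • η j) = c ^ 2 * normSqH (tens f η) ∧
    frohlichForm A V α (tens f fun j => (c : ℂ) • η j) = c ^ 2 * frohlichForm A V α (tens f η) := by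
  have hL := fun j => (hf j).memLp 2
  have hann : ∀ k j, ann k ((c : ℂ) • η j) = (c : ℂ) • ann k (η j) := fun k j => map_smul _ _ _
  refine ⟨?_, ?_⟩
  · simp only [normSqH_tens hL, fockForm_ofReal_smul, mpair_mul_right, Complex.re_ofReal_mul]
  · simp only [frohlichForm_tens hA hV hVf hf, kinT, potT, phDensity, intDensity, tip, hann,
      fockForm_ofReal_smul, mpair_mul_right, Complex.re_ofReal_mul]
    rw [mul_add, mul_add, ← integral_const_mul]
    congr 1
    refine integral_congr_ae (ae_of_all _ fun k => ?_)
    simp only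
    ring

end Scaling

/-! ### Truncated coherent states -/

section Coherent

variable {z : R3 → ℂ} (hz : Continuous z) (hc : HasCompactSupport z)

/-- The truncated coherent state as an element of the Fock space. -/
def coh (M : ℕ) : Fock := ⟨cohFn z M, (memF0_cohFn hz hc M).isFock⟩

/-- Coherent vectors are eigenvectors of annihilation, except that removing a phonon lowers the
truncation by one. Hence both truncations appear in the energy. -/
lemma ann_coh (k : R3) (M : ℕ) : ann k (coh hz hc (M + 1)) = z k • coh hz hc M := by
  refine Subtype.ext (funext fun n => funext fun K => ?_)
  rw [ann_apply]
  change _ * cohFn z (M + 1) (n + 1) (Fin.cons k K) = z k * cohFn z M n K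
  by_cases h : n < M
  · simp only [cohFn, if_pos h, if_pos (Nat.succ_lt_succ h), Fin.prod_univ_succ, Fin.cons_zero,
      Fin.cons_succ]
    have h1 : Real.sqrt ((n + 1).factorial : ℝ) = Real.sqrt (n + 1) * Real.sqrt n.factorial := by
      rw [← Real.sqrt_mul (by positivity), Nat.factorial_succ]; push_cast; rfl
    have h2 : (Real.sqrt ((n : ℝ) + 1) : ℂ) ≠ 0 := by
      rw [Ne, Complex.ofReal_eq_zero]; exact (Real.sqrt_pos.2 (by positivity)).ne'
    have h3 : (Real.sqrt (n.factorial : ℝ) : ℂ) ≠ 0 := by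
      rw [Ne, Complex.ofReal_eq_zero]
      exact (Real.sqrt_pos.2 (by exact_mod_cast n.factorial_pos)).ne'
    rw [h1]; push_cast; field_simp
  · simp only [cohFn, if_neg h, if_neg (by omega : ¬ n + 1 < M + 1), mul_zero]

/-- Partial sums of the exponential of `‖z‖²`. -/
def cohSum (z : R3 → ℂ) (M : ℕ) : ℝ := ∑ n ∈ Finset.range M, l2Sq z ^ n / n.factorial

/-- The shorter vector decides which sectors contribute, and there the two agree. The n-phonon
sector gives ‖z‖^(2n)/n!. -/
lemma fockForm_coh {M M' : ℕ} (h : M ≤ M') :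
    fockForm (coh hz hc M') (coh hz hc M) = cohSum z M := by
  rw [fockForm_eq_sum _ (N := M) fun n hn => funext fun K => if_neg (not_lt.2 hn), cohSum,
    Complex.ofReal_sum]
  refine Finset.sum_congr rfl fun n hn => ?_
  have hn' := Finset.mem_range.1 hn
  have e : ∀ K : Fin n → R3, (starRingEnd ℂ) (cohFn z M' n K) * cohFn z M n K =
      ((n.factorial : ℝ)⁻¹ : ℂ) * ((∏ i, ‖z (K i)‖ ^ 2 : ℝ) : ℂ) := fun K => by
    simp only [cohFn, if_pos hn', if_pos (hn'.trans_le h), map_mul, map_inv₀, Complex.conj_ofReal,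
      map_prod]
    have h1 : ((Real.sqrt n.factorial)⁻¹ : ℂ) * ((Real.sqrt n.factorial)⁻¹ : ℂ) =
        ((n.factorial : ℝ)⁻¹ : ℂ) := by
      rw [← mul_inv, ← Complex.ofReal_mul, Real.mul_self_sqrt (by positivity)]
    have h2 : (∏ i, (starRingEnd ℂ) (z (K i))) * ∏ i, z (K i) =
        ((∏ i, ‖z (K i)‖ ^ 2 : ℝ) : ℂ) := by
      rw [← Finset.prod_mul_distrib, Complex.ofReal_prod]
      refine Finset.prod_congr rfl fun i _ => ?_
      rw [mul_comm, Complex.mul_conj, Complex.normSq_eq_norm_sq]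
    rw [← h1, ← h2]; ring
  change ∫ K, (starRingEnd ℂ) (cohFn z M' n K) * cohFn z M n K = _
  simp_rw [e]
  rw [integral_const_mul, integral_complex_ofReal,
    integral_fintype_prod_volume_eq_pow fun x => ‖z x‖ ^ 2, Fintype.card_fin]
  change _ * ((l2Sq z ^ n : ℝ) : ℂ) = _
  push_cast
  rw [div_eq_inv_mul]

lemma eip_self (g : R3 → ℂ) : eip g g = (l2Sq g : ℂ) := by
  rw [eip, l2Sq, ← integral_complex_ofReal]
  refine integral_congr_ae (ae_of_all _ fun x => ?_)
  simp only
  rw [mul_comm, Complex.mul_conj, Complex.normSq_eq_norm_sq]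

lemma normSqH_coh {φ : R3 → ℂ} (hφ : IsTest φ) (M : ℕ) :
    normSqH (tens (fun _ : Fin 1 => φ) fun _ => coh hz hc M) = l2Sq φ * cohSum z M := by
  rw [normSqH_tens fun _ => hφ.memLp 2]
  simp only [mpair, Finset.univ_unique, Finset.sum_singleton, eip_self, fockForm_coh hz hc le_rfl]
  rw [← Complex.ofReal_mul, Complex.ofReal_re]

/-- The Fröhlich energy of a product of a test function and a truncated coherent state. -/
lemma frohlichForm_coh {A : R3 → R3} (hA : VectorL2Loc A) {V : R3 → ℝ}
    (hV : LocallyIntegrable V volume) (hVf : InfFormBounded V) {φ : R3 → ℂ} (hφ : IsTest φ)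
    (α : ℝ) (M : ℕ) :
    frohlichForm A V α (tens (fun _ : Fin 1 => φ) fun _ => coh hz hc (M + 1)) =
      testEnergy A V φ * cohSum z (M + 1) +
      (∫ k, (l2Sq φ * ‖z k‖ ^ 2 + Real.sqrt α / (Real.sqrt 2 * Real.pi) *
        (1 / ‖k‖ * (2 * (densityFT (density φ) k * z k).re)))) * cohSum z M := by
  rw [frohlichForm_tens hA hV hVf fun _ => hφ]
  have h1 : kinT A (fun _ : Fin 1 => φ) (fun _ => coh hz hc (M + 1)) =
      (∑ l, l2Sq (dA A l φ)) * cohSum z (M + 1) := by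
    simp only [kinT, mpair, kinMat, Finset.univ_unique, Finset.sum_singleton, eip_self,
      fockForm_coh hz hc le_rfl]
    rw [← Complex.ofReal_sum, ← Complex.ofReal_mul, Complex.ofReal_re]
  have h2 : potT V (fun _ : Fin 1 => φ) (fun _ => coh hz hc (M + 1)) =
      potEnergy V φ * cohSum z (M + 1) := by
    have : ∫ x, (V x : ℂ) * ((starRingEnd ℂ) (φ x) * φ x) = (potEnergy V φ : ℂ) := by
      rw [potEnergy, ← integral_complex_ofReal]
      refine integral_congr_ae (ae_of_all _ fun x => ?_)
      simp only
      rw [mul_comm ((starRingEnd ℂ) _), Complex.mul_conj, Complex.normSq_eq_norm_sq,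
        Complex.ofReal_mul]
    simp only [potT, mpair, potMat, Finset.univ_unique, Finset.sum_singleton, this,
      fockForm_coh hz hc le_rfl]
    rw [← Complex.ofReal_mul, Complex.ofReal_re]
  rw [h1, h2, testEnergy, add_mul, ← integral_mul_const]
  congr 1
  refine integral_congr_ae (ae_of_all _ fun k => ?_)
  have h3 : phDensity (fun _ : Fin 1 => φ) (fun _ => coh hz hc (M + 1)) k =
      l2Sq φ * ‖z k‖ ^ 2 * cohSum z M := by
    simp only [phDensity, tip, mpair, Finset.univ_unique, Finset.sum_singleton, eip_self, ann_coh,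
      LinearMap.map_smulₛₗ, LinearMap.smul_apply, map_smul, smul_eq_mul,
      fockForm_coh hz hc le_rfl]
    rw [← mul_assoc (z k), Complex.mul_conj, Complex.normSq_eq_norm_sq, ← Complex.ofReal_mul,
      ← Complex.ofReal_mul, Complex.ofReal_re]; ring
  have h4 : intDensity (fun _ : Fin 1 => φ) (fun _ => coh hz hc (M + 1)) k =
      densityFT (density φ) k * z k * (cohSum z M : ℂ) := by
    have : eip φ (waveMul k φ) = densityFT (density φ) k := by
      refine integral_congr_ae (ae_of_all _ fun x => ?_)
      simp only [waveMul, density]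
      rw [← Complex.normSq_eq_norm_sq, ← Complex.mul_conj]; ring
    simp only [intDensity, mpair, Finset.univ_unique, Finset.sum_singleton, ann_coh, map_smul,
      smul_eq_mul, fockForm_coh hz hc (Nat.le_succ M), this]
    ring
  simp only [h3, h4, Complex.re_mul_ofReal]
  ring

lemma cohSum_pos (z : R3 → ℂ) (M : ℕ) : 0 < cohSum z (M + 1) := by
  have := l2Sq_nonneg z
  rw [cohSum, Finset.sum_range_succ']
  simp only [pow_zero, Nat.factorial_zero, Nat.cast_one, div_one]
  positivity

lemma exists_normalized_coh {A : R3 → R3} (hA : VectorL2Loc A) {φ : R3 → ℂ} (hφ : IsTest φ)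
    (h0 : 0 < l2Sq φ) (M : ℕ) : ∃ c : ℝ,
      MemQ A (tens (fun _ : Fin 1 => φ) fun _ => (c : ℂ) • coh hz hc (M + 1)) ∧
      normSqH (tens (fun _ : Fin 1 => φ) fun _ => (c : ℂ) • coh hz hc (M + 1)) = 1 := by
  have hS := mul_pos h0 (cohSum_pos z M)
  refine ⟨1 / Real.sqrt (l2Sq φ * cohSum z (M + 1)), ?_, ?_⟩
  · refine ⟨1, fun _ => ((1 / Real.sqrt (l2Sq φ * cohSum z (M + 1)) : ℝ) : ℂ) • φ,
      fun _ => cohFn z (M + 1), fun _ => (hφ.const_smul _).memH1 hA,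
      fun _ => memF0_cohFn hz hc (M + 1), fun n x K => Finset.sum_congr rfl fun j _ => ?_⟩
    change φ x * (_ * cohFn z (M + 1) n K) = _ * φ x * cohFn z (M + 1) n K
    ring
  · rw [normSqH_tens fun _ => hφ.memLp 2]
    simp only [fockForm_ofReal_smul, mpair_mul_right, Complex.re_ofReal_mul]
    rw [← normSqH_tens (fun _ => hφ.memLp 2), normSqH_coh hz hc hφ, div_pow, Real.sq_sqrt hS.le,
      one_pow, one_div, inv_mul_cancel₀ hS.ne']

end Coherent

/-! ### Untruncated limit and the optimal classical field -/

lemma tendsto_cohSum (z : R3 → ℂ) : Tendsto (cohSum z) atTop (𝓝 (Real.exp (l2Sq z))) := by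
  have := (NormedSpace.expSeries_div_hasSum_exp (l2Sq z)).tendsto_sum_nat
  rwa [← Real.exp_eq_exp_ℝ] at this

/-- The energy with a classical field. -/
lemma le_classical_energy {A : R3 → R3} (hA : VectorL2Loc A) {V : R3 → ℝ}
    (hV : LocallyIntegrable V volume) (hVf : InfFormBounded V) {φ : R3 → ℂ} (hφ : IsTest φ)
    (h0 : 0 < l2Sq φ) {α E : ℝ} (hE : ∀ ψ, MemQ A ψ → normSqH ψ = 1 → E ≤ frohlichForm A V α ψ)
    {z : R3 → ℂ} (hz : Continuous z) (hc : HasCompactSupport z) :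
    E * l2Sq φ ≤ testEnergy A V φ +
      ∫ k, (l2Sq φ * ‖z k‖ ^ 2 + Real.sqrt α / (Real.sqrt 2 * Real.pi) *
        (1 / ‖k‖ * (2 * (densityFT (density φ) k * z k).re))) := by
  have h := tendsto_cohSum z
  have h' := h.comp (tendsto_add_atTop_nat 1)
  -- As M grows both partial sums tend to exp ‖z‖², so the shift of the truncation disappears and
  -- the exponential can be cancelled.
  have hle := le_of_tendsto_of_tendsto' (h'.const_mul (E * l2Sq φ))
    ((h'.const_mul (testEnergy A V φ)).add (h.const_mul _)) fun M => by
      have h1 : E * normSqH (tens (fun _ : Fin 1 => φ) fun _ => coh hz hc (M + 1)) ≤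
          frohlichForm A V α (tens (fun _ : Fin 1 => φ) fun _ => coh hz hc (M + 1)) := by
        obtain ⟨c, hψ, h1⟩ := exists_normalized_coh hz hc hA hφ h0 M
        obtain ⟨e1, e2⟩ := frohlichForm_tens_smul hA hV hVf (fun _ : Fin 1 => hφ)
          (fun _ => coh hz hc (M + 1)) α c
        have h2 := hE _ hψ h1
        rw [e1] at h1
        rw [e2] at h2
        have hn : 0 ≤ normSqH (tens (fun _ : Fin 1 => φ) fun _ => coh hz hc (M + 1)) := by
          rw [normSqH_coh hz hc hφ]; exact (mul_pos h0 (cohSum_pos z M)).le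
        calc _ ≤ _ := mul_le_mul_of_nonneg_right h2 hn
          _ = _ := by rw [mul_right_comm, h1, one_mul]
      rw [normSqH_coh hz hc hφ, frohlichForm_coh hz hc hA hV hVf hφ, ← mul_assoc] at h1
      exact h1
  rw [← add_mul] at hle
  exact le_of_mul_le_mul_right hle (Real.exp_pos _)

/-- Continuous compactly supported approximations of `1 / ‖k‖` from below. -/
def regInv (n : ℕ) (k : R3) : ℝ := max 0 (1 - ‖k‖ / (n + 1)) / (‖k‖ + 1 / (n + 1))

lemma regInv_nonneg (n : ℕ) (k : R3) : 0 ≤ regInv n k := by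
  have : 0 ≤ max 0 (1 - ‖k‖ / ((n : ℝ) + 1)) := le_max_left _ _
  unfold regInv; positivity

lemma regInv_le (n : ℕ) {k : R3} (hk : k ≠ 0) : regInv n k ≤ 1 / ‖k‖ := by
  have h0 : 0 < ‖k‖ := norm_pos_iff.2 hk
  refine div_le_div₀ zero_le_one (max_le zero_le_one ?_) h0 ?_
  · have : 0 ≤ ‖k‖ / ((n : ℝ) + 1) := by positivity
    linarith
  · have : 0 ≤ 1 / ((n : ℝ) + 1) := by positivity
    linarith

lemma continuous_regInv (n : ℕ) : Continuous (regInv n) :=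
  Continuous.div (by fun_prop) (by fun_prop) fun k => by positivity

lemma hasCompactSupport_regInv (n : ℕ) : HasCompactSupport (regInv n) := by
  refine HasCompactSupport.intro (isCompact_closedBall (0 : R3) (n + 1)) fun k hk => ?_
  have h1 : (n : ℝ) + 1 < ‖k‖ := by simpa using hk
  have h2 : 1 - ‖k‖ / ((n : ℝ) + 1) ≤ 0 := by
    rw [sub_nonpos, one_le_div (by positivity)]; exact h1.le
  rw [regInv, max_eq_left h2, zero_div]

lemma tendsto_regInv {k : R3} (hk : k ≠ 0) :
    Tendsto (fun n => regInv n k) atTop (𝓝 (1 / ‖k‖)) := by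
  have h1 := tendsto_one_div_add_atTop_nhds_zero_nat (𝕜 := ℝ)
  have h2 : Tendsto (fun n : ℕ => max 0 (1 - ‖k‖ / ((n : ℝ) + 1))) atTop (𝓝 1) := by
    have := (tendsto_const_nhds (x := (0 : ℝ))).max
      ((tendsto_const_nhds (x := (1 : ℝ))).sub (h1.const_mul ‖k‖))
    simpa [mul_one_div, div_eq_mul_inv] using this
  have h3 := h2.div ((tendsto_const_nhds (x := ‖k‖)).add h1) (by simpa using hk)
  rw [add_zero] at h3
  exact h3

/-- The energy of a test function in its optimal classical field. -/
lemma le_pekar_of_test {A : R3 → R3} (hA : VectorL2Loc A) {V : R3 → ℝ}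
    (hV : LocallyIntegrable V volume) (hVf : InfFormBounded V) {φ : R3 → ℂ} (hφ : IsTest φ)
    (h0 : 0 < l2Sq φ) {α E : ℝ} (hα : 0 < α)
    (hE : ∀ ψ, MemQ A ψ → normSqH ψ = 1 → E ≤ frohlichForm A V α ψ) :
    E * l2Sq φ ≤ testEnergy A V φ - α * (coulomb φ / l2Sq φ) := by
  set κ := Real.sqrt α / (Real.sqrt 2 * Real.pi) with hκ_def
  have hκ2 : κ ^ 2 = α / (2 * Real.pi ^ 2) := by
    rw [hκ_def, div_pow, mul_pow, Real.sq_sqrt hα.le, Real.sq_sqrt (by norm_num)]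
  set N := l2Sq φ
  set ρ := densityFT (density φ)
  have hρ : Continuous ρ := continuous_densityFT (integrable_norm_sq (hφ.memLp 2))
  obtain ⟨hi, hcoul⟩ := hφ.integrable_densityFT
  have hn : ∀ n, E * N ≤ testEnergy A V φ +
      ∫ k, κ ^ 2 / N * (‖ρ k‖ ^ 2 * (regInv n k ^ 2 - 2 * regInv n k * (1 / ‖k‖))) := fun n => by
    -- The minimizing field is -(κ/N) times the conjugate of ρ, divided by |k|. It is singular at 0
    -- and need not have compact support, so 1/|k| is replaced by `regInv`.
    have h1 := le_classical_energy hA hV hVf hφ h0 hE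
      (z := fun k => -((κ / N : ℝ) : ℂ) * ((starRingEnd ℂ) (ρ k) * (regInv n k : ℂ)))
      (continuous_const.mul ((Complex.continuous_conj.comp hρ).mul
        (Complex.continuous_ofReal.comp (continuous_regInv n))))
      ((((hasCompactSupport_regInv n).comp_left (g := fun t : ℝ => (t : ℂ))
        Complex.ofReal_zero).mul_left).mul_left)
    refine h1.trans_eq ?_
    congr 1
    refine integral_congr_ae (ae_of_all _ fun k => ?_)
    have e1 : ρ k * (-((κ / N : ℝ) : ℂ) * ((starRingEnd ℂ) (ρ k) * (regInv n k : ℂ))) =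
        ((-(κ / N) * ‖ρ k‖ ^ 2 * regInv n k : ℝ) : ℂ) := by
      have := Complex.mul_conj (ρ k)
      rw [Complex.normSq_eq_norm_sq] at this
      push_cast at this ⊢
      linear_combination (-((κ : ℂ) / N) * (regInv n k : ℂ)) * this
    simp only [← hκ_def]
    rw [e1, Complex.ofReal_re, norm_mul, norm_neg, norm_mul, RCLike.norm_conj, Complex.norm_real,
      Complex.norm_real, Real.norm_eq_abs, Real.norm_eq_abs, mul_pow, mul_pow, sq_abs, sq_abs]
    field_simp
    ring
  have hlim : Tendsto (fun n => ∫ k, κ ^ 2 / N *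
      (‖ρ k‖ ^ 2 * (regInv n k ^ 2 - 2 * regInv n k * (1 / ‖k‖)))) atTop
      (𝓝 (∫ k, κ ^ 2 / N * (‖ρ k‖ ^ 2 * ((1 / ‖k‖) ^ 2 - 2 * (1 / ‖k‖) * (1 / ‖k‖))))) := by
    refine tendsto_integral_of_dominated_convergence
      (fun k => κ ^ 2 / N * (2 * (‖ρ k‖ ^ 2 / ‖k‖ ^ 2))) (fun n => ?_)
      ((hi.const_mul 2).const_mul _) (fun n => ?_) ?_
    · have := (continuous_regInv n).measurable
      have := hρ.measurable
      exact Measurable.aestronglyMeasurable (by fun_prop)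
    · filter_upwards [Measure.ae_ne volume (0 : R3)] with k hk
      have b0 := regInv_nonneg n k
      have b1 := regInv_le n hk
      rw [norm_mul, norm_mul, Real.norm_of_nonneg (by positivity),
        Real.norm_of_nonneg (by positivity), Real.norm_eq_abs]
      -- Because 0 ≤ `regInv` ≤ 1/|k|, the integrands are dominated by twice the integrable density
      -- of the Coulomb energy.
      have b2 : |regInv n k ^ 2 - 2 * regInv n k * (1 / ‖k‖)| ≤ 2 * (1 / ‖k‖) ^ 2 := by
        rw [abs_le]; constructor <;> nlinarith
      calc _ ≤ κ ^ 2 / N * (‖ρ k‖ ^ 2 * (2 * (1 / ‖k‖) ^ 2)) := by gcongr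
        _ = _ := by ring
    · filter_upwards [Measure.ae_ne volume (0 : R3)] with k hk
      have := tendsto_regInv hk
      exact (((this.pow 2).sub ((this.const_mul 2).mul_const _)).const_mul _).const_mul _
  have hfin := ge_of_tendsto' (tendsto_const_nhds.add hlim) hn
  have e2 : ∫ k, κ ^ 2 / N * (‖ρ k‖ ^ 2 * ((1 / ‖k‖) ^ 2 - 2 * (1 / ‖k‖) * (1 / ‖k‖))) =
      -(α * (coulomb φ / N)) := by
    have : ∀ k, κ ^ 2 / N * (‖ρ k‖ ^ 2 * ((1 / ‖k‖) ^ 2 - 2 * (1 / ‖k‖) * (1 / ‖k‖))) =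
        -(κ ^ 2 / N) * (‖ρ k‖ ^ 2 / ‖k‖ ^ 2) := fun k => by ring
    simp_rw [this]
    rw [integral_const_mul, hcoul, hκ2]
    have := Real.pi_pos
    field_simp
    rfl
  rw [e2] at hfin
  linarith

lemma frohlichValues_nonempty {A : R3 → R3} (hA : VectorL2Loc A) (V : R3 → ℝ) (α : ℝ) :
    (frohlichValues A V α).Nonempty := by
  obtain ⟨φ, hφ, h1⟩ := exists_isTest_norm_one
  obtain ⟨c, hψ, h⟩ := exists_normalized_coh (z := 0) continuous_const HasCompactSupport.zero hA hφ
    (by rw [h1]; exact one_pos) 0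
  exact ⟨_, _, hψ, h, rfl⟩

/-- The ground state energy is at most the scaled Pekar energy. -/
lemma frohlichEnergy_le {A : R3 → R3} (hA : VectorL2Loc A) {V : R3 → ℝ}
    (hV : LocallyIntegrable V volume) (hVf : InfFormBounded V) {α : ℝ} (hα : 0 < α)
    (hb : BddBelow (frohlichValues (scaledA α A) (scaledV α V) α)) {φ : R3 → ℂ}
    (hφ : MemH1 A φ) (h1 : l2Sq φ = 1) :
    frohlichEnergy (scaledA α A) (scaledV α V) α ≤ α ^ 2 * pekarFunctional A V φ := by
  set E := frohlichEnergy (scaledA α A) (scaledV α V) α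
  have h := le_pekarFunctional hA hV hVf (E := E / α ^ 2) (fun u hu hu0 => ?_) hφ h1
  · rwa [div_le_iff₀ (by positivity), mul_comm] at h
  have hN : 0 < l2Sq (dil α u) := by rw [l2Sq_dil u hα]; positivity
  -- The trial function u lives at unit scale; its dilation by α is used in the scaled fields, where
  -- all terms carry the common factor α²·α⁻³.
  have h2 := le_pekar_of_test (hA.scaled hα) (locallyIntegrable_scaledV hV hα) (hVf.scaled hα)
    (hu.dil hα) hN hα fun ψ hψ hψ1 => csInf_le hb ⟨ψ, hψ, hψ1, rfl⟩
  rw [testEnergy, l2Sq_dil u hα, sum_l2Sq_dA_dil A u hα, potEnergy_dil V u hα,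
    coulomb_dil u hα] at h2
  rw [testEnergy]
  refine le_of_mul_le_mul_left (le_trans (le_of_eq ?_) (h2.trans_eq ?_))
    (by positivity : 0 < α ^ 2 * (α ^ 3)⁻¹)
  · field_simp
    rfl
  · field_simp

end Polaron

end

theorem mainTheorem1 (A : Polaron.R3 → Polaron.R3) (V : Polaron.R3 → ℝ)
    (hA : Polaron.VectorL2Loc A)
    (hV : MeasureTheory.LocallyIntegrable V MeasureTheory.volume)
    (hVform : Polaron.InfFormBounded V) :
    (Polaron.pekarValues A V).Nonempty ∧ BddBelow (Polaron.pekarValues A V) ∧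
    ∃ C : ℝ, ∃ α₀ : ℝ, 0 < α₀ ∧ ∀ α : ℝ, α₀ ≤ α →
      (Polaron.frohlichValues (Polaron.scaledA α A) (Polaron.scaledV α V) α).Nonempty ∧
      BddBelow (Polaron.frohlichValues (Polaron.scaledA α A) (Polaron.scaledV α V) α) ∧
      Polaron.frohlichEnergy (Polaron.scaledA α A) (Polaron.scaledV α V) α
        ≤ α ^ 2 * Polaron.pekarEnergy A V ∧
      α ^ 2 * Polaron.pekarEnergy A V - C * α ^ (9 / 5 : ℝ)
        ≤ Polaron.frohlichEnergy (Polaron.scaledA α A) (Polaron.scaledV α V) α := by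
  refine ⟨?_, Polaron.bddBelow_pekarValues hA hV hVform, ?_⟩
  · obtain ⟨φ, hφ, h1⟩ := Polaron.exists_isTest_norm_one
    exact ⟨_, φ, hφ.memH1 hA, h1, rfl⟩
  obtain ⟨C, β₀, hβ₀, h⟩ := Polaron.exists_frohlichForm_ge hA hV hVform
  refine ⟨C, β₀ ^ 10, by positivity, fun α hα => ?_⟩
  have hα0 : 0 < α := lt_of_lt_of_le (by positivity) hα
  -- With the tenth root as parameter all exponents of the lower bound are integers.
  set β : ℝ := α ^ (1 / 10 : ℝ)
  have hβα : β ^ 10 = α := by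
    rw [← Real.rpow_natCast, ← Real.rpow_mul hα0.le]; norm_num
  have hβ18 : β ^ 18 = α ^ (9 / 5 : ℝ) := by
    rw [← Real.rpow_natCast, ← Real.rpow_mul hα0.le]; norm_num
  have hβ : β₀ ≤ β := by
    refine le_of_pow_le_pow_left₀ (n := 10) (by norm_num) (by positivity) ?_
    rwa [hβα]
  have hlow := h β hβ
  rw [hβα, hβ18] at hlow
  have hne := Polaron.frohlichValues_nonempty (hA.scaled hα0) (Polaron.scaledV α V) α
  have hlb : ∀ e ∈ Polaron.frohlichValues (Polaron.scaledA α A) (Polaron.scaledV α V) α,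
      α ^ 2 * Polaron.pekarEnergy A V - C * α ^ (9 / 5 : ℝ) ≤ e := by
    rintro _ ⟨ψ, hψ, h1, rfl⟩
    simpa only [h1, mul_one] using hlow ψ hψ
  refine ⟨hne, ⟨_, hlb⟩, ?_, le_csInf hne hlb⟩
  rw [← div_le_iff₀' (by positivity)]
  obtain ⟨φ, hφ, h1⟩ := Polaron.exists_isTest_norm_one
  refine le_csInf ⟨_, φ, hφ.memH1 hA, h1, rfl⟩ ?_
  rintro _ ⟨φ, hφ, h1, rfl⟩
  rw [div_le_iff₀' (by positivity)]
  exact Polaron.frohlichEnergy_le hA hV hVform hα0 ⟨_, hlb⟩ hφ h1
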